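/- Let $R$ be a field containing $\mathbb{Q}$, let $G$ be a finite group, and let $\Lambda_{0}=\Lambda_{0,nov}(R)$ be the Novikov ring of formal sums $\sum_i a_iT^{\lambda_i}$ with $a_i\in R$, $\lambda_i\ge 0$, $\lambda_i\to\infty$. Fix an integer $N\ge 0$ and a submonoid $S\subset\mathbb{R}_{\ge 0}$ with $S\cap[0,E]$ finite for all $E$. A ($S$-gapped) filtered $A_\infty$-algebra is the $T$-adic completion $C=V\,\widehat\otimes_R\,\Lambda_0$ of $V\otimes_R\Lambda_0$ for a $\mathbb{Z}/2N$-graded $R$-vector space $V$ (with $\deg T=0$; $N=0$ is a $\mathbb{Z}$-grading), with $\Lambda_0$-multilinear operations $m_k\colon C[1]^{\otimes k}\to C[1]$, $k\ge 0$, of degree $1$ that satisfy the $A_\infty$-relations $$\sum_{k_1+k_2=k+1}\sum_i(-1)^{|x_1|'+\dots+|x_{i-1}|'}m_{k_1}(x_1,\dots,m_{k_2}(x_i,\dots),\dots,x_k)=0,\qquad |x|'=|x|-1,$$ with $m_0(1)\equiv 0$ modulo positive powers of $T$, and $m_k=\sum_{\lambda\in S}T^\lambda m_{k,\lambda}$ with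 $m_{k,\lambda}$ defined over $R$. A filtered $A_\infty$-homomorphism $\mathfrak f=\{f_k\}_{k\ge 0}\colon C_1\to C_2$ consists of $\Lambda_0$-multilinear maps $f_k\colon C_1[1]^{\otimes k}\to C_2[1]$ of degree $0$ satisfying $\hat{\mathfrak f}\circ\hat d=\hat d\circ\hat{\mathfrak f}$, with $f_0(1)\equiv 0$ modulo positive powers of $T$ and $f_k=\sum_{\lambda\in S}T^\lambda f_{k,\lambda}$. It is a weak homotopy equivalence if the reduction of $f_1$ modulo positive powers of $T$ induces an isomorphism on the cohomology of the reductions $(V_i,\bar m_1)$. A $G$-action on $C$ is a $\Lambda_0$-linear, degree-preserving, $S$-gapped action with $g\,m_k(x_1,\dots,x_k)=m_k(gx_1,\dots,gx_k)$; $\mathfrak f$ is $G$-equivariant if $g f_k(x_1,\dots,x_k)=f_k(gx_1,\dots,gx_k)$ for all $k$ and $g$. Two homomorphisms $\varphi,\varphi'\colon C\to C'$ are $G$-homotopic if there is a $G$-equivariant filtered $A_\infty$-homomorphism $H\colon C\to C'\otimes R[t,dt]$ (completed, with the induced $A_\infty$-structure and the $R[t,dt]$-linear $G$-action) with $\mathrm{Eval}_{t=0}\circ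 H=\varphi$ and $\mathrm{Eval}_{t=1}\circ H=\varphi'$. Theorem. Let $\mathfrak f\colon C_1\to C_2$ be a $G$-equivariant weak homotopy equivalence between filtered $A_\infty$-algebras with $G$-actions. Then there is a $G$-equivariant filtered $A_\infty$-homomorphism $\mathfrak h\colon C_2\to C_1$ that is a quasi-inverse of $\mathfrak f$ through $G$-equivariant homotopies: $\mathfrak h\circ\mathfrak f$ is $G$-homotopic to $\mathrm{id}_{C_1}$ and $\mathfrak f\circ\mathfrak h$ is $G$-homotopic to $\mathrm{id}_{C_2}$. -/

import Mathlib

open scoped NNReal DirectSum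

noncomputable section

namespace AInf

/-! ### The Novikov ring and completed free modules over it -/

section Novikov

variable (R : Type*) [Field R]

/-- The universal Novikov ring `Λ_{0,nov}(R)`: formal sums `∑ aᵢ T ^ λᵢ` with `aᵢ ∈ R`, `λᵢ ≥ 0`
and only finitely many terms of exponent at most `E`, for every `E`. -/
def NovikovRing : Subring (HahnSeries ℝ≥0 R) where
  carrier := {a | ∀ E : ℝ≥0, (a.support ∩ Set.Iic E).Finite}
  zero_mem' := by intro E; simp
  one_mem' := by
    intro E
    refine (Set.finite_singleton (0 : ℝ≥0)).subset ?_
    rintro l ⟨hl, -⟩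
    by_contra h
    exact hl (by simpa [HahnSeries.coeff_one] using h)
  add_mem' := by
    intro a b ha hb E
    refine ((ha E).union (hb E)).subset ?_
    rintro l ⟨hl, hE⟩
    rcases HahnSeries.support_add_subset _ _ hl with h | h
    · exact Or.inl ⟨h, hE⟩
    · exact Or.inr ⟨h, hE⟩
  neg_mem' := by
    intro a ha E
    simpa using ha E
  mul_mem' := by
    intro a b ha hb E
    refine ((ha E).image2 (· + ·) (hb E)).subset ?_
    rintro l ⟨hl, hE⟩
    obtain ⟨x, hx, y, hy, rfl⟩ := HahnSeries.support_mul_subset hl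
    have hE' : x + y ≤ E := hE
    exact ⟨x, ⟨hx, le_trans le_self_add hE'⟩, y, ⟨hy, le_trans le_add_self hE'⟩, rfl⟩

variable (V : Type*) [AddCommGroup V] [Module R V]

/-- The `T`-adic completion of the free module `V ⊗ Λ_{0,nov}(R)`: formal sums `∑ vᵢ T ^ λᵢ` with
`vᵢ ∈ V`, `λᵢ ≥ 0` and only finitely many terms of exponent at most `E`, for every `E`. -/
def Completed : Submodule (NovikovRing R) (HahnModule ℝ≥0 R V) where
  carrier := {x | ∀ E : ℝ≥0, (((HahnModule.of R).symm x).support ∩ Set.Iic E).Finite}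
  zero_mem' := by intro E; simp
  add_mem' := by
    intro a b ha hb E
    refine ((ha E).union (hb E)).subset ?_
    rintro l ⟨hl, hE⟩
    rcases HahnSeries.support_add_subset ((HahnModule.of R).symm a) ((HahnModule.of R).symm b) hl with h | h
    · exact Or.inl ⟨h, hE⟩
    · exact Or.inr ⟨h, hE⟩
  smul_mem' := by
    intro a x hx E
    refine ((a.2 E).image2 (· + ·) (hx E)).subset ?_
    rintro l ⟨hl, hE⟩
    have h : ((HahnModule.of R).symm ((a : HahnSeries ℝ≥0 R) • x)).coeff l ≠ 0 := hl
    rw [HahnModule.coeff_smul] at h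
    obtain ⟨⟨i, j⟩, hij, -⟩ := Finset.exists_ne_zero_of_sum_ne_zero h
    rw [Finset.mem_vaddAntidiagonal] at hij
    obtain ⟨h1, h2, h3⟩ := hij
    have h3' : i + j = l := h3
    subst h3'
    have hE' : i + j ≤ E := hE
    exact ⟨i, ⟨h1, le_trans le_self_add hE'⟩, j, ⟨h2, le_trans le_add_self hE'⟩, rfl⟩

end Novikov

section Basic

variable {R : Type*} [Field R] {V W : Type*} [AddCommGroup V] [Module R V]
  [AddCommGroup W] [Module R W]

/-- The coefficient of `T ^ l`. -/
def coeff (x : Completed R V) (l : ℝ≥0) : V := ((HahnModule.of R).symm (x : HahnModule ℝ≥0 R V)).coeff l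

theorem coeff_ext {x y : Completed R V} (h : ∀ l, coeff x l = coeff y l) : x = y :=
  Subtype.ext (HahnModule.ext _ _ (funext h))

@[simp] theorem coeff_zero (l : ℝ≥0) : coeff (0 : Completed R V) l = 0 := rfl

@[simp] theorem coeff_add (x y : Completed R V) (l : ℝ≥0) :
    coeff (x + y) l = coeff x l + coeff y l := rfl

theorem coeff_sum {ι : Type*} (s : Finset ι) (x : ι → Completed R V) (l : ℝ≥0) :
    coeff (∑ i ∈ s, x i) l = ∑ i ∈ s, coeff (x i) l := by
  classical
  induction s using Finset.induction_on with
  | empty => simp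
  | insert a s ha ih => simp [Finset.sum_insert ha, ih]

theorem finite_coeff (x : Completed R V) (E : ℝ≥0) : {l | coeff x l ≠ 0 ∧ l ≤ E}.Finite := x.2 E

/-- The element with given coefficients. -/
def mk (c : ℝ≥0 → V) (h : ∀ E : ℝ≥0, {l | c l ≠ 0 ∧ l ≤ E}.Finite) : Completed R V :=
  ⟨HahnModule.of R
    { coeff := c
      isPWO_support' := by
        refine Set.IsWF.isPWO ?_
        rw [Set.isWF_iff_no_descending_seq]
        intro f hf hmem
        have h1 : Set.range f ⊆ {l | c l ≠ 0 ∧ l ≤ f 0} := by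
          rintro _ ⟨n, rfl⟩
          exact ⟨hmem n, hf.antitone (Nat.zero_le n)⟩
        exact Set.infinite_range_of_injective hf.injective ((h (f 0)).subset h1) },
    h⟩

@[simp] theorem coeff_mk (c : ℝ≥0 → V) (h) (l : ℝ≥0) : coeff (mk (R := R) c h) l = c l := rfl

/-- The constant element `v T ^ 0`. -/
def const (v : V) : Completed R V :=
  mk (Pi.single 0 v) fun _ => (Set.finite_singleton 0).subset fun l hl => by
    by_contra h
    exact hl.1 (Pi.single_eq_of_ne h _)

/-- The `Λ₀`-linear extension of an `R`-linear map. -/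
def extend (f : V →ₗ[R] W) : Completed R V →ₗ[NovikovRing R] Completed R W where
  toFun x := mk (fun l => f (coeff x l)) fun E => (finite_coeff x E).subset fun l hl =>
    ⟨fun h => hl.1 (by simp [h]), hl.2⟩
  map_add' x y := coeff_ext fun l => by simp
  map_smul' a x := by
    refine coeff_ext fun l => ?_
    set y : Completed R W := mk (fun l => f (coeff x l)) _ with hy
    have hsub : ((HahnModule.of R).symm (y : HahnModule ℝ≥0 R W)).support ⊆
        ((HahnModule.of R).symm (x : HahnModule ℝ≥0 R V)).support := by
      intro i hi h0
      exact hi (show f (coeff x i) = 0 by rw [show coeff x i = 0 from h0, map_zero])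
    change f (((HahnModule.of R).symm ((a : HahnSeries ℝ≥0 R) • (x : HahnModule ℝ≥0 R V))).coeff l)
      = ((HahnModule.of R).symm ((a : HahnSeries ℝ≥0 R) • (y : HahnModule ℝ≥0 R W))).coeff l
    rw [HahnModule.coeff_smul_right
      ((HahnModule.of R).symm (x : HahnModule ℝ≥0 R V)).isPWO_support hsub,
      HahnModule.coeff_smul, map_sum]
    exact Finset.sum_congr rfl fun ij _ => map_smul f _ _

@[simp] theorem coeff_extend (f : V →ₗ[R] W) (x : Completed R V) (l : ℝ≥0) :
    coeff (extend f x) l = f (coeff x l) := rfl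

theorem coeff_smul_eq_zero {E : ℝ≥0} {x : Completed R V} (hx : ∀ l < E, coeff x l = 0)
    (a : NovikovRing R) : ∀ l < E, coeff (a • x) l = 0 := by
  intro l hl
  change ((HahnModule.of R).symm ((a : HahnSeries ℝ≥0 R) • (x : HahnModule ℝ≥0 R V))).coeff l = 0
  rw [HahnModule.coeff_smul]
  refine Finset.sum_eq_zero fun ij hij => ?_
  rw [Finset.mem_vaddAntidiagonal] at hij
  have h3 : ij.1 + ij.2 = l := hij.2.2
  have h4 : coeff x ij.2 = 0 := hx _ (lt_of_le_of_lt (h3 ▸ le_add_self) hl)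
  rw [show ((HahnModule.of R).symm (x : HahnModule ℝ≥0 R V)).coeff ij.2 = 0 from h4, smul_zero]

variable (R V) in
/-- The energy filtration `F ^ E C = T ^ E C`. -/
def filtration (E : ℝ≥0) : Submodule (NovikovRing R) (Completed R V) where
  carrier := {x | ∀ l < E, coeff x l = 0}
  zero_mem' := fun _ _ => rfl
  add_mem' := fun ha hb l hl => by simp [ha l hl, hb l hl]
  smul_mem' := fun a _ hx => coeff_smul_eq_zero hx a

/-- `s` is the sum of the series `∑ uₙ` for the `T`-adic topology. -/
def HasAdicSum (u : ℕ → Completed R V) (s : Completed R V) : Prop :=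
  ∀ E : ℝ≥0, ∃ n₀ : ℕ, ∀ n ≥ n₀, s - ∑ i ∈ Finset.range n, u i ∈ filtration R V E

variable (R) in
/-- The element `T ^ E` of the Novikov ring. -/
def T (E : ℝ≥0) : NovikovRing R :=
  ⟨HahnSeries.single E 1, fun _ => (Set.finite_singleton E).subset fun _ hl =>
    HahnSeries.support_single_subset hl.1⟩

theorem coeff_T_smul (E l : ℝ≥0) (x : Completed R V) : coeff (T R E • x) (E + l) = coeff x l := by
  change ((HahnModule.of R).symm (HahnSeries.single E (1 : R) •
    (x : HahnModule ℝ≥0 R V))).coeff (E +ᵥ l) = _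
  rw [HahnModule.coeff_single_smul_vadd, one_smul]
  rfl

theorem T_smul_mem (E : ℝ≥0) (x : Completed R V) : T R E • x ∈ filtration R V E := by
  intro l hl
  change ((HahnModule.of R).symm (HahnSeries.single E (1 : R) •
    (x : HahnModule ℝ≥0 R V))).coeff l = 0
  rw [HahnModule.coeff_smul]
  refine Finset.sum_eq_zero fun ij hij => ?_
  rw [Finset.mem_vaddAntidiagonal] at hij
  have h3 : ij.1 + ij.2 = l := hij.2.2
  rw [HahnSeries.coeff_single_of_ne, zero_smul]
  rintro h
  rw [← h3, h] at hl
  exact absurd hl (not_lt.2 le_self_add)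

theorem exists_eq_T_smul {E : ℝ≥0} {x : Completed R V} (hx : x ∈ filtration R V E) :
    ∃ y : Completed R V, x = T R E • y := by
  refine ⟨mk (fun l => coeff x (E + l)) fun E' => ?_, coeff_ext fun l => ?_⟩
  · refine Set.Finite.of_injOn (f := fun l => E + l) (t := {l | coeff x l ≠ 0 ∧ l ≤ E + E'})
      ?_ (add_right_injective E).injOn (finite_coeff x _)
    rintro l ⟨h1, h2⟩
    exact ⟨h1, add_le_add_right h2 E⟩
  · rcases lt_or_ge l E with h | h
    · rw [hx l h, T_smul_mem E _ l h]
    · obtain ⟨l', rfl⟩ := exists_add_of_le h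
      rw [coeff_T_smul, coeff_mk]

theorem map_mem_filtration {k : ℕ}
    (M : MultilinearMap (NovikovRing R) (fun _ : Fin k => Completed R V) (Completed R W))
    {x : Fin k → Completed R V} {E : ℝ≥0} (i : Fin k) (hx : x i ∈ filtration R V E) :
    M x ∈ filtration R W E := by
  obtain ⟨y, hy⟩ := exists_eq_T_smul hx
  rw [← Function.update_eq_self i x, hy, M.map_update_smul]
  exact T_smul_mem _ _

end Basic

/-! ### Polynomial coefficients -/

section Polynomial

variable {R : Type*} [Field R] {V W : Type*} [AddCommGroup V] [Module R V]
  [AddCommGroup W] [Module R W]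

variable (R V) in
/-- Sequences of elements of `C` that tend to zero `T`-adically. -/
def NullSeq : Submodule (NovikovRing R) (ℕ → Completed R V) where
  carrier := {u | ∀ E : ℝ≥0, ∃ n₀ : ℕ, ∀ n ≥ n₀, u n ∈ filtration R V E}
  zero_mem' := fun E => ⟨0, fun _ _ => zero_mem _⟩
  add_mem' := by
    intro a b ha hb E
    obtain ⟨p, hp⟩ := ha E
    obtain ⟨q, hq⟩ := hb E
    exact ⟨max p q, fun n hn => add_mem (hp n (le_trans (le_max_left _ _) hn))
      (hq n (le_trans (le_max_right _ _) hn))⟩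
  smul_mem' := by
    intro a u hu E
    obtain ⟨p, hp⟩ := hu E
    exact ⟨p, fun n hn => Submodule.smul_mem _ a (hp n hn)⟩

variable (R V) in
/-- The coefficient of `t ^ n`. -/
def polyCoeff (n : ℕ) : PolynomialModule R V →ₗ[R] V :=
  Finsupp.lapply n ∘ₗ (PolynomialModule.coeffLinearEquiv R R).toLinearMap

@[simp] theorem polyCoeff_apply (n : ℕ) (p : PolynomialModule R V) :
    polyCoeff R V n p = p.coeff n := rfl

theorem poly_ext {x y : Completed R (PolynomialModule R V)}
    (h : ∀ n, extend (polyCoeff R V n) x = extend (polyCoeff R V n) y) : x = y := by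
  refine coeff_ext fun l => PolynomialModule.ext (Finsupp.ext fun n => ?_)
  have := congrArg (fun z => coeff z l) (h n)
  simpa using this

theorem polyCoeff_nullSeq (x : Completed R (PolynomialModule R V)) :
    (fun n => extend (polyCoeff R V n) x) ∈ NullSeq R V := by
  intro E
  have hfin := (finite_coeff x E).toFinset
  refine ⟨(((finite_coeff x E).toFinset.biUnion fun l => (coeff x l).coeff.support).sup id) + 1,
    fun n hn l hl => ?_⟩
  by_contra h
  have h1 : coeff x l ≠ 0 := by
    intro h0
    simp [h0] at h
  have h2 : n ∈ (finite_coeff x E).toFinset.biUnion fun l => (coeff x l).coeff.support := by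
    rw [Finset.mem_biUnion]
    exact ⟨l, by simpa using ⟨h1, hl.le⟩, by simpa using h⟩
  have h3 : n ≤ _ := Finset.le_sup (f := id) h2
  omega

/-- The series `∑ uₙ t ^ n` attached to a sequence `uₙ ∈ C` tending to zero, as an element of the
completion of `C[t]`. -/
def assemble : NullSeq R V →ₗ[NovikovRing R] Completed R (PolynomialModule R V) :=
  have hfin (u : NullSeq R V) (l : ℝ≥0) :
      (Function.support fun n => coeff (u.1 n) l).Finite := by
    obtain ⟨N, hN⟩ := u.2 (l + 1)
    refine (Set.finite_Iio N).subset fun n hn => ?_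
    by_contra h
    exact hn (hN n (not_lt.1 h) l (lt_add_of_pos_right l one_pos))
  let f (u : NullSeq R V) : Completed R (PolynomialModule R V) :=
    mk (fun l => .ofCoeff R (Finsupp.ofSupportFinite (fun n => coeff (u.1 n) l) (hfin u l)))
      (by
        intro E
        obtain ⟨N, hN⟩ := u.2 (E + 1)
        refine (Set.Finite.biUnion (Set.finite_Iio N)
          fun n _ => finite_coeff (u.1 n) E).subset ?_
        rintro l ⟨h1, h2⟩
        by_contra h
        refine h1 (PolynomialModule.ext (Finsupp.ext fun n => ?_))
        change coeff (u.1 n) l = 0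
        by_contra h3
        refine h (Set.mem_biUnion (x := n) ?_ ⟨h3, h2⟩)
        by_contra h4
        exact h3 (hN n (not_lt.1 h4) l (lt_of_le_of_lt h2 (lt_add_of_pos_right E one_pos))))
  have hf (u : NullSeq R V) (n : ℕ) : extend (polyCoeff R V n) (f u) = u.1 n :=
    coeff_ext fun _ => rfl
  { toFun := f
    map_add' := fun u v => poly_ext fun n => by rw [map_add, hf, hf, hf]; rfl
    map_smul' := fun a u => poly_ext fun n => by
      rw [RingHom.id_apply, map_smul, hf, hf]; rfl }

@[simp] theorem polyCoeff_assemble (u : NullSeq R V) (n : ℕ) :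
    extend (polyCoeff R V n) (assemble u) = u.1 n := coeff_ext fun _ => rfl

/-- The `R[t]`-multilinear extension of a multilinear map:
`(∑ xᵢ t ^ i, ∑ yⱼ t ^ j, …) ↦ ∑ M (xᵢ, yⱼ, …) t ^ (i + j + ⋯)`. -/
def polyExtend {k : ℕ}
    (M : MultilinearMap (NovikovRing R) (fun _ : Fin k => Completed R V) (Completed R W)) :
    MultilinearMap (NovikovRing R) (fun _ : Fin k => Completed R (PolynomialModule R V))
      (Completed R (PolynomialModule R W)) :=
  assemble.compMultilinearMap <|
    (MultilinearMap.pi fun n => ∑ a ∈ Finset.Nat.antidiagonalTuple k n,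
      M.compLinearMap fun i => extend (polyCoeff R V (a i))).codRestrict (NullSeq R W) (by
    intro x E
    choose N hN using fun i => polyCoeff_nullSeq (x i) E
    refine ⟨∑ i, N i + 1, fun n hn => ?_⟩
    simp only [MultilinearMap.pi_apply, sum_apply]
    refine Submodule.sum_mem _ fun a ha => ?_
    rw [Finset.Nat.mem_antidiagonalTuple] at ha
    obtain ⟨i, hi⟩ : ∃ i, N i ≤ a i := by
      by_contra! h
      have := Finset.sum_le_sum fun i (_ : i ∈ Finset.univ) => (h i).le
      omega
    exact map_mem_filtration M i (hN i (a i) hi))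

end Polynomial

/-! ### Filtered `A∞` algebras and homomorphisms -/

section Algebra

variable {R : Type*} [Field R] {U V W : Type*} [AddCommGroup U] [Module R U]
  [AddCommGroup V] [Module R V] [AddCommGroup W] [Module R W] {N : ℕ}

variable (R U V) in
/-- Families of `Λ₀`-multilinear operations `f_k : C₁ ⊗ ⋯ ⊗ C₁ → C₂`, `k = 0, 1, 2, …`. Being
`Λ₀`-multilinear, they respect the energy filtrations and extend to the completed tensor powers. -/
abbrev Operations := ∀ k : ℕ,
  MultilinearMap (NovikovRing R) (fun _ : Fin k => Completed R U) (Completed R V)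

/-- The sign `(-1) ^ e` of a degree `e ∈ ℤ / 2N`. -/
def sign (e : ZMod (2 * N)) : ℤ :=
  if ZMod.castHom (dvd_mul_right 2 N) (ZMod 2) e = 0 then 1 else -1

/-- `x` is homogeneous of shifted degree `d`, i.e. it lies in the degree `d` part of `C[1]`, which
is the degree `d + 1` part of `C`. -/
def IsHomogeneous (gr : ZMod (2 * N) → Submodule R V) (d : ZMod (2 * N)) (x : Completed R V) :
    Prop :=
  ∀ l, coeff x l ∈ gr (d + 1)

/-- `f_k` has degree `r` as a map from `C₁[1] ⊗ ⋯ ⊗ C₁[1]` to `C₂[1]`, for every `k`. -/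
def HasDegree (gr₁ : ZMod (2 * N) → Submodule R U) (gr₂ : ZMod (2 * N) → Submodule R V)
    (r : ZMod (2 * N)) (f : Operations R U V) : Prop :=
  ∀ (k : ℕ) (x : Fin k → Completed R U) (d : Fin k → ZMod (2 * N)),
    (∀ i, IsHomogeneous gr₁ (d i) (x i)) → IsHomogeneous gr₂ (∑ i, d i + r) (f k x)

/-- Only energies from `S` occur in the operations:
`f_k = ∑_{λ ∈ S} T ^ λ f_{k, λ}` with `f_{k, λ}` defined over `R`. -/
def IsGapped (S : AddSubmonoid ℝ≥0) (f : Operations R U V) : Prop :=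
  ∀ (k : ℕ) (v : Fin k → U) (l : ℝ≥0), coeff (f k fun i => const (v i)) l ≠ 0 → l ∈ S

/-- `∑ (-1) ^ (|x₁|' + ⋯ + |xᵢ|') F (x₁, …, xᵢ, m_l (xᵢ₊₁, …, xᵢ₊ₗ), xᵢ₊ₗ₊₁, …, x_k)`, the sum of
all ways of inserting `m` into `F`. The inputs are the first `k` terms of the sequence `x`, with
shifted degrees given by `d`. -/
def insertionSum (F : Operations R U V) (m : Operations R U U) (k : ℕ) (x : ℕ → Completed R U)
    (d : ℕ → ZMod (2 * N)) : Completed R V :=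
  ∑ l ∈ Finset.range (k + 1), ∑ i ∈ Finset.range (k - l + 1),
    sign (∑ j ∈ Finset.range i, d j) • F (k - l + 1) fun j =>
      if (j : ℕ) < i then x j
      else if (j : ℕ) = i then m l fun s => x (i + s)
      else x (j + l - 1)

/-- `∑ F_n (f_{c₁} (x₁, …), …, f_{cₙ} (…, x_k))`, the sum over all ways of cutting the first `k`
terms of the sequence `x` into `n` consecutive, possibly empty, blocks of lengths `c₁, …, cₙ`. -/
def blockSum (F : Operations R V W) (f : Operations R U V) (k : ℕ) (x : ℕ → Completed R U)
    (n : ℕ) : Completed R W :=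
  ∑ c ∈ Finset.Nat.antidiagonalTuple n k,
    F n fun j => f (c j) fun s => x ((∑ i ∈ Finset.Iio j, c i) + s)

/-- The operations `m` make `C`, the completion of `V ⊗ Λ_{0,nov}(R)`, a filtered `A∞` algebra,
gapped by `S` and graded modulo `2N`. The operation `m₀` may be nonzero. -/
structure IsFilteredAInfAlgebra (S : AddSubmonoid ℝ≥0) (gr : ZMod (2 * N) → Submodule R V)
    (m : Operations R V V) : Prop where
  degree : HasDegree gr gr 1 m
  gapped : IsGapped S m
  curvature : ∀ x, coeff (m 0 x) 0 = 0
  relation : ∀ (k : ℕ) (x : ℕ → Completed R V) (d : ℕ → ZMod (2 * N)),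
    (∀ i < k, IsHomogeneous gr (d i) (x i)) → insertionSum m m k x d = 0

/-- `f` is a filtered `A∞` homomorphism, gapped by `S`. The operation `f₀` may be nonzero. -/
structure IsFilteredAInfHom (S : AddSubmonoid ℝ≥0)
    (gr₁ : ZMod (2 * N) → Submodule R U) (m₁ : Operations R U U)
    (gr₂ : ZMod (2 * N) → Submodule R V) (m₂ : Operations R V V)
    (f : Operations R U V) : Prop where
  degree : HasDegree gr₁ gr₂ 0 f
  gapped : IsGapped S f
  curvature : ∀ x, coeff (f 0 x) 0 = 0
  relation : ∀ (k : ℕ) (x : ℕ → Completed R U) (d : ℕ → ZMod (2 * N)),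
    (∀ i < k, IsHomogeneous gr₁ (d i) (x i)) →
      HasAdicSum (blockSum m₂ f k x) (insertionSum f m₁ k x d)

/-- `p = h ∘ f`. -/
def IsComposition (h : Operations R V W) (f : Operations R U V) (p : Operations R U W) : Prop :=
  ∀ (k : ℕ) (x : ℕ → Completed R U), HasAdicSum (blockSum h f k x) (p k fun i => x i)

variable (R V) in
/-- The identity homomorphism. -/
def idHom : Operations R V V
  | 1 => MultilinearMap.ofSubsingleton (NovikovRing R) _ _ 0 LinearMap.id
  | _ => 0

/-- The reduction modulo `Λ₊` of the linear part of `f`, a map from `V₁ = C₁ / Λ₊ C₁` to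
`V₂ = C₂ / Λ₊ C₂`. -/
def linearPart (f : Operations R U V) (v : U) : V := coeff (f 1 fun _ => const v) 0

/-- `f` is a weak homotopy equivalence: the reduction of `f₁` modulo `Λ₊` induces a bijection from
the cohomology of the reduction of `m₁` on `C₁` to that on `C₂`. -/
structure IsWeakHomotopyEquiv (m₁ : Operations R U U) (m₂ : Operations R V V)
    (f : Operations R U V) : Prop where
  injective : ∀ u, linearPart m₁ u = 0 → (∃ v, linearPart f u = linearPart m₂ v) →
    ∃ u', u = linearPart m₁ u'
  surjective : ∀ v, linearPart m₂ v = 0 →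
    ∃ u, linearPart m₁ u = 0 ∧ ∃ v', linearPart f u - v = linearPart m₂ v'

/-- `f` commutes with actions of `G`. -/
def IsEquivariant {G : Type*} (ρ₁ : G → Completed R U → Completed R U)
    (ρ₂ : G → Completed R V → Completed R V) (f : Operations R U V) : Prop :=
  ∀ (g : G) (k : ℕ) (x : Fin k → Completed R U), f k (fun i => ρ₁ g (x i)) = ρ₂ g (f k x)

/-- The linear action `ρ` of `G` is an action on the filtered `A∞` algebra `(C, m)`: it preserves
the grading, is gapped by `S`, and the operations are equivariant. -/
structure IsAInfAction {G : Type*} [Group G] (S : AddSubmonoid ℝ≥0)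
    (gr : ZMod (2 * N) → Submodule R V) (m : Operations R V V)
    (ρ : Representation (NovikovRing R) G (Completed R V)) : Prop where
  degree : ∀ g d x, IsHomogeneous gr d x → IsHomogeneous gr d (ρ g x)
  gapped : ∀ g v l, coeff (ρ g (const v)) l ≠ 0 → l ∈ S
  equivariant : IsEquivariant (fun g => ρ g) (fun g => ρ g) m

end Algebra

/-! ### The `A∞` algebra `C ⊗ R[t, dt]` and homotopies -/

section Path

variable {R : Type*} [Field R] {U V : Type*} [AddCommGroup U] [Module R U]
  [AddCommGroup V] [Module R V] {N : ℕ}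

variable (R V) in
/-- `V ⊗ R[t, dt]`. The pair `(P, Q)` stands for `P(t) + Q(t) dt`. -/
abbrev PathSpace := PolynomialModule R V × PolynomialModule R V

variable (R V) in
/-- `P + Q dt ↦ P` on `C ⊗ R[t, dt]`. -/
def functionPart : Completed R (PathSpace R V) →ₗ[NovikovRing R]
    Completed R (PolynomialModule R V) :=
  extend (LinearMap.fst R _ _)

variable (R V) in
/-- `P + Q dt ↦ Q` on `C ⊗ R[t, dt]`. -/
def formPart : Completed R (PathSpace R V) →ₗ[NovikovRing R]
    Completed R (PolynomialModule R V) :=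
  extend (LinearMap.snd R _ _)

variable (R V) in
/-- `P ↦ P`, from `C[t]` to `C ⊗ R[t, dt]`. -/
def ofFunction : Completed R (PolynomialModule R V) →ₗ[NovikovRing R]
    Completed R (PathSpace R V) :=
  extend (LinearMap.inl R _ _)

variable (R V) in
/-- `Q ↦ Q dt`, from `C[t]` to `C ⊗ R[t, dt]`. -/
def ofForm : Completed R (PolynomialModule R V) →ₗ[NovikovRing R]
    Completed R (PathSpace R V) :=
  extend (LinearMap.inr R _ _)

/-- `P + Q dt` has degree `d` when `P` has degree `d` and `Q` has degree `d - 1`. -/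
def pathGrading (gr : ZMod (2 * N) → Submodule R V) (d : ZMod (2 * N)) :
    Submodule R (PathSpace R V) :=
  ⨅ n, ((gr d).comap (polyCoeff R V n)).prod ((gr (d - 1)).comap (polyCoeff R V n))

/-- The involution `x ↦ (-1) ^ |x|' x` for the shifted degree `|x|' = |x| - 1`. -/
def parity (gr : ZMod (2 * N) → Submodule R V) [DirectSum.Decomposition gr] : V →ₗ[R] V :=
  DirectSum.toModule R _ V (fun e => sign (e - 1) • (gr e).subtype) ∘ₗ
    (DirectSum.decomposeLinearEquiv gr).toLinearMap

variable (R V) in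
/-- The derivative `d / dt` on `V[t]`. -/
def polyDerivative : PolynomialModule R V →ₗ[R] PolynomialModule R V :=
  Finsupp.lsum R (fun n => n • PolynomialModule.lsingle R (n - 1)) ∘ₗ
    (PolynomialModule.coeffLinearEquiv R R).toLinearMap

/-- The differential `P + Q dt ↦ (-1) ^ |P|' (dP / dt) dt`. -/
def pathDifferential (gr : ZMod (2 * N) → Submodule R V) [DirectSum.Decomposition gr] :
    Completed R (PathSpace R V) →ₗ[NovikovRing R] Completed R (PathSpace R V) :=
  extend (LinearMap.inr R _ _ ∘ₗ polyDerivative R V ∘ₗ PolynomialModule.map R (parity gr) ∘ₗ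
    LinearMap.fst R _ _)

/-- The `R[t, dt]`-multilinear extension of the operations,
`m_k (P₁ + Q₁ dt, …, P_k + Q_k dt) = m_k (P₁, …, P_k)
  + ∑ᵢ (-1) ^ (|Pᵢ₊₁|' + ⋯ + |P_k|') m_k (P₁, …, Qᵢ, …, P_k) dt`,
with the Koszul sign of moving `dt` to the right. -/
def formExtend (gr : ZMod (2 * N) → Submodule R V) [DirectSum.Decomposition gr]
    (m : Operations R V V) : Operations R (PathSpace R V) (PathSpace R V) := fun k =>
  (ofFunction R V).compMultilinearMap
      ((polyExtend (m k)).compLinearMap fun _ => functionPart R V) +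
    ∑ i : Fin k, (ofForm R V).compMultilinearMap
      ((polyExtend (m k)).compLinearMap fun j =>
        if j < i then functionPart R V
        else if j = i then formPart R V
        else extend (PolynomialModule.map R (parity gr)) ∘ₗ functionPart R V)

/-- The operations of the `A∞` algebra `C ⊗ R[t, dt]`: the extension of the operations of `C`, with
the differential of `R[t, dt]` added to `m₁`. -/
def pathOperations (gr : ZMod (2 * N) → Submodule R V) [DirectSum.Decomposition gr]
    (m : Operations R V V) : Operations R (PathSpace R V) (PathSpace R V)
  | 1 => formExtend gr m 1 +
      MultilinearMap.ofSubsingleton (NovikovRing R) _ _ 0 (pathDifferential gr)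
  | k => formExtend gr m k

variable (V) in
/-- `Eval_{t = r} : P(t) + Q(t) dt ↦ P(r)`. -/
def evalAt (r : R) : Completed R (PathSpace R V) →ₗ[NovikovRing R] Completed R V :=
  extend (PolynomialModule.eval r ∘ₗ LinearMap.fst R _ _)

/-- The `R[t, dt]`-linear extension of an action of `G` on `C` to `C ⊗ R[t, dt]`. -/
def pathAction {G : Type*} [Group G] (ρ : Representation (NovikovRing R) G (Completed R V))
    (g : G) (x : Completed R (PathSpace R V)) : Completed R (PathSpace R V) :=
  let ext := polyExtend (MultilinearMap.ofSubsingleton (NovikovRing R) _ _ (0 : Fin 1) (ρ g))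
  ofFunction R V (ext fun _ => functionPart R V x) + ofForm R V (ext fun _ => formPart R V x)

/-- `φ` and `φ'` are `G`-homotopic: there is a `G`-equivariant filtered `A∞` homomorphism
`H : C₁ → C₂ ⊗ R[t, dt]` with `Eval_{t = 0} ∘ H = φ` and `Eval_{t = 1} ∘ H = φ'`. -/
def AreGHomotopic {G : Type*} [Group G] (S : AddSubmonoid ℝ≥0)
    (gr₁ : ZMod (2 * N) → Submodule R U) (m₁ : Operations R U U)
    (ρ₁ : Representation (NovikovRing R) G (Completed R U))
    (gr₂ : ZMod (2 * N) → Submodule R V) [DirectSum.Decomposition gr₂] (m₂ : Operations R V V)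
    (ρ₂ : Representation (NovikovRing R) G (Completed R V))
    (φ φ' : Operations R U V) : Prop :=
  ∃ H : Operations R U (PathSpace R V),
    IsFilteredAInfHom S gr₁ m₁ (pathGrading gr₂) (pathOperations gr₂ m₂) H ∧
    IsEquivariant (fun g => ρ₁ g) (pathAction ρ₂) H ∧
    (∀ k, (evalAt V (0 : R)).compMultilinearMap (H k) = φ k) ∧
    (∀ k, (evalAt V (1 : R)).compMultilinearMap (H k) = φ' k)

end Path

end AInf

end

noncomputable section

set_option linter.unusedSectionVars false

namespace AInf

open Finset.HasAntidiagonal (antidiagonal mem_antidiagonal)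

/-! ### Words with energy and convolution -/

/-! The proof replaces completed modules by an ordinary coalgebra. After the choice of a homogeneous
basis, a gapped family of operations amounts to one `R`-linear map on the span `Bar` of words with
energy: its value at `(u, l)` is the coefficient of `T ^ l` of the operation on the letters of `u`
(`flat`, inverted by `sharp`). The comultiplication of `Bar` cuts a word and splits its energy. An
`A∞` structure becomes a coderivation of square zero, a homomorphism becomes a coalgebra morphism
commuting with these coderivations, and the sums in the definitions become compositions
(`coeff_blockSum`, `coeff_insertionSum`). Morphisms and coderivations exist with any component that
vanishes at the empty word of energy zero, and are determined by it (`exists_isComult`,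
`exists_isCoder`, `IsComult.ext`, `IsCoder.ext`). Most identities are therefore checked on
components only.

Curvature is controlled by the weight, which is the length plus twice the height of the energy.
Every part of a structure or morphism other than its linear part of energy zero strictly lowers the
weight. So inductions terminate, morphisms with identity linear part are invertible
(`IsComult.exists_inverse`), and no completion is needed.

The action of `G` may involve positive powers of `T`. Averaging `ρ g` against the inverse of its
constant part gives an isomorphism of words that makes the action constant (`exists_straightening`);
after that, whatever is built from equivariant components is equivariant. A second average gives
equivariant contractions of the reduced complexes (`exists_contraction`). From these and the weak
equivalence with linear part `f₀`, `exists_quasi_inverse` produces an equivariant `s` with `s f₀ s =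
s`, and contractions onto the images of `s f₀` and `f₀ s`.

For the nonlinear inverse (`exists_homotopy_inverse`), a change of coordinates on the source
exhibits a minimal model on the image of `s f₀`, and a change of coordinates on the target makes the
restriction of `f` to it strict. The homological perturbation lemma, based on the tensor trick,
projects the target to the minimal model by a morphism (`exists_perturbed_projection`). The
resulting `h` satisfies `h f h = h`.

Consequently `h f` and `f h` are idempotent, and only idempotents have to be deformed to the
identity. For an idempotent `φ` with linear part `e`, suitable coordinates make `φ` strict and split
the differential into a part on the image of `e` and a linear contractible complex
(`exists_normal_form`). In these coordinates `e + r (1 - e)` is a polynomial family of morphisms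
from `φ` to the identity, whose derivative is the commutator of the differential with an explicit
coderivation (`exists_homotopy_family`). This family is turned into a homomorphism to `C ⊗ R[t, dt]`
by comparing values at all `r`, which suffices because `R` is infinite (`areGHomotopic_of_family`).
-/

/-- A commutative monoid of energies in which every element has finitely many decompositions, with
a superadditive height that vanishes only at zero. -/
class EnergyMonoid (E : Type*) extends AddCommMonoid E, Finset.HasAntidiagonal E where
  /-- The height. -/
  height : E → ℕ
  height_add_le : ∀ a b, height a + height b ≤ height (a + b)
  eq_zero_of_height : ∀ a, height a = 0 → a = 0

/-- A word in the letters `I` together with an energy. -/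
@[ext]
structure Word (I E : Type*) where
  /-- The letters of the word. -/
  letters : List I
  /-- The energy of the word. -/
  energy : E

namespace Word

variable {I E : Type*} [EnergyMonoid E]

theorem height_zero : EnergyMonoid.height (0 : E) = 0 := by
  have := EnergyMonoid.height_add_le (0 : E) 0
  rw [add_zero] at this
  omega

instance : AddMonoid (Word I E) where
  zero := ⟨[], 0⟩
  add a b := ⟨a.letters ++ b.letters, a.energy + b.energy⟩
  zero_add a := Word.ext (List.nil_append _) (zero_add _)
  add_zero a := Word.ext (List.append_nil _) (add_zero _)
  add_assoc a b c := Word.ext (List.append_assoc _ _ _) (add_assoc _ _ _)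
  nsmul := @nsmulRec _ ⟨⟨[], 0⟩⟩ ⟨fun a b => ⟨a.letters ++ b.letters, a.energy + b.energy⟩⟩

@[simp] theorem letters_zero : (0 : Word I E).letters = [] := rfl
@[simp] theorem energy_zero : (0 : Word I E).energy = 0 := rfl
@[simp] theorem letters_add (a b : Word I E) : (a + b).letters = a.letters ++ b.letters := rfl
@[simp] theorem energy_add (a b : Word I E) : (a + b).energy = a.energy + b.energy := rfl

/-- The word with one more letter on the left. -/
def cons (i : I) (m : Word I E) : Word I E := ⟨i :: m.letters, m.energy⟩

/-- The empty word of given energy. -/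
def nil (I : Type*) {E : Type*} (l : E) : Word I E := ⟨[], l⟩

open Classical in
instance : Finset.HasAntidiagonal (Word I E) where
  antidiagonal m := (Finset.range (m.letters.length + 1) ×ˢ antidiagonal m.energy).image
    fun p => (⟨m.letters.take p.1, p.2.1⟩, ⟨m.letters.drop p.1, p.2.2⟩)
  mem_antidiagonal := by
    rintro m ⟨a, b⟩
    simp only [Finset.mem_image, Finset.mem_product, Finset.mem_range, Prod.exists, Prod.mk.injEq,
      mem_antidiagonal]
    constructor
    · rintro ⟨k, x, y, ⟨h1, h2⟩, rfl, rfl⟩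
      exact Word.ext (List.take_append_drop _ _) h2
    · rintro rfl
      exact ⟨a.letters.length, a.energy, b.energy, ⟨by simp, rfl⟩, by ext <;> simp, by ext <;> simp⟩

/-- A decomposition is recorded by the position of the cut and a splitting of the energy. Bounding
the position by the length makes the record unique, because the initial piece then has length `k`.
-/
theorem sum_antidiagonal {X : Type*} [AddCommMonoid X] (m : Word I E)
    (F : Word I E → Word I E → X) :
    ∑ p ∈ antidiagonal m, F p.1 p.2 =
      ∑ k ∈ Finset.range (m.letters.length + 1), ∑ q ∈ antidiagonal m.energy,
        F ⟨m.letters.take k, q.1⟩ ⟨m.letters.drop k, q.2⟩ := by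
  classical
  rw [← Finset.sum_product']
  refine (Finset.sum_image (f := fun p : Word I E × Word I E => F p.1 p.2)
    (g := fun p : ℕ × E × E => ((⟨m.letters.take p.1, p.2.1⟩ : Word I E),
      (⟨m.letters.drop p.1, p.2.2⟩ : Word I E))) ?_)
  rintro ⟨k, x, y⟩ hk ⟨k', x', y'⟩ hk' h
  simp only [Finset.coe_product, Set.mem_prod, Finset.mem_coe, Finset.mem_range] at hk hk'
  simp only [Prod.mk.injEq, Word.mk.injEq] at h
  obtain ⟨⟨h1, h2⟩, -, h3⟩ := h
  have := congrArg List.length h1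
  simp only [List.length_take] at this
  have : k = k' := by omega
  simp [this, h2, h3]

/-- The weight of a word. -/
def weight (m : Word I E) : ℕ := m.letters.length + 2 * EnergyMonoid.height m.energy

/-- Only this inequality is needed, since heights are merely superadditive. The factor two in the
weight absorbs curvature: an operation without inputs spends positive energy, hence weight at least
two, and creates a single letter. -/
theorem weight_add_le (a b : Word I E) : a.weight + b.weight ≤ (a + b).weight := by
  have := EnergyMonoid.height_add_le a.energy b.energy
  simp only [weight, letters_add, energy_add, List.length_append]
  omega

theorem weight_cons (i : I) (m : Word I E) : (cons i m).weight = m.weight + 1 := by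
  simp only [weight, cons, List.length_cons]
  omega

theorem weight_zero : (0 : Word I E).weight = 0 := by
  simp [weight, height_zero]

theorem eq_zero_of_weight {m : Word I E} (h : m.weight = 0) : m = 0 := by
  simp only [weight] at h
  exact Word.ext (List.length_eq_zero_iff.1 (by omega))
    (EnergyMonoid.eq_zero_of_height _ (by omega))

theorem weight_pos {m : Word I E} (h : m ≠ 0) : 0 < m.weight :=
  Nat.pos_of_ne_zero fun h' => h (eq_zero_of_weight h')

theorem eq_single_of_weight {m : Word I E} (h : m.weight = 1) : ∃ i, m = ⟨[i], 0⟩ := by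
  simp only [weight] at h
  obtain ⟨i, hi⟩ := List.length_eq_one_iff.1 (show m.letters.length = 1 by omega)
  exact ⟨i, Word.ext hi (EnergyMonoid.eq_zero_of_height _ (by omega))⟩

end Word

/-- Functions on an additive monoid with finite decompositions, with the convolution product. -/
def Conv (M A : Type*) := M → A

namespace Conv

open Finset (HasAntidiagonal sum_eq_single sum_sigma' sum_mul mul_sum sum_nbij' mem_sigma)

variable {M A : Type*} [AddMonoid M] [HasAntidiagonal M] [Semiring A]

-- Convolution is dual to the comultiplication of words, so products of functions give the matrix
-- coefficients of coalgebra morphisms. The coefficients may be noncommutative, which allows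
-- matrices in the construction of coderivations.
open Classical in
instance : Monoid (Conv M A) where
  one m := if m = 0 then 1 else 0
  mul f g m := ∑ p ∈ antidiagonal m, f p.1 * g p.2
  one_mul f := by
    funext m
    change ∑ p ∈ antidiagonal m, (if p.1 = 0 then (1 : A) else 0) * f p.2 = f m
    rw [sum_eq_single (0, m)]
    · simp
    · rintro ⟨a, b⟩ h1 h2
      rw [if_neg, zero_mul]
      rintro rfl
      rw [mem_antidiagonal, zero_add] at h1
      exact h2 (by rw [← h1])
    · intro h
      exact absurd (mem_antidiagonal.2 (zero_add m)) h
  mul_one f := by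
    funext m
    change ∑ p ∈ antidiagonal m, f p.1 * (if p.2 = 0 then (1 : A) else 0) = f m
    rw [sum_eq_single (m, 0)]
    · simp
    · rintro ⟨a, b⟩ h1 h2
      rw [if_neg, mul_zero]
      rintro rfl
      rw [mem_antidiagonal, add_zero] at h1
      exact h2 (by rw [← h1])
    · intro h
      exact absurd (mem_antidiagonal.2 (add_zero m)) h
  mul_assoc f g h := by
    funext m
    change ∑ p ∈ antidiagonal m, (∑ q ∈ antidiagonal p.1, f q.1 * g q.2) * h p.2 =
      ∑ p ∈ antidiagonal m, f p.1 * ∑ q ∈ antidiagonal p.2, g q.1 * h q.2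
    simp only [sum_mul, mul_sum]
    rw [sum_sigma', sum_sigma']
    refine sum_nbij' (fun x => ⟨(x.2.1, x.2.2 + x.1.2), (x.2.2, x.1.2)⟩)
      (fun x => ⟨(x.1.1 + x.2.1, x.2.2), (x.1.1, x.2.1)⟩) ?_ ?_ ?_ ?_ ?_
    · rintro ⟨⟨a, b⟩, ⟨c, d⟩⟩ hx
      simp only [mem_sigma, mem_antidiagonal] at hx ⊢
      exact ⟨by rw [← add_assoc, hx.2, hx.1], trivial⟩
    · rintro ⟨⟨a, b⟩, ⟨c, d⟩⟩ hx
      simp only [mem_sigma, mem_antidiagonal] at hx ⊢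
      exact ⟨by rw [add_assoc, hx.2, hx.1], trivial⟩
    · rintro ⟨⟨a, b⟩, ⟨c, d⟩⟩ hx
      simp only [mem_sigma, mem_antidiagonal] at hx ⊢
      obtain ⟨-, rfl⟩ := hx
      rfl
    · rintro ⟨⟨a, b⟩, ⟨c, d⟩⟩ hx
      simp only [mem_sigma, mem_antidiagonal] at hx ⊢
      obtain ⟨-, rfl⟩ := hx
      rfl
    · rintro ⟨⟨a, b⟩, ⟨c, d⟩⟩ hx
      exact mul_assoc _ _ _

theorem mul_apply (f g : Conv M A) (m : M) :
    (f * g) m = ∑ p ∈ antidiagonal m, f p.1 * g p.2 := rfl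

open Classical in
theorem one_apply (m : M) : (1 : Conv M A) m = if m = 0 then 1 else 0 := rfl

end Conv

/-! ### Multiplicative extension from letters to words, and its finiteness. -/

section Matrix

variable {I J E A : Type*} [EnergyMonoid E] [Semiring A]

open Classical in
/-- The function equal to one at the empty word of energy `l`. -/
def energyFun (I A : Type*) {E : Type*} [EnergyMonoid E] [Semiring A] (l : E) :
    Conv (Word I E) A := fun m => if m = Word.nil I l then 1 else 0

open Classical in
theorem energyFun_mul (l : E) (f : Conv (Word I E) A) (m : Word I E) :
    (energyFun I A l * f) m =
      ∑ q ∈ antidiagonal m.energy, if q.1 = l then f ⟨m.letters, q.2⟩ else 0 := by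
  rw [Conv.mul_apply, Word.sum_antidiagonal m fun a b => energyFun I A l a * f b,
    Finset.sum_eq_single 0]
  · refine Finset.sum_congr rfl fun q _ => ?_
    simp [energyFun, Word.nil]
  · intro k hk hk0
    refine Finset.sum_eq_zero fun q _ => ?_
    simp only [energyFun, Word.nil, Word.mk.injEq, List.take_eq_nil_iff, hk0, false_or]
    rcases eq_or_ne m.letters [] with h | h
    · simp only [h, List.length_nil, Finset.mem_range] at hk
      omega
    · simp [h]
  · simp

open Classical in
theorem mul_energyFun (l : E) (f : Conv (Word I E) A) (m : Word I E) :
    (f * energyFun I A l) m =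
      ∑ q ∈ antidiagonal m.energy, if q.2 = l then f ⟨m.letters, q.1⟩ else 0 := by
  rw [Conv.mul_apply, Word.sum_antidiagonal m fun a b => f a * energyFun I A l b,
    Finset.sum_eq_single m.letters.length]
  · refine Finset.sum_congr rfl fun q _ => ?_
    simp [energyFun, Word.nil]
  · intro k hk hk0
    refine Finset.sum_eq_zero fun q _ => ?_
    have : m.letters.drop k ≠ [] := by
      rw [Ne, List.drop_eq_nil_iff]
      rw [Finset.mem_range] at hk
      omega
    simp [energyFun, Word.nil, this]
  · simp

/-- An empty word can be split off on either side with the same effect, because energies commute.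
This centrality is what makes `matrixFun` multiplicative. -/
theorem energyFun_comm (l : E) (f : Conv (Word I E) A) :
    energyFun I A l * f = f * energyFun I A l := by
  classical
  funext m
  rw [energyFun_mul, mul_energyFun]
  refine Finset.sum_nbij' Prod.swap Prod.swap ?_ ?_ ?_ ?_ ?_ <;>
    simp +contextual [mem_antidiagonal, add_comm]

theorem energyFun_add (l l' : E) :
    energyFun I A (l + l') = energyFun I A l * energyFun I A l' := by
  classical
  funext m
  rw [energyFun_mul]
  obtain ⟨w, k⟩ := m
  simp only [energyFun, Word.nil, Word.mk.injEq]
  by_cases hw : w = []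
  · simp only [hw, true_and]
    by_cases h : k = l + l'
    · rw [if_pos h, Finset.sum_eq_single (l, l')]
      · simp
      · rintro ⟨a, b⟩ h1 h2
        by_cases ha : a = l
        · by_cases hb : b = l'
          · exact absurd (by rw [ha, hb]) h2
          · simp [hb]
        · simp [ha]
      · intro h'
        exact absurd (mem_antidiagonal.2 h.symm) h'
    · rw [if_neg h, Finset.sum_eq_zero]
      rintro ⟨a, b⟩ h1
      rw [mem_antidiagonal] at h1
      split_ifs with h2 h3
      · exact absurd (by rw [← h1, ← h2, ← h3]) h
      · rfl
      · rfl
  · simp [hw]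

theorem energyFun_zero : energyFun I A (0 : E) = 1 := by
  classical
  funext m
  rw [Conv.one_apply]
  rfl

/-- The multiplicative extension of a family of functions, indexed by letters, to words. -/
def matrixFun (g : J → Conv (Word I E) A) (k : Word J E) : Conv (Word I E) A :=
  energyFun I A k.energy * (k.letters.map g).prod

theorem matrixFun_add (g : J → Conv (Word I E) A) (k k' : Word J E) :
    matrixFun g (k + k') = matrixFun g k * matrixFun g k' := by
  simp only [matrixFun, Word.energy_add, Word.letters_add, List.map_append, List.prod_append,
    energyFun_add, mul_assoc]
  congr 1
  rw [← mul_assoc, ← mul_assoc, energyFun_comm k'.energy]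

theorem matrixFun_nil (g : J → Conv (Word I E) A) (l : E) :
    matrixFun g (Word.nil J l) = energyFun I A l := by
  simp [matrixFun, Word.nil]

theorem matrixFun_single (g : J → Conv (Word I E) A) (j : J) :
    matrixFun g ⟨[j], 0⟩ = g j := by
  simp [matrixFun, energyFun_zero]

/-- A letter contributes only through a nonempty piece, which uses up positive weight; there are
finitely many choices for the first letter, and induction on the weight bounds the rest. Without
`h0`, arbitrarily long lists could contribute and the images of words would be infinite sums. -/
theorem finite_prod (g : J → Conv (Word I E) A) (h0 : ∀ j, g j 0 = 0)
    (hfin : ∀ m, {j | g j m ≠ 0}.Finite) (m : Word I E) :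
    {u : List J | (u.map g).prod m ≠ 0}.Finite := by
  induction hn : m.weight using Nat.strong_induction_on generalizing m with
  | _ n ih =>
  subst hn
  have hS : ∀ p ∈ antidiagonal m, p.1 ≠ 0 →
      {u : List J | (u.map g).prod p.2 ≠ 0}.Finite := by
    rintro p hp hp0
    rw [mem_antidiagonal] at hp
    refine ih p.2.weight ?_ _ rfl
    have := Word.weight_add_le p.1 p.2
    have := Word.weight_pos hp0
    rw [hp] at *
    omega
  refine ((Set.finite_singleton []).union (Set.Finite.biUnion
    (s := {p | p ∈ antidiagonal m ∧ p.1 ≠ 0})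
    ((Finset.finite_toSet (antidiagonal m)).subset fun p hp => hp.1)
    (t := fun p => Set.image2 List.cons {j | g j p.1 ≠ 0} {u | (u.map g).prod p.2 ≠ 0})
    fun p hp => (hfin p.1).image2 _ (hS p hp.1 hp.2))).subset ?_
  rintro (_ | ⟨j, u⟩) hu
  · exact Or.inl rfl
  · right
    simp only [List.map_cons, List.prod_cons, Set.mem_ofPred_eq, Conv.mul_apply] at hu
    obtain ⟨p, hp, hne⟩ := Finset.exists_ne_zero_of_sum_ne_zero hu
    refine Set.mem_biUnion (x := p) ⟨hp, fun h => hne (by rw [h, h0, zero_mul])⟩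
      ⟨j, left_ne_zero_of_mul hne, u, right_ne_zero_of_mul hne, rfl⟩

theorem finite_matrixFun (g : J → Conv (Word I E) A) (h0 : ∀ j, g j 0 = 0)
    (hfin : ∀ m, {j | g j m ≠ 0}.Finite) (m : Word I E) :
    {k : Word J E | matrixFun g k m ≠ 0}.Finite := by
  classical
  refine (Set.Finite.biUnion (Finset.finite_toSet (antidiagonal m.energy))
    (t := fun q => (fun u : List J => (⟨u, q.1⟩ : Word J E)) ''
      {u | (u.map g).prod ⟨m.letters, q.2⟩ ≠ 0})
    fun q _ => (finite_prod g h0 hfin _).image _).subset ?_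
  intro k hk
  simp only [matrixFun, Set.mem_ofPred_eq, energyFun_mul] at hk
  obtain ⟨q, hq, hne⟩ := Finset.exists_ne_zero_of_sum_ne_zero hk
  by_cases h : q.1 = k.energy
  · rw [if_pos h] at hne
    exact Set.mem_biUnion hq ⟨k.letters, hne, by rw [h]⟩
  · exact absurd (if_neg h) hne

end Matrix

open scoped TensorProduct

/-! ### The bar coalgebra -/

section Bar

variable {R : Type*} [Field R] {I J K E : Type*} [EnergyMonoid E]
  {V W : Type*} [AddCommGroup V] [Module R V] [AddCommGroup W] [Module R W]

/-- The coalgebra of words with energy. -/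
abbrev Bar (R I E : Type*) [Field R] := Word I E →₀ R

variable (R) in
/-- The basis element attached to a word. -/
def wd (m : Word I E) : Bar R I E := Finsupp.single m 1

theorem bar_hom_ext {X : Type*} [AddCommMonoid X] [Module R X] {A B : Bar R I E →ₗ[R] X}
    (h : ∀ m, A (wd R m) = B (wd R m)) : A = B :=
  Finsupp.lhom_ext' fun m => LinearMap.ext_ring (h m)

variable (R) in
/-- The linear map with given values on words. -/
def onWords {X : Type*} [AddCommMonoid X] [Module R X] (f : Word I E → X) : Bar R I E →ₗ[R] X :=
  Finsupp.linearCombination R f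

@[simp] theorem onWords_wd {X : Type*} [AddCommMonoid X] [Module R X] (f : Word I E → X)
    (m : Word I E) : onWords R f (wd R m) = f m := by
  simp [onWords, wd]

theorem wd_apply [DecidableEq (Word I E)] (m k : Word I E) :
    wd R m k = if m = k then 1 else 0 := Finsupp.single_apply

variable (R I E) in
/-- The comultiplication, which splits both the word and its energy. -/
def comul : Bar R I E →ₗ[R] Bar R I E ⊗[R] Bar R I E :=
  onWords R fun m => ∑ p ∈ antidiagonal m, wd R p.1 ⊗ₜ[R] wd R p.2

@[simp] theorem comul_wd (m : Word I E) :
    comul R I E (wd R m) = ∑ p ∈ antidiagonal m, wd R p.1 ⊗ₜ[R] wd R p.2 := onWords_wd _ _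

open Classical in
variable (R I E) in
/-- The part of word length zero. -/
def eps : Bar R I E →ₗ[R] (E →₀ R) :=
  onWords R fun m => if m.letters = [] then Finsupp.single m.energy 1 else 0

variable (R I E) in
/-- The inclusion of the empty words. -/
def unit : (E →₀ R) →ₗ[R] Bar R I E :=
  Finsupp.linearCombination R fun l => wd R (Word.nil I l)

open Classical in
theorem unit_eps_wd (m : Word I E) :
    unit R I E (eps R I E (wd R m)) = if m.letters = [] then wd R m else 0 := by
  obtain ⟨w, l⟩ := m
  simp only [eps, onWords_wd]
  split_ifs with h
  · simp only [h, unit, Finsupp.linearCombination_single, one_smul, Word.nil]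
  · simp

open Classical in
/-- The part of word length one and energy zero. -/
def proj (b : Module.Basis I R V) : Bar R I E →ₗ[R] V :=
  onWords R fun m => if m.energy = 0 then
    match m.letters with
    | [i] => b i
    | _ => 0
  else 0

@[simp] theorem proj_single (b : Module.Basis I R V) (i : I) :
    proj b (wd R (⟨[i], 0⟩ : Word I E)) = b i := by
  simp [proj]

theorem proj_of_ne (b : Module.Basis I R V) {m : Word I E} (h : ∀ i, m ≠ ⟨[i], 0⟩) :
    proj b (wd R m) = 0 := by
  obtain ⟨w, l⟩ := m
  simp only [proj, onWords_wd]
  split_ifs with hl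
  · rcases w with _ | ⟨i, _ | ⟨j, w⟩⟩
    · rfl
    · exact absurd (by rw [hl]) (h i)
    · rfl
  · rfl

/-- Left multiplication of words by a vector. -/
def cons (b : Module.Basis I R V) : V →ₗ[R] Bar R I E →ₗ[R] Bar R I E :=
  b.constr R fun i => onWords R fun m => wd R (Word.cons i m)

@[simp] theorem cons_basis (b : Module.Basis I R V) (i : I) (m : Word I E) :
    cons b (b i) (wd R m) = wd R (Word.cons i m) := by
  simp [cons]

/-- `v ⊗ q ↦ v q`, precomposed with the projection of the first factor. -/
def glue (b : Module.Basis I R V) : Bar R I E ⊗[R] Bar R I E →ₗ[R] Bar R I E :=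
  TensorProduct.lift (cons b ∘ₗ proj b)

@[simp] theorem glue_tmul (b : Module.Basis I R V) (x y : Bar R I E) :
    glue b (x ⊗ₜ y) = cons b (proj b x) y := by
  simp [glue]

/-- A word is either empty or its first letter, taken with energy zero, followed by the rest. This
is the source of the recursions `IsComult.apply_wd` and `IsCoder.apply_wd`. -/
theorem eq_unit_add_glue (b : Module.Basis I R V) (q : Bar R I E) :
    q = unit R I E (eps R I E q) + glue b (comul R I E q) := by
  classical
  suffices h : LinearMap.id = unit R I E ∘ₗ eps R I E + glue b ∘ₗ comul R I E from
    LinearMap.congr_fun h q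
  refine bar_hom_ext fun m => ?_
  simp only [LinearMap.id_apply, LinearMap.add_apply, LinearMap.comp_apply, unit_eps_wd, comul_wd,
    map_sum, glue_tmul]
  obtain ⟨_ | ⟨i, w⟩, l⟩ := m
  · rw [if_pos rfl, Finset.sum_eq_zero, add_zero]
    intro p hp
    rw [mem_antidiagonal] at hp
    rw [proj_of_ne, map_zero, LinearMap.zero_apply]
    intro i h
    have := congrArg Word.letters hp
    simp [h] at this
  · rw [if_neg (by simp), zero_add, Finset.sum_eq_single (⟨[i], 0⟩, ⟨w, l⟩)]
    · simp [Word.cons]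
    · intro p hp hne
      rw [mem_antidiagonal] at hp
      rw [proj_of_ne, map_zero, LinearMap.zero_apply]
      rintro j h
      have h1 := congrArg Word.letters hp
      have h2 := congrArg Word.energy hp
      simp only [h, Word.letters_add, Word.energy_add, List.cons_append, List.nil_append,
        List.cons.injEq, zero_add] at h1 h2
      refine hne (Prod.ext (by rw [h, h1.1]) (Word.ext h1.2 h2))
    · intro h
      refine absurd (mem_antidiagonal.2 (Word.ext ?_ ?_)) h
      · simp
      · simp

variable (R I E) in
/-- The coefficient of a pair of words. -/
def pairCoeff (k k' : Word I E) : Bar R I E ⊗[R] Bar R I E →ₗ[R] R :=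
  LinearMap.mul' R R ∘ₗ TensorProduct.map (Finsupp.lapply k) (Finsupp.lapply k')

@[simp] theorem pairCoeff_tmul (k k' : Word I E) (x y : Bar R I E) :
    pairCoeff R I E k k' (x ⊗ₜ y) = x k * y k' := by
  simp [pairCoeff]

theorem tensor_ext {x y : Bar R I E ⊗[R] Bar R I E}
    (h : ∀ k k', pairCoeff R I E k k' x = pairCoeff R I E k k' y) : x = y := by
  apply (finsuppTensorFinsupp' R (Word I E) (Word I E)).injective
  ext ⟨k, k'⟩
  have key : ∀ z : Bar R I E ⊗[R] Bar R I E,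
      finsuppTensorFinsupp' R (Word I E) (Word I E) z (k, k') = pairCoeff R I E k k' z := by
    intro z
    induction z using TensorProduct.induction_on with
    | zero => simp
    | tmul x y => simp [finsuppTensorFinsupp'_apply_apply]
    | add x y hx hy => simp only [map_add, Finsupp.add_apply, hx, hy]
  rw [key, key, h]

/-- Comultiplication is the transpose of concatenation; compatibility with it becomes
multiplicativity of matrix coefficients. -/
theorem pairCoeff_comul (k k' : Word I E) (q : Bar R I E) :
    pairCoeff R I E k k' (comul R I E q) = q (k + k') := by
  classical
  suffices h : pairCoeff R I E k k' ∘ₗ comul R I E = Finsupp.lapply (k + k') from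
    LinearMap.congr_fun h q
  refine bar_hom_ext fun m => ?_
  simp only [LinearMap.comp_apply, comul_wd, map_sum, pairCoeff_tmul, Finsupp.lapply_apply,
    wd_apply]
  by_cases h : m = k + k'
  · rw [if_pos h, Finset.sum_eq_single (k, k')]
    · simp
    · rintro ⟨a, c⟩ - hne
      by_cases h1 : a = k
      · by_cases h2 : c = k'
        · exact absurd (by rw [h1, h2]) hne
        · simp [h2]
      · simp [h1]
    · intro h'
      exact absurd (mem_antidiagonal.2 h.symm) h'
  · rw [if_neg h, Finset.sum_eq_zero]
    rintro ⟨a, c⟩ hp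
    rw [mem_antidiagonal] at hp
    by_cases h1 : a = k
    · by_cases h2 : c = k'
      · exact absurd (by rw [← hp, ← h1, ← h2]) h
      · simp [h2]
    · simp [h1]

/-! ### Morphisms and coderivations -/

/-- `Φ` is a morphism of coalgebras over the coalgebra of energies. -/
structure IsComult (Φ : Bar R I E →ₗ[R] Bar R J E) : Prop where
  comul_eq : comul R J E ∘ₗ Φ = TensorProduct.map Φ Φ ∘ₗ comul R I E
  eps_eq : eps R J E ∘ₗ Φ = eps R I E
  one_eq : Φ (wd R 0) = wd R 0

/-- `X` is a coderivation along `Φ` and `Ψ`. -/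
structure IsCoder (Φ Ψ X : Bar R I E →ₗ[R] Bar R J E) : Prop where
  comul_eq : comul R J E ∘ₗ X = (TensorProduct.map X Ψ + TensorProduct.map Φ X) ∘ₗ comul R I E
  eps_eq : eps R J E ∘ₗ X = 0
  one_eq : X (wd R 0) = 0

theorem proj_zero (b : Module.Basis I R V) : proj b (wd R (0 : Word I E)) = 0 :=
  proj_of_ne b fun i h => by simpa using congrArg Word.letters h

theorem IsComult.id : IsComult (LinearMap.id : Bar R I E →ₗ[R] Bar R I E) where
  comul_eq := by simp
  eps_eq := rfl
  one_eq := rfl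

theorem IsComult.comp {Ψ : Bar R J E →ₗ[R] Bar R K E} {Φ : Bar R I E →ₗ[R] Bar R J E}
    (hΨ : IsComult Ψ) (hΦ : IsComult Φ) : IsComult (Ψ ∘ₗ Φ) where
  comul_eq := by
    rw [← LinearMap.comp_assoc, hΨ.comul_eq, LinearMap.comp_assoc, hΦ.comul_eq, ← LinearMap.comp_assoc,
      TensorProduct.map_comp]
  eps_eq := by rw [← LinearMap.comp_assoc, hΨ.eps_eq, hΦ.eps_eq]
  one_eq := by rw [LinearMap.comp_apply, hΦ.one_eq, hΨ.one_eq]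

theorem IsCoder.comp {Φ Ψ X : Bar R J E →ₗ[R] Bar R K E} {Ξ : Bar R I E →ₗ[R] Bar R J E}
    (hX : IsCoder Φ Ψ X) (hΞ : IsComult Ξ) : IsCoder (Φ ∘ₗ Ξ) (Ψ ∘ₗ Ξ) (X ∘ₗ Ξ) where
  comul_eq := by
    rw [← LinearMap.comp_assoc, hX.comul_eq, LinearMap.comp_assoc, hΞ.comul_eq, ← LinearMap.comp_assoc,
      LinearMap.add_comp, ← TensorProduct.map_comp, ← TensorProduct.map_comp]
  eps_eq := by rw [← LinearMap.comp_assoc, hX.eps_eq, LinearMap.zero_comp]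
  one_eq := by rw [LinearMap.comp_apply, hΞ.one_eq, hX.one_eq]

theorem IsComult.comp_coder {Φ Ψ X : Bar R I E →ₗ[R] Bar R J E} {Ξ : Bar R J E →ₗ[R] Bar R K E}
    (hΞ : IsComult Ξ) (hX : IsCoder Φ Ψ X) : IsCoder (Ξ ∘ₗ Φ) (Ξ ∘ₗ Ψ) (Ξ ∘ₗ X) where
  comul_eq := by
    rw [← LinearMap.comp_assoc, hΞ.comul_eq, LinearMap.comp_assoc, hX.comul_eq, ← LinearMap.comp_assoc,
      LinearMap.comp_add, TensorProduct.map_comp, TensorProduct.map_comp]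
  eps_eq := by rw [← LinearMap.comp_assoc, hΞ.eps_eq, hX.eps_eq]
  one_eq := by rw [LinearMap.comp_apply, hX.one_eq, map_zero]

theorem tensor_map_sub_left {X Y Z X' : Type*} [AddCommGroup X] [Module R X] [AddCommGroup Y]
    [Module R Y] [AddCommGroup Z] [Module R Z] [AddCommGroup X'] [Module R X'] (f g : X →ₗ[R] Y)
    (h : Z →ₗ[R] X') (x : X ⊗[R] Z) :
    TensorProduct.map (f - g) h x = TensorProduct.map f h x - TensorProduct.map g h x := by
  rw [← LinearMap.sub_apply]
  congr 1
  ext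
  simp [TensorProduct.sub_tmul]

theorem tensor_map_sub_right {X Y Z X' : Type*} [AddCommGroup X] [Module R X] [AddCommGroup Y]
    [Module R Y] [AddCommGroup Z] [Module R Z] [AddCommGroup X'] [Module R X'] (f g : X →ₗ[R] Y)
    (h : Z →ₗ[R] X') (x : Z ⊗[R] X) :
    TensorProduct.map h (f - g) x = TensorProduct.map h f x - TensorProduct.map h g x := by
  rw [← LinearMap.sub_apply]
  congr 1
  ext
  simp [TensorProduct.tmul_sub]

theorem IsCoder.sub {Φ Ψ X Y : Bar R I E →ₗ[R] Bar R J E} (hX : IsCoder Φ Ψ X)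
    (hY : IsCoder Φ Ψ Y) : IsCoder Φ Ψ (X - Y) where
  comul_eq := by
    refine LinearMap.ext fun x => ?_
    have h1 := LinearMap.congr_fun hX.comul_eq x
    have h2 := LinearMap.congr_fun hY.comul_eq x
    simp only [LinearMap.comp_apply, LinearMap.add_apply, LinearMap.sub_apply, map_sub,
      tensor_map_sub_left, tensor_map_sub_right] at *
    rw [h1, h2]
    abel
  eps_eq := LinearMap.ext fun x => by
    have h1 := LinearMap.congr_fun hX.eps_eq x
    have h2 := LinearMap.congr_fun hY.eps_eq x
    simp only [LinearMap.comp_apply, LinearMap.sub_apply, map_sub] at *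
    rw [h1, h2]
    exact sub_zero _
  one_eq := by rw [LinearMap.sub_apply, hX.one_eq, hY.one_eq, sub_zero]

theorem IsCoder.smul {Φ Ψ X : Bar R I E →ₗ[R] Bar R J E} (hX : IsCoder Φ Ψ X) (c : R) :
    IsCoder Φ Ψ (c • X) where
  comul_eq := by
    rw [LinearMap.comp_smul, hX.comul_eq, ← LinearMap.smul_comp, TensorProduct.map_smul_left,
      TensorProduct.map_smul_right, smul_add]
  eps_eq := by rw [LinearMap.comp_smul, hX.eps_eq, smul_zero]
  one_eq := by rw [LinearMap.smul_apply, hX.one_eq, smul_zero]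

theorem IsComult.sub {Φ Ψ : Bar R I E →ₗ[R] Bar R J E} (hΦ : IsComult Φ) (hΨ : IsComult Ψ) :
    IsCoder Φ Ψ (Φ - Ψ) where
  comul_eq := by
    refine LinearMap.ext fun x => ?_
    have h1 := LinearMap.congr_fun hΦ.comul_eq x
    have h2 := LinearMap.congr_fun hΨ.comul_eq x
    simp only [LinearMap.comp_apply, LinearMap.add_apply, LinearMap.sub_apply, map_sub,
      tensor_map_sub_left, tensor_map_sub_right] at *
    rw [h1, h2]
    abel
  eps_eq := LinearMap.ext fun x => by
    have h1 := LinearMap.congr_fun hΦ.eps_eq x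
    have h2 := LinearMap.congr_fun hΨ.eps_eq x
    simp only [LinearMap.comp_apply, LinearMap.sub_apply, map_sub] at *
    rw [h1, h2]
    exact sub_self _
  one_eq := by rw [LinearMap.sub_apply, hΦ.one_eq, hΨ.one_eq, sub_self]

/-- A recursion in the weight: the summand with `p.1 = 0` vanishes, and in the others `Φ` occurs in
full only at `p.2`, of smaller weight, while `p.1` enters through the component. -/
theorem IsComult.apply_wd {Φ : Bar R I E →ₗ[R] Bar R J E} (hΦ : IsComult Φ)
    (b : Module.Basis J R W) (m : Word I E) :
    Φ (wd R m) = unit R J E (eps R I E (wd R m)) +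
      ∑ p ∈ antidiagonal m, cons b (proj b (Φ (wd R p.1))) (Φ (wd R p.2)) := by
  conv_lhs => rw [eq_unit_add_glue b (Φ (wd R m))]
  congr 1
  · rw [← hΦ.eps_eq, LinearMap.comp_apply]
  · rw [← LinearMap.comp_apply (comul R J E), hΦ.comul_eq]
    simp

theorem IsCoder.apply_wd {Φ Ψ X : Bar R I E →ₗ[R] Bar R J E} (hX : IsCoder Φ Ψ X)
    (b : Module.Basis J R W) (m : Word I E) :
    X (wd R m) = ∑ p ∈ antidiagonal m, (cons b (proj b (X (wd R p.1))) (Ψ (wd R p.2)) +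
      cons b (proj b (Φ (wd R p.1))) (X (wd R p.2))) := by
  conv_lhs => rw [eq_unit_add_glue b (X (wd R m))]
  rw [← LinearMap.comp_apply (eps R J E), hX.eps_eq, ← LinearMap.comp_apply (comul R J E), hX.comul_eq]
  simp

/-! ### The weight filtration -/

/-- `X` lowers the weight of words by at least `c`. -/
def Lowers (c : ℕ) (X : Bar R I E →ₗ[R] Bar R J E) : Prop :=
  ∀ m k, X (wd R m) k ≠ 0 → k.weight + c ≤ m.weight

variable (R) in
/-- Combinations of words of weight at most `n`. -/
def weightLE (I : Type*) (E : Type*) [EnergyMonoid E] (n : ℤ) : Submodule R (Bar R I E) :=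
  Finsupp.supported R R {k | (k.weight : ℤ) ≤ n}

theorem mem_weightLE {n : ℤ} {q : Bar R I E} :
    q ∈ weightLE R I E n ↔ ∀ k, q k ≠ 0 → (k.weight : ℤ) ≤ n := by
  simp only [weightLE, Finsupp.mem_supported, Set.subset_def, Finset.mem_coe,
    Finsupp.mem_support_iff, Set.mem_ofPred_eq]

theorem wd_mem_weightLE {n : ℤ} {m : Word I E} (h : (m.weight : ℤ) ≤ n) :
    wd R m ∈ weightLE R I E n :=
  Finsupp.single_mem_supported R 1 h

theorem weightLE_mono {n n' : ℤ} (h : n ≤ n') : weightLE R I E n ≤ weightLE R I E n' :=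
  Finsupp.supported_mono fun _ hk => le_trans hk h

theorem lowers_iff {c : ℕ} {X : Bar R I E →ₗ[R] Bar R J E} :
    Lowers c X ↔ ∀ m, X (wd R m) ∈ weightLE R J E (m.weight - c) := by
  simp only [Lowers, mem_weightLE]
  refine forall_congr' fun m => forall_congr' fun k => imp_congr_right fun _ => ?_
  omega

theorem bar_eq_sum (q : Bar R I E) : q = ∑ m ∈ q.support, q m • wd R m := by
  conv_lhs => rw [← Finsupp.sum_single q]
  simp [Finsupp.sum, wd]

theorem Lowers.map_mem {c : ℕ} {X : Bar R I E →ₗ[R] Bar R J E} (hX : Lowers c X) {n : ℤ}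
    {q : Bar R I E} (hq : q ∈ weightLE R I E n) : X q ∈ weightLE R J E (n - c) := by
  rw [lowers_iff] at hX
  rw [mem_weightLE] at hq
  rw [bar_eq_sum q, map_sum]
  refine Submodule.sum_mem _ fun m hm => ?_
  rw [map_smul]
  refine Submodule.smul_mem _ _ (weightLE_mono ?_ (hX m))
  have := hq m (Finsupp.mem_support_iff.1 hm)
  omega

theorem Lowers.comp {c c' : ℕ} {X : Bar R J E →ₗ[R] Bar R K E} {Y : Bar R I E →ₗ[R] Bar R J E}
    (hX : Lowers c X) (hY : Lowers c' Y) : Lowers (c + c') (X ∘ₗ Y) := by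
  rw [lowers_iff] at *
  intro m
  have := (lowers_iff.2 hX).map_mem (hY m)
  refine weightLE_mono ?_ this
  push_cast
  omega

theorem cons_mem {b : Module.Basis I R V} (v : V) {n : ℤ} {q : Bar R I E}
    (hq : q ∈ weightLE R I E n) : cons b v q ∈ weightLE R I E (n + 1) := by
  rw [mem_weightLE] at hq
  rw [bar_eq_sum q, map_sum]
  refine Submodule.sum_mem _ fun m hm => ?_
  rw [map_smul]
  refine Submodule.smul_mem _ _ ?_
  rw [← b.linearCombination_repr v, Finsupp.linearCombination_apply, Finsupp.sum, map_sum,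
    LinearMap.sum_apply]
  refine Submodule.sum_mem _ fun i _ => ?_
  rw [map_smul, LinearMap.smul_apply, cons_basis]
  refine Submodule.smul_mem _ _ (wd_mem_weightLE ?_)
  have := hq m (Finsupp.mem_support_iff.1 hm)
  rw [Word.weight_cons]
  push_cast
  omega

/-- Each letter written by the recursion uses up a nonempty piece, of weight at least one, and an
empty word keeps its energy. -/
theorem IsComult.lowers {Φ : Bar R I E →ₗ[R] Bar R J E} (hΦ : IsComult Φ)
    (b : Module.Basis J R W) : Lowers 0 Φ := by
  classical
  rw [lowers_iff]
  intro m
  induction hn : m.weight using Nat.strong_induction_on generalizing m with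
  | _ n ih =>
  subst hn
  rw [hΦ.apply_wd b]
  refine add_mem ?_ (Submodule.sum_mem _ fun p hp => ?_)
  · simp only [eps, onWords_wd]
    split_ifs with h
    · simp only [unit, Finsupp.linearCombination_single, one_smul]
      exact wd_mem_weightLE (by simp [Word.weight, Word.nil])
    · rw [map_zero]
      exact zero_mem _
  · rw [mem_antidiagonal] at hp
    have h1 := Word.weight_add_le p.1 p.2
    rw [hp] at h1
    by_cases h0 : p.1 = 0
    · rw [h0, hΦ.one_eq, proj_zero, map_zero, LinearMap.zero_apply]
      exact zero_mem _
    · have h2 := Word.weight_pos h0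
      refine weightLE_mono ?_ (cons_mem _ (ih _ (by omega) p.2 rfl))
      push_cast
      omega

/-- The component of `X` is used exactly once and turns weight at least `1 + c` into one letter. The
remaining letters come from `Φ` and `Ψ`, which do not raise the weight. -/
theorem IsCoder.lowers {Φ Ψ X : Bar R I E →ₗ[R] Bar R J E} (hX : IsCoder Φ Ψ X)
    (hΦ : IsComult Φ) (hΨ : IsComult Ψ) (b : Module.Basis J R W) {c : ℕ}
    (h : ∀ m, m.weight < 1 + c → proj b (X (wd R m)) = 0) : Lowers c X := by
  rw [lowers_iff]
  intro m
  induction hn : m.weight using Nat.strong_induction_on generalizing m with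
  | _ n ih =>
  subst hn
  rw [hX.apply_wd b]
  refine Submodule.sum_mem _ fun p hp => ?_
  rw [mem_antidiagonal] at hp
  have h1 := Word.weight_add_le p.1 p.2
  rw [hp] at h1
  refine add_mem ?_ ?_
  · by_cases h2 : p.1.weight < 1 + c
    · rw [h _ h2, map_zero, LinearMap.zero_apply]
      exact zero_mem _
    · refine weightLE_mono ?_ (cons_mem _ (lowers_iff.1 (hΨ.lowers b) p.2))
      push_cast
      omega
  · by_cases h0 : p.1 = 0
    · rw [h0, hΦ.one_eq, proj_zero, map_zero, LinearMap.zero_apply]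
      exact zero_mem _
    · have h2 := Word.weight_pos h0
      refine weightLE_mono ?_ (cons_mem _ (ih _ (by omega) p.2 rfl))
      omega

/-- The recursion consists of the component and of values at words of smaller weight. Through
differences, this one vanishing statement gives the uniqueness of coderivations and of morphisms. -/
theorem IsCoder.eq_zero {Φ Ψ X : Bar R I E →ₗ[R] Bar R J E} (hX : IsCoder Φ Ψ X)
    (hΦ : Φ (wd R 0) = wd R 0) (b : Module.Basis J R W)
    (h : proj b ∘ₗ X = 0) : X = 0 := by
  refine bar_hom_ext fun m => ?_
  induction hn : m.weight using Nat.strong_induction_on generalizing m with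
  | _ n ih =>
  subst hn
  rw [hX.apply_wd b, LinearMap.zero_apply]
  refine Finset.sum_eq_zero fun p hp => ?_
  rw [mem_antidiagonal] at hp
  have h1 := Word.weight_add_le p.1 p.2
  rw [hp] at h1
  have h3 : proj b (X (wd R p.1)) = 0 := LinearMap.congr_fun h _
  rw [h3, map_zero, LinearMap.zero_apply, zero_add]
  by_cases h0 : p.1 = 0
  · rw [h0, hΦ, proj_zero, map_zero, LinearMap.zero_apply]
  · have h2 := Word.weight_pos h0
    rw [ih _ (by omega) p.2 rfl, LinearMap.zero_apply, map_zero]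

theorem IsCoder.ext {Φ Ψ X Y : Bar R I E →ₗ[R] Bar R J E} (hX : IsCoder Φ Ψ X)
    (hY : IsCoder Φ Ψ Y) (hΦ : Φ (wd R 0) = wd R 0) (b : Module.Basis J R W)
    (h : proj b ∘ₗ X = proj b ∘ₗ Y) : X = Y :=
  sub_eq_zero.1 ((hX.sub hY).eq_zero hΦ b (by rw [LinearMap.comp_sub, h, sub_self]))

/-- The difference of two morphisms is a coderivation along the pair. -/
theorem IsComult.ext {Φ Ψ : Bar R I E →ₗ[R] Bar R J E} (hΦ : IsComult Φ) (hΨ : IsComult Ψ)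
    (b : Module.Basis J R W) (h : proj b ∘ₗ Φ = proj b ∘ₗ Ψ) : Φ = Ψ :=
  sub_eq_zero.1 ((hΦ.sub hΨ).eq_zero hΦ.one_eq b (by rw [LinearMap.comp_sub, h, sub_self]))

/-! ### Existence -/

section Existence

theorem antidiagonal_zero : antidiagonal (0 : Word I E) = {(0, 0)} := by
  ext ⟨a, c⟩
  rw [mem_antidiagonal, Finset.mem_singleton]
  constructor
  · intro h
    have := Word.weight_add_le a c
    rw [h, Word.weight_zero] at this
    rw [Word.eq_zero_of_weight (m := a) (by omega), Word.eq_zero_of_weight (m := c) (by omega)]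
  · intro h
    simp only [Prod.mk.injEq] at h
    rw [h.1, h.2, add_zero]

open Classical in
theorem matrixFun_apply_zero {A : Type*} [Semiring A] (g : J → Conv (Word I E) A)
    (h0 : ∀ j, g j 0 = 0) (k : Word J E) : matrixFun g k 0 = if k = 0 then 1 else 0 := by
  rw [matrixFun, Conv.mul_apply, antidiagonal_zero, Finset.sum_singleton]
  obtain ⟨_ | ⟨j, u⟩, μ⟩ := k
  · simp only [energyFun, List.map_nil, List.prod_nil, Conv.one_apply, if_true, mul_one]
    congr 1
    exact propext ⟨fun h => Word.ext rfl (congrArg Word.energy h :).symm,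
      fun h => Word.ext rfl (congrArg Word.energy h :).symm⟩
  · rw [List.map_cons, List.prod_cons, Conv.mul_apply, antidiagonal_zero, Finset.sum_singleton,
      h0, zero_mul, mul_zero, if_neg]
    intro h
    simpa using congrArg Word.letters h

theorem eps_apply (q : Bar R J E) (l : E) : eps R J E q l = q (Word.nil J l) := by
  classical
  suffices h : Finsupp.lapply l ∘ₗ eps R J E = Finsupp.lapply (R := R) (Word.nil J l) from
    LinearMap.congr_fun h q
  refine bar_hom_ext fun k => ?_
  obtain ⟨u, μ⟩ := k
  simp only [eps, LinearMap.comp_apply, onWords_wd, Finsupp.lapply_apply, wd_apply, Word.nil,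
    Word.mk.injEq]
  by_cases h1 : u = [] <;> simp [h1, Finsupp.single_apply]

theorem repr_proj (b : Module.Basis J R W) (q : Bar R J E) (j : J) :
    b.repr (proj b q) j = q ⟨[j], 0⟩ := by
  classical
  suffices h : Finsupp.lapply j ∘ₗ b.repr.toLinearMap ∘ₗ proj b =
      Finsupp.lapply (R := R) (⟨[j], 0⟩ : Word J E) from LinearMap.congr_fun h q
  refine bar_hom_ext fun k => ?_
  by_cases hk : ∃ i, k = ⟨[i], 0⟩
  · obtain ⟨i, rfl⟩ := hk
    simp [wd_apply, Finsupp.single_apply]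
  · push Not at hk
    simp [proj_of_ne b hk, wd_apply, hk j]

open Classical in
theorem eps_wd_apply (m : Word I E) (l : E) :
    eps R I E (wd R m) l = if m = Word.nil I l then 1 else 0 := by
  rw [eps_apply, wd_apply]

/-- The coordinates of a vector valued function on words. -/
def coords (b : Module.Basis J R W) (f : Bar R I E →ₗ[R] W) (j : J) : Conv (Word I E) R :=
  fun m => b.repr (f (wd R m)) j

/-- The matrix coefficients are prescribed as the multiplicative extension of the coordinates of
`f`. Multiplicativity is compatibility with the comultiplication, and `finite_matrixFun` makes the
image of a word a finite combination. -/
theorem exists_isComult_coeff (b : Module.Basis J R W) (f : Bar R I E →ₗ[R] W)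
    (hf : f (wd R 0) = 0) :
    ∃ Φ : Bar R I E →ₗ[R] Bar R J E, IsComult Φ ∧ proj b ∘ₗ Φ = f ∧
      ∀ m k, Φ (wd R m) k = matrixFun (coords b f) k m := by
  classical
  have h0 : ∀ j, coords b f j 0 = 0 := fun j => by
    change b.repr (f (wd R 0)) j = 0
    simp [hf]
  have hfin := finite_matrixFun _ h0 fun m => (b.repr (f (wd R m))).hasFiniteSupport
  let Φ : Bar R I E →ₗ[R] Bar R J E := onWords R fun m =>
    Finsupp.ofSupportFinite (fun k => matrixFun (coords b f) k m) (hfin m)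
  have hΦ : ∀ m k, Φ (wd R m) k = matrixFun (coords b f) k m := fun m k => by
    simp only [Φ, onWords_wd]
    rfl
  refine ⟨Φ, ⟨?_, ?_, ?_⟩, ?_, hΦ⟩
  · refine bar_hom_ext fun m => tensor_ext fun k k' => ?_
    rw [LinearMap.comp_apply, pairCoeff_comul, hΦ, matrixFun_add, LinearMap.comp_apply, comul_wd]
    simp only [map_sum, TensorProduct.map_tmul, pairCoeff_tmul, hΦ]
    rfl
  · refine bar_hom_ext fun m => Finsupp.ext fun l => ?_
    rw [LinearMap.comp_apply, eps_apply, hΦ, matrixFun_nil, eps_wd_apply]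
    rfl
  · ext k
    rw [hΦ, matrixFun_apply_zero _ h0, wd_apply]
    simp only [eq_comm]
  · refine bar_hom_ext fun m => b.repr.injective (Finsupp.ext fun j => ?_)
    rw [LinearMap.comp_apply, repr_proj, hΦ, matrixFun_single]
    rfl

theorem exists_isComult (b : Module.Basis J R W) (f : Bar R I E →ₗ[R] W) (hf : f (wd R 0) = 0) :
    ∃ Φ : Bar R I E →ₗ[R] Bar R J E, IsComult Φ ∧ proj b ∘ₗ Φ = f :=
  let ⟨Φ, h1, h2, _⟩ := exists_isComult_coeff b f hf
  ⟨Φ, h1, h2⟩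

theorem IsComult.apply_coeff {Φ : Bar R I E →ₗ[R] Bar R J E} (hΦ : IsComult Φ)
    (b : Module.Basis J R W) (m : Word I E) (k : Word J E) :
    Φ (wd R m) k = matrixFun (coords b (proj b ∘ₗ Φ)) k m := by
  obtain ⟨Φ', h1, h2, h3⟩ := exists_isComult_coeff b (proj b ∘ₗ Φ)
    (by rw [LinearMap.comp_apply, hΦ.one_eq, proj_zero])
  rw [← h3, hΦ.ext h1 b h2.symm]

/-- The upper triangular family with given entries. -/
def upper (φ x ψ : J → Conv (Word I E) R) (j : J) : Conv (Word I E) (Matrix (Fin 2) (Fin 2) R) :=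
  fun m => !![φ j m, x j m; 0, ψ j m]

theorem upper_prod (φ x ψ : J → Conv (Word I E) R) (u : List J) (m : Word I E) :
    (u.map (upper φ x ψ)).prod m 0 0 = (u.map φ).prod m ∧
    (u.map (upper φ x ψ)).prod m 1 0 = 0 ∧
    (u.map (upper φ x ψ)).prod m 1 1 = (u.map ψ).prod m := by
  classical
  induction u generalizing m with
  | nil =>
    simp only [List.map_nil, List.prod_nil, Conv.one_apply]
    split_ifs <;> simp
  | cons j u ih =>
    simp only [List.map_cons, List.prod_cons, Conv.mul_apply, Matrix.sum_apply, Matrix.mul_apply,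
      Fin.sum_univ_two, (ih _).1, (ih _).2.1, (ih _).2.2]
    simp [upper]

theorem upper_matrixFun (φ x ψ : J → Conv (Word I E) R) (k : Word J E) (m : Word I E) :
    matrixFun (upper φ x ψ) k m 0 0 = matrixFun φ k m ∧
    matrixFun (upper φ x ψ) k m 1 1 = matrixFun ψ k m := by
  classical
  simp only [matrixFun, energyFun_mul, Matrix.sum_apply]
  constructor <;> refine Finset.sum_congr rfl fun q _ => ?_ <;> split_ifs <;>
    simp [(upper_prod φ x ψ _ _).1, (upper_prod φ x ψ _ _).2.2]

/-- In a product of upper triangular two by two matrices the off-diagonal entry obeys the Leibniz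
rule with respect to the diagonal entries. The multiplicative extension with matrix values thus
contains the coderivation, with `Φ` and `Ψ` on its diagonal. -/
theorem exists_isCoder (b : Module.Basis J R W) {Φ Ψ : Bar R I E →ₗ[R] Bar R J E}
    (hΦ : IsComult Φ) (hΨ : IsComult Ψ) (x : Bar R I E →ₗ[R] W) (hx : x (wd R 0) = 0) :
    ∃ X : Bar R I E →ₗ[R] Bar R J E, IsCoder Φ Ψ X ∧ proj b ∘ₗ X = x := by
  classical
  set g := upper (coords b (proj b ∘ₗ Φ)) (coords b x) (coords b (proj b ∘ₗ Ψ)) with hg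
  have h0 : ∀ j, g j 0 = 0 := fun j => by
    ext a c
    fin_cases a <;> fin_cases c <;>
      simp [hg, upper, coords, hΦ.one_eq, hΨ.one_eq, proj_zero, hx]
  have hfin := finite_matrixFun g h0 fun m =>
    ((((b.repr (proj b (Φ (wd R m)))).hasFiniteSupport).union
      (b.repr (x (wd R m))).hasFiniteSupport).union
      (b.repr (proj b (Ψ (wd R m)))).hasFiniteSupport).subset (by
      intro j hj
      by_contra hc
      simp only [Set.mem_union, not_or, Function.mem_support, not_not] at hc
      refine hj ?_
      ext a c
      fin_cases a <;> fin_cases c <;> simp [hg, upper, coords, hc])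
  let X : Bar R I E →ₗ[R] Bar R J E := onWords R fun m =>
    Finsupp.ofSupportFinite (fun k => matrixFun g k m 0 1) ((hfin m).subset fun k hk h => hk (by
      change matrixFun g k m 0 1 = 0
      rw [show matrixFun g k m = 0 from h]
      rfl))
  have hX : ∀ m k, X (wd R m) k = matrixFun g k m 0 1 := fun m k => by
    simp only [X, onWords_wd]
    rfl
  refine ⟨X, ⟨?_, ?_, ?_⟩, ?_⟩
  · refine bar_hom_ext fun m => tensor_ext fun k k' => ?_
    rw [LinearMap.comp_apply, pairCoeff_comul, hX, matrixFun_add, LinearMap.comp_apply, comul_wd]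
    simp only [map_sum, LinearMap.add_apply, TensorProduct.map_tmul, map_add, pairCoeff_tmul, hX,
      hΦ.apply_coeff b, hΨ.apply_coeff b, Conv.mul_apply, Matrix.sum_apply, Matrix.mul_apply,
      Fin.sum_univ_two]
    refine Finset.sum_congr rfl fun p _ => ?_
    rw [(upper_matrixFun _ _ _ _ _).1, (upper_matrixFun _ _ _ _ _).2, add_comm]
  · refine bar_hom_ext fun m => Finsupp.ext fun l => ?_
    rw [LinearMap.comp_apply, eps_apply, hX, matrixFun_nil, energyFun]
    split_ifs <;> simp
  · ext k
    rw [hX, matrixFun_apply_zero _ h0]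
    split_ifs <;> simp
  · refine bar_hom_ext fun m => b.repr.injective (Finsupp.ext fun j => ?_)
    rw [LinearMap.comp_apply, repr_proj, hX, matrixFun_single]
    rfl

end Existence

end Bar

open scoped TensorProduct

section Tools

variable {R : Type*} [Field R] {I J K E : Type*} [EnergyMonoid E]
  {U V W : Type*} [AddCommGroup U] [Module R U] [AddCommGroup V] [Module R V]
  [AddCommGroup W] [Module R W]

/-! ### Linear parts -/

theorem eps_of_ne {m : Word I E} (h : m.letters ≠ []) : eps R I E (wd R m) = 0 := by
  simp [eps, h]

/-- The inclusion of vectors as combinations of words of length one and energy zero. -/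
def single (E : Type*) [EnergyMonoid E] (b : Module.Basis I R V) : V →ₗ[R] Bar R I E :=
  (cons b).flip (wd R 0)

theorem single_basis (b : Module.Basis I R V) (i : I) :
    single E b (b i) = wd R ⟨[i], 0⟩ := by
  simp [single, Word.cons]

theorem cons_zero (b : Module.Basis I R V) (v : V) : cons b v (wd R 0) = single E b v := rfl

@[simp] theorem proj_cons_zero (b : Module.Basis I R V) (v : V) : proj b (single E b v) = v := by
  suffices h : proj b ∘ₗ single E b = LinearMap.id from LinearMap.congr_fun h v
  exact b.ext fun i => by simp [single_basis]

open Classical in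
theorem antidiagonal_single (i : I) : antidiagonal (⟨[i], 0⟩ : Word I E) =
    {(0, ⟨[i], 0⟩), (⟨[i], 0⟩, 0)} := by
  ext ⟨a, c⟩
  rw [mem_antidiagonal]
  simp only [Finset.mem_insert, Finset.mem_singleton, Prod.mk.injEq]
  constructor
  · intro h
    have h1 := Word.weight_add_le a c
    rw [h] at h1
    have h2 : (⟨[i], 0⟩ : Word I E).weight = 1 := by simp [Word.weight, Word.height_zero]
    by_cases ha : a = 0
    · subst ha
      exact Or.inl ⟨rfl, by rw [← h, zero_add]⟩
    · have := Word.weight_pos ha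
      have hc : c = 0 := Word.eq_zero_of_weight (by omega)
      subst hc
      exact Or.inr ⟨by rw [← h, add_zero], rfl⟩
  · rintro (⟨rfl, rfl⟩ | ⟨rfl, rfl⟩) <;> simp

theorem sum_antidiagonal_single {X : Type*} [AddCommMonoid X] (i : I)
    (F : Word I E × Word I E → X) :
    ∑ p ∈ antidiagonal (⟨[i], 0⟩ : Word I E), F p = F (0, ⟨[i], 0⟩) + F (⟨[i], 0⟩, 0) := by
  classical
  rw [antidiagonal_single, Finset.sum_pair]
  intro h
  have := congrArg (fun p => p.1.letters) h
  simp at this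

/-- The linear part of a map between bar coalgebras. -/
def lead (b : Module.Basis I R V) (b' : Module.Basis J R W) (X : Bar R I E →ₗ[R] Bar R J E) :
    V →ₗ[R] W := proj b' ∘ₗ X ∘ₗ single E b

theorem lead_apply (b : Module.Basis I R V) (b' : Module.Basis J R W)
    (X : Bar R I E →ₗ[R] Bar R J E) (v : V) : lead b b' X v = proj b' (X (single E b v)) := rfl

theorem lead_id (b : Module.Basis I R V) :
    lead b b (LinearMap.id : Bar R I E →ₗ[R] Bar R I E) = LinearMap.id :=
  LinearMap.ext fun v => by simp [lead_apply]

/-- A single letter of energy zero has only the trivial cuts. Hence taking linear parts is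
compatible with composition. -/
theorem IsComult.single {Φ : Bar R I E →ₗ[R] Bar R J E} (hΦ : IsComult Φ)
    (b : Module.Basis I R V) (b' : Module.Basis J R W) (v : V) :
    Φ (single E b v) = AInf.single E b' (lead b b' Φ v) := by
  suffices h : Φ ∘ₗ AInf.single E b = AInf.single E b' ∘ₗ lead b b' Φ from LinearMap.congr_fun h v
  refine b.ext fun i => ?_
  rw [LinearMap.comp_apply, LinearMap.comp_apply, lead_apply, single_basis, hΦ.apply_wd b',
    sum_antidiagonal_single, eps_of_ne (by simp)]
  simp [hΦ.one_eq, proj_zero, cons_zero]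

theorem IsCoder.single {Φ Ψ X : Bar R I E →ₗ[R] Bar R J E} (hX : IsCoder Φ Ψ X)
    (hΦ : IsComult Φ) (hΨ : IsComult Ψ) (b : Module.Basis I R V) (b' : Module.Basis J R W) (v : V) :
    X (single E b v) = AInf.single E b' (lead b b' X v) := by
  suffices h : X ∘ₗ AInf.single E b = AInf.single E b' ∘ₗ lead b b' X from LinearMap.congr_fun h v
  refine b.ext fun i => ?_
  rw [LinearMap.comp_apply, LinearMap.comp_apply, lead_apply, single_basis, hX.apply_wd b',
    sum_antidiagonal_single]
  simp [hX.one_eq, hΦ.one_eq, hΨ.one_eq, proj_zero, cons_zero]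

theorem lead_comp {c : Module.Basis K R U} {b : Module.Basis I R V} {b' : Module.Basis J R W}
    {Y : Bar R I E →ₗ[R] Bar R J E} {X : Bar R K E →ₗ[R] Bar R I E}
    (hX : ∀ v, X (single E c v) = single E b (lead c b X v)) :
    lead c b' (Y ∘ₗ X) = lead b b' Y ∘ₗ lead c b X :=
  LinearMap.ext fun v => by
    rw [lead_apply, LinearMap.comp_apply, hX, LinearMap.comp_apply, lead_apply _ _ Y]

/-! ### The morphism and the coderivation with a given component -/

open Classical in
/-- The morphism with component `f`. -/
def hat (b : Module.Basis J R W) (f : Bar R I E →ₗ[R] W) : Bar R I E →ₗ[R] Bar R J E :=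
  if h : f (wd R 0) = 0 then (exists_isComult b f h).choose else 0

theorem isComult_hat (b : Module.Basis J R W) {f : Bar R I E →ₗ[R] W} (h : f (wd R 0) = 0) :
    IsComult (hat b f) := by
  rw [hat, dif_pos h]
  exact (exists_isComult b f h).choose_spec.1

theorem proj_hat (b : Module.Basis J R W) {f : Bar R I E →ₗ[R] W} (h : f (wd R 0) = 0)
    (q : Bar R I E) : proj b (hat b f q) = f q := by
  rw [hat, dif_pos h]
  exact LinearMap.congr_fun (exists_isComult b f h).choose_spec.2 q

open Classical in
/-- The coderivation along `Φ` and `Ψ` with component `x`. -/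
def coder (b : Module.Basis J R W) (Φ Ψ : Bar R I E →ₗ[R] Bar R J E) (x : Bar R I E →ₗ[R] W) :
    Bar R I E →ₗ[R] Bar R J E :=
  if h : IsComult Φ ∧ IsComult Ψ ∧ x (wd R 0) = 0 then
    (exists_isCoder b h.1 h.2.1 x h.2.2).choose else 0

theorem isCoder_coder (b : Module.Basis J R W) {Φ Ψ : Bar R I E →ₗ[R] Bar R J E}
    (hΦ : IsComult Φ) (hΨ : IsComult Ψ) {x : Bar R I E →ₗ[R] W} (hx : x (wd R 0) = 0) :
    IsCoder Φ Ψ (coder b Φ Ψ x) := by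
  rw [coder, dif_pos ⟨hΦ, hΨ, hx⟩]
  exact (exists_isCoder b hΦ hΨ x hx).choose_spec.1

theorem proj_coder (b : Module.Basis J R W) {Φ Ψ : Bar R I E →ₗ[R] Bar R J E}
    (hΦ : IsComult Φ) (hΨ : IsComult Ψ) {x : Bar R I E →ₗ[R] W} (hx : x (wd R 0) = 0)
    (q : Bar R I E) : proj b (coder b Φ Ψ x q) = x q := by
  rw [coder, dif_pos ⟨hΦ, hΨ, hx⟩]
  exact LinearMap.congr_fun (exists_isCoder b hΦ hΨ x hx).choose_spec.2 q

/-- The strict morphism induced by a linear map. -/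
def strict (E : Type*) [EnergyMonoid E] (b : Module.Basis I R V) (b' : Module.Basis J R W)
    (a : V →ₗ[R] W) : Bar R I E →ₗ[R] Bar R J E :=
  hat b' (a ∘ₗ proj b)

theorem isComult_strict (b : Module.Basis I R V) (b' : Module.Basis J R W) (a : V →ₗ[R] W) :
    IsComult (strict E b b' a) :=
  isComult_hat _ (by rw [LinearMap.comp_apply, proj_zero, map_zero])

@[simp] theorem proj_strict (b : Module.Basis I R V) (b' : Module.Basis J R W) (a : V →ₗ[R] W)
    (q : Bar R I E) : proj b' (strict E b b' a q) = a (proj b q) :=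
  proj_hat _ (by rw [LinearMap.comp_apply, proj_zero, map_zero]) q

theorem strict_id (b : Module.Basis I R V) : strict E b b LinearMap.id = LinearMap.id :=
  (isComult_strict _ _ _).ext IsComult.id b (LinearMap.ext fun q => by simp)

theorem strict_comp (c : Module.Basis K R U) (b : Module.Basis I R V) (b' : Module.Basis J R W)
    (a : V →ₗ[R] W) (a' : U →ₗ[R] V) :
    strict E b b' a ∘ₗ strict E c b a' = strict E c b' (a ∘ₗ a') :=
  ((isComult_strict _ _ _).comp (isComult_strict _ _ _)).ext (isComult_strict _ _ _) b'
    (LinearMap.ext fun q => by simp)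

theorem lead_strict (b : Module.Basis I R V) (b' : Module.Basis J R W) (a : V →ₗ[R] W) :
    lead b b' (strict E b b' a) = a :=
  LinearMap.ext fun v => by simp [lead_apply]

theorem strict_zero (b : Module.Basis I R V) (b' : Module.Basis J R W) (a : V →ₗ[R] W) (l : E) :
    strict E b b' a (wd R (Word.nil I l)) = wd R (Word.nil J l) := by
  rw [(isComult_strict _ _ _).apply_wd b', Finset.sum_eq_zero, add_zero]
  · simp [eps, unit, Word.nil]
  · intro p hp
    rw [mem_antidiagonal] at hp
    rw [proj_strict, proj_of_ne, map_zero, map_zero, LinearMap.zero_apply]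
    intro i h
    have := congrArg Word.letters hp
    simp [h, Word.nil] at this

theorem sum_proj {X : Type*} [AddCommGroup X] [Module R X] (b : Module.Basis I R V)
    (i : I) (m : Word I E) (F : V →ₗ[R] Bar R I E →ₗ[R] X) :
    ∑ p ∈ antidiagonal (Word.cons i m), F (proj b (wd R p.1)) (wd R p.2) = F (b i) (wd R m) := by
  rw [Finset.sum_eq_single (⟨[i], 0⟩, m)]
  · simp
  · intro p hp hne
    rw [mem_antidiagonal] at hp
    rw [proj_of_ne, map_zero, LinearMap.zero_apply]
    rintro j h
    have h1 := congrArg Word.letters hp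
    have h2 := congrArg Word.energy hp
    simp only [h, Word.letters_add, Word.energy_add, List.cons_append, List.nil_append, Word.cons,
      List.cons.injEq, zero_add] at h1 h2
    exact hne (Prod.ext (by rw [h, h1.1]) (Word.ext h1.2 h2))
  · intro h
    exact absurd (mem_antidiagonal.2 (Word.ext (by simp [Word.cons]) (by simp [Word.cons]))) h

theorem strict_cons (b : Module.Basis I R V) (b' : Module.Basis J R W) (a : V →ₗ[R] W)
    (i : I) (m : Word I E) : strict E b b' a (wd R (Word.cons i m)) =
      cons b' (a (b i)) (strict E b b' a (wd R m)) := by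
  rw [(isComult_strict _ _ _).apply_wd b', eps_of_ne (by simp [Word.cons]), map_zero, zero_add]
  simp only [proj_strict]
  exact sum_proj b i m ((LinearMap.lcomp R _ (strict E b b' a)) ∘ₗ cons b' ∘ₗ a)

/-- A component that factors through `proj b` sees exactly the first letter, so the recursion runs
over letters. It serves to prove polynomial dependence on parameters. -/
theorem coder_cons (b : Module.Basis I R V) (b' : Module.Basis J R W) (a c x : V →ₗ[R] W)
    {X : Bar R I E →ₗ[R] Bar R J E} (hX : IsCoder (strict E b b' a) (strict E b b' c) X)
    (h : proj b' ∘ₗ X = x ∘ₗ proj b) (i : I) (m : Word I E) : X (wd R (Word.cons i m)) =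
      cons b' (x (b i)) (strict E b b' c (wd R m)) + cons b' (a (b i)) (X (wd R m)) := by
  have h' : ∀ q, proj b' (X q) = x (proj b q) := LinearMap.congr_fun h
  rw [hX.apply_wd b', Finset.sum_add_distrib]
  simp only [proj_strict, h']
  exact congrArg₂ (· + ·) (sum_proj b i m ((LinearMap.lcomp R _ (strict E b b' c)) ∘ₗ cons b' ∘ₗ x))
    (sum_proj b i m ((LinearMap.lcomp R _ X) ∘ₗ cons b' ∘ₗ a))

theorem coder_nil (b : Module.Basis I R V) (b' : Module.Basis J R W) (a c x : V →ₗ[R] W)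
    {X : Bar R I E →ₗ[R] Bar R J E} (hX : IsCoder (strict E b b' a) (strict E b b' c) X)
    (h : proj b' ∘ₗ X = x ∘ₗ proj b) (l : E) : X (wd R (Word.nil I l)) = 0 := by
  have h' : ∀ q, proj b' (X q) = x (proj b q) := LinearMap.congr_fun h
  rw [hX.apply_wd b']
  refine Finset.sum_eq_zero fun p hp => ?_
  rw [mem_antidiagonal] at hp
  rw [h', proj_strict, proj_of_ne]
  · simp
  · intro i h
    have := congrArg Word.letters hp
    simp [h, Word.nil] at this

/-! ### Sums of compositions of coderivations -/

/-- Each composite of two coderivations has two cross terms in its comultiplication. By `c₁` and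
`c₂`, the term `X₁ Φ₂ ⊗ Ψ₁ X₂` cancels `Φ₃ X₄ ⊗ X₃ Ψ₄`, and by `c₃` and `c₄` the other two cancel.
This takes the place of the graded commutator of coderivations, with the Koszul signs absorbed in
the morphisms. -/
theorem IsCoder.comp_add_comp {Φ₁ Ψ₁ X₁ Φ₃ Ψ₃ X₃ : Bar R J E →ₗ[R] Bar R K E}
    {Φ₂ Ψ₂ X₂ Φ₄ Ψ₄ X₄ : Bar R I E →ₗ[R] Bar R J E}
    (h₁ : IsCoder Φ₁ Ψ₁ X₁) (h₂ : IsCoder Φ₂ Ψ₂ X₂) (h₃ : IsCoder Φ₃ Ψ₃ X₃)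
    (h₄ : IsCoder Φ₄ Ψ₄ X₄) (hΦ : Φ₁ ∘ₗ Φ₂ = Φ₃ ∘ₗ Φ₄) (hΨ : Ψ₁ ∘ₗ Ψ₂ = Ψ₃ ∘ₗ Ψ₄)
    (c₁ : X₁ ∘ₗ Φ₂ = -(Φ₃ ∘ₗ X₄)) (c₂ : Ψ₁ ∘ₗ X₂ = X₃ ∘ₗ Ψ₄)
    (c₃ : X₃ ∘ₗ Φ₄ = -(Φ₁ ∘ₗ X₂)) (c₄ : Ψ₃ ∘ₗ X₄ = X₁ ∘ₗ Ψ₂) :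
    IsCoder (Φ₁ ∘ₗ Φ₂) (Ψ₁ ∘ₗ Ψ₂) (X₁ ∘ₗ X₂ + X₃ ∘ₗ X₄) where
  comul_eq := by
    rw [LinearMap.comp_add, ← LinearMap.comp_assoc, h₁.comul_eq, LinearMap.comp_assoc, h₂.comul_eq,
      ← LinearMap.comp_assoc _ _ (comul R K E), h₃.comul_eq, LinearMap.comp_assoc (X₄), h₄.comul_eq]
    simp only [← LinearMap.comp_assoc, ← LinearMap.add_comp]
    congr 1
    simp only [LinearMap.add_comp, LinearMap.comp_add, ← TensorProduct.map_comp]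
    refine TensorProduct.ext' fun x y => ?_
    have e₁ := LinearMap.congr_fun c₁ x
    have e₂ := LinearMap.congr_fun c₂ y
    have e₃ := LinearMap.congr_fun c₃ x
    have e₄ := LinearMap.congr_fun c₄ y
    have e₅ := LinearMap.congr_fun hΦ x
    have e₆ := LinearMap.congr_fun hΨ y
    simp only [LinearMap.comp_apply, LinearMap.neg_apply] at e₁ e₂ e₃ e₄ e₅ e₆
    simp only [LinearMap.add_apply, TensorProduct.map_tmul, LinearMap.comp_apply, e₁, e₂, e₃, e₄,
      e₅, e₆, TensorProduct.neg_tmul, TensorProduct.add_tmul, TensorProduct.tmul_add]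
    abel
  eps_eq := by
    rw [LinearMap.comp_add, ← LinearMap.comp_assoc, h₁.eps_eq, ← LinearMap.comp_assoc, h₃.eps_eq]
    simp
  one_eq := by simp [h₂.one_eq, h₄.one_eq]

/-! ### Inverses -/

/-- The geometric series for the inverse of `1 + Y` is finite on each element, since `Y` strictly
lowers weights and weights are natural numbers. -/
theorem bijective_of_lowers {X : Bar R I E →ₗ[R] Bar R I E} (h : Lowers 1 (X - LinearMap.id)) :
    Function.Bijective X := by
  set Y := X - LinearMap.id with hY
  have hXY : ∀ q, X q = q + Y q := fun q => by simp [hY]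
  have hmem : ∀ q : Bar R I E, ∃ n : ℕ, q ∈ weightLE R I E n := fun q => by
    refine ⟨q.support.sup Word.weight, mem_weightLE.2 fun k hk => ?_⟩
    exact_mod_cast Finset.le_sup (f := Word.weight) (Finsupp.mem_support_iff.2 hk)
  have hneg : ∀ q ∈ weightLE R I E (-1), q = 0 := fun q hq => by
    ext k
    by_contra hk
    have := mem_weightLE.1 hq k hk
    omega
  constructor
  · rw [← LinearMap.ker_eq_bot, LinearMap.ker_eq_bot']
    intro q hq
    have h1 : q = -Y q := by
      rw [hXY] at hq
      exact eq_neg_of_add_eq_zero_left hq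
    obtain ⟨n, hn⟩ := hmem q
    have h2 : ∀ k : ℕ, q ∈ weightLE R I E (n - k) := fun k => by
      induction k with
      | zero => simpa using hn
      | succ k ih =>
        rw [h1]
        refine Submodule.neg_mem _ (weightLE_mono ?_ (h.map_mem ih))
        push_cast
        omega
    exact hneg q (weightLE_mono (by push_cast; omega) (h2 (n + 1)))
  · intro q
    obtain ⟨n, hn⟩ := hmem q
    have : ∀ n : ℕ, ∀ q ∈ weightLE R I E ((n : ℤ) - 1), ∃ p, X p = q := fun n => by
      induction n with
      | zero => exact fun q hq => ⟨0, by rw [map_zero, hneg q (by simpa using hq)]⟩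
      | succ n ih =>
        intro q hq
        obtain ⟨p, hp⟩ := ih (-Y q) (Submodule.neg_mem _ (weightLE_mono (by push_cast; omega)
          (h.map_mem hq)))
        exact ⟨q + p, by rw [map_add, hp, hXY q]; abel⟩
    exact this (n + 1) q (weightLE_mono (by push_cast; omega) hn)

theorem exists_inverse_of_lowers {X : Bar R I E →ₗ[R] Bar R I E}
    (h : Lowers 1 (X - LinearMap.id)) : ∃ Y : Bar R I E →ₗ[R] Bar R I E,
      X ∘ₗ Y = LinearMap.id ∧ Y ∘ₗ X = LinearMap.id := by
  let e := LinearEquiv.ofBijective X (bijective_of_lowers h)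
  exact ⟨e.symm, LinearMap.ext fun x => e.apply_symm_apply x,
    LinearMap.ext fun x => e.symm_apply_apply x⟩

theorem IsComult.inverse {Φ : Bar R I E →ₗ[R] Bar R J E} {Ψ : Bar R J E →ₗ[R] Bar R I E}
    (hΦ : IsComult Φ) (h : Φ ∘ₗ Ψ = LinearMap.id) (h' : Ψ ∘ₗ Φ = LinearMap.id) : IsComult Ψ where
  comul_eq := by
    calc comul R I E ∘ₗ Ψ
        = TensorProduct.map (Ψ ∘ₗ Φ) (Ψ ∘ₗ Φ) ∘ₗ comul R I E ∘ₗ Ψ := by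
          rw [h', TensorProduct.map_id, LinearMap.id_comp]
      _ = TensorProduct.map Ψ Ψ ∘ₗ (TensorProduct.map Φ Φ ∘ₗ comul R I E) ∘ₗ Ψ := by
          rw [TensorProduct.map_comp]
          rfl
      _ = _ := by rw [← hΦ.comul_eq, LinearMap.comp_assoc, h, LinearMap.comp_id]
  eps_eq := by rw [← hΦ.eps_eq, LinearMap.comp_assoc, h, LinearMap.comp_id]
  one_eq := by rw [← hΦ.one_eq, ← LinearMap.comp_apply, h', LinearMap.id_apply]

/-- The difference to the identity is a coderivation whose component vanishes on words of weight at
most one, by the hypothesis on the linear part; hence it lowers weights by at least one. -/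
theorem IsComult.exists_inverse {Φ : Bar R I E →ₗ[R] Bar R I E} (hΦ : IsComult Φ)
    (b : Module.Basis I R V) (h : lead b b Φ = LinearMap.id) :
    ∃ Ψ : Bar R I E →ₗ[R] Bar R I E, IsComult Ψ ∧ Φ ∘ₗ Ψ = LinearMap.id ∧
      Ψ ∘ₗ Φ = LinearMap.id ∧ lead b b Ψ = LinearMap.id := by
  have hl : Lowers 1 (Φ - LinearMap.id) := by
    refine (hΦ.sub IsComult.id).lowers hΦ IsComult.id b fun m hm => ?_
    rcases Nat.lt_or_ge m.weight 1 with h1 | h1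
    · rw [Word.eq_zero_of_weight (m := m) (by omega)]
      simp [hΦ.one_eq]
    · obtain ⟨i, rfl⟩ := Word.eq_single_of_weight (m := m) (by omega)
      have := LinearMap.congr_fun h (b i)
      rw [lead_apply, single_basis] at this
      simp [this]
  obtain ⟨Ψ, h1, h2⟩ := exists_inverse_of_lowers hl
  refine ⟨Ψ, hΦ.inverse h1 h2, h1, h2, ?_⟩
  have h3 := lead_comp (b' := b) (Y := Ψ) (hΦ.single b b)
  rw [h2, h, lead_id] at h3
  exact h3.symm

end Tools

open scoped TensorProduct

/-! ### Symmetries and degrees -/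

section Sign

variable {N : ℕ}

theorem sign_add (a c : ZMod (2 * N)) : sign (a + c) = sign a * sign c := by
  have h2 : ∀ x : ZMod 2, x = 0 ∨ x = 1 := by decide
  simp only [sign, map_add]
  rcases h2 (ZMod.castHom (dvd_mul_right 2 N) (ZMod 2) a) with ha | ha <;>
    rcases h2 (ZMod.castHom (dvd_mul_right 2 N) (ZMod 2) c) with hc | hc <;>
    rw [ha, hc] <;> decide

theorem sign_zero : sign (0 : ZMod (2 * N)) = 1 := by
  simp [sign]

theorem sign_one : sign (1 : ZMod (2 * N)) = -1 := by
  simp only [sign, map_one]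
  decide

theorem sign_mul_self (a : ZMod (2 * N)) : sign a * sign a = 1 := by
  simp only [sign]
  split_ifs <;> rfl

theorem sign_neg (a : ZMod (2 * N)) : sign (-a) = sign a := by
  have h := sign_add (-a) a
  rw [neg_add_cancel, sign_zero] at h
  calc sign (-a) = sign (-a) * sign a * sign a := by rw [mul_assoc, sign_mul_self, mul_one]
    _ = sign a := by rw [← h, one_mul]

end Sign

section Sym

variable {R : Type*} [Field R] {G : Type*} {N : ℕ} {X Y Z : Type*} [AddCommGroup X] [Module R X]
  [AddCommGroup Y] [Module R Y] [AddCommGroup Z] [Module R Z]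

variable (R G N X) in
/-- A family of endomorphisms and projections to the homogeneous parts. -/
structure Sym where
  /-- The action. -/
  act : G → X →ₗ[R] X
  /-- The projections. -/
  pr : ZMod (2 * N) → X →ₗ[R] X

/-- `a` commutes with the actions and is homogeneous of degree `r`. -/
structure Good (S : Sym R G N X) (S' : Sym R G N Y) (r : ZMod (2 * N)) (a : X →ₗ[R] Y) : Prop where
  map_act : ∀ g x, a (S.act g x) = S'.act g (a x)
  map_pr : ∀ d x, a (S.pr d x) = S'.pr (d + r) (a x)

namespace Good

variable {S : Sym R G N X} {S' : Sym R G N Y} {S'' : Sym R G N Z} {r r' t : ZMod (2 * N)}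

theorem comp {a : X →ₗ[R] Y} {c : Y →ₗ[R] Z} (hc : Good S' S'' r' c) (ha : Good S S' r a)
    (h : r + r' = t) : Good S S'' t (c ∘ₗ a) where
  map_act g x := by simp [ha.map_act, hc.map_act]
  map_pr d x := by simp [ha.map_pr, hc.map_pr, ← h, add_assoc]

theorem add {a c : X →ₗ[R] Y} (ha : Good S S' r a) (hc : Good S S' r c) : Good S S' r (a + c) where
  map_act g x := by simp [ha.map_act, hc.map_act]
  map_pr d x := by simp [ha.map_pr, hc.map_pr]

theorem sub {a c : X →ₗ[R] Y} (ha : Good S S' r a) (hc : Good S S' r c) : Good S S' r (a - c) where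
  map_act g x := by simp [ha.map_act, hc.map_act]
  map_pr d x := by simp [ha.map_pr, hc.map_pr]

theorem smul {a : X →ₗ[R] Y} (ha : Good S S' r a) (c : R) : Good S S' r (c • a) where
  map_act g x := by simp [ha.map_act]
  map_pr d x := by simp [ha.map_pr]

theorem id : Good S S 0 (LinearMap.id : X →ₗ[R] X) where
  map_act _ _ := rfl
  map_pr _ _ := by rw [add_zero]; rfl

theorem inverse {a : X →ₗ[R] Y} {c : Y →ₗ[R] X} (ha : Good S S' 0 a) (h : a ∘ₗ c = LinearMap.id)
    (h' : c ∘ₗ a = LinearMap.id) : Good S' S 0 c where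
  map_act g y := by
    have e : ∀ y, a (c y) = y := LinearMap.congr_fun h
    have e' : ∀ x, c (a x) = x := LinearMap.congr_fun h'
    conv_lhs => rw [← e y, ← ha.map_act, e']
  map_pr d y := by
    have e : ∀ y, a (c y) = y := LinearMap.congr_fun h
    have e' : ∀ x, c (a x) = x := LinearMap.congr_fun h'
    have := ha.map_pr d (c y)
    rw [e, add_zero] at this
    rw [← this, e', add_zero]

end Good

/-- `t` is the sign operator. -/
structure IsSign (S : Sym R G N X) (t : X →ₗ[R] X) : Prop where
  map_pr : ∀ d x, t (S.pr d x) = sign d • S.pr d x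
  induction : ∀ p : Submodule R X, (∀ d x, S.pr d x ∈ p) → p = ⊤

/-- Both sides are explicit on homogeneous elements, which generate. The sign rules of the
coderivation calculus come from here: maps of odd degree anticommute with the sign operators. -/
theorem Good.sign_comm {S : Sym R G N X} {S' : Sym R G N Y} {r : ZMod (2 * N)} {a : X →ₗ[R] Y}
    (ha : Good S S' r a) {t : X →ₗ[R] X} {t' : Y →ₗ[R] Y} (ht : IsSign S t) (ht' : IsSign S' t')
    (x : X) : a (t x) = sign r • t' (a x) := by
  have h := ht.induction (LinearMap.eqLocus (a ∘ₗ t) (sign r • (t' ∘ₗ a))) (fun d x => by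
    rw [LinearMap.mem_eqLocus, LinearMap.smul_apply, LinearMap.comp_apply, LinearMap.comp_apply,
      ht.map_pr, map_zsmul, ha.map_pr, ht'.map_pr, smul_smul, sign_add, mul_left_comm,
      sign_mul_self, mul_one])
  exact (LinearMap.mem_eqLocus.1 (h ▸ Submodule.mem_top : x ∈ _))

theorem IsSign.comp_self {S : Sym R G N X} {t : X →ₗ[R] X} (ht : IsSign S t) :
    t ∘ₗ t = LinearMap.id := by
  have h := ht.induction (LinearMap.eqLocus (t ∘ₗ t) LinearMap.id) (fun d x => by
    rw [LinearMap.mem_eqLocus, LinearMap.comp_apply, ht.map_pr, map_zsmul, ht.map_pr, smul_smul,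
      sign_mul_self, one_smul, LinearMap.id_apply])
  exact LinearMap.ext fun x => LinearMap.mem_eqLocus.1 (h ▸ Submodule.mem_top : x ∈ _)

end Sym

/-! ### Homogeneous equivariant maps of words. -/

section Graded

variable {R : Type*} [Field R] {I J K E : Type*} [EnergyMonoid E]
  {U V W : Type*} [AddCommGroup U] [Module R U] [AddCommGroup V] [Module R V]
  [AddCommGroup W] [Module R W] {G : Type*} {N : ℕ}

/-- The degree of a word. -/
def wordDeg (deg : I → ZMod (2 * N)) (m : Word I E) : ZMod (2 * N) := (m.letters.map deg).sum

theorem wordDeg_add (deg : I → ZMod (2 * N)) (m k : Word I E) :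
    wordDeg deg (m + k) = wordDeg deg m + wordDeg deg k := by
  simp [wordDeg]

theorem wordDeg_cons (deg : I → ZMod (2 * N)) (i : I) (m : Word I E) :
    wordDeg deg (Word.cons i m) = deg i + wordDeg deg m := by
  simp [wordDeg, Word.cons]

/-- A homogeneous basis with an action. -/
structure Model (R I V G : Type*) [Field R] [AddCommGroup V] [Module R V] (N : ℕ) where
  /-- The basis. -/
  b : Module.Basis I R V
  /-- The degrees. -/
  deg : I → ZMod (2 * N)
  /-- The action. -/
  act : G → V →ₗ[R] V

namespace Model

variable (M : Model R I V G N) (M' : Model R J W G N)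

open Classical in
/-- The projections and the action on vectors. -/
def vec : Sym R G N V where
  act := M.act
  pr d := M.b.constr R fun i => if M.deg i = d then M.b i else 0

variable (E) in
open Classical in
/-- The projections and the action on words. -/
def bar : Sym R G N (Bar R I E) where
  act g := strict E M.b M.b (M.act g)
  pr d := onWords R fun m => if wordDeg M.deg m = d then wd R m else 0

/-- The sign operator on vectors. -/
def sgn : V →ₗ[R] V := M.b.constr R fun i => sign (M.deg i) • M.b i

variable (E) in
/-- The sign operator on words. -/
def tau : Bar R I E →ₗ[R] Bar R I E := strict E M.b M.b M.sgn

open Classical in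
theorem vec_pr_basis (d : ZMod (2 * N)) (i : I) :
    M.vec.pr d (M.b i) = if M.deg i = d then M.b i else 0 := by
  simp [vec]

open Classical in
theorem bar_pr_wd (d : ZMod (2 * N)) (m : Word I E) :
    (M.bar E).pr d (wd R m) = if wordDeg M.deg m = d then wd R m else 0 := by
  simp [bar]

theorem bar_pr_wd_self (m : Word I E) : (M.bar E).pr (wordDeg M.deg m) (wd R m) = wd R m := by
  classical
  rw [bar_pr_wd, if_pos rfl]

theorem vec_pr_basis_self (i : I) : M.vec.pr (M.deg i) (M.b i) = M.b i := by
  classical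
  rw [vec_pr_basis, if_pos rfl]

open Classical in
theorem vec_pr_pr (d d' : ZMod (2 * N)) (v : V) :
    M.vec.pr d (M.vec.pr d' v) = if d' = d then M.vec.pr d' v else 0 := by
  suffices h : M.vec.pr d ∘ₗ M.vec.pr d' = if d' = d then M.vec.pr d' else 0 by
    have := LinearMap.congr_fun h v
    rw [LinearMap.comp_apply] at this
    rw [this]
    split_ifs <;> rfl
  refine M.b.ext fun i => ?_
  rw [LinearMap.comp_apply, vec_pr_basis]
  by_cases h : M.deg i = d'
  · rw [if_pos h, vec_pr_basis, h]
    by_cases h' : d' = d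
    · rw [if_pos h', if_pos h', vec_pr_basis, if_pos h]
    · rw [if_neg h', if_neg h', LinearMap.zero_apply]
  · rw [if_neg h, map_zero]
    split_ifs
    · rw [vec_pr_basis, if_neg h]
    · rfl

open Classical in
theorem bar_pr_pr (d d' : ZMod (2 * N)) (q : Bar R I E) :
    (M.bar E).pr d ((M.bar E).pr d' q) = if d' = d then (M.bar E).pr d' q else 0 := by
  suffices h : (M.bar E).pr d ∘ₗ (M.bar E).pr d' = if d' = d then (M.bar E).pr d' else 0 by
    have := LinearMap.congr_fun h q
    rw [LinearMap.comp_apply] at this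
    rw [this]
    split_ifs <;> rfl
  refine bar_hom_ext fun m => ?_
  rw [LinearMap.comp_apply, bar_pr_wd]
  by_cases h : wordDeg M.deg m = d'
  · rw [if_pos h, bar_pr_wd, h]
    by_cases h' : d' = d
    · rw [if_pos h', if_pos h', bar_pr_wd, if_pos h]
    · rw [if_neg h', if_neg h', LinearMap.zero_apply]
  · rw [if_neg h, map_zero]
    split_ifs
    · rw [bar_pr_wd, if_neg h]
    · rfl

theorem isSign_vec : IsSign M.vec M.sgn where
  map_pr d v := by
    classical
    suffices h : M.sgn ∘ₗ M.vec.pr d = sign d • M.vec.pr d from LinearMap.congr_fun h v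
    refine M.b.ext fun i => ?_
    rw [LinearMap.comp_apply, LinearMap.smul_apply, vec_pr_basis]
    split_ifs with h
    · simp [sgn, h]
    · simp
  induction p hp := by
    rw [← top_le_iff, ← M.b.span_eq, Submodule.span_le]
    rintro _ ⟨i, rfl⟩
    rw [← vec_pr_basis_self]
    exact hp _ _

theorem tau_wd (m : Word I E) : M.tau E (wd R m) = sign (wordDeg M.deg m) • wd R m := by
  obtain ⟨w, l⟩ := m
  induction w with
  | nil =>
    refine (strict_zero M.b M.b M.sgn l).trans ?_
    simp [wordDeg, sign_zero, Word.nil]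
  | cons i w ih =>
    refine (strict_cons M.b M.b M.sgn i ⟨w, l⟩).trans ?_
    change cons M.b (M.sgn (M.b i)) (M.tau E _) = sign (wordDeg M.deg (Word.cons i ⟨w, l⟩)) • _
    rw [ih, wordDeg_cons, sign_add]
    simp [sgn, smul_smul, mul_comm, Word.cons]

theorem isSign_bar : IsSign (M.bar E) (M.tau E) where
  map_pr d v := by
    classical
    suffices h : M.tau E ∘ₗ (M.bar E).pr d = sign d • (M.bar E).pr d from LinearMap.congr_fun h v
    refine bar_hom_ext fun m => ?_
    rw [LinearMap.comp_apply, LinearMap.smul_apply, bar_pr_wd]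
    split_ifs with h
    · rw [tau_wd, h]
    · simp
  induction p hp := by
    rw [eq_top_iff]
    rintro q -
    rw [bar_eq_sum q]
    refine Submodule.sum_mem _ fun m _ => Submodule.smul_mem _ _ ?_
    rw [← M.bar_pr_wd_self m]
    exact hp _ _

theorem isComult_tau : IsComult (M.tau E) := isComult_strict _ _ _

theorem tau_tau : M.tau E ∘ₗ M.tau E = LinearMap.id := M.isSign_bar.comp_self

/-- The action preserves degrees. -/
def ActPr : Prop := ∀ g d v, M.act g (M.vec.pr d v) = M.vec.pr d (M.act g v)

theorem good_sgn (h : M.ActPr) : Good M.vec M.vec 0 M.sgn where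
  map_act g v := by
    have h1 : Good (G := Empty) ⟨nofun, M.vec.pr⟩ ⟨nofun, M.vec.pr⟩ 0 (M.act g) :=
      ⟨nofun, fun d x => by rw [add_zero]; exact h g d x⟩
    have h2 : IsSign (G := Empty) ⟨nofun, M.vec.pr⟩ M.sgn := ⟨M.isSign_vec.1, M.isSign_vec.2⟩
    have := h1.sign_comm h2 h2 v
    rw [sign_zero, one_smul] at this
    exact this.symm
  map_pr d v := by
    suffices h : M.sgn ∘ₗ M.vec.pr d = M.vec.pr (d + 0) ∘ₗ M.sgn from LinearMap.congr_fun h v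
    classical
    refine M.b.ext fun i => ?_
    rw [LinearMap.comp_apply, LinearMap.comp_apply, vec_pr_basis, add_zero]
    have : M.sgn (M.b i) = sign (M.deg i) • M.b i := by simp [sgn]
    rw [this, map_zsmul, vec_pr_basis]
    split_ifs <;> simp [this]

theorem good_proj : Good (M.bar E) M.vec 0 (proj M.b) where
  map_act g q := proj_strict _ _ _ _
  map_pr d q := by
    classical
    suffices h : proj M.b ∘ₗ (M.bar E).pr d = M.vec.pr (d + 0) ∘ₗ proj M.b from
      LinearMap.congr_fun h q
    refine bar_hom_ext fun m => ?_
    rw [LinearMap.comp_apply, LinearMap.comp_apply, bar_pr_wd, add_zero]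
    by_cases hm : ∃ i, m = ⟨[i], 0⟩
    · obtain ⟨i, rfl⟩ := hm
      rw [proj_single, vec_pr_basis]
      simp only [wordDeg, List.map_cons, List.map_nil, List.sum_cons, List.sum_nil, add_zero]
      split_ifs <;> simp
    · push Not at hm
      rw [proj_of_ne _ hm, map_zero]
      split_ifs
      · exact proj_of_ne _ hm
      · simp

theorem bar_pr_cons (d d' : ZMod (2 * N)) (v : V) (q : Bar R I E) :
    (M.bar E).pr (d + d') (AInf.cons M.b (M.vec.pr d v) ((M.bar E).pr d' q)) =
      AInf.cons M.b (M.vec.pr d v) ((M.bar E).pr d' q) := by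
  classical
  suffices h : ((AInf.cons (E := E) M.b).compl₁₂ (M.vec.pr d) ((M.bar E).pr d')).compr₂
      ((M.bar E).pr (d + d')) = (AInf.cons M.b).compl₁₂ (M.vec.pr d) ((M.bar E).pr d') from
    LinearMap.congr_fun₂ h v q
  refine M.b.ext fun i => bar_hom_ext fun m => ?_
  simp only [LinearMap.compr₂_apply, LinearMap.compl₁₂_apply, vec_pr_basis, bar_pr_wd]
  split_ifs with h1 h2
  · rw [cons_basis, bar_pr_wd, if_pos]
    rw [wordDeg_cons, h1, h2]
  all_goals simp

variable {M M'}

theorem hasDeg_of_wd {r : ZMod (2 * N)} {X : Bar R I E →ₗ[R] Bar R J E}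
    (h : ∀ m, (M'.bar E).pr (wordDeg M.deg m + r) (X (wd R m)) = X (wd R m)) (d : ZMod (2 * N))
    (q : Bar R I E) : X ((M.bar E).pr d q) = (M'.bar E).pr (d + r) (X q) := by
  classical
  suffices h : X ∘ₗ (M.bar E).pr d = (M'.bar E).pr (d + r) ∘ₗ X from LinearMap.congr_fun h q
  refine bar_hom_ext fun m => ?_
  rw [LinearMap.comp_apply, LinearMap.comp_apply, bar_pr_wd, ← h m, bar_pr_pr]
  simp only [add_left_inj]
  split_ifs
  · exact (h m).symm
  · simp

theorem pr_of_good {X : Type*} [AddCommGroup X] [Module R X] {S : Sym R G N X} {r : ZMod (2 * N)}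
    {x : Bar R I E →ₗ[R] X} (h : Good (M.bar E) S r x) (m : Word I E) :
    S.pr (wordDeg M.deg m + r) (x (wd R m)) = x (wd R m) := by
  rw [← h.map_pr, bar_pr_wd_self]

/-- The two composites with a group element are morphisms with equal components, hence equal.
Degrees propagate along the recursion, where prepending a letter adds degrees. -/
theorem good_comult {Φ : Bar R I E →ₗ[R] Bar R J E} (hΦ : IsComult Φ)
    (h : Good (M.bar E) M'.vec 0 (proj M'.b ∘ₗ Φ)) : Good (M.bar E) (M'.bar E) 0 Φ where
  map_act g q := by
    suffices h : Φ ∘ₗ strict E M.b M.b (M.act g) = strict E M'.b M'.b (M'.act g) ∘ₗ Φ from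
      LinearMap.congr_fun h q
    refine (hΦ.comp (isComult_strict _ _ _)).ext ((isComult_strict _ _ _).comp hΦ) M'.b
      (LinearMap.ext fun q => ?_)
    simp only [LinearMap.comp_apply, proj_strict]
    exact h.map_act g q
  map_pr := by
    refine hasDeg_of_wd fun m => ?_
    rw [add_zero]
    induction hn : m.weight using Nat.strong_induction_on generalizing m with
    | _ n ih =>
    subst hn
    conv_rhs => rw [hΦ.apply_wd M'.b]
    rw [hΦ.apply_wd M'.b, map_add, map_sum]
    congr 1
    · by_cases hm : m.letters = []
      · obtain ⟨_, l⟩ := m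
        subst hm
        simp only [eps, unit, onWords_wd, if_true, Finsupp.linearCombination_single, one_smul]
        exact M'.bar_pr_wd_self (Word.nil J l)
      · rw [eps_of_ne hm, map_zero, map_zero]
    · refine Finset.sum_congr rfl fun p hp => ?_
      rw [mem_antidiagonal] at hp
      have h1 := Word.weight_add_le p.1 p.2
      rw [hp] at h1
      by_cases h0 : p.1 = 0
      · rw [h0, hΦ.one_eq, proj_zero, map_zero, LinearMap.zero_apply, map_zero]
      · have h2 := Word.weight_pos h0
        have h3 := ih _ (by omega) p.2 rfl
        have h4 := pr_of_good h p.1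
        rw [add_zero, LinearMap.comp_apply] at h4
        rw [← h4, ← h3, ← hp, wordDeg_add]
        exact M'.bar_pr_cons _ _ _ _

theorem good_coder {r : ZMod (2 * N)} {Φ Ψ X : Bar R I E →ₗ[R] Bar R J E} (hX : IsCoder Φ Ψ X)
    (hΦ : IsComult Φ)
    (gΦ : Good (M.bar E) (M'.bar E) 0 Φ) (gΨ : Good (M.bar E) (M'.bar E) 0 Ψ)
    (h : Good (M.bar E) M'.vec r (proj M'.b ∘ₗ X)) : Good (M.bar E) (M'.bar E) r X where
  map_act g q := by
    suffices h : X ∘ₗ strict E M.b M.b (M.act g) = strict E M'.b M'.b (M'.act g) ∘ₗ X from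
      LinearMap.congr_fun h q
    have e₁ : Φ ∘ₗ strict E M.b M.b (M.act g) = strict E M'.b M'.b (M'.act g) ∘ₗ Φ :=
      LinearMap.ext (gΦ.map_act g)
    have e₂ : Ψ ∘ₗ strict E M.b M.b (M.act g) = strict E M'.b M'.b (M'.act g) ∘ₗ Ψ :=
      LinearMap.ext (gΨ.map_act g)
    have h2 := (isComult_strict (E := E) M'.b M'.b (M'.act g)).comp_coder hX
    rw [← e₁, ← e₂] at h2
    refine (hX.comp (isComult_strict _ _ _)).ext h2
      (hΦ.comp (isComult_strict _ _ _)).one_eq M'.b (LinearMap.ext fun q => ?_)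
    simp only [LinearMap.comp_apply, proj_strict]
    exact h.map_act g q
  map_pr := by
    refine hasDeg_of_wd fun m => ?_
    have gπ : Good (M.bar E) M'.vec 0 (proj M'.b ∘ₗ Φ) := M'.good_proj.comp gΦ (add_zero _)
    induction hn : m.weight using Nat.strong_induction_on generalizing m with
    | _ n ih =>
    subst hn
    conv_rhs => rw [hX.apply_wd M'.b]
    rw [hX.apply_wd M'.b, map_sum]
    refine Finset.sum_congr rfl fun p hp => ?_
    rw [mem_antidiagonal] at hp
    have h1 := Word.weight_add_le p.1 p.2
    rw [hp] at h1
    rw [map_add]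
    congr 1
    · have h3 := pr_of_good gΨ p.2
      have h4 := pr_of_good h p.1
      rw [LinearMap.comp_apply] at h4
      rw [add_zero] at h3
      rw [← h4, ← h3, ← hp, wordDeg_add, add_right_comm]
      exact M'.bar_pr_cons _ _ _ _
    · by_cases h0 : p.1 = 0
      · rw [h0, hΦ.one_eq, proj_zero, map_zero, LinearMap.zero_apply, map_zero]
      · have h2 := Word.weight_pos h0
        have h3 := ih _ (by omega) p.2 rfl
        have h4 := pr_of_good gπ p.1
        rw [add_zero, LinearMap.comp_apply] at h4
        rw [← h4, ← h3, ← hp, wordDeg_add, add_assoc]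
        exact M'.bar_pr_cons _ _ _ _

theorem good_strict {a : V →ₗ[R] W} (ha : Good M.vec M'.vec 0 a) :
    Good (M.bar E) (M'.bar E) 0 (strict E M.b M'.b a) := by
  refine good_comult (isComult_strict _ _ _) ?_
  have : proj M'.b ∘ₗ strict E M.b M'.b a = a ∘ₗ proj M.b := LinearMap.ext fun q => by simp
  rw [this]
  exact ha.comp M.good_proj (add_zero _)

theorem good_tau (h : M.ActPr) : Good (M.bar E) (M.bar E) 0 (M.tau E) :=
  good_strict (M.good_sgn h)

theorem good_single : Good M.vec (M.bar E) 0 (single E M.b) where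
  map_act g v := by
    have h := (isComult_strict (E := E) M.b M.b (M.act g)).single M.b M.b v
    rw [lead_strict] at h
    exact h.symm
  map_pr d v := by
    classical
    suffices h : single E M.b ∘ₗ M.vec.pr d = (M.bar E).pr (d + 0) ∘ₗ single E M.b from
      LinearMap.congr_fun h v
    refine M.b.ext fun i => ?_
    rw [LinearMap.comp_apply, LinearMap.comp_apply, vec_pr_basis, add_zero, single_basis,
      bar_pr_wd]
    simp only [wordDeg, List.map_cons, List.map_nil, List.sum_cons, List.sum_nil, add_zero]
    split_ifs <;> simp [single_basis]

theorem good_lead {r : ZMod (2 * N)} {X : Bar R I E →ₗ[R] Bar R J E}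
    (h : Good (M.bar E) (M'.bar E) r X) : Good M.vec M'.vec r (lead M.b M'.b X) :=
  M'.good_proj.comp (h.comp M.good_single (zero_add _)) (add_zero _)

end Model

end Graded

open scoped TensorProduct

/-! ### Homotopy inverses on the bar coalgebra -/

section Core

variable {R : Type*} [Field R] {I J E : Type*} [EnergyMonoid E]
  {V W : Type*} [AddCommGroup V] [Module R V]
  [AddCommGroup W] [Module R W] {G : Type*} {N : ℕ}

/-- `k` contracts the complex `(V, d)` to the image of the idempotent `e`, on which `d` is zero. -/
structure Contraction (d k e : V →ₗ[R] V) : Prop where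
  d_e : ∀ v, d (e v) = 0
  e_d : ∀ v, e (d v) = 0
  k_e : ∀ v, k (e v) = 0
  e_k : ∀ v, e (k v) = 0
  k_k : ∀ v, k (k v) = 0
  e_e : ∀ v, e (e v) = e v
  homotopy : ∀ v, d (k v) + k (d v) = v - e v

namespace Model

variable {M : Model R I V G N} {M' : Model R J W G N}

theorem tau_comm {X : Bar R I E →ₗ[R] Bar R J E} (h : Good (M.bar E) (M'.bar E) 0 X)
    (q : Bar R I E) : X (M.tau E q) = M'.tau E (X q) := by
  rw [h.sign_comm M.isSign_bar M'.isSign_bar, sign_zero, one_smul]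

theorem tau_anticomm {X : Bar R I E →ₗ[R] Bar R J E} {r : ZMod (2 * N)}
    (h : Good (M.bar E) (M'.bar E) r X) (hr : sign r = -1) :
    X ∘ₗ M.tau E = -(M'.tau E ∘ₗ X) :=
  LinearMap.ext fun q => by
    rw [LinearMap.comp_apply, h.sign_comm M.isSign_bar M'.isSign_bar, hr]
    simp

theorem sign_neg_one : sign (-1 : ZMod (2 * N)) = -1 := by rw [sign_neg, sign_one]

theorem isCoder_conj {Γ : Bar R I E →ₗ[R] Bar R J E} {β : Bar R J E →ₗ[R] Bar R I E}
    {D : Bar R I E →ₗ[R] Bar R I E} (hD : IsCoder (M.tau E) LinearMap.id D) (hΓ : IsComult Γ)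
    (hβ : IsComult β) (gΓ : Good (M.bar E) (M'.bar E) 0 Γ) (h : Γ ∘ₗ β = LinearMap.id) :
    IsCoder (M'.tau E) LinearMap.id (Γ ∘ₗ D ∘ₗ β) := by
  have h1 := hΓ.comp_coder (hD.comp hβ)
  have e : Γ ∘ₗ M.tau E ∘ₗ β = M'.tau E := LinearMap.ext fun q => by
    rw [LinearMap.comp_apply, LinearMap.comp_apply, tau_comm gΓ]
    exact congrArg _ (LinearMap.congr_fun h q)
  rwa [e, LinearMap.id_comp, h] at h1

/-- This provides nonlinear changes of coordinates. Each normal form below results from a clever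
choice of the component `x`, and the only condition to check is that its linear part is the
identity. -/
theorem exists_iso {x : Bar R I E →ₗ[R] V} (h0 : x (wd R 0) = 0)
    (h1 : ∀ v, x (single E M.b v) = v) (gx : Good (M.bar E) M.vec 0 x) :
    ∃ Γ β : Bar R I E →ₗ[R] Bar R I E, IsComult Γ ∧ IsComult β ∧ (∀ q, Γ (β q) = q) ∧
      (∀ q, β (Γ q) = q) ∧ (∀ q, proj M.b (Γ q) = x q) ∧ Good (M.bar E) (M.bar E) 0 Γ ∧
      Good (M.bar E) (M.bar E) 0 β ∧ lead M.b M.b Γ = LinearMap.id ∧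
      lead M.b M.b β = LinearMap.id := by
  have hΓ := isComult_hat M.b h0
  have lΓ : lead M.b M.b (hat M.b x) = LinearMap.id := LinearMap.ext fun v => by
    rw [lead_apply, proj_hat M.b h0, h1, LinearMap.id_apply]
  have gΓ : Good (M.bar E) (M.bar E) 0 (hat M.b x) := by
    refine good_comult hΓ ?_
    rwa [show proj M.b ∘ₗ hat M.b x = x from LinearMap.ext (proj_hat M.b h0)]
  obtain ⟨β, hβ, e1, e2, lβ⟩ := hΓ.exists_inverse M.b lΓ
  exact ⟨_, β, hΓ, hβ, LinearMap.congr_fun e1, LinearMap.congr_fun e2, proj_hat M.b h0, gΓ,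
    gΓ.inverse e1 e2, lΓ, lβ⟩

variable [CharZero R]

/-- The tensor trick. -/
theorem exists_tensor_trick (hM : M.ActPr) {d k e : V →ₗ[R] V} (c : Contraction d k e)
    (gd : Good M.vec M.vec 1 d) (gk : Good M.vec M.vec (-1) k) (ge : Good M.vec M.vec 0 e) :
    ∃ D K : Bar R I E →ₗ[R] Bar R I E, IsCoder (M.tau E) LinearMap.id D ∧
      IsCoder (M.tau E) (strict E M.b M.b e) K ∧ (∀ q, proj M.b (D q) = d (proj M.b q)) ∧
      (∀ q, proj M.b (K q) = k (proj M.b q)) ∧ Good (M.bar E) (M.bar E) 1 D ∧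
      Good (M.bar E) (M.bar E) (-1) K ∧ (∀ q, K (K q) = 0) ∧
      ∀ q, D (K q) + K (D q) = q - strict E M.b M.b e q := by
  have hτ : IsComult (M.tau E) := M.isComult_tau
  have hE := isComult_strict (E := E) M.b M.b e
  have x0 : (d ∘ₗ proj M.b) (wd R (0 : Word I E)) = 0 := by simp [proj_zero]
  have y0 : (k ∘ₗ proj M.b) (wd R (0 : Word I E)) = 0 := by simp [proj_zero]
  set D := coder M.b (M.tau E) LinearMap.id (d ∘ₗ proj M.b)
  -- `K` applies `k` to one letter, the sign operator to the letters on its left and `e` to those on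
  -- its right, summed over all letters.
  set K := coder M.b (M.tau E) (strict E M.b M.b e) (k ∘ₗ proj M.b)
  have hD : IsCoder (M.tau E) LinearMap.id D := isCoder_coder _ hτ IsComult.id x0
  have hK : IsCoder (M.tau E) (strict E M.b M.b e) K := isCoder_coder _ hτ hE y0
  have pD : ∀ q, proj M.b (D q) = d (proj M.b q) := proj_coder _ hτ IsComult.id x0
  have pK : ∀ q, proj M.b (K q) = k (proj M.b q) := proj_coder _ hτ hE y0
  have gD : Good (M.bar E) (M.bar E) 1 D := by
    refine good_coder hD hτ (good_tau hM) Good.id ?_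
    rw [show proj M.b ∘ₗ D = d ∘ₗ proj M.b from LinearMap.ext pD]
    exact gd.comp M.good_proj (zero_add _)
  have gK : Good (M.bar E) (M.bar E) (-1) K := by
    refine good_coder hK hτ (good_tau hM) (good_strict ge) ?_
    rw [show proj M.b ∘ₗ K = k ∘ₗ proj M.b from LinearMap.ext pK]
    exact gk.comp M.good_proj (zero_add _)
  have aD := tau_anticomm gD sign_one
  have aK := tau_anticomm gK sign_neg_one
  have EK : strict E M.b M.b e ∘ₗ K = 0 :=
    (hE.comp_coder hK).eq_zero (hE.comp hτ).one_eq M.b (LinearMap.ext fun q => by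
      simp [pK, c.e_k])
  have KE : K ∘ₗ strict E M.b M.b e = 0 :=
    (hK.comp hE).eq_zero (hτ.comp hE).one_eq M.b (LinearMap.ext fun q => by
      simp [pK, c.k_e])
  have ED : strict E M.b M.b e ∘ₗ D = 0 :=
    (hE.comp_coder hD).eq_zero (hE.comp hτ).one_eq M.b (LinearMap.ext fun q => by
      simp [pD, c.e_d])
  have DE : D ∘ₗ strict E M.b M.b e = 0 :=
    (hD.comp hE).eq_zero (hτ.comp hE).one_eq M.b (LinearMap.ext fun q => by
      simp [pD, c.d_e])
  refine ⟨D, K, hD, hK, pD, pK, gD, gK, fun q => ?_, fun q => ?_⟩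
  -- The calculus applies to `K K + K K` rather than to `K K`; the factor two is removed in
  -- characteristic zero.
  · have h := (hK.comp_add_comp hK hK hK rfl rfl aK (EK.trans KE.symm) aK
      (EK.trans KE.symm)).eq_zero (hτ.comp hτ).one_eq M.b
      (LinearMap.ext fun q => by simp [pK, c.k_k])
    have h2 := LinearMap.congr_fun h q
    rw [LinearMap.add_apply, ← two_smul R] at h2
    exact (smul_eq_zero.1 h2).resolve_left two_ne_zero
  -- Both `D K + K D` and the difference of the identity and `strict e` are coderivations along the
  -- same pair, with equal components by the homotopy identity for `d` and `k`.
  · have h1 := hD.comp_add_comp hK hK hD rfl (LinearMap.comp_id _).symm aD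
      (LinearMap.comp_id _).symm aK (ED.trans DE.symm)
    rw [M.tau_tau, LinearMap.id_comp] at h1
    have h2 := h1.ext (IsComult.id.sub hE) rfl M.b (LinearMap.ext fun q => by
      simp [pD, pK, c.homotopy])
    exact LinearMap.congr_fun h2 q

/-- This is the projection `P = ŝ (1 + A K)⁻¹` of the homological perturbation lemma, where `D = Δ +
A` and `Δ` is the linear part. The inclusion needs no correction because `hDj` already holds. That
`P` commutes with the differentials and that it is comultiplicative follow from one device: `q + A K
q = D K q + K Δ q + ĵ ŝ q`, and these elements fill the whole space since `1 + A K` is bijective. So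
an identity only has to be understood on the images of `K` and `ĵ` and under composition with `D`.
-/
theorem exists_perturbed_projection (hM' : M'.ActPr) {D : Bar R J E →ₗ[R] Bar R J E}
    (hD : IsCoder (M'.tau E) LinearMap.id D) (hDD : ∀ q, D (D q) = 0)
    (gD : Good (M'.bar E) (M'.bar E) 1 D) {C : Bar R I E →ₗ[R] Bar R I E}
    {k : W →ₗ[R] W} {j : V →ₗ[R] W} {s : W →ₗ[R] V}
    (c : Contraction (lead M'.b M'.b D) k (j ∘ₗ s)) (gk : Good M'.vec M'.vec (-1) k)
    (gj : Good M.vec M'.vec 0 j) (gs : Good M'.vec M.vec 0 s) (sjs : ∀ w, s (j (s w)) = s w)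
    (jsj : ∀ v, j (s (j v)) = j v)
    (hCC : ∀ q, C (C q) = 0) (hC : ∀ q, strict E M.b M.b (s ∘ₗ j) (C q) = C q)
    (hC' : ∀ q, C (strict E M.b M.b (s ∘ₗ j) q) = C q)
    (hDj : ∀ q, D (strict E M.b M'.b j q) = strict E M.b M'.b j (C q)) :
    ∃ P : Bar R J E →ₗ[R] Bar R I E, IsComult P ∧ Good (M'.bar E) (M.bar E) 0 P ∧
      (∀ q, P (D q) = C (P q)) ∧
      (∀ q, P (strict E M.b M'.b j q) = strict E M.b M.b (s ∘ₗ j) q) ∧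
      ∀ v, P (single E M'.b v) = single E M.b (s v) := by
  obtain ⟨Δ, K, hΔ, hK, pΔ, pK, gΔ, gK, KK, hΔK⟩ := exists_tensor_trick (E := E) hM' c
    (good_lead gD) gk (gj.comp gs (add_zero 0))
  have hτ : IsComult (M'.tau E) := M'.isComult_tau
  have hs := isComult_strict (E := E) M'.b M.b s
  have hj := isComult_strict (E := E) M.b M'.b j
  set ŝ := strict E M'.b M.b s
  set ĵ := strict E M.b M'.b j
  have eE : ∀ q, strict E M'.b M'.b (j ∘ₗ s) q = ĵ (ŝ q) := fun q =>
    (LinearMap.congr_fun (strict_comp M'.b M.b M'.b j s) q).symm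
  have eE' : ∀ q, strict E M.b M.b (s ∘ₗ j) q = ŝ (ĵ q) := fun q =>
    (LinearMap.congr_fun (strict_comp M.b M'.b M.b s j) q).symm
  have sjs' : ∀ q, ŝ (ĵ (ŝ q)) = ŝ q := fun q => by
    have h : strict E M'.b M.b ((s ∘ₗ j) ∘ₗ s) = ŝ := congrArg _ (LinearMap.ext sjs)
    rw [← eE']
    exact (LinearMap.congr_fun (strict_comp M'.b M.b M.b (s ∘ₗ j) s) q).trans
      (LinearMap.congr_fun h q)
  have sK : ∀ q, ŝ (K q) = 0 := LinearMap.congr_fun <|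
    (hs.comp_coder hK).eq_zero (hs.comp hτ).one_eq M.b (LinearMap.ext fun q => by
      have h := c.e_k (proj M'.b q)
      simp only [LinearMap.comp_apply, ŝ, proj_strict, pK, LinearMap.zero_apply] at h ⊢
      rw [← sjs, h, map_zero])
  have Kj : ∀ q, K (ĵ q) = 0 := LinearMap.congr_fun <|
    (hK.comp hj).eq_zero (hτ.comp hj).one_eq M'.b (LinearMap.ext fun q => by
      have h := c.k_e (j (proj M.b q))
      simp only [LinearMap.comp_apply, ĵ, proj_strict, pK, LinearMap.zero_apply] at h ⊢
      rw [← jsj, h])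
  simp only [eE] at hΔK
  simp only [eE'] at hC hC' ⊢
  -- the perturbation
  set A := D - Δ with hA
  have hDA : ∀ q, D q = Δ q + A q := fun q => by simp [hA]
  have cA : IsCoder (M'.tau E) LinearMap.id A := hD.sub hΔ
  have A1 : ∀ w, A (single E M'.b w) = 0 := fun w => by
    rw [cA.single hτ IsComult.id M'.b M'.b, lead_apply, hA, LinearMap.sub_apply, map_sub, pΔ,
      proj_cons_zero, ← lead_apply M'.b M'.b D, sub_self, map_zero]
  -- `D` and `Δ` agree on words of weight at most one, so the perturbation strictly lowers the
  -- weight. This makes `1 + A K` invertible.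
  have lA : Lowers 1 A := cA.lowers hτ IsComult.id M'.b fun m hm => by
    rcases Nat.lt_or_ge m.weight 1 with h1 | h1
    · rw [Word.eq_zero_of_weight (m := m) (by omega), cA.one_eq, map_zero]
    · obtain ⟨i, rfl⟩ := Word.eq_single_of_weight (m := m) (by omega)
      rw [← single_basis M'.b, A1, map_zero]
  have lK : Lowers 0 K := hK.lowers hτ (isComult_strict _ _ _) M'.b fun m hm => by
    rw [Word.eq_zero_of_weight (m := m) (by omega), hK.one_eq, map_zero]
  have lT : Lowers 1 (LinearMap.id + A ∘ₗ K - LinearMap.id) := by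
    rw [show LinearMap.id + A ∘ₗ K - LinearMap.id = A ∘ₗ K from LinearMap.ext fun q => by
      rw [LinearMap.sub_apply, LinearMap.add_apply]
      exact add_sub_cancel_left _ _]
    exact lA.comp lK
  obtain ⟨Q, TQ', QT'⟩ := exists_inverse_of_lowers lT
  have TQ : ∀ q, Q q + A (K (Q q)) = q := LinearMap.congr_fun TQ'
  have QT : ∀ q, Q (q + A (K q)) = q := LinearMap.congr_fun QT'
  have gQ : Good (M'.bar E) (M'.bar E) 0 Q :=
    (Good.id.add ((gD.sub gΔ).comp gK (neg_add_cancel _))).inverse TQ' QT'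
  have QK : ∀ q, K q = 0 → Q q = q := fun q hq => by
    have := QT q
    rwa [hq, map_zero, add_zero] at this
  set P := ŝ ∘ₗ Q with hP
  have gP : Good (M'.bar E) (M.bar E) 0 P := (good_strict gs).comp gQ (add_zero _)
  have PT : ∀ q, P (q + A (K q)) = ŝ q := fun q => congrArg ŝ (QT q)
  have PK : ∀ q, P (K q) = 0 := fun q => by rw [hP, LinearMap.comp_apply, QK _ (KK q), sK]
  have Pj : ∀ q, P (ĵ q) = ŝ (ĵ q) := fun q => by rw [hP, LinearMap.comp_apply, QK _ (Kj q)]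
  have dec : ∀ q, q = Δ (K q) + K (Δ q) + ĵ (ŝ q) := fun q => by rw [hΔK, sub_add_cancel]
  have PD : ∀ q, P (D q) = C (P q) := by
    -- The defect `Z` kills the images of `K` and `ĵ` and satisfies `Z D = -C Z`. Hence it kills `D
    -- K q` as well, and so all of `q + A K q`.
    set Z := P ∘ₗ D - C ∘ₗ P with hZ
    have Z1 : ∀ q, Z q = P (D q) - C (P q) := fun _ => rfl
    have ZK : ∀ q, Z (K q) = 0 := fun q => by
      have h1 : D (K q) = (q + A (K q)) - ĵ (ŝ q) - K (Δ q) := by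
        have := hΔK q
        rw [hDA, ← sub_eq_zero]
        rw [← sub_eq_zero] at this
        rw [← this]
        abel
      rw [Z1, h1, map_sub, map_sub, PT, PK, PK, Pj, sjs', map_zero]
      simp
    have Zj : ∀ q, Z (ĵ q) = 0 := fun q => by
      rw [Z1, hDj, Pj, Pj, hC, hC', sub_self]
    have ZD : ∀ q, Z (D q) = -C (Z q) := fun q => by
      rw [Z1, Z1, hDD, map_zero, map_sub, hCC, sub_zero, zero_sub]
    have Z2 : ∀ q, Z (q + A (K q)) = 0 := fun q => by
      have h1 : q + A (K q) = D (K q) + K (Δ q) + ĵ (ŝ q) := by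
        refine (congrArg (· + A (K q)) (dec q)).trans ?_
        rw [hDA (K q)]
        abel
      rw [h1, map_add, map_add, ZD, ZK, ZK, Zj]
      simp
    intro q
    rw [← sub_eq_zero, ← Z1, ← TQ q, Z2]
  have Qs : ∀ w, Q (single E M'.b w) = single E M'.b w := fun w => by
    have h := QT (single E M'.b w)
    rwa [hK.single hτ (isComult_strict _ _ _) M'.b M'.b, A1, add_zero] at h
  have cP : IsComult P := by
    -- As `K` is a coderivation and `P K = 0`, `Y` vanishes on the image of `K`. It intertwines `D`
    -- with the operator `B` that `C` induces on the tensor square, so the decomposition of `q + A K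
    -- q` leaves only the term of `ĵ ŝ q`.
    set Y := TensorProduct.map P P ∘ₗ comul R J E with hY
    have YK : ∀ q, Y (K q) = 0 := LinearMap.congr_fun (f := Y ∘ₗ K) (g := 0) <| by
      rw [hY, LinearMap.comp_assoc, hK.comul_eq, ← LinearMap.comp_assoc, LinearMap.comp_add,
        ← TensorProduct.map_comp, ← TensorProduct.map_comp,
        show P ∘ₗ K = 0 from LinearMap.ext PK]
      simp
    have Yj : ∀ q, Y (ĵ q) = comul R I E (ŝ (ĵ q)) :=
      LinearMap.congr_fun (f := Y ∘ₗ ĵ) (g := comul R I E ∘ₗ ŝ ∘ₗ ĵ) <| by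
      rw [hY, LinearMap.comp_assoc, hj.comul_eq, ← LinearMap.comp_assoc,
        ← TensorProduct.map_comp, show P ∘ₗ ĵ = ŝ ∘ₗ ĵ from LinearMap.ext Pj,
        (hs.comp hj).comul_eq]
    let B : Bar R I E ⊗[R] Bar R I E →ₗ[R] Bar R I E ⊗[R] Bar R I E :=
      TensorProduct.map C LinearMap.id + TensorProduct.map (M.tau E) C
    have hB : B ∘ₗ TensorProduct.map P P = TensorProduct.map (C ∘ₗ P) P +
        TensorProduct.map (M.tau E ∘ₗ P) (C ∘ₗ P) := by
      rw [LinearMap.add_comp, ← TensorProduct.map_comp, ← TensorProduct.map_comp,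
        LinearMap.id_comp]
    have YD : ∀ q, Y (D q) = B (Y q) :=
      LinearMap.congr_fun (f := Y ∘ₗ D) (g := B ∘ₗ Y) <| by
      rw [hY, LinearMap.comp_assoc, hD.comul_eq, ← LinearMap.comp_assoc, LinearMap.comp_add,
        ← TensorProduct.map_comp, ← TensorProduct.map_comp, ← LinearMap.comp_assoc, hB,
        show P ∘ₗ D = C ∘ₗ P from LinearMap.ext PD,
        show P ∘ₗ M'.tau E = M.tau E ∘ₗ P from LinearMap.ext (tau_comm gP), LinearMap.comp_id]
    have YT : ∀ q, Y (q + A (K q)) = comul R I E (ŝ q) := fun q => by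
      have h1 : q + A (K q) = D (K q) + K (Δ q) + ĵ (ŝ q) := by
        refine (congrArg (· + A (K q)) (dec q)).trans ?_
        rw [hDA (K q)]
        abel
      rw [h1, map_add, map_add, YD, YK, YK, Yj, map_zero, sjs', zero_add, zero_add]
    refine ⟨LinearMap.ext fun q => ?_, LinearMap.ext fun q => ?_, ?_⟩
    · rw [← hY]
      conv_rhs => rw [← TQ q, YT]
      rfl
    · have h1 : eps R J E (Q q) = eps R J E q := by
        conv_rhs => rw [← TQ q, map_add]
        rw [show eps R J E (A (K (Q q))) = 0 from LinearMap.congr_fun cA.eps_eq _]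
        exact (add_zero _).symm
      rw [← h1]
      exact LinearMap.congr_fun hs.eps_eq (Q q)
    · rw [hP, LinearMap.comp_apply, QK _ hK.one_eq, hs.one_eq]
  refine ⟨P, cP, gP, PD, Pj, fun w => ?_⟩
  rw [hP, LinearMap.comp_apply, Qs, hs.single M'.b M.b, lead_strict]

/-- The source contains a minimal model as `β Ê`, and `f` maps it to the target by a morphism whose
linear part is injective on the image of `s f₀`. Straightening this morphism reduces the problem to
a projection onto a strict summand, supplied by perturbation. The conclusion `h f h = h` is stronger
than an inverse up to homotopy on cohomology and makes both composites idempotent. -/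
theorem exists_homotopy_inverse (hM' : M'.ActPr) {D : Bar R I E →ₗ[R] Bar R I E}
    {D' : Bar R J E →ₗ[R] Bar R J E} {f : Bar R I E →ₗ[R] Bar R J E}
    (hD : IsCoder (M.tau E) LinearMap.id D) (hDD : ∀ q, D (D q) = 0)
    (gD : Good (M.bar E) (M.bar E) 1 D) (hD' : IsCoder (M'.tau E) LinearMap.id D')
    (hDD' : ∀ q, D' (D' q) = 0) (gD' : Good (M'.bar E) (M'.bar E) 1 D') (hf : IsComult f)
    (gf : Good (M.bar E) (M'.bar E) 0 f) (hfD : ∀ q, f (D q) = D' (f q))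
    {k : V →ₗ[R] V} {k' : W →ₗ[R] W} {s : W →ₗ[R] V} (gk : Good M.vec M.vec (-1) k)
    (gk' : Good M'.vec M'.vec (-1) k') (gs : Good M'.vec M.vec 0 s)
    (c : Contraction (lead M.b M.b D) k (s ∘ₗ lead M.b M'.b f))
    (c' : Contraction (lead M'.b M'.b D') k' (lead M.b M'.b f ∘ₗ s))
    (hs : ∀ w, s (lead M.b M'.b f (s w)) = s w) :
    ∃ h : Bar R J E →ₗ[R] Bar R I E, IsComult h ∧ Good (M'.bar E) (M.bar E) 0 h ∧
      (∀ q, h (D' q) = D (h q)) ∧ (∀ q, h (f (h q)) = h q) ∧ lead M'.b M.b h = s := by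
  set d := lead M.b M.b D with hd
  set d' := lead M'.b M'.b D' with hd'
  set f₀ := lead M.b M'.b f with hf₀
  have gd : Good M.vec M.vec 1 d := good_lead gD
  have gf₀ : Good M.vec M'.vec 0 f₀ := good_lead gf
  have ge : Good M.vec M.vec 0 (s ∘ₗ f₀) := gs.comp gf₀ (add_zero 0)
  have hτ : IsComult (M.tau E) := M.isComult_tau
  -- Unlike `f₀`, this map satisfies `j s j = j` in addition to `s j s = s`, and it has the same
  -- composites with `s` on both sides.
  set j := f₀ ∘ₗ s ∘ₗ f₀ with hj
  have gj : Good M.vec M'.vec 0 j := gf₀.comp ge (add_zero 0)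
  have ej : s ∘ₗ j = s ∘ₗ f₀ := LinearMap.ext fun v => hs _
  have je : j ∘ₗ s = f₀ ∘ₗ s := LinearMap.ext fun v => congrArg f₀ (hs _)
  have hE := isComult_strict (E := E) M.b M.b (s ∘ₗ f₀)
  have hŝ := isComult_strict (E := E) M'.b M.b s
  have hĵ := isComult_strict (E := E) M.b M'.b j
  set Ê := strict E M.b M.b (s ∘ₗ f₀)
  set ŝ := strict E M'.b M.b s
  set ĵ := strict E M.b M'.b j
  have sĵ : ∀ q, ŝ (ĵ q) = Ê q := fun q => by
    have h := LinearMap.congr_fun (strict_comp (E := E) M.b M'.b M.b s j) q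
    rwa [ej] at h
  have EE : ∀ q, Ê (Ê q) = Ê q := fun q => by
    have h := LinearMap.congr_fun (strict_comp (E := E) M.b M.b M.b (s ∘ₗ f₀) (s ∘ₗ f₀)) q
    rwa [show (s ∘ₗ f₀) ∘ₗ s ∘ₗ f₀ = s ∘ₗ f₀ from LinearMap.ext fun v => hs _] at h
  -- normal form on the source
  obtain ⟨Γ, β, hΓ, hβ, Γβ, βΓ, pΓ, gΓ, gβ, lΓ, lβ⟩ := exists_iso (M := M)
    (x := (s ∘ₗ f₀) ∘ₗ proj M.b + (d ∘ₗ k) ∘ₗ proj M.b + k ∘ₗ proj M.b ∘ₗ D)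
    (by simp [proj_zero, hD.one_eq])
    (fun v => by
      have h := c.homotopy v
      rw [eq_sub_iff_add_eq] at h
      simp only [LinearMap.add_apply, LinearMap.comp_apply, proj_cons_zero] at h ⊢
      rw [← lead_apply M.b M.b D, ← hd]
      nth_rw 4 [← h]
      abel)
    (((ge.comp M.good_proj (add_zero _)).add
      ((gd.comp gk (neg_add_cancel _)).comp M.good_proj (add_zero _))).add
      (gk.comp (M.good_proj.comp gD (add_zero _)) (add_neg_cancel _)))
  have cD₁ := isCoder_conj hD hΓ hβ gΓ (LinearMap.ext Γβ)
  set D₁ := Γ ∘ₗ D ∘ₗ β with hD₁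
  have D₁D₁ : ∀ q, D₁ (D₁ q) = 0 := fun q => by simp [hD₁, βΓ, hDD]
  -- At `D q` the chosen component `e + d k + k D` equals `e D + d k D`, because `D D = 0`, and `d`
  -- of the component is `d k D`. So in the new coordinates all terms except the linear `d` take
  -- values in the image of `e = s f₀`.
  have pD₁ : ∀ q, proj M.b (D₁ q) = s (f₀ (proj M.b (D₁ q))) + d (proj M.b q) := fun q => by
    have h1 : ∀ q, proj M.b (D₁ (Γ q)) =
        s (f₀ (proj M.b (D q))) + d (k (proj M.b (D q))) := fun q => by
      simp only [hD₁, LinearMap.comp_apply, βΓ, pΓ, LinearMap.add_apply, hDD, map_zero, add_zero]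
    have h2 := c.e_e
    have h3 := c.e_d
    have h4 := c.d_e
    have h5 : ∀ v, d (d v) = 0 := fun v => by
      have := hDD (single E M.b v)
      rw [hD.single hτ IsComult.id M.b M.b] at this
      rw [hd, lead_apply, this, map_zero]
    simp only [LinearMap.comp_apply] at h2 h3 h4
    rw [← Γβ q, h1, pΓ]
    simp only [LinearMap.add_apply, LinearMap.comp_apply, map_add, h2, h3, h4, h5, add_zero,
      zero_add]
  -- The differential of the minimal model on the image of `e`, where `d` vanishes; `β Ê` includes
  -- this model in the source.
  set C := D₁ ∘ₗ Ê with hC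
  have EC : ∀ q, Ê (C q) = C q := by
    have h1 := hE.comp_coder (cD₁.comp hE)
    have e : Ê ∘ₗ M.tau E ∘ₗ Ê = M.tau E ∘ₗ Ê := LinearMap.ext fun q => by
      simp only [LinearMap.comp_apply]
      rw [tau_comm (good_strict ge)]
      exact congrArg _ (EE q)
    have e' : Ê ∘ₗ LinearMap.id ∘ₗ Ê = LinearMap.id ∘ₗ Ê := LinearMap.ext EE
    rw [e, e'] at h1
    refine LinearMap.congr_fun (h1.ext (cD₁.comp hE) (hτ.comp hE).one_eq M.b
      (LinearMap.ext fun q => ?_))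
    have h2 := c.d_e (proj M.b q)
    rw [← proj_strict (E := E) M.b M.b] at h2
    change proj M.b (Ê (D₁ (Ê q))) = proj M.b (D₁ (Ê q))
    rw [pD₁, h2, add_zero]
    exact proj_strict _ _ _ _
  have Di : ∀ q, D (β (Ê q)) = β (Ê (C q)) := fun q => by
    rw [EC]
    simp [hC, hD₁, βΓ]
  -- normal form on the target
  obtain ⟨γ, δ, hγ, hδ, γδ, δγ, pγ, gγ, gδ, lγ, lδ⟩ := exists_iso (M := M')
    (x := proj M'.b ∘ₗ f ∘ₗ β ∘ₗ Ê ∘ₗ ŝ + proj M'.b - (f₀ ∘ₗ s) ∘ₗ proj M'.b)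
    (by simp [proj_zero, hŝ.one_eq, hE.one_eq, hβ.one_eq, hf.one_eq])
    (fun w => by
      simp only [LinearMap.add_apply, LinearMap.sub_apply, LinearMap.comp_apply, ŝ, Ê,
        hŝ.single M'.b M.b, hE.single M.b M.b, hβ.single M.b M.b, hf.single M.b M'.b,
        lead_strict, lβ, LinearMap.id_apply, proj_cons_zero]
      rw [← hf₀, hs, add_sub_cancel_left])
    (((M'.good_proj.comp (gf.comp (gβ.comp ((good_strict ge).comp (good_strict gs) (add_zero _))
      (add_zero _)) (add_zero _)) (add_zero _)).add M'.good_proj).sub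
      ((gf₀.comp gs (add_zero _)).comp M'.good_proj (add_zero _)))
  -- The component of `γ` replaces the linear `f₀ s` by the nonlinear `f β Ê ŝ`. In the coordinates
  -- `γ` the image of the minimal model in the target is therefore that of the strict morphism `ĵ`.
  have γj : ∀ q, γ (ĵ q) = f (β (Ê q)) :=
    LinearMap.congr_fun (f := γ ∘ₗ ĵ) (g := f ∘ₗ β ∘ₗ Ê) <|
      (hγ.comp hĵ).ext (hf.comp (hβ.comp hE)) M'.b <| LinearMap.ext fun q => by
        simp only [LinearMap.comp_apply, pγ, LinearMap.add_apply, LinearMap.sub_apply, sĵ, EE]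
        simp only [ĵ, proj_strict, hj, LinearMap.comp_apply, hs]
        exact add_sub_cancel_right _ _
  have cD₂ := isCoder_conj hD' hδ hγ gδ (LinearMap.ext δγ)
  set D₂ := δ ∘ₗ D' ∘ₗ γ with hD₂
  have lD₂ : lead M'.b M'.b D₂ = d' := LinearMap.ext fun w => by
    rw [lead_apply, hD₂, LinearMap.comp_apply, LinearMap.comp_apply, hγ.single M'.b M'.b, lγ,
      LinearMap.id_apply, hD'.single M'.isComult_tau IsComult.id M'.b M'.b, hδ.single M'.b M'.b,
      lδ, LinearMap.id_apply, proj_cons_zero]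
  have hDj : ∀ q, D₂ (ĵ q) = ĵ (C q) := fun q => by
    have h : D' (γ (ĵ q)) = γ (ĵ (C q)) := by rw [γj, γj, ← hfD, Di]
    rw [hD₂, LinearMap.comp_apply, LinearMap.comp_apply, h, δγ]
  obtain ⟨P, hP, gP, PD, Pj, Ps⟩ := exists_perturbed_projection (E := E) (M := M) hM' cD₂
    (fun q => by simp [hD₂, γδ, hDD']) (gδ.comp (gD'.comp gγ (zero_add _)) (add_zero _))
    (C := C) (k := k') (j := j) (s := s) (by rw [lD₂, je]; exact c') gk' gj gs
    (fun w => by simp only [hj, LinearMap.comp_apply, hs])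
    (fun v => by simp only [hj, LinearMap.comp_apply, hs])
    (fun q => by
      change D₁ (Ê (C q)) = 0
      rw [EC]
      exact D₁D₁ _)
    (fun q => by rw [ej]; exact EC q)
    (fun q => by
      rw [ej]
      exact congrArg D₁ (EE q)) hDj
  rw [ej] at Pj
  -- Straighten the target, project to the minimal model, include it in the source.
  refine ⟨β ∘ₗ Ê ∘ₗ P ∘ₗ δ, hβ.comp (hE.comp (hP.comp hδ)),
    gβ.comp ((good_strict ge).comp (gP.comp gδ (add_zero _)) (add_zero _)) (add_zero _),
    fun q => ?_, fun q => ?_, LinearMap.ext fun w => ?_⟩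
  · have h : δ (D' q) = D₂ (δ q) := by simp [hD₂, γδ]
    simp only [LinearMap.comp_apply]
    rw [h, PD, Di]
  -- In the middle of `h f h`, the morphism `f β Ê` is `γ ĵ`, then `δ γ = 1` and `P ĵ = Ê`; what
  -- remains is the idempotency of `Ê`.
  · simp only [LinearMap.comp_apply]
    rw [← γj, δγ, Pj, EE]
  · have h := c.e_e
    rw [lead_apply]
    simp only [LinearMap.comp_apply]
    rw [hδ.single M'.b M'.b, lδ, LinearMap.id_apply, Ps, hE.single M.b M.b, lead_strict,
      hβ.single M.b M.b, lβ, LinearMap.id_apply, proj_cons_zero, LinearMap.comp_apply, hs]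

end Model

end Core

open scoped TensorProduct

/-! ### Polynomial families -/

section PolyFun

variable {R : Type*} [Field R] {V W : Type*} [AddCommGroup V] [Module R V]
  [AddCommGroup W] [Module R W]

/-- The polynomial of values of a functional. -/
def toPoly (c : V →ₗ[R] R) : PolynomialModule R V →ₗ[R] Polynomial R :=
  (PolynomialModule.equivPolynomialSelf.toLinearMap.restrictScalars R) ∘ₗ PolynomialModule.map R c

theorem toPoly_single (c : V →ₗ[R] R) (n : ℕ) (v : V) :
    toPoly c (PolynomialModule.lsingle R n v) = Polynomial.monomial n (c v) := by
  rw [toPoly, LinearMap.comp_apply, PolynomialModule.map_lsingle]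
  exact PolynomialModule.equivPolynomial_single n (c v)

theorem eval_toPoly (c : V →ₗ[R] R) (r : R) (p : PolynomialModule R V) :
    (toPoly c p).eval r = c (PolynomialModule.eval r p) := by
  suffices h : Polynomial.leval r ∘ₗ toPoly c = c ∘ₗ PolynomialModule.eval r from
    LinearMap.congr_fun h p
  refine PolynomialModule.hom_ext fun n => LinearMap.ext fun v => ?_
  simp [toPoly_single, mul_comm]

theorem polyDerivative_single (n : ℕ) (v : V) :
    polyDerivative R V (PolynomialModule.lsingle R n v) =
      n • PolynomialModule.lsingle R (n - 1) v := by
  rw [polyDerivative, LinearMap.comp_apply, Finsupp.lsum_apply]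
  exact (Finsupp.sum_single_index (by simp)).trans rfl

theorem toPoly_derivative (c : V →ₗ[R] R) (p : PolynomialModule R V) :
    toPoly c (polyDerivative R V p) = Polynomial.derivative (toPoly c p) := by
  suffices h : toPoly c ∘ₗ polyDerivative R V = Polynomial.derivative ∘ₗ toPoly c from
    LinearMap.congr_fun h p
  refine PolynomialModule.hom_ext fun n => LinearMap.ext fun v => ?_
  simp only [LinearMap.comp_apply, toPoly_single, polyDerivative_single, map_nsmul]
  rw [Polynomial.derivative_monomial, ← map_nsmul, nsmul_eq_mul, mul_comm]

theorem coeff_toPoly (c : V →ₗ[R] R) (n : ℕ) (p : PolynomialModule R V) :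
    (toPoly c p).coeff n = c (p.coeff n) := by
  suffices h : Polynomial.lcoeff R n ∘ₗ toPoly c = c ∘ₗ polyCoeff R V n from
    LinearMap.congr_fun h p
  refine PolynomialModule.hom_ext fun k => LinearMap.ext fun v => ?_
  simp only [LinearMap.comp_apply, toPoly_single, Polynomial.lcoeff_apply,
    Polynomial.coeff_monomial, polyCoeff_apply, PolynomialModule.lsingle_apply]
  split_ifs <;> simp

/-- Coordinate functionals reduce this to scalar polynomials over an infinite field. -/
theorem eq_of_eval [Infinite R] {p q : PolynomialModule R V}
    (h : ∀ r : R, PolynomialModule.eval r p = PolynomialModule.eval r q) : p = q := by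
  refine PolynomialModule.ext (Finsupp.ext fun n => ?_)
  have hb := Module.Basis.ofVectorSpace R V
  refine hb.ext_elem fun i => ?_
  have h1 : toPoly (hb.coord i) p = toPoly (hb.coord i) q :=
    Polynomial.funext fun r => by rw [eval_toPoly, eval_toPoly, h]
  have h2 := congrArg (fun x => Polynomial.coeff x n) h1
  simp only [coeff_toPoly] at h2
  exact h2

/-- The polynomial `y` is the divided difference of `p` at `r`. Differentiating `p - p(r) = (X - r)
y` at `r` gives the claim, so derivatives of families can be read off from differences. -/
theorem eval_derivative_eq [Infinite R] {p y : PolynomialModule R V} (r : R)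
    (h : ∀ r' : R, PolynomialModule.eval r' p - PolynomialModule.eval r p =
      (r' - r) • PolynomialModule.eval r' y) :
    PolynomialModule.eval r (polyDerivative R V p) = PolynomialModule.eval r y := by
  have hb := Module.Basis.ofVectorSpace R V
  refine hb.ext_elem fun i => ?_
  have h1 : toPoly (hb.coord i) p - Polynomial.C ((toPoly (hb.coord i) p).eval r) =
      (Polynomial.X - Polynomial.C r) * toPoly (hb.coord i) y := Polynomial.funext fun r' => by
    simp only [Polynomial.eval_sub, Polynomial.eval_C, Polynomial.eval_mul, Polynomial.eval_X,
      eval_toPoly, ← map_sub, h, LinearMap.map_smul, smul_eq_mul]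
  have h2 := congrArg (fun x => (Polynomial.derivative x).eval r) h1
  simp only [Polynomial.derivative_sub, Polynomial.derivative_C, sub_zero,
    Polynomial.derivative_mul, Polynomial.derivative_X, one_mul, Polynomial.eval_add,
    Polynomial.eval_mul, Polynomial.eval_sub, Polynomial.eval_X, Polynomial.eval_C, sub_self,
    zero_mul, add_zero, ← toPoly_derivative, eval_toPoly] at h2
  exact h2

/-- Families of vectors that depend polynomially on a parameter. -/
def IsPolyFun (F : R → V) : Prop := ∃ p : PolynomialModule R V, ∀ r, PolynomialModule.eval r p = F r

namespace IsPolyFun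

theorem const (v : V) : IsPolyFun fun _ : R => v :=
  ⟨PolynomialModule.lsingle R 0 v, fun r => by simp⟩

theorem add {F F' : R → V} (h : IsPolyFun F) (h' : IsPolyFun F') :
    IsPolyFun fun r => F r + F' r :=
  let ⟨p, hp⟩ := h
  let ⟨p', hp'⟩ := h'
  ⟨p + p', fun r => by rw [map_add, hp, hp']⟩

theorem map {F : R → V} (h : IsPolyFun F) (a : V →ₗ[R] W) : IsPolyFun fun r => a (F r) :=
  let ⟨p, hp⟩ := h
  ⟨PolynomialModule.map R a p, fun r => by
    have := PolynomialModule.eval_map (R' := R) a p r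
    rw [hp] at this
    exact this⟩

theorem smul {F : R → V} (h : IsPolyFun F) : IsPolyFun fun r => r • F r :=
  let ⟨p, hp⟩ := h
  ⟨(Polynomial.X : Polynomial R) • p, fun r => by
    rw [PolynomialModule.eval_smul, hp, Polynomial.eval_X]⟩

theorem sum {ι : Type*} (s : Finset ι) {F : ι → R → V} (h : ∀ i ∈ s, IsPolyFun (F i)) :
    IsPolyFun fun r => ∑ i ∈ s, F i r := by
  classical
  induction s using Finset.induction_on with
  | empty => simpa using const (R := R) (0 : V)
  | insert a s ha ih =>
    simp only [Finset.sum_insert ha]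
    exact (h a (Finset.mem_insert_self _ _)).add (ih fun i hi => h i (Finset.mem_insert_of_mem hi))

variable {I E : Type*} [EnergyMonoid E]

theorem bar {F : R → Bar R I E →ₗ[R] V} (h : ∀ m, IsPolyFun fun r => F r (wd R m))
    (q : Bar R I E) : IsPolyFun fun r => F r q := by
  have : (fun r => F r q) = fun r => ∑ m ∈ q.support, q m • F r (wd R m) := funext fun r => by
    conv_lhs => rw [bar_eq_sum q, map_sum]
    simp only [map_smul]
  rw [this]
  exact sum _ fun m _ => (h m).map (q m • LinearMap.id)

theorem exists_linear {F : R → Bar R I E →ₗ[R] V} (h : ∀ m, IsPolyFun fun r => F r (wd R m)) :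
    ∃ P : Bar R I E →ₗ[R] PolynomialModule R V, ∀ r q, PolynomialModule.eval r (P q) = F r q := by
  choose p hp using h
  refine ⟨onWords R p, fun r q => ?_⟩
  suffices h : PolynomialModule.eval r ∘ₗ onWords R p = F r from LinearMap.congr_fun h q
  exact bar_hom_ext fun m => by rw [LinearMap.comp_apply, onWords_wd, hp]

end IsPolyFun

end PolyFun

/-! ### Normal forms of idempotents and homotopies -/

section Idempotent

variable {R : Type*} [Field R] {I E : Type*} [EnergyMonoid E]
  {V : Type*} [AddCommGroup V] [Module R V] {G : Type*} {N : ℕ}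

-- Each letter contributes one factor that is affine in the parameter.
variable (E) in
theorem isPolyFun_strict (b : Module.Basis I R V) (a c : V →ₗ[R] V) (q : Bar R I E) :
    IsPolyFun fun r : R => strict E b b (a + r • c) q := by
  refine IsPolyFun.bar (fun m => ?_) q
  obtain ⟨w, l⟩ := m
  induction w with
  | nil =>
    simp only [show (⟨[], l⟩ : Word I E) = Word.nil I l from rfl, strict_zero]
    exact .const _
  | cons i w ih =>
    simp only [show (⟨i :: w, l⟩ : Word I E) = Word.cons i ⟨w, l⟩ from rfl, strict_cons,
      LinearMap.add_apply, LinearMap.smul_apply, map_add, map_smul]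
    exact (ih.map _).add (ih.map _).smul

theorem isPolyFun_coder (b : Module.Basis I R V) (a c x : V →ₗ[R] V)
    {X : R → Bar R I E →ₗ[R] Bar R I E} {A : R → V →ₗ[R] V}
    (hX : ∀ r, IsCoder (strict E b b (a + r • c)) (strict E b b (A r)) (X r))
    (hA : ∀ q, IsPolyFun fun r : R => strict E b b (A r) q)
    (h : ∀ r, proj b ∘ₗ X r = x ∘ₗ proj b) (q : Bar R I E) : IsPolyFun fun r : R => X r q := by
  refine IsPolyFun.bar (fun m => ?_) q
  obtain ⟨w, l⟩ := m
  induction w with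
  | nil =>
    simp only [show (⟨[], l⟩ : Word I E) = Word.nil I l from rfl,
      fun r => coder_nil b b _ _ x (hX r) (h r)]
    exact .const _
  | cons i w ih =>
    simp only [show (⟨i :: w, l⟩ : Word I E) = Word.cons i ⟨w, l⟩ from rfl,
      fun r => coder_cons b b _ _ x (hX r) (h r), LinearMap.add_apply, LinearMap.smul_apply,
      map_add, map_smul]
    exact ((hA _).map _).add ((ih.map _).add (ih.map _).smul)

namespace Model

variable {M : Model R I V G N}

/-- The component `e φ + d k (1 - φ) + k (D - φ D)` has linear part `e + d k + k d = 1`. In the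
corresponding coordinates `φ` is strict, and `D` splits into its restriction to the image of `e`,
with values there, and the linear contractible complex `d`. -/
theorem exists_normal_form {D φ : Bar R I E →ₗ[R] Bar R I E}
    (hD : IsCoder (M.tau E) LinearMap.id D) (hDD : ∀ q, D (D q) = 0)
    (gD : Good (M.bar E) (M.bar E) 1 D) (hφ : IsComult φ) (gφ : Good (M.bar E) (M.bar E) 0 φ)
    (hφD : ∀ q, φ (D q) = D (φ q)) (hφφ : ∀ q, φ (φ q) = φ q) {k : V →ₗ[R] V}
    (gk : Good M.vec M.vec (-1) k) (c : Contraction (lead M.b M.b D) k (lead M.b M.b φ)) :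
    ∃ Γ β : Bar R I E →ₗ[R] Bar R I E, IsComult Γ ∧ IsComult β ∧ (∀ q, Γ (β q) = q) ∧
      (∀ q, β (Γ q) = q) ∧ Good (M.bar E) (M.bar E) 0 Γ ∧ Good (M.bar E) (M.bar E) 0 β ∧
      (∀ q, Γ (φ q) = strict E M.b M.b (lead M.b M.b φ) (Γ q)) ∧
      (∀ q, proj M.b (Γ (D (β q))) =
        proj M.b (Γ (D (β (strict E M.b M.b (lead M.b M.b φ) q)))) +
          lead M.b M.b D (proj M.b q)) ∧
      ∀ q, lead M.b M.b φ (proj M.b (Γ (D (β (strict E M.b M.b (lead M.b M.b φ) q))))) =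
        proj M.b (Γ (D (β (strict E M.b M.b (lead M.b M.b φ) q)))) := by
  set d := lead M.b M.b D with hd
  set e := lead M.b M.b φ with he
  have gd : Good M.vec M.vec 1 d := good_lead gD
  have ge : Good M.vec M.vec 0 e := good_lead gφ
  have hE := isComult_strict (E := E) M.b M.b e
  have dd : ∀ v, d (d v) = 0 := fun v => by
    have := hDD (single E M.b v)
    rw [hD.single M.isComult_tau IsComult.id M.b M.b] at this
    rw [hd, lead_apply, this, map_zero]
  obtain ⟨Γ, β, hΓ, hβ, Γβ, βΓ, pΓ, gΓ, gβ, -, -⟩ := exists_iso (M := M)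
    (x := e ∘ₗ proj M.b ∘ₗ φ + (d ∘ₗ k) ∘ₗ (proj M.b - proj M.b ∘ₗ φ) +
      k ∘ₗ (proj M.b ∘ₗ D - proj M.b ∘ₗ φ ∘ₗ D))
    (by simp [proj_zero, hD.one_eq, hφ.one_eq])
    (fun v => by
      have h := c.homotopy v
      rw [eq_sub_iff_add_eq] at h
      simp only [LinearMap.add_apply, LinearMap.sub_apply, LinearMap.comp_apply,
        hφ.single M.b M.b, hD.single M.isComult_tau IsComult.id M.b M.b, proj_cons_zero]
      rw [← hd, ← he, c.e_e, c.e_d, map_sub, c.k_e, sub_zero, sub_zero]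
      conv_rhs => rw [← h]
      abel)
    (((ge.comp (M.good_proj.comp gφ (add_zero _)) (add_zero _)).add
      ((gd.comp gk (neg_add_cancel _)).comp (M.good_proj.sub (M.good_proj.comp gφ (add_zero _)))
        (add_zero _))).add
      (gk.comp ((M.good_proj.comp gD (add_zero _)).sub
        (M.good_proj.comp (gφ.comp gD (add_zero _)) (add_zero _))) (add_neg_cancel _)))
  simp only [LinearMap.add_apply, LinearMap.sub_apply, LinearMap.comp_apply] at pΓ
  -- On the image of `φ` both differences in the component vanish, by idempotency and since `φ`
  -- commutes with `D`.
  have pφ : ∀ q, proj M.b (Γ (φ q)) = e (proj M.b (φ q)) := fun q => by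
    rw [pΓ, hφφ, ← hφD, hφφ]
    simp
  have Γφ : ∀ q, Γ (φ q) = strict E M.b M.b e (Γ q) :=
    LinearMap.congr_fun (f := Γ ∘ₗ φ) (g := strict E M.b M.b e ∘ₗ Γ) <|
      (hΓ.comp hφ).ext (hE.comp hΓ) M.b <| LinearMap.ext fun q => by
        simp only [LinearMap.comp_apply, proj_strict]
        rw [pφ, pΓ, map_add, map_add, c.e_e, c.e_d, c.e_k, add_zero, add_zero]
  have h1 : ∀ q, proj M.b (Γ (D (β (strict E M.b M.b e q)))) = e (proj M.b (D (φ (β q)))) :=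
    fun q => by
      conv_lhs => rw [← Γβ q, ← Γφ, βΓ, ← hφD, pφ]
      rw [hφD]
  refine ⟨Γ, β, hΓ, hβ, Γβ, βΓ, gΓ, gβ, Γφ, fun q => ?_, fun q => ?_⟩
  · rw [h1, pΓ]
    conv_rhs => rw [← Γβ q]
    rw [pΓ, βΓ, hDD]
    simp only [map_add, dd, c.d_e, map_zero, sub_self, add_zero, zero_add, hφD]
  · rw [h1, c.e_e]

/-- In normal coordinates the strict morphisms of `ε r = e + r (1 - e)` join `φ` to the identity.
They commute with the differential, because `ε r` is the identity on the image of `e` and commutes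
with `d`. `Y r' r` is the divided difference of the family, so `Y r r` is its derivative; the
coderivation with component `k` is a primitive of it, by the homotopy identity. Using divided
differences avoids differentiating maps of words. -/
theorem exists_homotopy_family [CharZero R] (hM : M.ActPr) {D φ : Bar R I E →ₗ[R] Bar R I E}
    (hD : IsCoder (M.tau E) LinearMap.id D) (hDD : ∀ q, D (D q) = 0)
    (gD : Good (M.bar E) (M.bar E) 1 D) (hφ : IsComult φ) (gφ : Good (M.bar E) (M.bar E) 0 φ)
    (hφD : ∀ q, φ (D q) = D (φ q)) (hφφ : ∀ q, φ (φ q) = φ q) {k : V →ₗ[R] V}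
    (gk : Good M.vec M.vec (-1) k) (c : Contraction (lead M.b M.b D) k (lead M.b M.b φ)) :
    ∃ (Φ X : R → Bar R I E →ₗ[R] Bar R I E) (Y : R → R → Bar R I E →ₗ[R] Bar R I E),
      (∀ r, IsComult (Φ r)) ∧ (∀ r, Good (M.bar E) (M.bar E) 0 (Φ r)) ∧
      (∀ r q, Φ r (D q) = D (Φ r q)) ∧ (∀ r, IsCoder (Φ r) (Φ r ∘ₗ M.tau E) (X r)) ∧
      (∀ r, Good (M.bar E) (M.bar E) (-1) (X r)) ∧ Φ 0 = φ ∧ Φ 1 = LinearMap.id ∧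
      (∀ q, IsPolyFun fun r => Φ r q) ∧ (∀ q, IsPolyFun fun r => X r q) ∧
      (∀ r' r q, Φ r' q - Φ r q = (r' - r) • Y r' r q) ∧ (∀ r q, IsPolyFun fun r' => Y r' r q) ∧
      ∀ r q, Y r r q = M.tau E (X r (D q) - D (X r q)) := by
  obtain ⟨Γ, β, hΓ, hβ, Γβ, βΓ, gΓ, gβ, Γφ, hm₁, hm₂⟩ :=
    exists_normal_form hD hDD gD hφ gφ hφD hφφ gk c
  have cD := isCoder_conj hD hΓ hβ gΓ (LinearMap.ext Γβ)
  set D' := Γ ∘ₗ D ∘ₗ β with hD'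
  set d := lead M.b M.b D
  set e := lead M.b M.b φ
  have hD'Γ : ∀ q, D' (Γ q) = Γ (D q) := fun q => by simp [hD', βΓ]
  have gd : Good M.vec M.vec 1 d := good_lead gD
  have ge : Good M.vec M.vec 0 e := good_lead gφ
  have gD' : Good (M.bar E) (M.bar E) 1 D' := gΓ.comp (gD.comp gβ (zero_add _)) (add_zero _)
  have hτ : IsComult (M.tau E) := M.isComult_tau
  set ε : R → V →ₗ[R] V := fun r => e + r • (LinearMap.id - e) with hε
  have gε : ∀ r, Good M.vec M.vec 0 (ε r) := fun r => ge.add ((Good.id.sub ge).smul r)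
  have ε_apply : ∀ r v, ε r v = e v + r • (v - e v) := fun r v => rfl
  have ε_e : ∀ r v, ε r (e v) = e v := fun r v => by rw [ε_apply, c.e_e, sub_self, smul_zero, add_zero]
  have e_ε : ∀ r v, e (ε r v) = e v := fun r v => by
    rw [ε_apply, map_add, c.e_e, map_smul, map_sub, c.e_e, sub_self, smul_zero, add_zero]
  have ε_d : ∀ r v, ε r (d v) = d (ε r v) := fun r v => by
    rw [ε_apply, ε_apply, c.e_d, map_add, map_smul, map_sub, c.d_e, zero_add, sub_zero]
  set S : R → Bar R I E →ₗ[R] Bar R I E := fun r => strict E M.b M.b (ε r) with hS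
  have cS : ∀ r, IsComult (S r) := fun r => isComult_strict _ _ _
  have gS : ∀ r, Good (M.bar E) (M.bar E) 0 (S r) := fun r => good_strict (gε r)
  have pS : ∀ r q, proj M.b (S r q) = ε r (proj M.b q) := fun r q => proj_strict _ _ _ _
  have ES : ∀ r q, strict E M.b M.b e (S r q) = strict E M.b M.b e q := fun r q => by
    have h := LinearMap.congr_fun (strict_comp (E := E) M.b M.b M.b e (ε r)) q
    rwa [show e ∘ₗ ε r = e from LinearMap.ext (e_ε r)] at h
  have SD : ∀ r, S r ∘ₗ D' = D' ∘ₗ S r := fun r => by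
    have h1 := (cS r).comp_coder cD
    have e1 : S r ∘ₗ M.tau E = M.tau E ∘ₗ S r := LinearMap.ext (tau_comm (gS r))
    rw [e1, LinearMap.comp_id, ← LinearMap.id_comp (S r)] at h1
    refine h1.ext (cD.comp (cS r)) (hτ.comp (cS r)).one_eq M.b (LinearMap.ext fun q => ?_)
    simp only [LinearMap.comp_apply, LinearMap.id_apply, pS]
    simp only [hD', LinearMap.comp_apply]
    rw [hm₁, hm₁ (S r q), map_add, ES, pS, ε_d, ← hm₂, ε_e]
  have y0 : (k ∘ₗ proj M.b) (wd R (0 : Word I E)) = 0 := by simp [proj_zero]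
  set K : R → Bar R I E →ₗ[R] Bar R I E := fun r =>
    coder M.b (S r ∘ₗ M.tau E) (S r) (k ∘ₗ proj M.b) with hK
  have cK : ∀ r, IsCoder (S r ∘ₗ M.tau E) (S r) (K r) := fun r =>
    isCoder_coder _ ((cS r).comp hτ) (cS r) y0
  have pK : ∀ r q, proj M.b (K r q) = k (proj M.b q) := fun r =>
    proj_coder _ ((cS r).comp hτ) (cS r) y0
  have gK : ∀ r, Good (M.bar E) (M.bar E) (-1) (K r) := fun r => by
    refine good_coder (cK r) ((cS r).comp hτ) ((gS r).comp (good_tau hM) (add_zero _)) (gS r) ?_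
    rw [show proj M.b ∘ₗ K r = k ∘ₗ proj M.b from LinearMap.ext (pK r)]
    exact gk.comp M.good_proj (zero_add _)
  have EK : ∀ r q, strict E M.b M.b e (K r q) = 0 := fun r => LinearMap.congr_fun <|
    ((isComult_strict M.b M.b e).comp_coder (cK r)).eq_zero
      ((isComult_strict M.b M.b e).comp ((cS r).comp hτ)).one_eq M.b (LinearMap.ext fun q => by
        simp [pK, c.e_k])
  have z0 : ((LinearMap.id - e) ∘ₗ proj M.b) (wd R (0 : Word I E)) = 0 := by simp [proj_zero]
  set Y : R → R → Bar R I E →ₗ[R] Bar R I E := fun r' r =>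
    coder M.b (S r') (S r) ((LinearMap.id - e) ∘ₗ proj M.b) with hY
  have cY : ∀ r' r, IsCoder (S r') (S r) (Y r' r) := fun r' r =>
    isCoder_coder _ (cS r') (cS r) z0
  have pY : ∀ r' r q, proj M.b (Y r' r q) = proj M.b q - e (proj M.b q) := fun r' r =>
    proj_coder _ (cS r') (cS r) z0
  have gY : ∀ r, Good (M.bar E) (M.bar E) 0 (Y r r) := fun r => by
    refine good_coder (cY r r) (cS r) (gS r) (gS r) ?_
    rw [show proj M.b ∘ₗ Y r r = (LinearMap.id - e) ∘ₗ proj M.b from LinearMap.ext (pY r r)]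
    exact (Good.id.sub ge).comp M.good_proj (add_zero _)
  have DK : ∀ r q, D' (K r q) + K r (D' q) = Y r r q := fun r => by
    have e1 : S r ∘ₗ M.tau E = M.tau E ∘ₗ S r := LinearMap.ext (tau_comm (gS r))
    have e2 : M.tau E ∘ₗ S r ∘ₗ M.tau E = S r := by
      rw [e1, ← LinearMap.comp_assoc, M.tau_tau, LinearMap.id_comp]
    have e3 : (S r ∘ₗ M.tau E) ∘ₗ M.tau E = S r := by
      rw [LinearMap.comp_assoc, M.tau_tau, LinearMap.comp_id]
    have h1 := cD.comp_add_comp (cK r) (cK r) cD (e2.trans e3.symm) (LinearMap.comp_id _).symm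
      (by
        have h2 := tau_anticomm gD' sign_one
        rw [← LinearMap.comp_assoc, ← SD, LinearMap.comp_assoc, h2, LinearMap.comp_neg]
        rfl)
      (LinearMap.comp_id _).symm (tau_anticomm (gK r) sign_neg_one) (SD r)
    rw [e2, LinearMap.id_comp] at h1
    refine LinearMap.congr_fun (h1.ext (cY r r) (cS r).one_eq M.b (LinearMap.ext fun q => ?_))
    simp only [LinearMap.comp_apply, LinearMap.add_apply, map_add, pK, pY]
    simp only [hD', LinearMap.comp_apply]
    rw [hm₁, EK, hm₁ q, map_add, ← hm₂, c.k_e, pK]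
    simp [c.homotopy]
  have dS : ∀ r' r q, S r' q - S r q = (r' - r) • Y r' r q := fun r' r =>
    LinearMap.congr_fun <| ((cS r').sub (cS r)).ext ((cY r' r).smul (r' - r)) (cS r').one_eq M.b <|
      LinearMap.ext fun q => by
        simp only [LinearMap.comp_apply, LinearMap.sub_apply, LinearMap.smul_apply, map_sub,
          map_smul, pS, pY, ε_apply, sub_smul]
        abel
  have pfS : ∀ q, IsPolyFun fun r => S r q := isPolyFun_strict E M.b e (LinearMap.id - e)
  have pfY : ∀ r q, IsPolyFun fun r' => Y r' r q := fun r =>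
    isPolyFun_coder M.b e (LinearMap.id - e) (LinearMap.id - e) (A := fun _ => ε r) (fun r' => cY r' r)
      (fun q => .const _) (fun r' => LinearMap.ext (pY r' r))
  have pfK : ∀ q, IsPolyFun fun r => K r q := by
    have e1 : ∀ r, S r ∘ₗ M.tau E =
        strict E M.b M.b (e ∘ₗ M.sgn + r • ((LinearMap.id - e) ∘ₗ M.sgn)) := fun r =>
      strict_comp M.b M.b M.b (ε r) M.sgn
    refine isPolyFun_coder M.b (e ∘ₗ M.sgn) ((LinearMap.id - e) ∘ₗ M.sgn) k (A := ε) (fun r => ?_) pfS (fun r => LinearMap.ext (pK r))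
    rw [← e1]
    exact cK r
  have Γτ : ∀ q, Γ (M.tau E q) = M.tau E (Γ q) := tau_comm gΓ
  have βτ : ∀ q, β (M.tau E q) = M.tau E (β q) := tau_comm gβ
  -- Composing with the sign operator turns a coderivation along `(S r ∘ τ, S r)` into one along `(S
  -- r, S r ∘ τ)`, the convention in which `dt` is moved to the right. The factor `-1` compensates
  -- the sign from exchanging `D` with the sign operator.
  refine ⟨fun r => β ∘ₗ S r ∘ₗ Γ, fun r => (-1 : R) • (β ∘ₗ K r ∘ₗ Γ ∘ₗ M.tau E),
    fun r' r => β ∘ₗ Y r' r ∘ₗ Γ,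
    fun r => hβ.comp ((cS r).comp hΓ), fun r => gβ.comp ((gS r).comp gΓ (add_zero _)) (add_zero _),
    fun r q => ?_, fun r => ?_, fun r => ?_, ?_, ?_, fun q => (pfS (Γ q)).map β,
    fun q => (pfK (Γ (M.tau E q))).map ((-1 : R) • β), fun r' r q => ?_,
    fun r q => (pfY r (Γ q)).map β, fun r q => ?_⟩
  · have h1 := LinearMap.congr_fun (SD r) (Γ q)
    simp only [LinearMap.comp_apply] at h1 ⊢
    rw [← hD'Γ, h1]
    simp [hD', βΓ]
  · have h1 := ((hβ.comp_coder ((cK r).comp hΓ)).comp hτ).smul (-1)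
    have e1 : (β ∘ₗ (S r ∘ₗ M.tau E) ∘ₗ Γ) ∘ₗ M.tau E = β ∘ₗ S r ∘ₗ Γ := LinearMap.ext fun q => by
      simp only [LinearMap.comp_apply, ← Γτ]
      rw [show M.tau E (M.tau E q) = q from LinearMap.congr_fun M.tau_tau q]
    rw [e1] at h1
    exact h1
  · exact (gβ.comp ((gK r).comp (gΓ.comp (good_tau hM) (add_zero _)) (zero_add _))
      (add_zero _)).smul _
  · refine LinearMap.ext fun q => ?_
    have h1 : ε 0 = e := by simp [hε]
    simp only [LinearMap.comp_apply, hS, h1]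
    rw [← Γφ, βΓ]
  · refine LinearMap.ext fun q => ?_
    have h1 : ε 1 = LinearMap.id := LinearMap.ext fun v => by simp [ε_apply]
    simp only [LinearMap.comp_apply, hS, h1, strict_id, LinearMap.id_apply, βΓ]
  · simp only [LinearMap.comp_apply]
    rw [← map_sub, dS, map_smul]
  · have h1 : ∀ q, β (D' q) = D (β q) := fun q => by simp [hD', βΓ]
    have h2 : ∀ q, D (M.tau E q) = -M.tau E (D q) := fun q =>
      LinearMap.congr_fun (tau_anticomm gD sign_one) q
    have h3 : ∀ q, M.tau E (D q) = -D (M.tau E q) := fun q => by rw [h2, neg_neg]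
    have h4 : ∀ q, M.tau E (M.tau E q) = q := LinearMap.congr_fun M.tau_tau
    have h6 : ((-1 : R) • (β ∘ₗ K r ∘ₗ Γ ∘ₗ M.tau E)) (D q) = β (K r (D' (Γ (M.tau E q)))) := by
      simp only [LinearMap.smul_apply, LinearMap.comp_apply, neg_smul, one_smul]
      rw [h3, map_neg, map_neg, map_neg, neg_neg, hD'Γ]
    have h7 : D (((-1 : R) • (β ∘ₗ K r ∘ₗ Γ ∘ₗ M.tau E)) q) =
        -β (D' (K r (Γ (M.tau E q)))) := by
      simp only [LinearMap.smul_apply, LinearMap.comp_apply, neg_smul, one_smul]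
      rw [map_neg, h1]
    rw [h6, h7, sub_neg_eq_add, ← map_add, add_comm, DK, ← βτ, ← tau_comm (gY r), ← Γτ, h4]
    rfl

/-- The components of a homotopy with values in polynomials. -/
theorem exists_polynomial_components [CharZero R] {D : Bar R I E →ₗ[R] Bar R I E}
    {Φ X : R → Bar R I E →ₗ[R] Bar R I E} {Y : R → R → Bar R I E →ₗ[R] Bar R I E}
    (pΦ : ∀ q, IsPolyFun fun r => Φ r q) (pX : ∀ q, IsPolyFun fun r => X r q)
    (hY : ∀ r' r q, Φ r' q - Φ r q = (r' - r) • Y r' r q)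
    (pY : ∀ r q, IsPolyFun fun r' => Y r' r q)
    (hYX : ∀ r q, Y r r q = M.tau E (X r (D q) - D (X r q))) :
    ∃ P Q : Bar R I E →ₗ[R] PolynomialModule R V,
      (∀ r q, PolynomialModule.eval r (P q) = proj M.b (Φ r q)) ∧
      (∀ r q, PolynomialModule.eval r (Q q) = proj M.b (X r q)) ∧
      ∀ r q, PolynomialModule.eval r (polyDerivative R V (P q)) =
        M.sgn (proj M.b (X r (D q)) - proj M.b (D (X r q))) := by
  obtain ⟨P, hP⟩ := IsPolyFun.exists_linear (F := fun r => proj M.b ∘ₗ Φ r)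
    fun m => (pΦ (wd R m)).map (proj M.b)
  obtain ⟨Q, hQ⟩ := IsPolyFun.exists_linear (F := fun r => proj M.b ∘ₗ X r)
    fun m => (pX (wd R m)).map (proj M.b)
  refine ⟨P, Q, hP, hQ, fun r q => ?_⟩
  obtain ⟨y, hy⟩ := (pY r q).map (proj M.b)
  rw [eval_derivative_eq r (y := y) (fun r' => by
    rw [hP, hP, hy, LinearMap.comp_apply, LinearMap.comp_apply, ← map_sub, hY, map_smul]), hy]
  change proj M.b (Y r r q) = _
  rw [hYX, ← map_sub]
  exact proj_strict _ _ _ _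

end Model

end Idempotent

/-! ### Equivariant contractions -/

section Linear

variable {R : Type*} [Field R] {I J : Type*} {V W : Type*} [AddCommGroup V] [Module R V]
  [AddCommGroup W] [Module R W] {N : ℕ}

/-- A linear section of `d` over its range, extended to the whole space. -/
theorem exists_generalized_inverse (d : V →ₗ[R] V) : ∃ k : V →ₗ[R] V, ∀ v, d (k (d v)) = d v := by
  obtain ⟨g, hg⟩ := d.rangeRestrict.exists_rightInverse_of_surjective
    (LinearMap.range_rangeRestrict d)
  obtain ⟨k, hk⟩ := LinearMap.exists_extend g
  refine ⟨k, fun v => ?_⟩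
  have h1 : k (d v) = g (d.rangeRestrict v) := LinearMap.congr_fun hk (d.rangeRestrict v)
  have h2 := LinearMap.congr_fun hg (d.rangeRestrict v)
  rw [h1]
  exact congrArg Subtype.val h2

theorem contraction_of_generalized_inverse {d k : V →ₗ[R] V} (dd : ∀ v, d (d v) = 0)
    (dkd : ∀ v, d (k (d v)) = d v) (kdk : ∀ v, k (d (k v)) = k v) (kk : ∀ v, k (k v) = 0) :
    Contraction d k (LinearMap.id - d ∘ₗ k - k ∘ₗ d) := by
  constructor <;> intro v <;>
    simp only [LinearMap.sub_apply, LinearMap.comp_apply, LinearMap.id_apply, map_sub, dd, dkd, kdk,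
      kk, map_zero, sub_zero, sub_self]
  abel

namespace Model

/-- The equation `d k d = d` is affine in `k`, so it survives passing to the part of degree `-1` and
averaging over `G`. The remaining identities `k d k = k` and `k k = 0` are then forced by formulas
in `d` and `k`, which keep equivariance. -/
theorem exists_contraction [CharZero R] {G : Type*} [Group G] [Finite G] {M : Model R I V G N}
    (hM : M.ActPr) (hmul : ∀ g h v, M.act (g * h) v = M.act g (M.act h v))
    (hone : ∀ v, M.act 1 v = v) {d : V →ₗ[R] V} (gd : Good M.vec M.vec 1 d)
    (dd : ∀ v, d (d v) = 0) :
    ∃ k : V →ₗ[R] V, Good M.vec M.vec (-1) k ∧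
      Contraction d k (LinearMap.id - d ∘ₗ k - k ∘ₗ d) := by
  classical
  have := Fintype.ofFinite G
  obtain ⟨k₀, hk₀⟩ := exists_generalized_inverse d
  obtain ⟨k₁, k₁b⟩ : ∃ k₁ : V →ₗ[R] V, ∀ i, k₁ (M.b i) = M.vec.pr (M.deg i + -1) (k₀ (M.b i)) :=
    ⟨M.b.constr R fun i => M.vec.pr (M.deg i + -1) (k₀ (M.b i)), fun i => by simp⟩
  have k₁pr' : ∀ e, k₁ ∘ₗ M.vec.pr e = M.vec.pr (e + -1) ∘ₗ k₁ := fun e => M.b.ext fun i => by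
    rw [LinearMap.comp_apply, LinearMap.comp_apply, vec_pr_basis, k₁b, vec_pr_pr]
    by_cases h : M.deg i = e
    · rw [if_pos h, if_pos (by rw [h]), k₁b]
    · rw [if_neg h, if_neg fun h' => h (add_right_cancel h'), map_zero]
  have k₁pr : ∀ e v, k₁ (M.vec.pr e v) = M.vec.pr (e + -1) (k₁ v) := fun e v => by
    rw [← LinearMap.comp_apply, k₁pr', LinearMap.comp_apply]
  have k₁k₀' : ∀ e, k₁ ∘ₗ M.vec.pr e = M.vec.pr (e + -1) ∘ₗ k₀ ∘ₗ M.vec.pr e := fun e =>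
    M.b.ext fun i => by
      rw [LinearMap.comp_apply, LinearMap.comp_apply, LinearMap.comp_apply, vec_pr_basis]
      by_cases h : M.deg i = e
      · rw [if_pos h, k₁b, h]
      · rw [if_neg h, map_zero, map_zero, map_zero]
  have k₁k₀ : ∀ e v, k₁ (M.vec.pr e v) = M.vec.pr (e + -1) (k₀ (M.vec.pr e v)) := fun e v => by
    rw [← LinearMap.comp_apply, k₁k₀', LinearMap.comp_apply, LinearMap.comp_apply]
  have dk₁d : ∀ v, d (k₁ (d v)) = d v :=
    LinearMap.congr_fun (f := d ∘ₗ k₁ ∘ₗ d) (g := d) <| M.b.ext fun i => by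
      have h : M.vec.pr (M.deg i + 1) (d (M.b i)) = d (M.b i) := by
        rw [← gd.map_pr, vec_pr_basis_self]
      simp only [LinearMap.comp_apply]
      conv_lhs => rw [← h, k₁k₀, h, gd.map_pr, neg_add_cancel_right, hk₀, h]
  obtain ⟨k₂, k₂_apply⟩ : ∃ k₂ : V →ₗ[R] V, ∀ v, k₂ v =
      (Fintype.card G : R)⁻¹ • ∑ g : G, M.act g (k₁ (M.act g⁻¹ v)) :=
    ⟨(Fintype.card G : R)⁻¹ • ∑ g : G, M.act g ∘ₗ k₁ ∘ₗ M.act g⁻¹, fun v => by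
      simp only [LinearMap.smul_apply, LinearMap.sum_apply, LinearMap.comp_apply]⟩
  have gk₂ : Good M.vec M.vec (-1) k₂ := by
    constructor
    · intro h v
      change k₂ (M.act h v) = M.act h (k₂ v)
      rw [k₂_apply, k₂_apply, map_smul, map_sum]
      congr 1
      rw [← Equiv.sum_comp (Equiv.mulLeft h) fun g => M.act g (k₁ (M.act g⁻¹ (M.act h v)))]
      refine Finset.sum_congr rfl fun g _ => ?_
      rw [Equiv.coe_mulLeft, hmul, ← hmul (h * g)⁻¹, mul_inv_rev, inv_mul_cancel_right]
    · intro e v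
      rw [k₂_apply, k₂_apply, map_smul, map_sum]
      simp only [hM _ _ _, k₁pr]
  have dk₂d : ∀ v, d (k₂ (d v)) = d v := fun v => by
    have hd : ∀ g v, d (M.act g v) = M.act g (d v) := gd.map_act
    have h : ∀ g, d (M.act g (k₁ (M.act g⁻¹ (d v)))) = d v := fun g => by
      rw [hd, ← hd g⁻¹, dk₁d, hd, ← hmul, mul_inv_cancel, hone]
    rw [k₂_apply, map_smul, map_sum]
    simp only [h, Finset.sum_const, Finset.card_univ]
    rw [← Nat.cast_smul_eq_nsmul R, smul_smul, inv_mul_cancel₀, one_smul]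
    exact Nat.cast_ne_zero.2 Fintype.card_ne_zero
  -- This replacement achieves `k d k = k` and keeps `d k d = d`.
  set k₃ := k₂ ∘ₗ d ∘ₗ k₂ with hk₃
  have gk₃ : Good M.vec M.vec (-1) k₃ :=
    gk₂.comp (gd.comp gk₂ (neg_add_cancel _)) (zero_add _)
  have h₁ : ∀ v, d (k₃ (d v)) = d v := fun v => by simp only [hk₃, LinearMap.comp_apply, dk₂d]
  have h₂ : ∀ v, k₃ (d (k₃ v)) = k₃ v := fun v => by simp only [hk₃, LinearMap.comp_apply, dk₂d]
  clear_value k₃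
  have h₃ : (-1 : ZMod (2 * N)) + -1 + 1 = -1 := by abel
  have gk₄ : Good M.vec M.vec (-1 + -1) (k₃ ∘ₗ k₃) := gk₃.comp gk₃ rfl
  -- The subtracted term has values in the image of `d`, hence does not affect `d k`. It makes the
  -- square vanish because `k₃ d k₃ = k₃`.
  obtain ⟨k, hk⟩ : ∃ k, k = k₃ - d ∘ₗ k₃ ∘ₗ k₃ := ⟨_, rfl⟩
  have gk : Good M.vec M.vec (-1) k := hk ▸ gk₃.sub (gd.comp gk₄ h₃)
  have k_apply : ∀ v, k v = k₃ v - d (k₃ (k₃ v)) := fun v => by rw [hk]; rfl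
  have e₁ : ∀ v, d (k (d v)) = d v := fun v => by
    simp only [k_apply, map_sub, h₁, dd, sub_zero]
  have e₂ : ∀ v, k (d (k v)) = k v := fun v => by
    simp only [k_apply, map_sub, h₂, dd, sub_zero]
  have e₃ : ∀ v, k (k v) = 0 := fun v => by
    simp only [k_apply, map_sub, h₂, map_zero, sub_self]
  exact ⟨k, gk, contraction_of_generalized_inverse dd e₁ e₂ e₃⟩

/-- The images of `e` and `e'` represent the two cohomologies, so `e' f` is an isomorphism between
them; `s` is its inverse, precomposed with `e'`. Equivariance of `s` follows from this
characterisation and not from the way it was chosen. -/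
theorem exists_quasi_inverse {G : Type*} {M : Model R I V G N} {M' : Model R J W G N}
    {d k : V →ₗ[R] V} {d' k' : W →ₗ[R] W} {f : V →ₗ[R] W}
    (c : Contraction d k (LinearMap.id - d ∘ₗ k - k ∘ₗ d))
    (c' : Contraction d' k' (LinearMap.id - d' ∘ₗ k' - k' ∘ₗ d'))
    (gd : Good M.vec M.vec 1 d) (gk : Good M.vec M.vec (-1) k) (gd' : Good M'.vec M'.vec 1 d')
    (gk' : Good M'.vec M'.vec (-1) k') (gf : Good M.vec M'.vec 0 f)
    (hf : ∀ v, f (d v) = d' (f v))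
    (hinj : ∀ u, d u = 0 → (∃ w, f u = d' w) → ∃ u', u = d u')
    (hsurj : ∀ w, d' w = 0 → ∃ u, d u = 0 ∧ ∃ w', f u - w = d' w') :
    ∃ (s : W →ₗ[R] V) (κ : V →ₗ[R] V) (κ' : W →ₗ[R] W), Good M'.vec M.vec 0 s ∧
      Good M.vec M.vec (-1) κ ∧ Good M'.vec M'.vec (-1) κ' ∧ (∀ w, s (f (s w)) = s w) ∧
      Contraction d κ (s ∘ₗ f) ∧ Contraction d' κ' (f ∘ₗ s) := by
  have ge : Good M.vec M.vec 0 (LinearMap.id - d ∘ₗ k - k ∘ₗ d) :=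
    (Good.id.sub (gd.comp gk (neg_add_cancel _))).sub (gk.comp gd (add_neg_cancel _))
  have ge' : Good M'.vec M'.vec 0 (LinearMap.id - d' ∘ₗ k' - k' ∘ₗ d') :=
    (Good.id.sub (gd'.comp gk' (neg_add_cancel _))).sub (gk'.comp gd' (add_neg_cancel _))
  set e := LinearMap.id - d ∘ₗ k - k ∘ₗ d
  set e' := LinearMap.id - d' ∘ₗ k' - k' ∘ₗ d'
  have dec : ∀ v, v = d (k v) + k (d v) + e v := fun v => by rw [c.homotopy, sub_add_cancel]
  have dec' : ∀ v, v = d' (k' v) + k' (d' v) + e' v := fun v => by rw [c'.homotopy, sub_add_cancel]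
  have inj : ∀ v, e v = v → e' (f v) = 0 → v = 0 := fun v h1 h2 => by
    have hd : d v = 0 := by rw [← h1, c.d_e]
    have h3 := dec' (f v)
    rw [h2, ← hf, hd, map_zero, map_zero, add_zero, add_zero] at h3
    obtain ⟨u, rfl⟩ := hinj v hd ⟨_, h3⟩
    rw [← h1, c.e_d]
  have surj : ∀ w, e' w = w → ∃ v, e v = v ∧ e' (f v) = w := fun w h1 => by
    obtain ⟨u, hu, w', hw'⟩ := hsurj w (by rw [← h1, c'.d_e])
    refine ⟨e u, c.e_e u, ?_⟩
    have h2 : e u = u - d (k u) := by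
      have h3 := dec u
      rw [hu, map_zero, add_zero] at h3
      exact eq_sub_of_add_eq' h3.symm
    rw [sub_eq_iff_eq_add] at hw'
    rw [h2, map_sub, hf, map_sub, c'.e_d, sub_zero, hw', map_add, c'.e_d, zero_add, h1]
  -- a generalized inverse between the images of the idempotents
  obtain ⟨t, ht⟩ : ∃ t : W →ₗ[R] V, ∀ v, e' (f (e (t (e' (f (e v)))))) = e' (f (e v)) := by
    let a : V →ₗ[R] W := e' ∘ₗ f ∘ₗ e
    obtain ⟨g, hg⟩ := a.rangeRestrict.exists_rightInverse_of_surjective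
      (LinearMap.range_rangeRestrict a)
    obtain ⟨t, ht⟩ := LinearMap.exists_extend g
    refine ⟨t, fun v => ?_⟩
    have h1 : t (a v) = g (a.rangeRestrict v) := LinearMap.congr_fun ht (a.rangeRestrict v)
    have h2 := LinearMap.congr_fun hg (a.rangeRestrict v)
    change a (t (a v)) = a v
    rw [h1]
    exact congrArg Subtype.val h2
  set s := e ∘ₗ t ∘ₗ e' with hs
  have s_e' : ∀ w, s (e' w) = s w := fun w => by simp only [hs, LinearMap.comp_apply, c'.e_e]
  have e_s : ∀ w, e (s w) = s w := fun w => by simp only [hs, LinearMap.comp_apply, c.e_e]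
  have sfe : ∀ v, s (f (e v)) = e v := fun v => by
    rw [← sub_eq_zero]
    refine inj _ ?_ ?_
    · rw [map_sub, e_s, c.e_e]
    · rw [map_sub, map_sub]
      simp only [hs, LinearMap.comp_apply, ht, sub_self]
  have efs : ∀ w, e' (f (s w)) = e' w := fun w => by
    obtain ⟨v, h1, h2⟩ := surj (e' w) (c'.e_e w)
    rw [← s_e', ← h2, s_e', ← h1, sfe]
  -- As `s` inverts `e' f` between the images, it intertwines any endomorphisms compatible with `f`,
  -- `e` and `e'`. This is used for group elements and for the projections to homogeneous parts.
  have key : ∀ (x : V →ₗ[R] V) (x' : W →ₗ[R] W), (∀ v, f (x v) = x' (f v)) →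
      (∀ v, e (x v) = x (e v)) → (∀ w, e' (x' w) = x' (e' w)) → ∀ w, s (x' w) = x (s w) := by
    intro x x' h1 h2 h3 w
    rw [← s_e', h3, ← efs w, ← h3, s_e', ← h1, ← e_s w, ← h2, sfe]
  have gs : Good M'.vec M.vec 0 s :=
    ⟨fun g => key _ _ (gf.map_act g) (ge.map_act g) (ge'.map_act g), fun r => by
      rw [add_zero]
      refine key _ _ (fun v => ?_) (fun v => ?_) (fun v => ?_)
      · rw [gf.map_pr, add_zero]
      · rw [ge.map_pr, add_zero]
      · rw [ge'.map_pr, add_zero]⟩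
  have sfs : ∀ w, s (f (s w)) = s w := fun w => by rw [← e_s w, sfe]
  have d_s : ∀ w, d (s w) = 0 := fun w => by rw [← e_s, c.d_e]
  have s_d : ∀ w, s (d' w) = 0 := fun w => by rw [← s_e', c'.e_d, map_zero]
  have k_s : ∀ w, k (s w) = 0 := fun w => by rw [← e_s, c.k_e]
  have s_k : ∀ w, s (k' w) = 0 := fun w => by rw [← s_e', c'.e_k, map_zero]
  -- The projections `s f` and `e` agree on the image of `e` but not everywhere, and likewise on the
  -- target. The correction terms adapt the contractions to the new projections.
  refine ⟨s, k - (s ∘ₗ f) ∘ₗ k, k' - k' ∘ₗ f ∘ₗ s, gs,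
    gk.sub ((gs.comp gf (add_zero 0)).comp gk (add_zero _)),
    gk'.sub (gk'.comp (gf.comp gs (add_zero 0)) (zero_add _)), sfs, ?_, ?_⟩
  · constructor <;> intro v <;>
      simp only [LinearMap.sub_apply, LinearMap.comp_apply, map_sub, d_s, k_s, hf, s_d, sfs,
        c.k_k, map_zero, sub_zero, sub_self]
    have h1 : s (f v) = e v + s (f (k (d v))) := by
      conv_lhs => rw [dec v]
      rw [map_add, map_add, map_add, map_add, hf, s_d, sfe, zero_add, add_comm]
    have h2 := c.homotopy v
    rw [h1, add_sub, h2]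
    abel
  · constructor <;> intro w <;>
      simp only [LinearMap.sub_apply, LinearMap.comp_apply, map_sub, ← hf, d_s, s_k, s_d, sfs,
        c'.k_k, map_zero, sub_zero, sub_self]
    have h2 := c'.homotopy w
    have h3 := c'.homotopy (f (s w))
    rw [efs, ← hf, d_s, map_zero, map_zero, add_zero] at h3
    rw [sub_add_eq_add_sub, h2, h3]
    abel

end Model

end Linear

/-! ### Linear maps of completed modules -/

section Lift

variable {R : Type*} [Field R] {U V W : Type*} [AddCommGroup U] [Module R U] [AddCommGroup V]
  [Module R V] [AddCommGroup W] [Module R W]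

variable (R) in
/-- The constants of the Novikov ring. -/
def scal : R →+* NovikovRing R :=
  (HahnSeries.C : R →+* HahnSeries ℝ≥0 R).codRestrict _ fun _ _ =>
    (Set.finite_singleton 0).subset fun _ hl => HahnSeries.support_single_subset hl.1

instance Completed.instModule : Module R (Completed R V) := Module.compHom _ (scal R)

theorem smul_eq_scal (r : R) (x : Completed R V) : r • x = scal R r • x := rfl

@[simp] theorem coeff_smul (r : R) (x : Completed R V) (l : ℝ≥0) :
    coeff (r • x) l = r • coeff x l := by
  have := HahnModule.coeff_single_smul_vadd (r := r) (a := l) (b := (0 : ℝ≥0))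
    (x := (x : HahnModule ℝ≥0 R V))
  rw [zero_vadd] at this
  exact this

@[simp] theorem coeff_sub (x y : Completed R V) (l : ℝ≥0) :
    coeff (x - y) l = coeff x l - coeff y l := rfl

variable (R V) in
/-- The coefficient of `T ^ l`, as a linear map. -/
def coeffHom (l : ℝ≥0) : Completed R V →ₗ[R] V where
  toFun x := coeff x l
  map_add' _ _ := rfl
  map_smul' r x := coeff_smul r x l

@[simp] theorem coeffHom_apply (l : ℝ≥0) (x : Completed R V) : coeffHom R V l x = coeff x l := rfl

theorem coeff_const (v : V) (l : ℝ≥0) : coeff (const (R := R) v) l = if l = 0 then v else 0 := by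
  change (Pi.single 0 v : ℝ≥0 → V) l = _
  rw [Pi.single_apply]

@[simp] theorem coeff_const_zero (v : V) : coeff (const (R := R) v) 0 = v := by
  rw [coeff_const, if_pos rfl]

variable (R V) in
/-- Constants, as a linear map. -/
def constHom : V →ₗ[R] Completed R V where
  toFun := const
  map_add' u v := coeff_ext fun l => by
    rw [coeff_add, coeff_const, coeff_const, coeff_const]
    split_ifs <;> simp
  map_smul' r v := coeff_ext fun l => by
    rw [RingHom.id_apply, coeff_smul, coeff_const, coeff_const]
    split_ifs <;> simp

@[simp] theorem constHom_apply (v : V) : constHom R V v = const v := rfl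

theorem extend_const (f : V →ₗ[R] W) (v : V) : extend f (const v) = const (f v) :=
  coeff_ext fun l => by
    rw [coeff_extend, coeff_const, coeff_const]
    split_ifs <;> simp

theorem coeff_T_smul_of_le {E l : ℝ≥0} (h : E ≤ l) (x : Completed R V) :
    coeff (T R E • x) l = coeff x (l - E) := by
  obtain ⟨l', rfl⟩ := exists_add_of_le h
  rw [coeff_T_smul, add_tsub_cancel_left]

theorem coeff_T_smul_of_lt {E l : ℝ≥0} (h : l < E) (x : Completed R V) :
    coeff (T R E • x) l = 0 := T_smul_mem E x l h

theorem map_filtration (A : Completed R V →ₗ[NovikovRing R] Completed R W) {E : ℝ≥0}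
    {x : Completed R V} (hx : x ∈ filtration R V E) : A x ∈ filtration R W E := by
  obtain ⟨y, rfl⟩ := exists_eq_T_smul hx
  rw [map_smul]
  exact T_smul_mem _ _

theorem eq_of_sub_mem_filtration {x y : Completed R V}
    (h : ∀ E, x - y ∈ filtration R V E) : x = y := by
  refine coeff_ext fun l => sub_eq_zero.1 ?_
  exact h (l + 1) l (lt_add_of_pos_right l one_pos)

/-- The exponents at most `E` that occur in `x`. -/
def exponents (x : Completed R V) (E : ℝ≥0) : Finset ℝ≥0 := (finite_coeff x E).toFinset

theorem mem_exponents {x : Completed R V} {E l : ℝ≥0} :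
    l ∈ exponents x E ↔ coeff x l ≠ 0 ∧ l ≤ E := by
  simp [exponents]

theorem sub_sum_exponents_mem (x : Completed R V) (E : ℝ≥0) :
    x - ∑ i ∈ exponents x E, T R i • const (coeff x i) ∈ filtration R V E := by
  intro l hl
  rw [coeff_sub, coeff_sum, sub_eq_zero]
  rw [Finset.sum_eq_single l]
  · rw [coeff_T_smul_of_le le_rfl, tsub_self, coeff_const_zero]
  · intro i _ hi
    rcases lt_or_ge l i with h | h
    · exact coeff_T_smul_of_lt h _
    · rw [coeff_T_smul_of_le h, coeff_const, if_neg]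
      rw [tsub_eq_zero_iff_le]
      exact fun h' => hi (le_antisymm h h')
  · intro h
    rw [mem_exponents, not_and_or, not_not] at h
    rcases h with h | h
    · rw [h, coeff_T_smul_of_le le_rfl, tsub_self, coeff_const_zero]
    · exact absurd hl.le h

theorem coeff_novikov_smul_const (a : NovikovRing R) (v : V) (l : ℝ≥0) :
    coeff (a • const (R := R) v) l = (a : HahnSeries ℝ≥0 R).coeff l • v := by
  change ((HahnModule.of R).symm ((a : HahnSeries ℝ≥0 R) • (const (R := R) v :
    HahnModule ℝ≥0 R V))).coeff l = _
  rw [HahnModule.coeff_smul]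
  have key : ∀ j, ((HahnModule.of R).symm (const (R := R) v : HahnModule ℝ≥0 R V)).coeff j =
      if j = 0 then v else 0 := fun j => coeff_const v j
  simp only [key]
  rw [Finset.sum_eq_single (l, 0)]
  · simp
  · rintro ⟨i, j⟩ h1 h2
    rw [Finset.mem_vaddAntidiagonal] at h1
    have h3 : i + j = l := h1.2.2
    rw [if_neg, smul_zero]
    rintro (rfl : j = 0)
    rw [add_zero] at h3
    exact h2 (by rw [h3])
  · intro h
    rw [Finset.mem_vaddAntidiagonal, not_and_or, not_and_or] at h
    simp only [if_true]
    rcases h with h | h | h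
    · rw [show (a : HahnSeries ℝ≥0 R).coeff l = 0 by simpa using h, zero_smul]
    · have : v = 0 := by
        by_contra h'
        exact h (by rw [HahnSeries.mem_support, key]; simpa using h')
      rw [this, smul_zero]
    · exact absurd (show l + 0 = l from add_zero l) h

/-- Multiplying the constant vector `1` embeds the Novikov ring in the completion of `R`, so the
truncation already available for vectors applies to scalars. -/
theorem exists_eq_sum_T (a : NovikovRing R) (E : ℝ≥0) : ∃ (s : Finset ℝ≥0) (r : ℝ≥0 → R)
    (a' : NovikovRing R), a = ∑ i ∈ s, T R i * scal R (r i) + T R E * a' := by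
  have hinj : ∀ a a' : NovikovRing R, a • const (R := R) (1 : R) = a' • const 1 → a = a' := by
    intro a a' h
    refine Subtype.ext (HahnSeries.ext (funext fun l => ?_))
    have := congrArg (fun x => coeff x l) h
    simpa [coeff_novikov_smul_const] using this
  obtain ⟨y, hy⟩ := exists_eq_T_smul (sub_sum_exponents_mem (a • const (R := R) (1 : R)) E)
  refine ⟨exponents (a • const (R := R) (1 : R)) E, fun i => coeff (a • const (R := R) (1 : R)) i,
    ⟨(HahnModule.of R).symm (y : HahnModule ℝ≥0 R R), y.2⟩, hinj _ _ ?_⟩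
  rw [sub_eq_iff_eq_add'] at hy
  conv_lhs => rw [hy]
  rw [add_smul, Finset.sum_smul]
  congr 1
  · refine Finset.sum_congr rfl fun i _ => ?_
    have := (constHom R R).map_smul (coeff (a • const (R := R) (1 : R)) i) 1
    rw [smul_eq_mul, mul_one] at this
    rw [mul_smul]
    exact congrArg _ this
  · rw [mul_smul]
    congr 1
    refine coeff_ext fun l => ?_
    rw [coeff_novikov_smul_const, smul_eq_mul, mul_one]
    rfl

/-- An `R`-linear map that commutes with all `T ^ E` is linear over the Novikov ring. -/
def ofTLinear (A : Completed R V →ₗ[R] Completed R W)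
    (h : ∀ E x, A (T R E • x) = T R E • A x) :
    Completed R V →ₗ[NovikovRing R] Completed R W where
  toFun := A
  map_add' := map_add A
  map_smul' a x := by
    refine eq_of_sub_mem_filtration fun E => ?_
    obtain ⟨s, r, a', rfl⟩ := exists_eq_sum_T a E
    have : A ((∑ i ∈ s, T R i * scal R (r i) + T R E * a') • x) -
        (∑ i ∈ s, T R i * scal R (r i) + T R E * a') • A x =
        T R E • (A (a' • x) - a' • A x) := by
      rw [add_smul, add_smul, map_add, mul_smul, mul_smul, h, Finset.sum_smul, Finset.sum_smul,
        map_sum, smul_sub, add_sub_add_comm, add_eq_right, sub_eq_zero]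
      refine Finset.sum_congr rfl fun i _ => ?_
      rw [mul_smul, mul_smul, h, ← smul_eq_scal, map_smul, smul_eq_scal]
    rw [RingHom.id_apply, this]
    exact T_smul_mem _ _

theorem lift_sum_eq (φ : V →ₗ[R] Completed R W) (x : Completed R V) (l : ℝ≥0) {s : Finset ℝ≥0}
    (hs : exponents x l ⊆ s) (hl : ∀ i ∈ s, i ≤ l) :
    ∑ i ∈ exponents x l, coeff (φ (coeff x i)) (l - i) =
      ∑ i ∈ s, coeff (φ (coeff x i)) (l - i) := by
  refine Finset.sum_subset hs fun i hi h => ?_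
  have : coeff x i = 0 := by
    by_contra h'
    exact h (mem_exponents.2 ⟨h', hl i hi⟩)
  rw [this, map_zero, coeff_zero]

/-- The series `∑ T ^ λᵢ φ vᵢ` attached to `∑ vᵢ T ^ λᵢ`. -/
def liftSeries (φ : V →ₗ[R] Completed R W) (x : Completed R V) : Completed R W :=
  mk (fun l => ∑ i ∈ exponents x l, coeff (φ (coeff x i)) (l - i)) fun E => by
    classical
    refine (Set.Finite.biUnion (finite_coeff x E) (t := fun i => (fun j => i + j) ''
      {j | coeff (φ (coeff x i)) j ≠ 0 ∧ j ≤ E})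
      fun i _ => (finite_coeff (φ (coeff x i)) E).image _).subset ?_
    rintro l ⟨h1, h2⟩
    obtain ⟨i, hi, h3⟩ := Finset.exists_ne_zero_of_sum_ne_zero h1
    rw [mem_exponents] at hi
    exact Set.mem_biUnion (x := i) ⟨hi.1, hi.2.trans h2⟩
      ⟨l - i, ⟨h3, tsub_le_self.trans h2⟩, add_tsub_cancel_of_le hi.2⟩

theorem coeff_liftSeries (φ : V →ₗ[R] Completed R W) (x : Completed R V) (l : ℝ≥0) :
    coeff (liftSeries φ x) l = ∑ i ∈ exponents x l, coeff (φ (coeff x i)) (l - i) := rfl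

theorem liftSeries_add (φ : V →ₗ[R] Completed R W) (x y : Completed R V) :
    liftSeries φ (x + y) = liftSeries φ x + liftSeries φ y := by
  classical
  refine coeff_ext fun l => ?_
  have h : ∀ i ∈ exponents x l ∪ exponents y l ∪ exponents (x + y) l, i ≤ l := by
    intro i hi
    simp only [Finset.mem_union, mem_exponents] at hi
    tauto
  have h1 : exponents x l ⊆ exponents x l ∪ exponents y l ∪ exponents (x + y) l :=
    fun i hi => by simp [hi]
  have h2 : exponents y l ⊆ exponents x l ∪ exponents y l ∪ exponents (x + y) l :=
    fun i hi => by simp [hi]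
  rw [coeff_add, coeff_liftSeries, coeff_liftSeries, coeff_liftSeries,
    lift_sum_eq φ (x + y) l Finset.subset_union_right h, lift_sum_eq φ x l h1 h,
    lift_sum_eq φ y l h2 h, ← Finset.sum_add_distrib]
  refine Finset.sum_congr rfl fun i _ => ?_
  rw [coeff_add, map_add, coeff_add]

theorem liftSeries_smul (φ : V →ₗ[R] Completed R W) (r : R) (x : Completed R V) :
    liftSeries φ (r • x) = r • liftSeries φ x := by
  refine coeff_ext fun l => ?_
  have h : exponents (r • x) l ⊆ exponents x l := by
    intro i hi
    rw [mem_exponents, coeff_smul] at hi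
    exact mem_exponents.2 ⟨fun h => hi.1 (by rw [h, smul_zero]), hi.2⟩
  rw [coeff_smul, coeff_liftSeries, coeff_liftSeries,
    lift_sum_eq φ (r • x) l h fun i hi => (mem_exponents.1 hi).2, Finset.smul_sum]
  refine Finset.sum_congr rfl fun i _ => ?_
  rw [coeff_smul, map_smul, coeff_smul]

theorem liftSeries_T (φ : V →ₗ[R] Completed R W) (E : ℝ≥0) (x : Completed R V) :
    liftSeries φ (T R E • x) = T R E • liftSeries φ x := by
  refine coeff_ext fun l => ?_
  rw [coeff_liftSeries]
  rcases lt_or_ge l E with h | h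
  · rw [coeff_T_smul_of_lt h]
    refine Finset.sum_eq_zero fun i hi => ?_
    rw [mem_exponents] at hi
    exact absurd (coeff_T_smul_of_lt (hi.2.trans_lt h) x) hi.1
  · rw [coeff_T_smul_of_le h, coeff_liftSeries]
    symm
    refine Finset.sum_nbij (fun i => E + i) (fun i hi => ?_)
      (add_right_injective E).injOn (fun i hi => ?_) fun i hi => ?_
    · rw [mem_exponents] at hi ⊢
      rw [coeff_T_smul]
      exact ⟨hi.1, (add_le_add_right hi.2 E).trans_eq (add_tsub_cancel_of_le h)⟩
    · rw [Finset.mem_coe, mem_exponents] at hi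
      rcases lt_or_ge i E with h' | h'
      · exact absurd (coeff_T_smul_of_lt h' x) hi.1
      · rw [coeff_T_smul_of_le h'] at hi
        exact ⟨i - E, mem_exponents.2 ⟨hi.1, tsub_le_tsub_right hi.2 E⟩,
          add_tsub_cancel_of_le h'⟩
    · rw [coeff_T_smul, tsub_add_eq_tsub_tsub]

/-- The `Λ₀`-linear extension `∑ vᵢ T ^ λᵢ ↦ ∑ T ^ λᵢ φ vᵢ`. -/
def lift (φ : V →ₗ[R] Completed R W) : Completed R V →ₗ[NovikovRing R] Completed R W :=
  ofTLinear ⟨⟨liftSeries φ, liftSeries_add φ⟩, liftSeries_smul φ⟩ (liftSeries_T φ)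

theorem coeff_lift (φ : V →ₗ[R] Completed R W) (x : Completed R V) (l : ℝ≥0) :
    coeff (lift φ x) l = ∑ i ∈ exponents x l, coeff (φ (coeff x i)) (l - i) := rfl

theorem coeff_lift_of_subset (φ : V →ₗ[R] Completed R W) (x : Completed R V) (l : ℝ≥0)
    {s : Finset ℝ≥0} (hs : exponents x l ⊆ s) (hl : ∀ i ∈ s, i ≤ l) :
    coeff (lift φ x) l = ∑ i ∈ s, coeff (φ (coeff x i)) (l - i) := lift_sum_eq φ x l hs hl

@[simp] theorem lift_const (φ : V →ₗ[R] Completed R W) (v : V) : lift φ (const v) = φ v := by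
  refine coeff_ext fun l => ?_
  rw [coeff_lift_of_subset φ (const v) l (s := {0}), Finset.sum_singleton, coeff_const_zero,
    tsub_zero]
  · intro i hi
    rw [mem_exponents, coeff_const] at hi
    rw [Finset.mem_singleton]
    by_contra h
    exact hi.1 (if_neg h)
  · simp

/-- Modulo `T ^ E` every element is a finite combination of multiples of constants. A `Λ₀`-linear
map preserves the filtration automatically, so no continuity has to be assumed. -/
theorem completed_hom_ext {A B : Completed R V →ₗ[NovikovRing R] Completed R W}
    (h : ∀ v, A (const v) = B (const v)) : A = B := by
  refine LinearMap.ext fun x => eq_of_sub_mem_filtration fun E => ?_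
  have : A x - B x = (A - B) (x - ∑ i ∈ exponents x E, T R i • const (coeff x i)) := by
    rw [map_sub, map_sum]
    simp [h]
  rw [this]
  exact map_filtration _ (sub_sum_exponents_mem x E)

/-- The restriction of a `Λ₀`-linear map to the constants. -/
def onConst (A : Completed R V →ₗ[NovikovRing R] Completed R W) : V →ₗ[R] Completed R W where
  toFun v := A (const v)
  map_add' u v := by rw [← constHom_apply, map_add, map_add]; rfl
  map_smul' r v := by
    rw [← constHom_apply, map_smul, smul_eq_scal, map_smul]; rfl

@[simp] theorem onConst_apply (A : Completed R V →ₗ[NovikovRing R] Completed R W) (v : V) :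
    onConst A v = A (const v) := rfl

theorem lift_onConst (A : Completed R V →ₗ[NovikovRing R] Completed R W) : lift (onConst A) = A :=
  completed_hom_ext fun v => by simp

theorem coeff_apply (A : Completed R V →ₗ[NovikovRing R] Completed R W) (x : Completed R V)
    (l : ℝ≥0) : coeff (A x) l = ∑ i ∈ exponents x l, coeff (A (const (coeff x i))) (l - i) := by
  conv_lhs => rw [← lift_onConst A, coeff_lift]
  rfl

theorem coeff_apply_of_subset (A : Completed R V →ₗ[NovikovRing R] Completed R W)
    (x : Completed R V) (l : ℝ≥0) {s : Finset ℝ≥0} (hs : exponents x l ⊆ s) (hl : ∀ i ∈ s, i ≤ l) :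
    coeff (A x) l = ∑ i ∈ s, coeff (A (const (coeff x i))) (l - i) := by
  conv_lhs => rw [← lift_onConst A, coeff_lift_of_subset _ _ _ hs hl]
  rfl

end Lift

/-! ### Discrete monoids of energies -/

/-- Only finitely many elements of `S` are bounded by a given real number. -/
class Discrete (S : AddSubmonoid ℝ≥0) : Prop where
  finite : ∀ E : ℝ≥0, ((S : Set ℝ≥0) ∩ Set.Iic E).Finite

section Discrete

variable (S : AddSubmonoid ℝ≥0) [hS : Discrete S]

theorem exists_gap : ∃ ε : ℝ≥0, 0 < ε ∧ ∀ a ∈ S, a ≠ 0 → ε ≤ a := by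
  classical
  have hfin : ((S : Set ℝ≥0) ∩ Set.Iic 1 ∩ {0}ᶜ).Finite := (hS.finite 1).inter_of_left _
  rcases Set.eq_empty_or_nonempty ((S : Set ℝ≥0) ∩ Set.Iic 1 ∩ {0}ᶜ) with h | h
  · refine ⟨1, one_pos, fun a ha h0 => ?_⟩
    by_contra h1
    have : a ∈ (S : Set ℝ≥0) ∩ Set.Iic 1 ∩ {0}ᶜ := ⟨⟨ha, (not_le.1 h1).le⟩, h0⟩
    rw [h] at this
    exact this
  · obtain ⟨ε, ⟨⟨hε, h1⟩, h0⟩, hmin⟩ := Set.exists_min_image _ id hfin h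
    refine ⟨ε, pos_iff_ne_zero.2 h0, fun a ha h0' => ?_⟩
    rcases le_or_gt a 1 with h2 | h2
    · exact hmin a ⟨⟨ha, h2⟩, h0'⟩
    · exact le_trans h1 h2.le

/-- A lower bound for the positive elements of `S`. -/
def gap : ℝ≥0 := (exists_gap S).choose

theorem gap_pos : 0 < gap S := (exists_gap S).choose_spec.1

theorem finite_decompositions (l : S) : {p : S × S | p.1 + p.2 = l}.Finite := by
  have h := hS.finite l
  refine Set.Finite.of_injOn (f := fun p : S × S => ((p.1 : ℝ≥0), (p.2 : ℝ≥0))) ?_ ?_ (h.prod h)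
  · rintro ⟨a, c⟩ (rfl : a + c = l)
    exact ⟨⟨a.2, (le_self_add : (a : ℝ≥0) ≤ a + c)⟩, ⟨c.2, (le_add_self : (c : ℝ≥0) ≤ a + c)⟩⟩
  · rintro ⟨a, c⟩ - ⟨a', c'⟩ - h
    simp only [Prod.mk.injEq, SetLike.coe_eq_coe] at h
    rw [h.1, h.2]

/-- The height measures energy in units of the gap, rounded down. Rounding down is superadditive,
and a nonzero element of `S` is at least one gap. -/
instance : EnergyMonoid S where
  antidiagonal l := (finite_decompositions S l).toFinset
  mem_antidiagonal := by simp
  height a := ⌊(a : ℝ≥0) / gap S⌋₊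
  height_add_le a c := by
    refine Nat.le_floor ?_
    push_cast
    rw [add_div]
    exact add_le_add (Nat.floor_le zero_le) (Nat.floor_le zero_le)
  eq_zero_of_height a h := by
    by_contra h0
    rw [Nat.floor_eq_zero, div_lt_one (gap_pos S)] at h
    exact not_le.2 h ((exists_gap S).choose_spec.2 a a.2 fun h' => h0 (Subtype.ext h'))

theorem height_le {a : S} {E : ℝ≥0} (h : (a : ℝ≥0) ≤ E) :
    EnergyMonoid.height a ≤ ⌊E / gap S⌋₊ :=
  Nat.floor_le_floor (div_le_div_of_nonneg_right h (gap_pos S).le)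

end Discrete

/-! ### Operations with given values on words -/

section Sharp

variable {R : Type*} [Field R] {I J U V W : Type*} [AddCommGroup U] [Module R U]
  [AddCommGroup V] [Module R V] [AddCommGroup W] [Module R W]
  {S : AddSubmonoid ℝ≥0} [hS : Discrete S]

/-- Left multiplication of lists by a vector. -/
def listCons (b : Module.Basis I R V) : V →ₗ[R] (List I →₀ R) →ₗ[R] (List I →₀ R) :=
  b.constr R fun i => Finsupp.lmapDomain R R (List.cons i)

theorem listCons_basis (b : Module.Basis I R V) (i : I) (u : List I) :
    listCons b (b i) (Finsupp.single u 1) = Finsupp.single (i :: u) 1 := by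
  simp [listCons]

/-- The product of an element of the completion with a fixed word. -/
def mulWord (b : Module.Basis I R V) (x : List I →₀ R) :
    Completed R V →ₗ[NovikovRing R] Completed R (List I →₀ R) :=
  lift (constHom R (List I →₀ R) ∘ₗ (listCons b).flip x)

theorem mulWord_const (b : Module.Basis I R V) (x : List I →₀ R) (v : V) :
    mulWord b x (const v) = constHom R _ (listCons b v x) := lift_const _ _

theorem mulWord_add (b : Module.Basis I R V) (x x' : List I →₀ R) :
    mulWord b (x + x') = mulWord b x + mulWord b x' :=
  completed_hom_ext fun v => by
    rw [LinearMap.add_apply, mulWord_const, mulWord_const, mulWord_const, map_add, map_add]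

theorem mulWord_smul (b : Module.Basis I R V) (r : R) (x : List I →₀ R) :
    mulWord b (r • x) = scal R r • mulWord b x :=
  completed_hom_ext fun v => by
    rw [LinearMap.smul_apply, mulWord_const, mulWord_const, map_smul, map_smul, smul_eq_scal]

/-- The product of a fixed element of the completion with a word. -/
def mulElement (b : Module.Basis I R V) (y : Completed R V) :
    (List I →₀ R) →ₗ[R] Completed R (List I →₀ R) where
  toFun x := mulWord b x y
  map_add' x x' := by rw [mulWord_add, LinearMap.add_apply]
  map_smul' r x := by rw [mulWord_smul, LinearMap.smul_apply, RingHom.id_apply, smul_eq_scal]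

theorem mulElement_apply (b : Module.Basis I R V) (y : Completed R V) (x : List I →₀ R) :
    mulElement b y x = mulWord b x y := rfl

theorem lift_mulElement_add (b : Module.Basis I R V) (y y' : Completed R V) :
    lift (mulElement b (y + y')) = lift (mulElement b y) + lift (mulElement b y') :=
  completed_hom_ext fun x => by
    rw [LinearMap.add_apply, lift_const, lift_const, lift_const, mulElement_apply,
      mulElement_apply, mulElement_apply, map_add]

theorem lift_mulElement_smul (b : Module.Basis I R V) (a : NovikovRing R) (y : Completed R V) :
    lift (mulElement b (a • y)) = a • lift (mulElement b y) :=
  completed_hom_ext fun x => by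
    rw [LinearMap.smul_apply, lift_const, lift_const, mulElement_apply, mulElement_apply, map_smul]

/-- Left multiplication by an element of the completion. -/
def mulLeft (b : Module.Basis I R V) : Completed R V →ₗ[NovikovRing R]
    Module.End (NovikovRing R) (Completed R (List I →₀ R)) where
  toFun y := lift (mulElement b y)
  map_add' := lift_mulElement_add b
  map_smul' := lift_mulElement_smul b

theorem mulLeft_const (b : Module.Basis I R V) (v : V) (x : List I →₀ R) :
    mulLeft b (const v) (const x) = const (listCons b v x) := by
  change lift (mulElement b (const v)) (const x) = _
  rw [lift_const, mulElement_apply, mulWord_const, constHom_apply]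

/-- The words of energy `l`. -/
def atEnergy {E : Type*} [EnergyMonoid E] (l : E) : (List I →₀ R) →ₗ[R] Bar R I E :=
  Finsupp.lmapDomain R R fun u => ⟨u, l⟩

theorem atEnergy_single {E : Type*} [EnergyMonoid E] (l : E) (u : List I) :
    atEnergy l (Finsupp.single u (1 : R)) = wd R ⟨u, l⟩ := by
  simp [atEnergy, wd]

open Classical in
/-- The sum of the components of `φ` of all energies. -/
def allEnergies (φ : Bar R I S →ₗ[R] W) : (List I →₀ R) →ₗ[R] Completed R W where
  toFun x := mk (fun l => if h : l ∈ S then φ (atEnergy (⟨l, h⟩ : S) x) else 0) fun E =>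
    (hS.finite E).subset fun l hl => ⟨by
      by_contra h
      exact hl.1 (dif_neg h), hl.2⟩
  map_add' x y := coeff_ext fun l => by
    simp only [coeff_mk, coeff_add, map_add]
    split_ifs <;> simp
  map_smul' r x := coeff_ext fun l => by
    simp only [coeff_mk, coeff_smul, map_smul, RingHom.id_apply]
    split_ifs <;> simp

/-- The operations with component `φ`. -/
def sharp (b : Module.Basis I R V) (φ : Bar R I S →ₗ[R] W) : Operations R V W := fun k =>
  (lift (allEnergies φ) ∘ₗ LinearMap.applyₗ (const (Finsupp.single [] 1))).compMultilinearMap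
    ((MultilinearMap.mkPiAlgebraFin (NovikovRing R) k
      (Module.End (NovikovRing R) (Completed R (List I →₀ R)))).compLinearMap fun _ => mulLeft b)

theorem prod_mulLeft (b : Module.Basis I R V) (v : List V) :
    (v.map fun v => mulLeft b (const v)).prod (const (Finsupp.single [] 1)) =
      const (v.foldr (fun v x => listCons b v x) (Finsupp.single [] 1)) := by
  induction v with
  | nil => rfl
  | cons a v ih =>
    rw [List.map_cons, List.prod_cons, Module.End.mul_apply, ih, mulLeft_const, List.foldr_cons]

/-- In `sharp`, completed inputs act by left multiplication on the completed span of lists, and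
multilinearity is inherited from the product of endomorphisms. On constants this product, applied to
the empty list, is the usual product of vectors. -/
theorem sharp_const (b : Module.Basis I R V) (φ : Bar R I S →ₗ[R] W) (k : ℕ) (v : Fin k → V) :
    sharp b φ k (fun i => const (v i)) =
      allEnergies φ ((List.ofFn v).foldr (fun v x => listCons b v x) (Finsupp.single [] 1)) := by
  have h := prod_mulLeft b (List.ofFn v)
  rw [List.map_ofFn] at h
  change lift (allEnergies φ) ((List.ofFn fun i => mulLeft b (const (v i))).prod
    (const (Finsupp.single [] 1))) = _
  refine (congrArg _ h).trans ?_
  rw [lift_const]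

theorem foldr_basis (b : Module.Basis I R V) (w : List I) :
    (w.map b).foldr (fun v x => listCons b v x) (Finsupp.single [] 1) = Finsupp.single w 1 := by
  induction w with
  | nil => rfl
  | cons i w ih => rw [List.map_cons, List.foldr_cons, ih, listCons_basis]

theorem isGapped_sharp (b : Module.Basis I R V) (φ : Bar R I S →ₗ[R] W) :
    IsGapped S (sharp b φ) := by
  intro k v l h
  rw [sharp_const] at h
  by_contra h'
  exact h (dif_neg h')

/-- The components of operations on words. -/
def flat (S : AddSubmonoid ℝ≥0) [Discrete S] (b : Module.Basis I R V) (F : Operations R V W) :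
    Bar R I S →ₗ[R] W :=
  onWords R fun m => coeff (F m.letters.length fun j => const (b (m.letters.get j))) m.energy

theorem flat_wd (b : Module.Basis I R V) (F : Operations R V W) (u : List I) (l : S) :
    flat S b F (wd R ⟨u, l⟩) = coeff (F u.length fun j => const (b (u.get j))) l := onWords_wd _ _

theorem flat_wd_seq (b : Module.Basis I R V) (F : Operations R V W) {k : ℕ}
    {x : ℕ → Completed R V} {u : List I} (hk : u.length = k)
    (hx : ∀ (s : ℕ) (h : s < u.length), x s = const (b u[s])) (l : S) :
    coeff (F k fun j => x j) l = flat S b F (wd R ⟨u, l⟩) := by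
  subst hk
  rw [flat_wd]
  congr 2
  funext j
  exact hx j j.2

theorem flat_sharp (b : Module.Basis I R V) (φ : Bar R I S →ₗ[R] W) : flat S b (sharp b φ) = φ := by
  refine bar_hom_ext fun ⟨u, l⟩ => ?_
  rw [flat_wd, sharp_const]
  have h : (List.ofFn fun j => b (u.get j)) = u.map b := by
    conv_rhs => rw [← List.ofFn_get u, List.map_ofFn]
    rfl
  rw [h, foldr_basis]
  exact (dif_pos l.2).trans (by rw [atEnergy_single])

theorem flat_zero (b : Module.Basis I R V) {F : Operations R V W}
    (h : ∀ x, coeff (F 0 x) 0 = 0) : flat S b F (wd R 0) = 0 :=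
  (flat_wd b F [] 0).trans (h _)

/-! ### Coefficients of operations -/

/-- Only energies in `S` occur in `x`. -/
def SuppIn (S : AddSubmonoid ℝ≥0) (x : Completed R V) : Prop := ∀ l, coeff x l ≠ 0 → l ∈ S

theorem suppIn_const (v : V) : SuppIn S (const (R := R) v) := by
  intro l hl
  rw [coeff_const] at hl
  rw [show l = 0 by by_contra h; exact hl (if_neg h)]
  exact S.zero_mem

theorem suppIn_apply (A : Completed R V →ₗ[NovikovRing R] Completed R W)
    (hA : ∀ v, SuppIn S (A (const v))) {x : Completed R V} (hx : SuppIn S x) :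
    SuppIn S (A x) := by
  intro l hl
  rw [coeff_apply] at hl
  obtain ⟨i, hi, h⟩ := Finset.exists_ne_zero_of_sum_ne_zero hl
  rw [mem_exponents] at hi
  rw [← add_tsub_cancel_of_le hi.2]
  exact S.add_mem (hx _ hi.1) (hA _ _ h)

theorem coeff_apply_eq_sum_antidiagonal (A : Completed R V →ₗ[NovikovRing R] Completed R W)
    (hA : ∀ v, SuppIn S (A (const v))) {x : Completed R V} (hx : SuppIn S x) (l : S) :
    coeff (A x) l = ∑ p ∈ antidiagonal l, coeff (A (const (coeff x p.1))) p.2 := by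
  rw [coeff_apply]
  symm
  refine Finset.sum_bij_ne_zero (fun p _ _ => (p.1 : ℝ≥0)) ?_ ?_ ?_ ?_
  · rintro ⟨a, c⟩ h h0
    rw [mem_antidiagonal] at h
    rw [mem_exponents]
    refine ⟨fun h' => h0 ?_, ?_⟩
    · simp only [h']
      rw [← onConst_apply, map_zero, coeff_zero]
    · rw [← h]
      exact le_self_add
  · rintro ⟨a, c⟩ h - ⟨a', c'⟩ h' - haa
    rw [mem_antidiagonal] at h h'
    have : a = a' := Subtype.ext haa
    subst this
    have : c = c' := Subtype.ext (add_left_cancel (a := (a : ℝ≥0))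
      ((congrArg Subtype.val h).trans (congrArg Subtype.val h').symm))
    rw [this]
  · intro i hi h0
    rw [mem_exponents] at hi
    refine ⟨(⟨i, hx i hi.1⟩, ⟨l - i, hA _ _ h0⟩), ?_, h0, rfl⟩
    rw [mem_antidiagonal]
    exact Subtype.ext (add_tsub_cancel_of_le hi.2)
  · rintro ⟨a, c⟩ h -
    rw [mem_antidiagonal] at h
    rw [← h, AddSubmonoid.coe_add, add_tsub_cancel_left]

/-- The component of energy `l` of the product of `n` elements of the completion. -/
def cvec (b : Module.Basis I R V) : ∀ n : ℕ, (Fin n → Completed R V) → S → Bar R I S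
  | 0, _, l => wd R (Word.nil I l)
  | n + 1, y, l => ∑ p ∈ antidiagonal l, cons b (coeff (y 0) p.1) (cvec b n (Fin.tail y) p.2)

theorem cvec_zero (b : Module.Basis I R V) (y : Fin 0 → Completed R V) (l : S) :
    cvec b 0 y l = wd R (Word.nil I l) := rfl

theorem cvec_succ (b : Module.Basis I R V) (n : ℕ) (y : Fin (n + 1) → Completed R V) (l : S) :
    cvec b (n + 1) y l =
      ∑ p ∈ antidiagonal l, cons b (coeff (y 0) p.1) (cvec b n (Fin.tail y) p.2) := rfl

/-- The operations obtained by fixing the first input. -/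
def fixFirst (F : Operations R V W) (z : Completed R V) : Operations R V W :=
  fun k => (F (k + 1)).curryLeft z

theorem flat_cons (b : Module.Basis I R V) (F : Operations R V W) (v : V) (q : Bar R I S) :
    flat S b F (cons b v q) = flat S b (fixFirst F (const v)) q := by
  suffices h : flat S b F ∘ₗ cons b v = flat S b (fixFirst F (const v)) from
    LinearMap.congr_fun h q
  refine bar_hom_ext fun m => ?_
  obtain ⟨u, l⟩ := m
  rw [flat_wd]
  have : flat S b F ∘ₗ (cons b).flip (wd R ⟨u, l⟩) = coeffHom R W l ∘ₗ
      onConst ((F (u.length + 1)).toLinearMap (Fin.cons 0 fun j => const (b (u.get j))) 0) := by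
    refine b.ext fun i => ?_
    simp only [LinearMap.comp_apply, LinearMap.flip_apply, cons_basis, coeffHom_apply,
      onConst_apply, MultilinearMap.toLinearMap_apply, Fin.update_cons_zero]
    rw [Word.cons, flat_wd]
    congr 2
    funext j
    refine Fin.cases ?_ (fun j => ?_) j <;> simp
  refine (LinearMap.congr_fun this v).trans ?_
  simp [fixFirst]

theorem IsGapped.fixFirst {F : Operations R V W} (hF : IsGapped S F) (v : V) :
    IsGapped S (fixFirst F (const v)) := by
  intro k v' l h
  refine hF (k + 1) (Fin.cons v v') l ?_
  rw [show (fun i => const (R := R) ((Fin.cons v v' : Fin (k + 1) → V) i)) =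
    Fin.cons (const v) fun i => const (v' i) from ?_]
  · exact h
  · funext j
    refine Fin.cases ?_ (fun j => ?_) j <;> simp

theorem apply_eq_first (F : Operations R V W) (n : ℕ) (y : Fin (n + 1) → Completed R V)
    (z : Completed R V) : (F (n + 1)).toLinearMap y 0 z = fixFirst F z n (Fin.tail y) := by
  rw [MultilinearMap.toLinearMap_apply, fixFirst, MultilinearMap.curryLeft_apply]
  congr 1
  conv_lhs => rw [← Fin.cons_self_tail y, Fin.update_cons_zero]

theorem IsGapped.suppIn {F : Operations R V W} (hF : IsGapped S F) {n : ℕ}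
    {y : Fin n → Completed R V} (hy : ∀ j, SuppIn S (y j)) : SuppIn S (F n y) := by
  induction n generalizing F with
  | zero =>
    rw [Subsingleton.elim y fun j => const (0 : V)]
    exact hF 0 _
  | succ n ih =>
    have h : F (n + 1) y = (F (n + 1)).toLinearMap y 0 (y 0) := by simp
    rw [h]
    refine suppIn_apply _ (fun v => ?_) (hy 0)
    rw [apply_eq_first]
    exact ih (hF.fixFirst v) fun j => hy j.succ

/-- Fix the first input and expand it in powers of `T`; for a constant first input `flat_cons`
absorbs the input into the word. This is the bridge from nested operations to composed maps of
words. -/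
theorem IsGapped.coeff_eq {F : Operations R V W} (hF : IsGapped S F) (b : Module.Basis I R V)
    {n : ℕ} {y : Fin n → Completed R V} (hy : ∀ j, SuppIn S (y j)) (l : S) :
    coeff (F n y) l = flat S b F (cvec b n y l) := by
  induction n generalizing F l with
  | zero =>
    rw [cvec_zero, Word.nil, flat_wd]
    congr 2
    exact Subsingleton.elim _ _
  | succ n ih =>
    have h : F (n + 1) y = (F (n + 1)).toLinearMap y 0 (y 0) := by simp
    rw [h, cvec_succ, map_sum, coeff_apply_eq_sum_antidiagonal (S := S) _ (fun v => ?_) (hy 0)]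
    · refine Finset.sum_congr rfl fun p _ => ?_
      rw [flat_cons, apply_eq_first]
      exact ih (hF.fixFirst _) (fun j => hy j.succ) _
    · rw [apply_eq_first]
      exact (hF.fixFirst v).suppIn fun j => hy j.succ

theorem cvec_succ_const (b : Module.Basis I R V) (n : ℕ) (y : Fin (n + 1) → Completed R V) (v : V)
    (hy : y 0 = const v) (l : S) : cvec b (n + 1) y l = cons b v (cvec b n (Fin.tail y) l) := by
  rw [cvec_succ, Finset.sum_eq_single (0, l)]
  · rw [hy, ZeroMemClass.coe_zero, coeff_const_zero]
  · rintro ⟨a, c⟩ h h0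
    rw [mem_antidiagonal] at h
    rw [hy, coeff_const, if_neg, map_zero, LinearMap.zero_apply]
    intro h1
    have : a = 0 := Subtype.ext h1
    subst this
    rw [zero_add] at h
    exact h0 (Prod.ext rfl h)
  · intro h
    exact absurd (mem_antidiagonal.2 (zero_add l)) h

theorem cvec_const (b : Module.Basis I R V) {n : ℕ} {x : ℕ → Completed R V} {u : List I}
    (hn : u.length = n) (hx : ∀ (s : ℕ) (h : s < u.length), x s = const (b u[s])) (l : S) :
    cvec b n (fun j => x j) l = wd R ⟨u, l⟩ := by
  induction n generalizing u x with
  | zero => rw [List.length_eq_zero_iff] at hn; subst hn; rfl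
  | succ n ih =>
    obtain _ | ⟨i, u⟩ := u
    · simp at hn
    rw [cvec_succ_const b n _ (b i) (hx 0 (by simp))]
    have := ih (x := fun s => x (s + 1)) (u := u) (by simpa using hn) fun s h =>
      hx (s + 1) (by simpa using h)
    exact (congrArg _ this).trans (cons_basis b i _)

end Sharp

/-! ### Multilinear functions of sequences -/

section Multilinear

variable {R : Type*} [Field R] {U V W X : Type*} [AddCommGroup U] [Module R U]
  [AddCommGroup V] [Module R V] [AddCommGroup W] [Module R W] [AddCommGroup X] [Module R X]

/-- `Φ` is a multilinear function of the terms with index in `s` of a sequence. -/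
structure IsMultilinearOn (s : Finset ℕ) (Φ : (ℕ → Completed R V) → Completed R W) : Prop where
  linear : ∀ i ∈ s, ∀ x, ∃ A : Completed R V →ₗ[NovikovRing R] Completed R W,
    ∀ z, Φ (Function.update x i z) = A z
  congr : ∀ x y, (∀ i ∈ s, x i = y i) → Φ x = Φ y

namespace IsMultilinearOn

variable {s : Finset ℕ} {Φ Ψ : (ℕ → Completed R V) → Completed R W}

theorem coordinate (i : ℕ) : IsMultilinearOn {i} fun x : ℕ → Completed R V => x i where
  linear := by
    intro j hj x
    rw [Finset.mem_singleton] at hj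
    subst hj
    exact ⟨LinearMap.id, fun z => by simp⟩
  congr x y h := h i (by simp)

theorem update_of_notMem (h : IsMultilinearOn s Φ) {i : ℕ} (hi : i ∉ s)
    (x : ℕ → Completed R V) (z : Completed R V) : Φ (Function.update x i z) = Φ x :=
  h.congr _ _ fun j hj => Function.update_of_ne (by rintro rfl; exact hi hj) _ _

theorem comp {n : ℕ} (F : MultilinearMap (NovikovRing R) (fun _ : Fin n => Completed R W)
      (Completed R X)) {s : Fin n → Finset ℕ} {t : Finset ℕ}
    {Φ : Fin n → (ℕ → Completed R V) → Completed R W} (h : ∀ j, IsMultilinearOn (s j) (Φ j))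
    (hd : ∀ j j' i, i ∈ s j → i ∈ s j' → j = j') (ht : ∀ i, i ∈ t ↔ ∃ j, i ∈ s j) :
    IsMultilinearOn t fun x => F fun j => Φ j x where
  linear := by
    intro i hi x
    obtain ⟨j, hj⟩ := (ht i).1 hi
    obtain ⟨A, hA⟩ := (h j).linear i hj x
    refine ⟨F.toLinearMap (fun j => Φ j x) j ∘ₗ A, fun z => ?_⟩
    rw [LinearMap.comp_apply, MultilinearMap.toLinearMap_apply, ← hA]
    congr 1
    funext j'
    by_cases hj' : j' = j
    · subst hj'
      simp
    · rw [Function.update_of_ne hj']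
      exact (h j').update_of_notMem (fun h' => hj' (hd _ _ _ h' hj)) _ _
  congr x y hxy := congrArg F (funext fun j => (h j).congr x y fun i hi =>
    hxy i ((ht i).2 ⟨j, hi⟩))

theorem map (A : Completed R W →ₗ[NovikovRing R] Completed R X) (h : IsMultilinearOn s Φ) :
    IsMultilinearOn s fun x => A (Φ x) where
  linear i hi x := by
    obtain ⟨B, hB⟩ := h.linear i hi x
    exact ⟨A ∘ₗ B, fun z => by rw [hB]; rfl⟩
  congr x y hxy := by rw [h.congr x y hxy]

theorem sub (h : IsMultilinearOn s Φ) (h' : IsMultilinearOn s Ψ) :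
    IsMultilinearOn s fun x => Φ x - Ψ x where
  linear i hi x := by
    obtain ⟨B, hB⟩ := h.linear i hi x
    obtain ⟨B', hB'⟩ := h'.linear i hi x
    exact ⟨B - B', fun z => by rw [hB, hB']; rfl⟩
  congr x y hxy := by rw [h.congr x y hxy, h'.congr x y hxy]

theorem zsmul (h : IsMultilinearOn s Φ) (c : ℤ) : IsMultilinearOn s fun x => c • Φ x where
  linear i hi x := by
    obtain ⟨B, hB⟩ := h.linear i hi x
    exact ⟨c • B, fun z => by rw [hB]; rfl⟩
  congr x y hxy := by rw [h.congr x y hxy]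

theorem sum {ι : Type*} (t : Finset ι) {Φ : ι → (ℕ → Completed R V) → Completed R W}
    (h : ∀ a ∈ t, IsMultilinearOn s (Φ a)) : IsMultilinearOn s fun x => ∑ a ∈ t, Φ a x where
  linear i hi x := by
    classical
    choose! B hB using fun a ha => (h a ha).linear i hi x
    exact ⟨∑ a ∈ t, B a, fun z => by
      rw [LinearMap.sum_apply]
      exact Finset.sum_congr rfl fun a ha => hB a ha z⟩
  congr x y hxy := Finset.sum_congr rfl fun a ha => (h a ha).congr x y hxy

theorem multilinearMap {k : ℕ}
    (F : MultilinearMap (NovikovRing R) (fun _ : Fin k => Completed R V) (Completed R W)) :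
    IsMultilinearOn (Finset.range k) fun x => F fun j => x j :=
  comp F (s := fun j => {(j : ℕ)}) (fun j => coordinate (j : ℕ))
    (fun j j' i h h' => Fin.ext (by simp at h h'; omega)) fun i => by
      simp only [Finset.mem_range, Finset.mem_singleton]
      exact ⟨fun h => ⟨⟨i, h⟩, rfl⟩, fun ⟨j, hj⟩ => hj ▸ j.2⟩

theorem operation (F : Operations R V W) (k : ℕ) :
    IsMultilinearOn (Finset.range k) fun x => F k fun j => x j := multilinearMap (F k)

theorem block (f : Operations R V W) (o c : ℕ) :
    IsMultilinearOn (Finset.Ico o (o + c)) fun x => f c fun j => x (o + j) :=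
  comp (f c) (s := fun j => {o + (j : ℕ)}) (fun j => coordinate (o + (j : ℕ)))
    (fun j j' i h h' => Fin.ext (by simp at h h'; omega)) fun i => by
      simp only [Finset.mem_Ico, Finset.mem_singleton]
      exact ⟨fun h => ⟨⟨i - o, by omega⟩, by simp; omega⟩, fun ⟨j, hj⟩ => by omega⟩

theorem insertion {N : ℕ} (F : Operations R V W) (m : Operations R V V) (k : ℕ) (d : ℕ → ZMod (2 * N)) :
    IsMultilinearOn (Finset.range k) fun x => insertionSum F m k x d := by
  refine sum _ fun l hl => sum _ fun i hi => zsmul ?_ _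
  rw [Finset.mem_range] at hl hi
  -- A slot of `F` uses one term before the insertion, the whole block at position `i`, or one
  -- shifted term after it. These index sets partition `range k`; for `l = 0` the block is empty.
  refine comp (F (k - l + 1)) (s := fun j => if (j : ℕ) < i then {(j : ℕ)} else
    if (j : ℕ) = i then Finset.Ico i (i + l) else {(j : ℕ) + l - 1})
    (Φ := fun j x => if (j : ℕ) < i then x j else if (j : ℕ) = i then m l fun s => x (i + s)
      else x (j + l - 1)) (fun j => ?_) (fun j j' a h h' => ?_) fun a => ?_
  · split_ifs
    · exact coordinate _
    · exact block m i l
    · exact coordinate _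
  · refine Fin.ext ?_
    split_ifs at h h' <;> simp at h h' <;> omega
  · rw [Finset.mem_range]
    constructor
    · intro ha
      rcases lt_or_ge a i with h | h
      · exact ⟨⟨a, by omega⟩, by simp [h]⟩
      · rcases lt_or_ge a (i + l) with h1 | h1
        · exact ⟨⟨i, by omega⟩, by simp [h, h1]⟩
        · refine ⟨⟨a - l + 1, by omega⟩, ?_⟩
          rw [if_neg (by simp; omega), if_neg (by simp; omega)]
          simp
          omega
    · rintro ⟨j, hj⟩
      have := j.2
      split_ifs at hj <;> simp at hj <;> omega

theorem exists_block {n : ℕ} (c : Fin n → ℕ) (a : ℕ) (h : a < ∑ i, c i) :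
    ∃ j, ∑ i ∈ Finset.Iio j, c i ≤ a ∧ a < ∑ i ∈ Finset.Iio j, c i + c j := by
  induction n generalizing a with
  | zero => simp at h
  | succ n ih =>
    rw [Fin.sum_univ_castSucc] at h
    have hcast : ∀ j : Fin n, ∑ i ∈ Finset.Iio j.castSucc, c i =
        ∑ i ∈ Finset.Iio j, c i.castSucc := by
      intro j
      rw [Fin.Iio_castSucc, Finset.sum_map]
      rfl
    rcases lt_or_ge a (∑ i : Fin n, c i.castSucc) with h1 | h1
    · obtain ⟨j, hj⟩ := ih (fun i => c i.castSucc) a h1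
      exact ⟨j.castSucc, by rwa [hcast]⟩
    · refine ⟨Fin.last n, ?_⟩
      have : ∑ i ∈ Finset.Iio (Fin.last n), c i = ∑ i : Fin n, c i.castSucc := by
        rw [Fin.Iio_last_eq_map, Finset.sum_map]
        rfl
      rw [this]
      exact ⟨h1, h⟩

theorem sum_Iio_add_le {n : ℕ} (c : Fin n → ℕ) {j j' : Fin n} (h : j < j') :
    ∑ i ∈ Finset.Iio j, c i + c j ≤ ∑ i ∈ Finset.Iio j', c i := by
  have h1 : ∑ i ∈ Finset.Iio j, c i + c j = ∑ i ∈ insert j (Finset.Iio j), c i := by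
    rw [Finset.sum_insert (by simp), add_comm]
  rw [h1]
  refine Finset.sum_le_sum_of_subset fun i hi => ?_
  simp only [Finset.mem_insert, Finset.mem_Iio] at hi ⊢
  rcases hi with rfl | hi
  · exact h
  · exact hi.trans h

theorem blocks (F : Operations R W X) (f : Operations R V W) (k n : ℕ) :
    IsMultilinearOn (Finset.range k) fun x => blockSum F f k x n := by
  refine sum _ fun c hc => ?_
  rw [Finset.Nat.mem_antidiagonalTuple] at hc
  refine comp (F n) (s := fun j => Finset.Ico (∑ i ∈ Finset.Iio j, c i)
    (∑ i ∈ Finset.Iio j, c i + c j)) (fun j => block f _ _) (fun j j' a h h' => ?_) fun a => ?_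
  · rw [Finset.mem_Ico] at h h'
    rcases lt_trichotomy j j' with h1 | h1 | h1
    · have := sum_Iio_add_le c h1
      omega
    · exact h1
    · have := sum_Iio_add_le c h1
      omega
  · simp only [Finset.mem_range, Finset.mem_Ico]
    constructor
    · intro ha
      exact exists_block c a (hc ▸ ha)
    · rintro ⟨j, -, h2⟩
      refine h2.trans_le ?_
      rw [← hc, show ∑ i ∈ Finset.Iio j, c i + c j = ∑ i ∈ insert j (Finset.Iio j), c i by
        rw [Finset.sum_insert (by simp), add_comm]]
      exact Finset.sum_le_sum_of_subset (Finset.subset_univ _)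

/-- Inputs are replaced by constants one at a time. The coefficient at `l` of a `Λ₀`-linear image
involves coefficients of images of constants at energies at most `l` only, whence the lower set.
Taking `q = ⊥` proves vanishing, and taking a graded piece proves statements about degrees. -/
theorem coeff_mem {k : ℕ} (h : IsMultilinearOn (Finset.range k) Φ) {L : Set ℝ≥0}
    (hL : IsLowerSet L) (q : Submodule R W) (B : ℕ → Set V)
    (hB : ∀ x, (∀ s < k, ∃ v ∈ B s, x s = const v) → ∀ l ∈ L, coeff (Φ x) l ∈ q)
    (x : ℕ → Completed R V) (hx : ∀ s < k, ∀ l, coeff (x s) l ∈ Submodule.span R (B s)) :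
    ∀ l ∈ L, coeff (Φ x) l ∈ q := by
  suffices H : ∀ j ≤ k, ∀ x : ℕ → Completed R V,
      (∀ s < j, ∀ l, coeff (x s) l ∈ Submodule.span R (B s)) →
      (∀ s < k, j ≤ s → ∃ v ∈ B s, x s = const v) → ∀ l ∈ L, coeff (Φ x) l ∈ q from
    H k le_rfl x hx fun s h1 h2 => absurd h1 (not_lt.2 h2)
  intro j
  induction j with
  | zero => exact fun _ x _ h => hB x fun s hs => h s hs (Nat.zero_le _)
  | succ j ih =>
    intro hj x h1 h2 l hl
    obtain ⟨A, hA⟩ := h.linear j (Finset.mem_range.2 hj) x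
    have hx : Φ x = A (x j) := by rw [← hA, Function.update_eq_self]
    rw [hx, coeff_apply]
    refine Submodule.sum_mem _ fun i _ => ?_
    have key : ∀ v ∈ Submodule.span R (B j), ∀ l ∈ L, coeff (A (const v)) l ∈ q := by
      intro v hv l hl
      rw [← coeffHom_apply, ← onConst_apply, ← LinearMap.comp_apply, ← Submodule.mem_comap]
      refine Submodule.span_le.2 (fun v hv => ?_) hv
      change coeff (A (const v)) l ∈ q
      rw [← hA]
      refine ih (by omega) _ (fun s hs l => ?_) (fun s hs hs' => ?_) l hl
      · rw [Function.update_of_ne (by omega)]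
        exact h1 s (by omega) l
      · rcases Nat.eq_or_lt_of_le hs' with rfl | hlt
        · exact ⟨v, hv, by simp⟩
        · rw [Function.update_of_ne (by omega)]
          exact h2 s hs hlt
    exact key _ (h1 j (Nat.lt_succ_self j) i) _ (hL tsub_le_self hl)

end IsMultilinearOn

theorem exists_word {I : Type*} {b : Module.Basis I R V} {k : ℕ} {J : ℕ → Set I}
    {x : ℕ → Completed R V} (h : ∀ s < k, ∃ v ∈ b '' J s, x s = const v) :
    ∃ u : List I, u.length = k ∧
      ∀ (s : ℕ) (hs : s < u.length), u[s] ∈ J s ∧ x s = const (b u[s]) := by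
  have : ∀ s : Fin k, ∃ i, i ∈ J s ∧ x s = const (b i) := by
    intro s
    obtain ⟨_, ⟨i, hi, rfl⟩, h'⟩ := h s s.2
    exact ⟨i, hi, h'⟩
  choose w hw using this
  refine ⟨List.ofFn w, by simp, fun s hs => ?_⟩
  rw [List.length_ofFn] at hs
  rw [List.getElem_ofFn]
  exact hw ⟨s, hs⟩

theorem IsMultilinearOn.coeff_mem_of_words {I : Type*} (b : Module.Basis I R V) {k : ℕ}
    {Φ : (ℕ → Completed R V) → Completed R W} (h : IsMultilinearOn (Finset.range k) Φ)
    {L : Set ℝ≥0} (hL : IsLowerSet L) (q : Submodule R W) (J : ℕ → Set I)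
    (hB : ∀ (x : ℕ → Completed R V) (u : List I), u.length = k →
      (∀ (s : ℕ) (hs : s < u.length), u[s] ∈ J s ∧ x s = const (b u[s])) →
      ∀ l ∈ L, coeff (Φ x) l ∈ q)
    (x : ℕ → Completed R V) (hx : ∀ s < k, ∀ l, coeff (x s) l ∈ Submodule.span R (b '' J s)) :
    ∀ l ∈ L, coeff (Φ x) l ∈ q := by
  refine h.coeff_mem hL q (fun s => b '' J s) (fun x hx => ?_) x hx
  obtain ⟨u, hu, hu'⟩ := exists_word hx
  exact hB x u hu hu'

variable {S : AddSubmonoid ℝ≥0} [hS : Discrete S]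

/-- Gapped operations are determined by their components. -/
theorem IsGapped.ext {I : Type*} (b : Module.Basis I R V) {F F' : Operations R V W}
    (hF : IsGapped S F) (hF' : IsGapped S F') (h : flat S b F = flat S b F') : F = F' := by
  funext k
  refine MultilinearMap.ext fun y => coeff_ext fun l => ?_
  rw [← sub_eq_zero, ← coeff_sub, ← Submodule.mem_bot R]
  have := ((IsMultilinearOn.operation F k).sub (IsMultilinearOn.operation F' k)).coeff_mem_of_words
    b isLowerSet_univ ⊥ (fun _ => Set.univ) (fun x u hu hx l _ => ?_)
    (fun j => if h : j < k then y ⟨j, h⟩ else 0) (fun s _ l => by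
      rw [Set.image_univ, b.span_eq]; trivial) l trivial
  · simpa using this
  · rw [Submodule.mem_bot, coeff_sub, sub_eq_zero]
    by_cases hl : l ∈ S
    · rw [flat_wd_seq b F hu (fun s hs => (hx s hs).2) ⟨l, hl⟩, h,
        ← flat_wd_seq b F' hu (fun s hs => (hx s hs).2) ⟨l, hl⟩]
    · have hs : ∀ j : Fin k, SuppIn S (x j) := fun j => by
        rw [(hx j (hu ▸ j.2)).2]
        exact suppIn_const _
      have h1 : coeff (F k fun j => x j) l = 0 := by
        by_contra h0
        exact hl (hF.suppIn hs l h0)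
      have h2 : coeff (F' k fun j => x j) l = 0 := by
        by_contra h0
        exact hl (hF'.suppIn hs l h0)
      rw [h1, h2]

end Multilinear

/-! ### Block sums and insertion sums in terms of words -/

section LenPart

variable {R : Type*} [Field R] {I E : Type*} [EnergyMonoid E] {V : Type*} [AddCommGroup V]
  [Module R V]

open Classical in
/-- The part of word length `n`. -/
def lenPart (n : ℕ) : Bar R I E →ₗ[R] Bar R I E :=
  onWords R fun m => if m.letters.length = n then wd R m else 0

open Classical in
theorem lenPart_wd (n : ℕ) (m : Word I E) :
    lenPart n (wd R m) = if m.letters.length = n then wd R m else 0 := onWords_wd _ _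

theorem lenPart_cons (b : Module.Basis I R V) (n : ℕ) (v : V) (q : Bar R I E) :
    lenPart (n + 1) (cons b v q) = cons b v (lenPart n q) := by
  classical
  suffices h : ∀ m, (lenPart (n + 1) ∘ₗ (cons b).flip (wd R m) : V →ₗ[R] Bar R I E) =
      (cons b).flip (lenPart n (wd R m)) by
    have : (lenPart (n + 1) ∘ₗ cons b v : Bar R I E →ₗ[R] Bar R I E) = cons b v ∘ₗ lenPart n :=
      bar_hom_ext fun m => LinearMap.congr_fun (h m) v
    exact LinearMap.congr_fun this q
  intro m
  refine b.ext fun i => ?_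
  rw [LinearMap.comp_apply, LinearMap.flip_apply, cons_basis, lenPart_wd, LinearMap.flip_apply,
    lenPart_wd]
  simp only [Word.cons, List.length_cons, add_left_inj]
  split_ifs
  · rw [cons_basis]; rfl
  · simp

theorem lenPart_zero_cons (b : Module.Basis I R V) (v : V) (q : Bar R I E) :
    lenPart 0 (cons b v q) = 0 := by
  classical
  suffices h : ∀ m, (lenPart 0 ∘ₗ (cons b).flip (wd R m) : V →ₗ[R] Bar R I E) = 0 by
    have : (lenPart 0 ∘ₗ cons b v : Bar R I E →ₗ[R] Bar R I E) = 0 :=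
      bar_hom_ext fun m => LinearMap.congr_fun (h m) v
    exact LinearMap.congr_fun this q
  intro m
  refine b.ext fun i => ?_
  rw [LinearMap.comp_apply, LinearMap.flip_apply, cons_basis, lenPart_wd]
  simp [Word.cons]

theorem sum_lenPart {n : ℕ} {q : Bar R I E} (hq : ∀ m, q m ≠ 0 → m.weight < n) :
    ∑ i ∈ Finset.range n, lenPart i q = q := by
  classical
  conv_lhs => rw [bar_eq_sum q]
  conv_rhs => rw [bar_eq_sum q]
  simp only [map_sum, map_smul]
  rw [Finset.sum_comm]
  refine Finset.sum_congr rfl fun m hm => ?_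
  rw [← Finset.smul_sum]
  congr 1
  simp only [lenPart_wd]
  rw [Finset.sum_ite_eq, if_pos]
  have := hq m (Finsupp.mem_support_iff.1 hm)
  rw [Word.weight] at this
  rw [Finset.mem_range]
  omega

end LenPart

section Sums

variable {R : Type*} [Field R] {I J U V W : Type*} [AddCommGroup U] [Module R U]
  [AddCommGroup V] [Module R V] [AddCommGroup W] [Module R W]
  {S : AddSubmonoid ℝ≥0} [hS : Discrete S] {N : ℕ}

theorem sum_antidiagonalTuple_succ {X : Type*} [AddCommMonoid X] (n k : ℕ)
    (F : (Fin (n + 1) → ℕ) → X) :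
    ∑ c ∈ Finset.Nat.antidiagonalTuple (n + 1) k, F c = ∑ a ∈ Finset.range (k + 1),
      ∑ c ∈ Finset.Nat.antidiagonalTuple n (k - a), F (Fin.cons a c) := by
  rw [Finset.sum_sigma']
  refine Finset.sum_nbij' (fun c => ⟨c 0, Fin.tail c⟩) (fun p => Fin.cons p.1 p.2) ?_ ?_ ?_ ?_ ?_
  · intro c hc
    rw [Finset.Nat.mem_antidiagonalTuple, Fin.sum_univ_succ] at hc
    rw [Finset.mem_sigma, Finset.mem_range, Finset.Nat.mem_antidiagonalTuple]
    simp only [Fin.tail]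
    omega
  · rintro ⟨a, c⟩ h
    rw [Finset.mem_sigma, Finset.mem_range, Finset.Nat.mem_antidiagonalTuple] at h
    simp only at h
    rw [Finset.Nat.mem_antidiagonalTuple, Fin.sum_univ_succ]
    simp only [Fin.cons_zero, Fin.cons_succ]
    omega
  · intro c _
    exact Fin.cons_self_tail c
  · rintro ⟨a, c⟩ _
    simp
  · intro c _
    rw [Fin.cons_self_tail]

theorem sum_Iio_succ {n : ℕ} (a : ℕ) (c : Fin n → ℕ) (j : Fin n) :
    ∑ i ∈ Finset.Iio j.succ, (Fin.cons a c : Fin (n + 1) → ℕ) i = a + ∑ i ∈ Finset.Iio j, c i := by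
  have h : ∀ (m : ℕ) (j : Fin m) (c : Fin m → ℕ), ∑ i ∈ Finset.Iio j, c i =
      ∑ i, if i < j then c i else 0 := by
    intro m j c
    rw [← Finset.sum_filter]
    congr 1
    ext
    simp
  rw [h, h, Fin.sum_univ_succ]
  simp

/-- The blocks of lengths `c` of a sequence, inserted into operations. -/
def blockArgs (f : Operations R U V) (x : ℕ → Completed R U) {n : ℕ} (c : Fin n → ℕ) (j : Fin n) :
    Completed R V :=
  f (c j) fun s => x ((∑ i ∈ Finset.Iio j, c i) + s)

theorem blockArgs_zero (f : Operations R U V) (x : ℕ → Completed R U) {n : ℕ} (a : ℕ)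
    (c : Fin n → ℕ) : blockArgs f x (Fin.cons a c : Fin (n + 1) → ℕ) 0 = f a fun s => x s := by
  have h : ∑ i ∈ Finset.Iio (0 : Fin (n + 1)), (Fin.cons a c : Fin (n + 1) → ℕ) i = 0 := by
    rw [show Finset.Iio (0 : Fin (n + 1)) = ∅ by ext; simp]
    rfl
  rw [blockArgs, h]
  simp only [zero_add]
  rfl

theorem blockArgs_succ (f : Operations R U V) (x : ℕ → Completed R U) {n : ℕ} (a : ℕ)
    (c : Fin n → ℕ) (j : Fin n) : blockArgs f x (Fin.cons a c : Fin (n + 1) → ℕ) j.succ =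
      blockArgs f (fun s => x (a + s)) c j := by
  rw [blockArgs, sum_Iio_succ]
  simp only [add_assoc]
  rfl

/-- The sequence `x` consists of the letters of `u`. -/
def Spells (b : Module.Basis I R U) (x : ℕ → Completed R U) (u : List I) : Prop :=
  ∀ (s : ℕ) (h : s < u.length), x s = const (b u[s])

theorem Spells.drop {b : Module.Basis I R U} {x : ℕ → Completed R U} {u : List I}
    (h : Spells b x u) (a : ℕ) : Spells b (fun s => x (a + s)) (u.drop a) := by
  intro s hs
  rw [List.length_drop] at hs
  rw [List.getElem_drop]
  exact h (a + s) (by omega)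

theorem Spells.take {b : Module.Basis I R U} {x : ℕ → Completed R U} {u : List I}
    (h : Spells b x u) (a : ℕ) : Spells b x (u.take a) := by
  intro s hs
  rw [List.length_take] at hs
  rw [List.getElem_take]
  exact h s (by omega)

theorem Spells.coeff_eq {b : Module.Basis I R U} {x : ℕ → Completed R U} {u : List I}
    (h : Spells b x u) (f : Operations R U V) {a : ℕ} (ha : a ≤ u.length) (l : S) :
    coeff (f a fun s => x s) l = flat S b f (wd R ⟨u.take a, l⟩) :=
  flat_wd_seq b f (by simpa using ha) (h.take a) l

theorem Spells.suppIn {b : Module.Basis I R U} {x : ℕ → Completed R U} {u : List I}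
    (h : Spells b x u) {s : ℕ} (hs : s < u.length) : SuppIn S (x s) := by
  rw [h s hs]
  exact suppIn_const _

/-- Choosing the length of the first block and the energy of its value is choosing a cut of the
word; both sides then satisfy the recursion of `IsComult.apply_wd`. -/
theorem sum_cvec_blockArgs {b : Module.Basis I R U} (b' : Module.Basis J R V)
    {f : Operations R U V} {Φ : Bar R I S →ₗ[R] Bar R J S} (hΦ : IsComult Φ)
    (hf : proj b' ∘ₗ Φ = flat S b f) (n : ℕ) {x : ℕ → Completed R U} {u : List I}
    (hx : Spells b x u) (l : S) :
    ∑ c ∈ Finset.Nat.antidiagonalTuple n u.length, cvec b' n (blockArgs f x c) l =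
      lenPart n (Φ (wd R ⟨u, l⟩)) := by
  classical
  have hf' : ∀ q, proj b' (Φ q) = flat S b f q := LinearMap.congr_fun hf
  induction n generalizing x u l with
  | zero =>
    rw [hΦ.apply_wd b', map_add, map_sum, Finset.sum_eq_zero (s := antidiagonal _)
      fun p _ => lenPart_zero_cons _ _ _, add_zero]
    simp only [eps, onWords_wd, cvec_zero]
    rcases eq_or_ne u [] with rfl | hu
    · rw [if_pos rfl]
      simp [unit, lenPart_wd, Word.nil]
    · rw [if_neg hu, map_zero, map_zero]
      refine Finset.sum_eq_zero fun c hc => ?_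
      rw [Finset.Nat.mem_antidiagonalTuple] at hc
      simp at hc
      exact absurd hc.symm (by simpa using hu)
  | succ n ih =>
    rw [hΦ.apply_wd b', map_add, map_sum, sum_antidiagonalTuple_succ]
    have h0 : lenPart (n + 1) (unit R J S (eps R I S (wd R ⟨u, l⟩))) = 0 := by
      simp only [eps, onWords_wd]
      split_ifs
      · simp [unit, lenPart_wd, Word.nil]
      · simp
    rw [h0, zero_add]
    refine Eq.trans ?_ (Word.sum_antidiagonal (⟨u, l⟩ : Word I S) fun p p' =>
      lenPart (n + 1) (cons b' (proj b' (Φ (wd R p))) (Φ (wd R p')))).symm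
    refine Finset.sum_congr rfl fun a ha => ?_
    rw [Finset.mem_range, Nat.lt_succ_iff] at ha
    simp only [cvec_succ]
    rw [Finset.sum_comm]
    refine Finset.sum_congr rfl fun p _ => ?_
    simp only [blockArgs_zero]
    rw [lenPart_cons, ← ih (hx.drop a), map_sum, List.length_drop, hf',
      ← hx.coeff_eq f ha]
    refine Finset.sum_congr rfl fun c _ => ?_
    congr 2
    funext j
    exact blockArgs_succ f x a c j

/-- The arguments with one of the blocks inserted into different operations. -/
def mixedArgs (f κ ψ : Operations R U V) (x : ℕ → Completed R U) {n : ℕ} (c : Fin n → ℕ)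
    (i j : Fin n) : Completed R V :=
  if j < i then blockArgs f x c j else if j = i then blockArgs κ x c j else blockArgs ψ x c j

/-- The distinguished block is either the first one or a later one, which matches the two summands
of `IsCoder.apply_wd`. -/
theorem sum_cvec_mixedArgs {b : Module.Basis I R U} (b' : Module.Basis J R V)
    {f κ ψ : Operations R U V} {Φ Ψ X : Bar R I S →ₗ[R] Bar R J S} (hX : IsCoder Φ Ψ X)
    (hΨ : IsComult Ψ) (hf : proj b' ∘ₗ Φ = flat S b f) (hκ : proj b' ∘ₗ X = flat S b κ)
    (hψ : proj b' ∘ₗ Ψ = flat S b ψ) (n : ℕ) {x : ℕ → Completed R U} {u : List I}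
    (hx : Spells b x u) (l : S) :
    ∑ c ∈ Finset.Nat.antidiagonalTuple n u.length, ∑ i, cvec b' n (mixedArgs f κ ψ x c i) l =
      lenPart n (X (wd R ⟨u, l⟩)) := by
  classical
  have hf' : ∀ q, proj b' (Φ q) = flat S b f q := LinearMap.congr_fun hf
  have hκ' : ∀ q, proj b' (X q) = flat S b κ q := LinearMap.congr_fun hκ
  induction n generalizing x u l with
  | zero =>
    rw [hX.apply_wd b', map_sum, Finset.sum_eq_zero (s := antidiagonal _) fun p _ => by
      rw [map_add, lenPart_zero_cons, lenPart_zero_cons, add_zero]]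
    simp
  | succ n ih =>
    rw [hX.apply_wd b', map_sum, sum_antidiagonalTuple_succ]
    refine Eq.trans ?_ (Word.sum_antidiagonal (⟨u, l⟩ : Word I S) fun p p' =>
      lenPart (n + 1) (cons b' (proj b' (X (wd R p))) (Ψ (wd R p')) +
        cons b' (proj b' (Φ (wd R p))) (X (wd R p')))).symm
    refine Finset.sum_congr rfl fun a ha => ?_
    rw [Finset.mem_range, Nat.lt_succ_iff] at ha
    simp only [Fin.sum_univ_succ, cvec_succ, Finset.sum_add_distrib, map_add]
    congr 1
    · rw [Finset.sum_comm]
      refine Finset.sum_congr rfl fun p _ => ?_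
      rw [lenPart_cons, ← sum_cvec_blockArgs b' hΨ hψ n (hx.drop a), map_sum, List.length_drop,
        hκ', ← hx.coeff_eq κ ha]
      refine Finset.sum_congr rfl fun c _ => ?_
      rw [mixedArgs, if_neg (lt_irrefl _), if_pos rfl, blockArgs_zero]
      congr 2
      funext j
      rw [Fin.tail, mixedArgs, if_neg (by simp), if_neg (by simp), blockArgs_succ]
    · have : ∀ c : Fin n → ℕ, ∀ i : Fin n, mixedArgs f κ ψ x (Fin.cons a c : Fin (n + 1) → ℕ)
          i.succ 0 = f a fun s => x s := fun c i => by
        rw [mixedArgs, if_pos (Fin.succ_pos i), blockArgs_zero]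
      simp only [this]
      have h2 : ∀ c : Fin n → ℕ, ∀ i : Fin n,
          Fin.tail (mixedArgs f κ ψ x (Fin.cons a c : Fin (n + 1) → ℕ) i.succ) =
            mixedArgs f κ ψ (fun s => x (a + s)) c i := fun c i => by
        funext j
        rw [Fin.tail, mixedArgs, mixedArgs]
        simp only [Fin.succ_lt_succ_iff, Fin.succ_inj, blockArgs_succ]
      simp only [h2]
      rw [Finset.sum_congr rfl fun c _ => Finset.sum_comm, Finset.sum_comm]
      refine Finset.sum_congr rfl fun p _ => ?_
      rw [lenPart_cons, ← ih (hx.drop a), map_sum, List.length_drop, hf',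
        ← hx.coeff_eq f ha]
      refine Finset.sum_congr rfl fun c _ => ?_
      rw [map_sum]

theorem blockArgs_suppIn {b : Module.Basis I R U} {f : Operations R U V} (hf : IsGapped S f)
    {x : ℕ → Completed R U} {u : List I} (hx : Spells b x u) {n : ℕ} {c : Fin n → ℕ}
    (hc : c ∈ Finset.Nat.antidiagonalTuple n u.length) (j : Fin n) :
    SuppIn S (blockArgs f x c j) := by
  refine hf.suppIn fun s => hx.suppIn ?_
  rw [Finset.Nat.mem_antidiagonalTuple] at hc
  have h1 : ∑ i ∈ Finset.Iio j, c i + c j ≤ ∑ i, c i := by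
    rw [show ∑ i ∈ Finset.Iio j, c i + c j = ∑ i ∈ insert j (Finset.Iio j), c i by
      rw [Finset.sum_insert (by simp), add_comm]]
    exact Finset.sum_le_sum_of_subset (Finset.subset_univ _)
  have := s.2
  omega

theorem suppIn_sum {ι : Type*} {t : Finset ι} {y : ι → Completed R V}
    (h : ∀ a ∈ t, SuppIn S (y a)) : SuppIn S (∑ a ∈ t, y a) := by
  intro l hl
  rw [coeff_sum] at hl
  obtain ⟨a, ha, h0⟩ := Finset.exists_ne_zero_of_sum_ne_zero hl
  exact h a ha l h0

theorem suppIn_blockSum {b : Module.Basis I R U} {F : Operations R V W} {f : Operations R U V}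
    (hF : IsGapped S F) (hf : IsGapped S f) {x : ℕ → Completed R U} {u : List I}
    (hx : Spells b x u) (n : ℕ) : SuppIn S (blockSum F f u.length x n) :=
  suppIn_sum fun _ hc => hF.suppIn fun j => blockArgs_suppIn hf hx hc j

theorem coeff_blockSum {b : Module.Basis I R U} (b' : Module.Basis J R V)
    {F : Operations R V W} {f : Operations R U V} (hF : IsGapped S F) (hf : IsGapped S f)
    {Φ : Bar R I S →ₗ[R] Bar R J S} (hΦ : IsComult Φ)
    (hfΦ : proj b' ∘ₗ Φ = flat S b f) {x : ℕ → Completed R U} {u : List I} (hx : Spells b x u)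
    (n : ℕ) (l : S) :
    coeff (blockSum F f u.length x n) l = flat S b' F (lenPart n (Φ (wd R ⟨u, l⟩))) := by
  rw [← sum_cvec_blockArgs b' hΦ hfΦ n hx, map_sum, blockSum, coeff_sum]
  exact Finset.sum_congr rfl fun c hc => hF.coeff_eq b' (blockArgs_suppIn hf hx hc) l

theorem cvec_congr (b : Module.Basis I R U) {n n' : ℕ} (h : n = n') (y : ℕ → Completed R U)
    (l : S) : cvec b n (fun j => y j) l = cvec b n' (fun j => y j) l := by
  subst h
  rfl

/-- The arguments with a block of length `a` starting at position `i` inserted into `m`. -/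
def insertArgs (m : Operations R U U) (x : ℕ → Completed R U) (a i j : ℕ) : Completed R U :=
  if j < i then x j else if j = i then m a fun s => x (i + s) else x (j + a - 1)

/-- An insertion at position zero is the summand with the component of `D` in front. A later
insertion leaves the first letter unchanged up to the sign of its degree, which is the effect of the
sign operator in the coderivation rule. -/
theorem sum_cvec_insertArgs {G : Type*} (M : Model R I U G N) {m : Operations R U U}
    {D : Bar R I S →ₗ[R] Bar R I S} (hD : IsCoder (M.tau S) LinearMap.id D)
    (hm : proj M.b ∘ₗ D = flat S M.b m) {x : ℕ → Completed R U} {u : List I}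
    (hx : Spells M.b x u) {d : ℕ → ZMod (2 * N)} (hd : ∀ (s : ℕ) (h : s < u.length),
      d s = M.deg u[s]) (l : S) :
    ∑ i ∈ Finset.range (u.length + 1), ∑ a ∈ Finset.range (u.length - i + 1),
      sign (∑ j ∈ Finset.range i, d j) •
        cvec M.b (u.length - a + 1) (fun j => insertArgs m x a i j) l = D (wd R ⟨u, l⟩) := by
  have hm' : ∀ q, proj M.b (D q) = flat S M.b m q := LinearMap.congr_fun hm
  induction u generalizing x d with
  | nil =>
    rw [hD.apply_wd M.b]
    refine Eq.trans ?_ (Word.sum_antidiagonal (⟨[], l⟩ : Word I S) fun p p' =>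
      cons M.b (proj M.b (D (wd R p))) (wd R p') +
        cons M.b (proj M.b (M.tau S (wd R p))) (D (wd R p'))).symm
    have h0 : ∀ q : S, proj M.b (M.tau S (wd R ⟨[], q⟩)) = 0 := fun q => by
      rw [Model.tau, proj_strict, proj_of_ne _ (by simp), map_zero]
    simp [sign_zero, h0, cvec_succ]
    refine Finset.sum_congr rfl fun p _ => ?_
    rw [hm', insertArgs, if_neg (lt_irrefl _), if_pos rfl, flat_wd, cvec_zero]
    exact congrArg (fun z => cons M.b (coeff (m 0 z) p.1) (wd R ⟨[], p.2⟩))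
      (Subsingleton.elim _ _)
  | cons w u ih =>
    rw [hD.apply_wd M.b, Finset.sum_add_distrib]
    have h1 : ∀ F : Bar R I S →ₗ[R] Bar R I S,
        ∑ p ∈ antidiagonal (⟨w :: u, l⟩ : Word I S),
          cons M.b (proj M.b (M.tau S (wd R p.1))) (F (wd R p.2)) =
        sign (M.deg w) • cons M.b (M.b w) (F (wd R ⟨u, l⟩)) := by
      intro F
      simp only [Model.tau, proj_strict]
      refine (sum_proj M.b w ⟨u, l⟩ ((LinearMap.lcomp R _ F) ∘ₗ cons M.b ∘ₗ M.sgn)).trans ?_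
      simp [Model.sgn]
    rw [h1 D, Finset.sum_range_succ', add_comm]
    congr 1
    · rw [Finset.range_zero, Finset.sum_empty, sign_zero]
      refine Eq.trans ?_ (Word.sum_antidiagonal (⟨w :: u, l⟩ : Word I S) fun p p' =>
        cons M.b (proj M.b (D (wd R p))) (wd R p')).symm
      refine Finset.sum_congr rfl fun a ha => ?_
      replace ha : a ≤ (w :: u).length := Nat.lt_succ_iff.1 (Finset.mem_range.1 ha)
      rw [one_smul, cvec_succ]
      refine Finset.sum_congr rfl fun p _ => ?_
      rw [hm', ← hx.coeff_eq m ha]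
      congr 1
      · rw [insertArgs, Fin.val_zero, if_neg (lt_irrefl _), if_pos rfl]
        simp only [zero_add]
      · rw [← cvec_const M.b rfl (hx.drop a)]
        refine Eq.trans ?_ (cvec_congr M.b 
          (List.length_drop (i := a) (l := w :: u)).symm (fun j => x (a + j)) _)
        congr 1
        funext j
        rw [Fin.tail, insertArgs, if_neg (by simp), if_neg (by simp)]
        congr 1
        simp
        omega
    · have hx' : Spells M.b (fun s => x (1 + s)) u := hx.drop 1
      rw [← ih hx' (d := fun s => d (1 + s)) fun s h => by
        rw [hd (1 + s) (by simp; omega)]; simp [add_comm 1], map_sum, Finset.smul_sum]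
      refine Finset.sum_congr (by simp) fun i hi => ?_
      rw [map_sum, Finset.smul_sum]
      refine Finset.sum_congr (by simp) fun a ha => ?_
      rw [Finset.mem_range] at hi ha
      rw [Finset.sum_range_succ', sign_add, mul_comm, mul_smul, map_zsmul, hd 0 (by simp)]
      have h2 : ∀ j, d (j + 1) = d (1 + j) := fun j => by rw [add_comm]
      simp only [h2, List.getElem_cons_zero]
      congr 2
      rw [cvec_congr M.b (show (w :: u).length - a + 1 = (u.length - a + 1) + 1 by
        simp; omega), cvec_succ_const M.b _ _ (M.b w)]
      · congr 2
        funext j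
        simp only [Fin.tail, insertArgs, Fin.val_succ, add_lt_add_iff_right, add_left_inj]
        split_ifs
        · rw [add_comm]
        · congr 1
          funext s
          congr 1
          omega
        · congr 1
          omega
      · rw [insertArgs, Fin.val_zero, if_pos (Nat.succ_pos i)]
        exact hx 0 (by simp)

theorem insertArgs_suppIn {b : Module.Basis I R U} {m : Operations R U U} (hm : IsGapped S m)
    {x : ℕ → Completed R U} {u : List I} (hx : Spells b x u) {a i j : ℕ} (hi : i + a ≤ u.length)
    (hj : j < u.length - a + 1) : SuppIn S (insertArgs m x a i j) := by
  rw [insertArgs]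
  split_ifs
  · exact hx.suppIn (by omega)
  · exact hm.suppIn fun s => hx.suppIn (by have := s.2; omega)
  · exact hx.suppIn (by omega)

theorem suppIn_zsmul {x : Completed R V} (h : SuppIn S x) (c : ℤ) : SuppIn S (c • x) := by
  intro l hl
  refine h l fun h0 => hl ?_
  have : coeff (c • x) l = c • coeff x l := map_zsmul (coeffHom R V l) c x
  rw [this, h0, smul_zero]

theorem suppIn_insertionSum {b : Module.Basis I R U} {F : Operations R U W}
    {m : Operations R U U} (hF : IsGapped S F) (hm : IsGapped S m) {x : ℕ → Completed R U}
    {u : List I} (hx : Spells b x u) (d : ℕ → ZMod (2 * N)) :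
    SuppIn S (insertionSum F m u.length x d) := by
  refine suppIn_sum fun a ha => suppIn_sum fun i hi => suppIn_zsmul (hF.suppIn fun j => ?_) _
  rw [Finset.mem_range] at ha hi
  exact insertArgs_suppIn hm hx (by omega) j.2

theorem coeff_insertionSum {G : Type*} (M : Model R I U G N) {F : Operations R U W}
    {m : Operations R U U} (hF : IsGapped S F) (hmS : IsGapped S m)
    {D : Bar R I S →ₗ[R] Bar R I S} (hD : IsCoder (M.tau S) LinearMap.id D)
    (hm : proj M.b ∘ₗ D = flat S M.b m) {x : ℕ → Completed R U} {u : List I}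
    (hx : Spells M.b x u) {d : ℕ → ZMod (2 * N)} (hd : ∀ (s : ℕ) (h : s < u.length),
      d s = M.deg u[s]) (l : S) :
    coeff (insertionSum F m u.length x d) l = flat S M.b F (D (wd R ⟨u, l⟩)) := by
  rw [← sum_cvec_insertArgs M hD hm hx hd, map_sum, insertionSum, coeff_sum]
  simp only [coeff_sum, map_sum]
  -- `insertionSum` runs over the block length first, the recursion on words over the position
  -- first.
  rw [Finset.sum_comm' (s' := fun i => Finset.range (u.length - i + 1))
    (t' := Finset.range (u.length + 1)) (by
      intro a i
      simp only [Finset.mem_range]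
      omega)]
  refine Finset.sum_congr rfl fun i hi => Finset.sum_congr rfl fun a ha => ?_
  rw [Finset.mem_range] at ha hi
  rw [map_zsmul, ← hF.coeff_eq M.b fun j => insertArgs_suppIn hmS hx (by omega) j.2]
  exact map_zsmul (coeffHom R W l) _ _

end Sums

/-! ### The defining relations in terms of words -/

section Relations

variable {R : Type*} [Field R] {I J U V W G : Type*} [AddCommGroup U] [Module R U]
  [AddCommGroup V] [Module R V] [AddCommGroup W] [Module R W]
  {S : AddSubmonoid ℝ≥0} [hS : Discrete S] {N : ℕ}

/-- The basis is homogeneous for the grading, with the shifted degrees. -/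
def Model.Adapted (M : Model R I V G N) (gr : ZMod (2 * N) → Submodule R V) : Prop :=
  ∀ d, gr (d + 1) = Submodule.span R (M.b '' {i | M.deg i = d})

-- Bases of the graded pieces are collected. Letters carry the shifted degree, one less than the
-- degree in `V`.
universe v in
theorem exists_adapted_basis {V : Type v} [AddCommGroup V] [Module R V] (gr : ZMod (2 * N) → Submodule R V) [DirectSum.Decomposition gr] :
    ∃ (I : Type v) (b : Module.Basis I R V) (deg : I → ZMod (2 * N)),
      ∀ d, gr (d + 1) = Submodule.span R (b '' {i | deg i = d}) := by
  have hint := DirectSum.Decomposition.isInternal gr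
  refine ⟨Σ e, ↑(Module.Basis.ofVectorSpaceIndex R (gr e)),
    hint.collectedBasis (fun e => Module.Basis.ofVectorSpace R (gr e)), fun i => i.1 - 1,
    fun d => ?_⟩
  refine le_antisymm (fun v hv => ?_) (Submodule.span_le.2 ?_)
  · have h := (Module.Basis.ofVectorSpace R (gr (d + 1))).mem_span ⟨v, hv⟩
    have h2 := Submodule.mem_map_of_mem (f := (gr (d + 1)).subtype) h
    rw [Submodule.map_span] at h2
    refine Submodule.span_mono ?_ h2
    rintro _ ⟨_, ⟨j, rfl⟩, rfl⟩
    exact ⟨⟨d + 1, j⟩, by simp, by simp⟩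
  · rintro _ ⟨i, hi, rfl⟩
    have : i.1 = d + 1 := by
      have : i.1 - 1 = d := hi
      rw [← this, sub_add_cancel]
    have h := hint.collectedBasis_mem (fun e => Module.Basis.ofVectorSpace R (gr e)) i
    rw [this] at h
    exact h

theorem Model.Adapted.basis_mem {M : Model R I V G N} {gr : ZMod (2 * N) → Submodule R V}
    (h : M.Adapted gr) (i : I) : M.b i ∈ gr (M.deg i + 1) := by
  rw [h]
  exact Submodule.subset_span ⟨i, rfl, rfl⟩

theorem Model.Adapted.isHomogeneous {M : Model R I V G N} {gr : ZMod (2 * N) → Submodule R V}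
    (h : M.Adapted gr) (i : I) : IsHomogeneous gr (M.deg i) (const (R := R) (M.b i)) := by
  intro l
  rw [coeff_const]
  split_ifs
  · exact h.basis_mem i
  · exact Submodule.zero_mem _

/-- The sequence of letters of a word. -/
def spell (b : Module.Basis I R V) (u : List I) (s : ℕ) : Completed R V :=
  if h : s < u.length then const (b u[s]) else 0

theorem spells_spell (b : Module.Basis I R V) (u : List I) : Spells b (spell b u) u :=
  fun _ h => dif_pos h

/-- The degrees of the letters of a word. -/
def degs (deg : I → ZMod (2 * N)) (u : List I) (s : ℕ) : ZMod (2 * N) :=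
  if h : s < u.length then deg u[s] else 0

theorem degs_eq (deg : I → ZMod (2 * N)) (u : List I) (s : ℕ) (h : s < u.length) :
    degs deg u s = deg u[s] := dif_pos h

theorem Model.Adapted.spell_isHomogeneous {M : Model R I V G N}
    {gr : ZMod (2 * N) → Submodule R V} (h : M.Adapted gr) (u : List I) :
    ∀ s < u.length, IsHomogeneous gr (degs M.deg u s) (spell M.b u s) := by
  intro s hs
  rw [spell, dif_pos hs, degs_eq _ _ _ hs]
  exact h.isHomogeneous _

variable (S) in
/-- A bound for the lengths of the words that contribute to energies below `E`. -/
def lengthBound (k : ℕ) (E : ℝ≥0) : ℕ := k + 2 * ⌊E / gap S⌋₊ + 2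

theorem weight_lt_lengthBound {u : List I} {l : S} {E : ℝ≥0} (h : (l : ℝ≥0) ≤ E) :
    (⟨u, l⟩ : Word I S).weight < lengthBound S u.length E := by
  have := height_le S h
  simp only [Word.weight, lengthBound]
  omega

/-- Since the weight is not raised, the image of a word of bounded length and energy contains only
words of bounded length. In this way the adic series of the definitions become finite sums. -/
theorem sum_lenPart_of_lowers {X : Bar R I S →ₗ[R] Bar R J S} (hX : Lowers 0 X) {u : List I} {l : S}
    {E : ℝ≥0} (h : (l : ℝ≥0) ≤ E) {n : ℕ} (hn : lengthBound S u.length E ≤ n) :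
    ∑ i ∈ Finset.range n, lenPart i (X (wd R ⟨u, l⟩)) = X (wd R ⟨u, l⟩) :=
  sum_lenPart fun m hm => by
    have h1 := hX _ _ hm
    have h2 := weight_lt_lengthBound (u := u) h
    omega

theorem mem_filtration_iff {x : Completed R V} {E : ℝ≥0} :
    x ∈ filtration R V E ↔ ∀ l ∈ Set.Iio E, coeff x l ∈ (⊥ : Submodule R V) := Iff.rfl

/-- A multilinear function equals the sum of a series of blocks if it does so on words. -/
theorem hasAdicSum_of_words (b : Module.Basis I R U) (F : Operations R V W) (f : Operations R U V)
    {k : ℕ} {L : (ℕ → Completed R U) → Completed R W} (hL : IsMultilinearOn (Finset.range k) L)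
    (D : ℕ → Set I)
    (h : ∀ (x : ℕ → Completed R U) (u : List I), u.length = k → Spells b x u →
      (∀ (s : ℕ) (hs : s < u.length), u[s] ∈ D s) → ∀ (E : ℝ≥0), ∀ n ≥ lengthBound S k E,
        L x - ∑ i ∈ Finset.range n, blockSum F f k x i ∈ filtration R W E)
    {x : ℕ → Completed R U} (hx : ∀ s < k, ∀ l, coeff (x s) l ∈ Submodule.span R (b '' D s)) :
    HasAdicSum (blockSum F f k x) (L x) := by
  intro E
  refine ⟨lengthBound S k E, fun n hn => ?_⟩
  rw [mem_filtration_iff]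
  refine (hL.sub (IsMultilinearOn.sum (Finset.range n) fun i _ =>
    IsMultilinearOn.blocks F f k i)).coeff_mem_of_words b (isLowerSet_Iio E) ⊥ D
      (fun x u hu hux => ?_) x hx
  rw [← mem_filtration_iff]
  exact h x u hu (fun s hs => (hux s hs).2) (fun s hs => (hux s hs).1) E n hn

theorem mem_filtration_of_suppIn {x : Completed R V} (hx : SuppIn S x) {E : ℝ≥0}
    (h : ∀ l : S, (l : ℝ≥0) < E → coeff x l = 0) : x ∈ filtration R V E := by
  intro l hl
  by_contra h0
  exact h0 (h ⟨l, hx l h0⟩ hl)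

theorem SuppIn.sub {x y : Completed R V} (hx : SuppIn S x) (hy : SuppIn S y) :
    SuppIn S (x - y) := by
  intro l hl
  rw [coeff_sub] at hl
  by_cases h : coeff x l = 0
  · refine hy l fun h' => hl ?_
    rw [h, h', sub_zero]
  · exact hx l h

theorem coeff_sum_blockSum {b : Module.Basis I R U} (b' : Module.Basis J R V)
    {F : Operations R V W} {f : Operations R U V} (hF : IsGapped S F) (hf : IsGapped S f)
    {Φ : Bar R I S →ₗ[R] Bar R J S} (hΦ : IsComult Φ) (hfΦ : proj b' ∘ₗ Φ = flat S b f)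
    {x : ℕ → Completed R U} {u : List I} (hx : Spells b x u) {l : S} {E : ℝ≥0}
    (hl : (l : ℝ≥0) ≤ E) {n : ℕ} (hn : lengthBound S u.length E ≤ n) :
    coeff (∑ i ∈ Finset.range n, blockSum F f u.length x i) l =
      flat S b' F (Φ (wd R ⟨u, l⟩)) := by
  rw [coeff_sum, ← sum_lenPart_of_lowers (hΦ.lowers b') hl hn, map_sum]
  exact Finset.sum_congr rfl fun i _ => coeff_blockSum b' hF hf hΦ hfΦ hx i l

theorem sum_blockSum_mem {b : Module.Basis I R U} (b' : Module.Basis J R V)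
    {F : Operations R V W} {f : Operations R U V} (hF : IsGapped S F) (hf : IsGapped S f)
    {Φ : Bar R I S →ₗ[R] Bar R J S} (hΦ : IsComult Φ) (hfΦ : proj b' ∘ₗ Φ = flat S b f)
    {x : ℕ → Completed R U} {u : List I} (hx : Spells b x u) {z : Completed R W}
    (hz : SuppIn S z) (h : ∀ l : S, coeff z l = flat S b' F (Φ (wd R ⟨u, l⟩))) {E : ℝ≥0} {n : ℕ}
    (hn : lengthBound S u.length E ≤ n) :
    z - ∑ i ∈ Finset.range n, blockSum F f u.length x i ∈ filtration R W E := by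
  refine mem_filtration_of_suppIn (hz.sub (suppIn_sum fun i _ => suppIn_blockSum hF hf hx i))
    fun l hl => ?_
  rw [coeff_sub, coeff_sum_blockSum b' hF hf hΦ hfΦ hx hl.le hn, h, sub_self]

/-- The relation of a homomorphism, in terms of words. -/
theorem flat_comp_of_relation {M : Model R I U G N} (b' : Module.Basis J R V)
    {gr : ZMod (2 * N) → Submodule R U} (hM : M.Adapted gr) {m : Operations R U U}
    {F : Operations R V V} {f : Operations R U V} (hm : IsGapped S m) (hF : IsGapped S F)
    (hf : IsGapped S f) {D : Bar R I S →ₗ[R] Bar R I S} (hD : IsCoder (M.tau S) LinearMap.id D)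
    (hmD : proj M.b ∘ₗ D = flat S M.b m) {Φ : Bar R I S →ₗ[R] Bar R J S} (hΦ : IsComult Φ)
    (hfΦ : proj b' ∘ₗ Φ = flat S M.b f)
    (h : ∀ (k : ℕ) (x : ℕ → Completed R U) (d : ℕ → ZMod (2 * N)),
      (∀ i < k, IsHomogeneous gr (d i) (x i)) →
        HasAdicSum (blockSum F f k x) (insertionSum f m k x d)) :
    flat S b' F ∘ₗ Φ = flat S M.b f ∘ₗ D := by
  refine bar_hom_ext fun ⟨u, l⟩ => ?_
  have hx := spells_spell M.b u
  -- The filtration controls coefficients strictly below its level, so level `l + 1` is used to see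
  -- the coefficient at `l`.
  obtain ⟨n₀, hn₀⟩ := h u.length (spell M.b u) (degs M.deg u) (hM.spell_isHomogeneous u) (l + 1)
  have h1 := hn₀ (max n₀ (lengthBound S u.length (l + 1))) (le_max_left _ _) l
    (lt_add_of_pos_right _ one_pos)
  rw [coeff_sub, coeff_insertionSum M hf hm hD hmD hx (degs_eq M.deg u),
    coeff_sum_blockSum b' hF hf hΦ hfΦ hx (E := l + 1) le_self_add (le_max_right _ _),
    sub_eq_zero] at h1
  exact h1.symm

/-- By multilinearity it suffices to test letters of the prescribed degrees, because these span the
homogeneous parts. On them the signs in the insertion sum are those of the coderivation. -/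
theorem relation_of_flat_comp {M : Model R I U G N} (b' : Module.Basis J R V)
    {gr : ZMod (2 * N) → Submodule R U} (hM : M.Adapted gr) {m : Operations R U U}
    {F : Operations R V V} {f : Operations R U V} (hm : IsGapped S m) (hF : IsGapped S F)
    (hf : IsGapped S f) {D : Bar R I S →ₗ[R] Bar R I S} (hD : IsCoder (M.tau S) LinearMap.id D)
    (hmD : proj M.b ∘ₗ D = flat S M.b m) {Φ : Bar R I S →ₗ[R] Bar R J S} (hΦ : IsComult Φ)
    (hfΦ : proj b' ∘ₗ Φ = flat S M.b f) (h : flat S b' F ∘ₗ Φ = flat S M.b f ∘ₗ D)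
    (k : ℕ) (x : ℕ → Completed R U) (d : ℕ → ZMod (2 * N))
    (hx : ∀ i < k, IsHomogeneous gr (d i) (x i)) :
    HasAdicSum (blockSum F f k x) (insertionSum f m k x d) := by
  refine hasAdicSum_of_words (S := S) M.b F f (IsMultilinearOn.insertion f m k d)
    (fun s => {i | M.deg i = d s}) (fun x u hu hux hd E n hn => ?_) fun s hs l =>
      hM (d s) ▸ hx s hs l
  subst hu
  refine sum_blockSum_mem b' hF hf hΦ hfΦ hux (suppIn_insertionSum hf hm hux d) (fun l => ?_) hn
  rw [coeff_insertionSum M hf hm hD hmD hux fun s hs => (hd s hs).symm]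
  exact (LinearMap.congr_fun h _).symm

theorem isComposition_of_flat_comp (b : Module.Basis I R U) (b' : Module.Basis J R V)
    {F : Operations R V W} {f : Operations R U V} {p : Operations R U W} (hF : IsGapped S F)
    (hf : IsGapped S f) (hp : IsGapped S p) {Φ : Bar R I S →ₗ[R] Bar R J S} (hΦ : IsComult Φ)
    (hfΦ : proj b' ∘ₗ Φ = flat S b f) (h : flat S b' F ∘ₗ Φ = flat S b p) :
    IsComposition F f p := by
  intro k x
  refine hasAdicSum_of_words (S := S) b F f (IsMultilinearOn.operation p k)
    (fun s => Set.univ) (fun x u hu hux hd E n hn => ?_) fun s hs l => by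
      rw [Set.image_univ, b.span_eq]; trivial
  subst hu
  refine sum_blockSum_mem b' hF hf hΦ hfΦ hux (hp.suppIn fun j => hux.suppIn j.2) (fun l => ?_) hn
  rw [flat_wd_seq b p rfl hux, ← h]
  rfl

/-- The relation of an algebra, in terms of words. -/
theorem flat_comp_eq_zero {M : Model R I U G N} {gr : ZMod (2 * N) → Submodule R U}
    (hM : M.Adapted gr) {m : Operations R U U} (hm : IsGapped S m)
    {D : Bar R I S →ₗ[R] Bar R I S} (hD : IsCoder (M.tau S) LinearMap.id D)
    (hmD : proj M.b ∘ₗ D = flat S M.b m)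
    (h : ∀ (k : ℕ) (x : ℕ → Completed R U) (d : ℕ → ZMod (2 * N)),
      (∀ i < k, IsHomogeneous gr (d i) (x i)) → insertionSum m m k x d = 0) :
    flat S M.b m ∘ₗ D = 0 := by
  refine bar_hom_ext fun ⟨u, l⟩ => ?_
  have h1 := h u.length (spell M.b u) (degs M.deg u) (hM.spell_isHomogeneous u)
  rw [LinearMap.comp_apply, ← coeff_insertionSum M hm hm hD hmD (spells_spell M.b u)
    (degs_eq M.deg u), h1]
  rfl

/-! ### Degrees -/

theorem Model.Adapted.mem_iff {M : Model R I V G N} {gr : ZMod (2 * N) → Submodule R V}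
    (h : M.Adapted gr) {d : ZMod (2 * N)} {v : V} : v ∈ gr (d + 1) ↔ M.vec.pr d v = v := by
  classical
  rw [h]
  constructor
  · intro hv
    induction hv using Submodule.span_induction with
    | mem v hv =>
      obtain ⟨i, rfl, rfl⟩ := hv
      exact M.vec_pr_basis_self i
    | zero => exact map_zero _
    | add v w _ _ hv hw => rw [map_add, hv, hw]
    | smul r v _ hv => rw [map_smul, hv]
  · intro hv
    rw [← hv]
    have h1 : (⊤ : Submodule R V) ≤ (Submodule.span R (M.b '' {i | M.deg i = d})).comap
        (M.vec.pr d) := by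
      rw [← M.b.span_eq, Submodule.span_le]
      rintro _ ⟨i, rfl⟩
      rw [SetLike.mem_coe, Submodule.mem_comap]
      rw [M.vec_pr_basis]
      split_ifs with hi
      · exact Submodule.subset_span ⟨i, hi, rfl⟩
      · exact Submodule.zero_mem _
    exact h1 trivial

theorem Model.Adapted.degree_of_pr {M : Model R I U G N} {gr₁ : ZMod (2 * N) → Submodule R U}
    (hM : M.Adapted gr₁) {gr₂ : ZMod (2 * N) → Submodule R W} {r : ZMod (2 * N)}
    {f : Operations R U W} (hf : IsGapped S f)
    (h : ∀ m, flat S M.b f (wd R m) ∈ gr₂ (wordDeg M.deg m + r + 1)) :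
    HasDegree gr₁ gr₂ r f := by
  intro k x d hx l
  have key := (IsMultilinearOn.operation f k).coeff_mem_of_words M.b isLowerSet_univ
    (gr₂ (∑ i, d i + r + 1)) (fun s => {i | if hs : s < k then M.deg i = d ⟨s, hs⟩ else True})
    (fun x u hu hux l _ => ?_)
    (fun s => if hs : s < k then x ⟨s, hs⟩ else 0) (fun s hs l => ?_) l trivial
  · simpa using key
  · by_cases hl : l ∈ S
    · subst hu
      rw [flat_wd_seq M.b f rfl (fun s hs => (hux s hs).2) ⟨l, hl⟩]
      have h1 : wordDeg M.deg (⟨u, ⟨l, hl⟩⟩ : Word I S) = ∑ i, d i := by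
        rw [wordDeg, ← List.sum_ofFn]
        congr 1
        refine List.ext_getElem (by simp) fun s hs hs' => ?_
        rw [List.getElem_map, List.getElem_ofFn]
        have := (hux s (by simpa using hs)).1
        simp only [Set.mem_ofPred_eq] at this
        rw [dif_pos (by simpa using hs)] at this
        exact this
      rw [← h1]
      exact h _
    · have : coeff (f k fun j => x j) l = 0 := by
        by_contra h0
        refine hl (hf.suppIn (fun j => ?_) l h0)
        rw [(hux j (hu ▸ j.2)).2]
        exact suppIn_const _
      rw [this]
      exact Submodule.zero_mem _
  · have : {i | if hs : s < k then M.deg i = d ⟨s, hs⟩ else True} = {i | M.deg i = d ⟨s, hs⟩} := by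
      ext i
      simp [hs]
    rw [this, ← hM, dif_pos hs]
    exact hx ⟨s, hs⟩ l

theorem Model.Adapted.flat_mem {M : Model R I U G N} {gr₁ : ZMod (2 * N) → Submodule R U}
    (hM : M.Adapted gr₁) {gr₂ : ZMod (2 * N) → Submodule R W} {r : ZMod (2 * N)}
    {f : Operations R U W} (hf : HasDegree gr₁ gr₂ r f) (m : Word I S) :
    flat S M.b f (wd R m) ∈ gr₂ (wordDeg M.deg m + r + 1) := by
  obtain ⟨u, l⟩ := m
  have h := hf u.length (fun j => const (M.b (u.get j))) (fun j => M.deg (u.get j))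
    (fun j => hM.isHomogeneous _) l
  rw [flat_wd]
  have h1 : wordDeg M.deg (⟨u, l⟩ : Word I S) = ∑ j : Fin u.length, M.deg (u.get j) := by
    rw [wordDeg, ← List.sum_ofFn]
    congr 1
    refine List.ext_getElem (by simp) fun s hs hs' => ?_
    rw [List.getElem_map, List.getElem_ofFn]
    rfl
  rw [h1]
  exact h

end Relations

/-! ### Linear maps of completed modules on words -/

section LinearOperations

variable {R : Type*} [Field R] {I J K U V W G : Type*} [AddCommGroup U] [Module R U]
  [AddCommGroup V] [Module R V] [AddCommGroup W] [Module R W]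
  {S : AddSubmonoid ℝ≥0} [hS : Discrete S] {N : ℕ}

/-- A linear map, as operations. -/
def linOps (B : Completed R U →ₗ[NovikovRing R] Completed R V) : Operations R U V
  | 1 => MultilinearMap.ofSubsingleton (NovikovRing R) _ _ 0 B
  | _ => 0

theorem linOps_one (B : Completed R U →ₗ[NovikovRing R] Completed R V)
    (x : Fin 1 → Completed R U) : linOps B 1 x = B (x 0) := rfl

theorem linOps_of_ne (B : Completed R U →ₗ[NovikovRing R] Completed R V) {k : ℕ} (hk : k ≠ 1) :
    linOps B k = 0 := by
  match k with
  | 0 => rfl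
  | 1 => exact absurd rfl hk
  | k + 2 => rfl

theorem idHom_eq : idHom R V = linOps LinearMap.id := by
  funext k
  match k with
  | 0 => rfl
  | 1 => rfl
  | k + 2 => rfl

theorem isGapped_linOps {B : Completed R U →ₗ[NovikovRing R] Completed R V}
    (hB : ∀ v, SuppIn S (B (const v))) : IsGapped S (linOps B) := by
  intro k v l h
  by_cases hk : k = 1
  · subst hk
    exact hB _ l h
  · rw [linOps_of_ne B hk] at h
    exact absurd rfl h

theorem flat_linOps_letter (b : Module.Basis I R U)
    (B : Completed R U →ₗ[NovikovRing R] Completed R V) (i : I) (l : S) :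
    flat S b (linOps B) (wd R ⟨[i], l⟩) = coeff (B (const (b i))) l := flat_wd _ _ _ _

theorem flat_linOps_of_ne (b : Module.Basis I R U)
    (B : Completed R U →ₗ[NovikovRing R] Completed R V) {u : List I} (hu : u.length ≠ 1) (l : S) :
    flat S b (linOps B) (wd R ⟨u, l⟩) = 0 := by
  rw [flat_wd, linOps_of_ne B hu]
  rfl

theorem flat_linOps_zero (b : Module.Basis I R U)
    (B : Completed R U →ₗ[NovikovRing R] Completed R V) : flat S b (linOps B) (wd R 0) = 0 :=
  flat_linOps_of_ne b B (by simp) 0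

/-- The morphism of words induced by a linear map. -/
def linHat (S : AddSubmonoid ℝ≥0) [Discrete S] (b : Module.Basis I R U) (b' : Module.Basis J R V)
    (B : Completed R U →ₗ[NovikovRing R] Completed R V) : Bar R I S →ₗ[R] Bar R J S :=
  hat b' (flat S b (linOps B))

theorem isComult_linHat (b : Module.Basis I R U) (b' : Module.Basis J R V)
    (B : Completed R U →ₗ[NovikovRing R] Completed R V) : IsComult (linHat S b b' B) :=
  isComult_hat b' (flat_linOps_zero b B)

theorem proj_linHat (b : Module.Basis I R U) (b' : Module.Basis J R V)
    (B : Completed R U →ₗ[NovikovRing R] Completed R V) (q : Bar R I S) :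
    proj b' (linHat S b b' B q) = flat S b (linOps B) q := proj_hat b' (flat_linOps_zero b B) q

theorem linHat_nil (b : Module.Basis I R U) (b' : Module.Basis J R V)
    (B : Completed R U →ₗ[NovikovRing R] Completed R V) (l : S) :
    linHat S b b' B (wd R ⟨[], l⟩) = wd R ⟨[], l⟩ := by
  rw [(isComult_linHat b b' B).apply_wd b', Finset.sum_eq_zero, add_zero]
  · simp [eps, unit, Word.nil]
  · rintro ⟨⟨u, p⟩, ⟨u', p'⟩⟩ hp
    rw [mem_antidiagonal] at hp
    have h1 := congrArg Word.letters hp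
    simp only [Word.letters_add, List.append_eq_nil_iff] at h1
    rw [proj_linHat, h1.1, flat_linOps_of_ne _ _ (by simp), map_zero, LinearMap.zero_apply]

theorem linHat_cons (b : Module.Basis I R U) (b' : Module.Basis J R V)
    (B : Completed R U →ₗ[NovikovRing R] Completed R V) (i : I) (u : List I) (l : S) :
    linHat S b b' B (wd R ⟨i :: u, l⟩) = ∑ p ∈ antidiagonal l,
      cons b' (coeff (B (const (b i))) p.1) (linHat S b b' B (wd R ⟨u, p.2⟩)) := by
  rw [(isComult_linHat b b' B).apply_wd b', eps_of_ne (by simp), map_zero, zero_add]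
  simp only [proj_linHat]
  refine (Word.sum_antidiagonal (⟨i :: u, l⟩ : Word I S) fun p p' =>
    cons b' (flat S b (linOps B) (wd R p)) (linHat S b b' B (wd R p'))).trans ?_
  rw [Finset.sum_eq_single 1]
  · simp only [List.take_succ_cons, List.take_zero, List.drop_succ_cons, List.drop_zero,
      flat_linOps_letter]
  · intro a ha ha1
    refine Finset.sum_eq_zero fun p _ => ?_
    rw [flat_linOps_of_ne, map_zero, LinearMap.zero_apply]
    simp only [List.length_cons, Finset.mem_range] at ha
    simp only [List.length_take, List.length_cons]
    omega
  · simp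

theorem cvec_linear (b : Module.Basis I R U) (b' : Module.Basis J R V)
    (B : Completed R U →ₗ[NovikovRing R] Completed R V) {x : ℕ → Completed R U} {u : List I}
    (hx : Spells b x u) (l : S) :
    cvec b' u.length (fun j => B (x j)) l = linHat S b b' B (wd R ⟨u, l⟩) := by
  induction u generalizing x l with
  | nil => rw [linHat_nil]; rfl
  | cons i u ih =>
    rw [linHat_cons]
    refine (cvec_succ b' u.length _ l).trans (Finset.sum_congr rfl fun p _ => ?_)
    congr 2
    · congr 1
      exact congrArg _ (hx 0 (by simp))
    · rw [← ih (x := fun s => x (s + 1)) fun s hs => hx (s + 1) (by simpa using hs)]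
      rfl

/-- Operations with all inputs transformed by a linear map. -/
def precomp (F : Operations R V W) (B : Completed R U →ₗ[NovikovRing R] Completed R V) :
    Operations R U W := fun k => (F k).compLinearMap fun _ => B

/-- Operations with the output transformed by a linear map. -/
def postcomp (B : Completed R V →ₗ[NovikovRing R] Completed R W) (F : Operations R U V) :
    Operations R U W := fun k => B.compMultilinearMap (F k)

theorem IsGapped.precomp {F : Operations R V W} (hF : IsGapped S F)
    {B : Completed R U →ₗ[NovikovRing R] Completed R V} (hB : ∀ v, SuppIn S (B (const v))) :
    IsGapped S (precomp F B) := fun _ v l h => hF.suppIn (fun j => hB (v j)) l h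

theorem IsGapped.postcomp {F : Operations R U V} (hF : IsGapped S F)
    {B : Completed R V →ₗ[NovikovRing R] Completed R W} (hB : ∀ v, SuppIn S (B (const v))) :
    IsGapped S (postcomp B F) := fun _ v l h =>
  suppIn_apply B hB (hF.suppIn fun j => suppIn_const (v j)) l h

theorem flat_precomp (b : Module.Basis I R U) (b' : Module.Basis J R V) {F : Operations R V W}
    (hF : IsGapped S F) {B : Completed R U →ₗ[NovikovRing R] Completed R V}
    (hB : ∀ v, SuppIn S (B (const v))) :
    flat S b (precomp F B) = flat S b' F ∘ₗ linHat S b b' B := by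
  refine bar_hom_ext fun ⟨u, l⟩ => ?_
  have hx := spells_spell b u
  rw [LinearMap.comp_apply, ← cvec_linear b b' B hx, ← hF.coeff_eq b' (y := fun j : Fin u.length =>
    B (spell b u j)) fun j => suppIn_apply B hB (hx.suppIn j.2)]
  exact (flat_wd_seq b (precomp F B) rfl hx l).symm

theorem flat_lenPart_one (b : Module.Basis I R U)
    (B : Completed R U →ₗ[NovikovRing R] Completed R V) (q : Bar R I S) :
    flat S b (linOps B) (lenPart 1 q) = flat S b (linOps B) q := by
  classical
  suffices h : flat S b (linOps B) ∘ₗ lenPart 1 = flat S b (linOps B) from LinearMap.congr_fun h q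
  refine bar_hom_ext fun ⟨u, l⟩ => ?_
  rw [LinearMap.comp_apply, lenPart_wd]
  split_ifs with h
  · rfl
  · rw [map_zero, flat_linOps_of_ne _ _ h]

/-- A linear map, seen as operations, uses only words of length one. So `Z` may be a morphism or a
coderivation with component `F`, and both cases are treated together. -/
theorem flat_postcomp_of_lenPart (b : Module.Basis I R U) (b' : Module.Basis J R V)
    {F : Operations R U V} (hF : IsGapped S F)
    {B : Completed R V →ₗ[NovikovRing R] Completed R W} (hB : ∀ v, SuppIn S (B (const v)))
    {Z : Bar R I S →ₗ[R] Bar R J S}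
    (hZ : ∀ (u : List I) (l : S), lenPart 1 (Z (wd R ⟨u, l⟩)) =
      cvec b' 1 (fun _ => F u.length fun j => spell b u j) l) :
    flat S b (postcomp B F) = flat S b' (linOps B) ∘ₗ Z := by
  refine bar_hom_ext fun ⟨u, l⟩ => ?_
  have hx := spells_spell b u
  rw [LinearMap.comp_apply, ← flat_lenPart_one, hZ, ← (isGapped_linOps hB).coeff_eq b'
    (y := fun _ : Fin 1 => F u.length fun j => spell b u j) fun j =>
      hF.suppIn fun j => hx.suppIn j.2]
  exact (flat_wd_seq b (postcomp B F) rfl hx l).symm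

theorem antidiagonalTuple_one (k : ℕ) : Finset.Nat.antidiagonalTuple 1 k = {fun _ => k} := by
  ext c
  rw [Finset.Nat.mem_antidiagonalTuple, Finset.mem_singleton]
  constructor
  · intro h
    funext j
    rw [Subsingleton.elim j 0, ← h]
    simp
  · rintro rfl
    simp

theorem blockArgs_one (f : Operations R U V) (x : ℕ → Completed R U) (k : ℕ) (j : Fin 1) :
    blockArgs f x (fun _ : Fin 1 => k) j = f k fun s => x s := by
  have h : ∑ i ∈ Finset.Iio j, k = 0 := by
    rw [show Finset.Iio j = ∅ by
      ext i
      simp [Subsingleton.elim i j]]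
    rfl
  rw [blockArgs, h]
  simp only [zero_add]

theorem IsComult.lenPart_one {b : Module.Basis I R U} (b' : Module.Basis J R V)
    {F : Operations R U V} {Φ : Bar R I S →ₗ[R] Bar R J S} (hΦ : IsComult Φ)
    (hF : proj b' ∘ₗ Φ = flat S b F) (u : List I) (l : S) : lenPart 1 (Φ (wd R ⟨u, l⟩)) =
      cvec b' 1 (fun _ => F u.length fun j => spell b u j) l := by
  rw [← sum_cvec_blockArgs b' hΦ hF 1 (spells_spell b u), antidiagonalTuple_one,
    Finset.sum_singleton]
  congr 1
  funext j
  exact blockArgs_one _ _ _ _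

theorem IsCoder.lenPart_one {b : Module.Basis I R U} (b' : Module.Basis J R V)
    {F : Operations R U V} {Φ Ψ X : Bar R I S →ₗ[R] Bar R J S} (hX : IsCoder Φ Ψ X)
    (hΨ : IsComult Ψ) (hF : proj b' ∘ₗ X = flat S b F) (u : List I) (l : S) :
    lenPart 1 (X (wd R ⟨u, l⟩)) =
      cvec b' 1 (fun _ => F u.length fun j => spell b u j) l := by
  -- With a single block only the distinguished operation occurs, so any operations with the
  -- components of `Φ` and `Ψ` will do; `sharp` supplies some.
  rw [← sum_cvec_mixedArgs b' hX hΨ (flat_sharp b (proj b' ∘ₗ Φ)).symm hF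
    (flat_sharp b (proj b' ∘ₗ Ψ)).symm 1 (spells_spell b u), antidiagonalTuple_one,
    Finset.sum_singleton, Fin.sum_univ_one]
  congr 1
  funext j
  rw [mixedArgs, if_neg (by simp), if_pos (Subsingleton.elim _ _), blockArgs_one]

theorem linOps_comp (B : Completed R V →ₗ[NovikovRing R] Completed R W)
    (B' : Completed R U →ₗ[NovikovRing R] Completed R V) :
    linOps (B ∘ₗ B') = precomp (linOps B) B' := by
  funext k
  by_cases hk : k = 1
  · subst hk
    rfl
  · rw [precomp, linOps_of_ne _ hk, linOps_of_ne _ hk]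
    rfl

theorem linHat_comp (b : Module.Basis I R U) (b' : Module.Basis J R V) (b'' : Module.Basis K R W)
    {B : Completed R V →ₗ[NovikovRing R] Completed R W}
    {B' : Completed R U →ₗ[NovikovRing R] Completed R V} (hB : ∀ v, SuppIn S (B (const v)))
    (hB' : ∀ v, SuppIn S (B' (const v))) :
    linHat S b b'' (B ∘ₗ B') = linHat S b' b'' B ∘ₗ linHat S b b' B' := by
  refine (isComult_linHat _ _ _).ext ((isComult_linHat _ _ _).comp (isComult_linHat _ _ _)) b''
    (LinearMap.ext fun q => ?_)
  rw [LinearMap.comp_apply, proj_linHat, LinearMap.comp_apply, LinearMap.comp_apply, proj_linHat,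
    linOps_comp, flat_precomp b b' (isGapped_linOps hB) hB']
  rfl

theorem flat_linOps_extend (b : Module.Basis I R U) (a : U →ₗ[R] V) :
    flat S b (linOps (extend a)) = a ∘ₗ proj b := by
  refine bar_hom_ext fun ⟨u, l⟩ => ?_
  rw [LinearMap.comp_apply]
  by_cases hu : u.length = 1
  · obtain ⟨i, rfl⟩ := List.length_eq_one_iff.1 hu
    rw [flat_linOps_letter, extend_const, coeff_const]
    by_cases hl : l = 0
    · subst hl
      simp
    · rw [if_neg (fun h => hl (Subtype.ext h) : ¬(l : ℝ≥0) = 0), proj_of_ne, map_zero]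
      intro j h
      exact hl (congrArg Word.energy h)
  · rw [flat_linOps_of_ne _ _ hu, proj_of_ne, map_zero]
    intro j h
    exact hu (by rw [show u = [j] from congrArg Word.letters h]; rfl)

theorem linHat_extend (b : Module.Basis I R U) (b' : Module.Basis J R V) (a : U →ₗ[R] V) :
    linHat S b b' (extend a) = strict S b b' a :=
  (isComult_linHat _ _ _).ext (isComult_strict _ _ _) b' (LinearMap.ext fun q => by
    rw [LinearMap.comp_apply, proj_linHat, LinearMap.comp_apply, proj_strict, flat_linOps_extend]
    rfl)

theorem suppIn_extend (a : U →ₗ[R] V) (v : U) : SuppIn S (extend a (const v)) := by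
  rw [extend_const]
  exact suppIn_const _

theorem extend_id : extend (LinearMap.id : V →ₗ[R] V) = LinearMap.id :=
  LinearMap.ext fun _ => rfl

theorem flat_idHom (b : Module.Basis I R V) : flat S b (idHom R V) = proj b := by
  rw [idHom_eq, ← extend_id, flat_linOps_extend, LinearMap.id_comp]

theorem isGapped_idHom : IsGapped S (idHom R V) := by
  rw [idHom_eq, ← extend_id]
  exact isGapped_linOps (suppIn_extend _)

theorem coeff_zero_apply (A : Completed R U →ₗ[NovikovRing R] Completed R V) (x : Completed R U) :
    coeff (A x) 0 = coeff (A (const (coeff x 0))) 0 := by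
  rw [coeff_apply_of_subset A x 0 (s := {0}) (fun i hi => ?_) (by simp), Finset.sum_singleton,
    tsub_zero]
  rw [mem_exponents] at hi
  rw [Finset.mem_singleton]
  exact le_antisymm hi.2 zero_le

/-- The constant part of a linear map. -/
def constPart (A : Completed R U →ₗ[NovikovRing R] Completed R V) : U →ₗ[R] V :=
  coeffHom R V 0 ∘ₗ onConst A

@[simp] theorem constPart_apply (A : Completed R U →ₗ[NovikovRing R] Completed R V) (v : U) :
    constPart A v = coeff (A (const v)) 0 := rfl

theorem constPart_comp (A : Completed R V →ₗ[NovikovRing R] Completed R W)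
    (B : Completed R U →ₗ[NovikovRing R] Completed R V) :
    constPart (A ∘ₗ B) = constPart A ∘ₗ constPart B :=
  LinearMap.ext fun _ => coeff_zero_apply A _

theorem lead_linHat (b : Module.Basis I R U) (b' : Module.Basis J R V)
    (B : Completed R U →ₗ[NovikovRing R] Completed R V) :
    lead b b' (linHat S b b' B) = constPart B := by
  refine b.ext fun i => ?_
  rw [lead_apply, single_basis, proj_linHat]
  exact flat_linOps_letter b B i 0

theorem lead_of_flat (b : Module.Basis I R U) (b' : Module.Basis J R V) {F : Operations R U V}
    {X : Bar R I S →ₗ[R] Bar R J S} (h : proj b' ∘ₗ X = flat S b F) (v : U) :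
    lead b b' X v = linearPart F v := by
  have : lead b b' X = constPart ((F 1).toLinearMap 0 0) := by
    refine b.ext fun i => ?_
    rw [lead_apply, single_basis]
    refine (LinearMap.congr_fun h _).trans ((flat_wd b F [i] 0).trans ?_)
    rw [constPart_apply, MultilinearMap.toLinearMap_apply]
    congr 2
    funext j
    obtain rfl : j = (0 : Fin 1) := Subsingleton.elim (α := Fin 1) j 0
    simp
  rw [this, constPart_apply, MultilinearMap.toLinearMap_apply, linearPart]
  congr 2
  funext j
  rw [Subsingleton.elim j 0]
  simp

/-! ### Degrees and equivariance on words -/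

theorem Model.Adapted.map_pr {X : Bar R I S →ₗ[R] V} {M : Model R I U G N} {M' : Model R J V G N}
    {r : ZMod (2 * N)} {gr : ZMod (2 * N) → Submodule R V} (hM' : M'.Adapted gr)
    (h : ∀ m, X (wd R m) ∈ gr (wordDeg M.deg m + r + 1)) (d : ZMod (2 * N)) (q : Bar R I S) :
    X ((M.bar S).pr d q) = M'.vec.pr (d + r) (X q) := by
  classical
  suffices h : X ∘ₗ (M.bar S).pr d = M'.vec.pr (d + r) ∘ₗ X from LinearMap.congr_fun h q
  refine bar_hom_ext fun m => ?_
  have h1 := hM'.mem_iff.1 (h m)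
  rw [LinearMap.comp_apply, LinearMap.comp_apply, M.bar_pr_wd, ← h1, M'.vec_pr_pr]
  simp only [add_left_inj]
  split_ifs
  · exact h1.symm
  · simp

/-- The model without its action. -/
def Model.forget (M : Model R I V G N) : Model R I V Empty N := ⟨M.b, M.deg, fun g => g.elim⟩

/-- Degrees do not involve the group, so the action is forgotten and `good_comult` is applied with
an empty index type in place of `G`. -/
theorem map_pr_comult {M : Model R I U G N} {M' : Model R J V G N} {Φ : Bar R I S →ₗ[R] Bar R J S}
    (hΦ : IsComult Φ)
    (h : ∀ d q, proj M'.b (Φ ((M.bar S).pr d q)) = M'.vec.pr (d + 0) (proj M'.b (Φ q)))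
    (d : ZMod (2 * N)) (q : Bar R I S) : Φ ((M.bar S).pr d q) = (M'.bar S).pr (d + 0) (Φ q) :=
  (Model.good_comult (M := M.forget) (M' := M'.forget) hΦ ⟨fun g => g.elim, h⟩).map_pr d q

theorem map_pr_coder {M : Model R I U G N} {D : Bar R I S →ₗ[R] Bar R I S}
    (hD : IsCoder (M.tau S) LinearMap.id D)
    (h : ∀ d q, proj M.b (D ((M.bar S).pr d q)) = M.vec.pr (d + 1) (proj M.b (D q)))
    (d : ZMod (2 * N)) (q : Bar R I S) : D ((M.bar S).pr d q) = (M.bar S).pr (d + 1) (D q) :=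
  (Model.good_coder (M := M.forget) (M' := M.forget) hD M.isComult_tau
    (Model.good_tau (M := M.forget) fun g => g.elim) Good.id ⟨fun g => g.elim, h⟩).map_pr d q

/-- The projections of words to the homogeneous parts, with the action of `G` on words induced by
linear maps of the completion. -/
def Model.twisted (M : Model R I V G N)
    (ρ : G → Completed R V →ₗ[NovikovRing R] Completed R V) : Sym R G N (Bar R I S) where
  act g := linHat S M.b M.b (ρ g)
  pr := (M.bar S).pr

/-- Transforming the inputs or the output of gapped operations gives gapped operations again, and
these are equal exactly when their components are. Thus equivariance can be tested on words even
when the action involves positive powers of `T`. -/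
theorem flat_comp_linHat {b : Module.Basis I R U} {b' : Module.Basis J R V}
    {ρ₁ : Completed R U →ₗ[NovikovRing R] Completed R U}
    {ρ₂ : Completed R V →ₗ[NovikovRing R] Completed R V} (h₁ : ∀ v, SuppIn S (ρ₁ (const v)))
    (h₂ : ∀ v, SuppIn S (ρ₂ (const v))) {F : Operations R U V} (hF : IsGapped S F)
    {Z : Bar R I S →ₗ[R] Bar R J S}
    (hZ : ∀ (u : List I) (l : S), lenPart 1 (Z (wd R ⟨u, l⟩)) =
      cvec b' 1 (fun _ => F u.length fun j => spell b u j) l) :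
    (∀ (k : ℕ) (x : Fin k → Completed R U), F k (fun i => ρ₁ (x i)) = ρ₂ (F k x)) ↔
      ∀ q, flat S b F (linHat S b b ρ₁ q) = proj b' (linHat S b' b' ρ₂ (Z q)) := by
  have h3 : (∀ (k : ℕ) (x : Fin k → Completed R U), F k (fun i => ρ₁ (x i)) = ρ₂ (F k x)) ↔
      precomp F ρ₁ = postcomp ρ₂ F := by
    constructor
    · intro h
      funext k
      exact MultilinearMap.ext (h k)
    · intro h k x
      exact congrArg (fun F : Operations R U V => F k x) h
  have h4 : precomp F ρ₁ = postcomp ρ₂ F ↔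
      flat S b (precomp F ρ₁) = flat S b (postcomp ρ₂ F) :=
    ⟨fun h => by rw [h], fun h => IsGapped.ext b (hF.precomp h₁) (hF.postcomp h₂) h⟩
  rw [h3, h4, flat_precomp b b hF h₁, flat_postcomp_of_lenPart b b' hF h₂ hZ, LinearMap.ext_iff]
  simp only [LinearMap.comp_apply, proj_linHat]

end LinearOperations

/-! ### Straightening of actions and transport of structures to words -/

section Transport

variable {R : Type*} [Field R] {I J U V W G : Type*} [AddCommGroup U] [Module R U]
  [AddCommGroup V] [Module R V] [AddCommGroup W] [Module R W]
  {S : AddSubmonoid ℝ≥0} [hS : Discrete S] {N : ℕ}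

theorem hasDegree_linOps {gr₁ : ZMod (2 * N) → Submodule R U} {gr₂ : ZMod (2 * N) → Submodule R V}
    {B : Completed R U →ₗ[NovikovRing R] Completed R V}
    (h : ∀ d x, IsHomogeneous gr₁ d x → IsHomogeneous gr₂ d (B x)) :
    HasDegree gr₁ gr₂ 0 (linOps B) := by
  intro k x d hx
  by_cases hk : k = 1
  · subst hk
    rw [linOps_one, Fin.sum_univ_one, add_zero]
    exact h _ _ (hx 0)
  · rw [linOps_of_ne B hk]
    exact fun l => Submodule.zero_mem _

theorem linHat_map_pr {M : Model R I U G N} {M' : Model R J V G N}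
    {gr₁ : ZMod (2 * N) → Submodule R U} {gr₂ : ZMod (2 * N) → Submodule R V}
    (hM : M.Adapted gr₁) (hM' : M'.Adapted gr₂)
    {B : Completed R U →ₗ[NovikovRing R] Completed R V}
    (h : ∀ d x, IsHomogeneous gr₁ d x → IsHomogeneous gr₂ d (B x)) (d : ZMod (2 * N))
    (q : Bar R I S) : linHat S M.b M'.b B ((M.bar S).pr d q) =
      (M'.bar S).pr (d + 0) (linHat S M.b M'.b B q) := by
  refine map_pr_comult (isComult_linHat _ _ _) (fun d q => ?_) d q
  rw [proj_linHat, proj_linHat]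
  exact hM'.map_pr (M := M) (fun m => hM.flat_mem (hasDegree_linOps h) m) d q

theorem linHat_tau {M : Model R I V G N} {gr : ZMod (2 * N) → Submodule R V} (hM : M.Adapted gr)
    {B : Completed R V →ₗ[NovikovRing R] Completed R V}
    (h : ∀ d x, IsHomogeneous gr d x → IsHomogeneous gr d (B x)) (q : Bar R I S) :
    linHat S M.b M.b B (M.tau S q) = M.tau S (linHat S M.b M.b B q) := by
  have h1 : Good (M.forget.bar S) (M.forget.bar S) 0 (linHat S M.b M.b B) :=
    ⟨fun g => g.elim, linHat_map_pr hM hM h⟩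
  have h2 := h1.sign_comm M.forget.isSign_bar M.forget.isSign_bar q
  rw [sign_zero, one_smul] at h2
  exact h2

variable [Group G]

/-- The coderivation of an algebra commutes with the action on words. -/
theorem good_twisted_coder {M : Model R I V G N} {gr : ZMod (2 * N) → Submodule R V}
    (hM : M.Adapted gr) {m : Operations R V V} (hdeg : HasDegree gr gr 1 m) (hm : IsGapped S m)
    {ρ : Representation (NovikovRing R) G (Completed R V)} (hρ : IsAInfAction S gr m ρ)
    {D : Bar R I S →ₗ[R] Bar R I S} (hD : IsCoder (M.tau S) LinearMap.id D)
    (hmD : proj M.b ∘ₗ D = flat S M.b m) :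
    Good (M.twisted (S := S) fun g => ρ g) (M.twisted fun g => ρ g) 1 D where
  map_act g q := by
    have h1 := (flat_comp_linHat (S := S) (hρ.gapped g) (hρ.gapped g) hm
      (hD.lenPart_one M.b IsComult.id hmD)).1 (hρ.equivariant g)
    have h2 : linHat S M.b M.b (ρ g) ∘ₗ M.tau S = M.tau S ∘ₗ linHat S M.b M.b (ρ g) :=
      LinearMap.ext (linHat_tau hM (hρ.degree g))
    have h3 := hD.comp (isComult_linHat (S := S) M.b M.b (ρ g))
    have h4 := (isComult_linHat (S := S) M.b M.b (ρ g)).comp_coder hD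
    rw [h2] at h4
    have h5 := h3.ext h4 (M.isComult_tau.comp (isComult_linHat _ _ _)).one_eq M.b
      (LinearMap.ext fun q => by
        refine Eq.trans ?_ (h1 q)
        rw [← hmD]
        rfl)
    exact LinearMap.congr_fun h5 q
  map_pr := map_pr_coder hD fun d q => by
    have h := LinearMap.congr_fun hmD
    simp only [LinearMap.comp_apply] at h
    rw [h, h]
    exact hM.map_pr (fun m => hM.flat_mem hdeg m) d q

theorem good_twisted_comult {M : Model R I U G N} {M' : Model R J V G N}
    {gr₁ : ZMod (2 * N) → Submodule R U} {gr₂ : ZMod (2 * N) → Submodule R V}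
    (hM : M.Adapted gr₁) (hM' : M'.Adapted gr₂) {f : Operations R U V}
    (hdeg : HasDegree gr₁ gr₂ 0 f) (hf : IsGapped S f)
    {ρ₁ : Representation (NovikovRing R) G (Completed R U)}
    {ρ₂ : Representation (NovikovRing R) G (Completed R V)}
    (h₁ : ∀ g v, SuppIn S (ρ₁ g (const v))) (h₂ : ∀ g v, SuppIn S (ρ₂ g (const v)))
    (h : IsEquivariant (fun g => ρ₁ g) (fun g => ρ₂ g) f)
    {Φ : Bar R I S →ₗ[R] Bar R J S} (hΦ : IsComult Φ) (hfΦ : proj M'.b ∘ₗ Φ = flat S M.b f) :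
    Good (M.twisted (S := S) fun g => ρ₁ g) (M'.twisted fun g => ρ₂ g) 0 Φ where
  map_act g q := by
    have h1 := (flat_comp_linHat (S := S) (h₁ g) (h₂ g) hf (hΦ.lenPart_one M'.b hfΦ)).1 (h g)
    have h5 := (hΦ.comp (isComult_linHat (S := S) M.b M.b (ρ₁ g))).ext
      ((isComult_linHat (S := S) M'.b M'.b (ρ₂ g)).comp hΦ) M'.b (LinearMap.ext fun q => by
        refine Eq.trans ?_ (h1 q)
        rw [← hfΦ]
        rfl)
    exact LinearMap.congr_fun h5 q
  map_pr := map_pr_comult hΦ fun d q => by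
    have h := LinearMap.congr_fun hfΦ
    simp only [LinearMap.comp_apply] at h
    rw [h, h]
    exact hM'.map_pr (fun m => hM.flat_mem hdeg m) d q

theorem flat_mem_of_good {M : Model R I U G N} {M' : Model R J V G N}
    {gr₂ : ZMod (2 * N) → Submodule R V} (hM' : M'.Adapted gr₂) {r : ZMod (2 * N)}
    {ρ₁ : G → Completed R U →ₗ[NovikovRing R] Completed R U}
    {ρ₂ : G → Completed R V →ₗ[NovikovRing R] Completed R V} {Z : Bar R I S →ₗ[R] Bar R J S}
    (hZ : Good (M.twisted (S := S) ρ₁) (M'.twisted ρ₂) r Z) (m : Word I S) :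
    proj M'.b (Z (wd R m)) ∈ gr₂ (wordDeg M.deg m + r + 1) := by
  rw [hM'.mem_iff]
  have h1 : Good (M.forget.bar S) M'.forget.vec r (proj M'.b ∘ₗ Z) :=
    M'.forget.good_proj.comp ⟨fun g => g.elim, hZ.map_pr⟩ (add_zero _)
  exact Model.pr_of_good h1 m

/-- An action can be made constant by an isomorphism of words. -/
theorem exists_straightening [CharZero R] [Finite G] {gr : ZMod (2 * N) → Submodule R V}
    (b : Module.Basis I R V) (deg : I → ZMod (2 * N))
    (hb : ∀ d, gr (d + 1) = Submodule.span R (b '' {i | deg i = d}))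
    {ρ : Representation (NovikovRing R) G (Completed R V)}
    (hdeg : ∀ g d x, IsHomogeneous gr d x → IsHomogeneous gr d (ρ g x))
    (hgap : ∀ g v, SuppIn S (ρ g (const v))) :
    ∃ M : Model R I V G N, M.b = b ∧ M.deg = deg ∧ M.Adapted gr ∧ M.ActPr ∧
      (∀ g h v, M.act (g * h) v = M.act g (M.act h v)) ∧ (∀ v, M.act 1 v = v) ∧
      ∃ A A' : Bar R I S →ₗ[R] Bar R I S, IsComult A ∧ IsComult A' ∧ (∀ q, A (A' q) = q) ∧
        (∀ q, A' (A q) = q) ∧ Good (M.bar S) (M.twisted fun g => ρ g) 0 A ∧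
        Good (M.twisted fun g => ρ g) (M.bar S) 0 A' ∧ lead M.b M.b A = LinearMap.id ∧
        lead M.b M.b A' = LinearMap.id := by
  have := Fintype.ofFinite G
  obtain ⟨M, hMb, hMd, hMa⟩ : ∃ M : Model R I V G N, M.b = b ∧ M.deg = deg ∧
      ∀ g, M.act g = constPart (ρ g) := ⟨⟨b, deg, fun g => constPart (ρ g)⟩, rfl, rfl, fun _ => rfl⟩
  have hM : M.Adapted gr := by
    subst hMb hMd
    exact hb
  have hmul : ∀ g h v, M.act (g * h) v = M.act g (M.act h v) := fun g h v => by
    rw [hMa, hMa, hMa, map_mul]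
    exact LinearMap.congr_fun (constPart_comp (ρ g) (ρ h)) v
  have hone : ∀ v, M.act 1 v = v := fun v => by
    rw [hMa, map_one]
    exact coeff_const_zero (R := R) v
  have hact : ∀ g d v, v ∈ gr (d + 1) → M.act g v ∈ gr (d + 1) := fun g d v hv => by
    rw [hMa]
    refine hdeg g d _ (fun l => ?_) 0
    rw [coeff_const]
    split_ifs
    · exact hv
    · exact Submodule.zero_mem _
  have hpr : M.ActPr := by
    classical
    intro g d v
    suffices h : M.act g ∘ₗ M.vec.pr d = M.vec.pr d ∘ₗ M.act g from LinearMap.congr_fun h v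
    refine M.b.ext fun i => ?_
    have h1 := hM.mem_iff.1 (hact g _ _ (hM.basis_mem i))
    rw [LinearMap.comp_apply, LinearMap.comp_apply, M.vec_pr_basis, ← h1, M.vec_pr_pr]
    split_ifs
    · exact h1.symm
    · exact map_zero _
  have hcard : (Fintype.card G : R) ≠ 0 := Nat.cast_ne_zero.2 Fintype.card_ne_zero
  -- The average of `ρ g` composed with the inverse of its constant part. It intertwines the
  -- constant action with `ρ`, and its constant part is the identity, so it is invertible on words.
  obtain ⟨P, hP⟩ : ∃ P : Completed R V →ₗ[NovikovRing R] Completed R V, P =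
      scal R (Fintype.card G : R)⁻¹ • ∑ g, ρ g ∘ₗ extend (M.act g⁻¹) := ⟨_, rfl⟩
  have P_apply : ∀ x, P x = (Fintype.card G : R)⁻¹ • ∑ g, ρ g (extend (M.act g⁻¹) x) := fun x => by
    rw [hP, LinearMap.smul_apply, LinearMap.sum_apply, smul_eq_scal]
    rfl
  have ρP : ∀ h, ρ h ∘ₗ P = P ∘ₗ extend (M.act h) := fun h => by
    refine LinearMap.ext fun x => ?_
    rw [LinearMap.comp_apply, LinearMap.comp_apply, P_apply, P_apply, smul_eq_scal, map_smul,
      smul_eq_scal, map_sum]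
    congr 1
    refine (Fintype.sum_equiv (Equiv.mulLeft h⁻¹) _ _ fun g => ?_).symm
    have h1 : ∀ y, ρ h (ρ (h⁻¹ * g) y) = ρ g y := fun y => by
      rw [← Module.End.mul_apply, ← map_mul, mul_inv_cancel_left]
    refine Eq.trans ?_ (h1 _).symm
    congr 1
    refine coeff_ext fun l => ?_
    rw [coeff_extend, coeff_extend, coeff_extend, ← hmul]
    congr 2
    rw [Equiv.coe_mulLeft]
    group
  have gapP : ∀ v, SuppIn S (P (const v)) := fun v l hl => by
    rw [P_apply, coeff_smul] at hl
    have h1 : SuppIn S (∑ g, ρ g (extend (M.act g⁻¹) (const v))) :=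
      suppIn_sum fun g _ => by
        rw [extend_const]
        exact hgap g _
    exact h1 l fun h0 => hl (by rw [h0, smul_zero])
  have degP : ∀ d x, IsHomogeneous gr d x → IsHomogeneous gr d (P x) := fun d x hx l => by
    rw [P_apply, coeff_smul, coeff_sum]
    refine Submodule.smul_mem _ _ (Submodule.sum_mem _ fun g _ => hdeg g d _ (fun l => ?_) l)
    rw [coeff_extend]
    exact hact _ _ _ (hx l)
  have leadP : constPart P = LinearMap.id := by
    refine LinearMap.ext fun v => ?_
    rw [constPart_apply, P_apply, coeff_smul, coeff_sum, LinearMap.id_apply]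
    have : ∀ g, coeff (ρ g (extend (M.act g⁻¹) (const v))) 0 = v := fun g => by
      rw [extend_const, ← constPart_apply, ← hMa, ← hmul, mul_inv_cancel, hone]
    rw [Finset.sum_congr rfl fun g _ => this g, Finset.sum_const, Finset.card_univ,
      ← Nat.cast_smul_eq_nsmul R, smul_smul, inv_mul_cancel₀ hcard, one_smul]
  have cA : IsComult (linHat S M.b M.b P) := isComult_linHat _ _ _
  have lA : lead M.b M.b (linHat S M.b M.b P) = LinearMap.id := by rw [lead_linHat, leadP]
  obtain ⟨A', cA', h1, h2, lA'⟩ := cA.exists_inverse M.b lA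
  have gA : Good (M.bar S) (M.twisted fun g => ρ g) 0 (linHat S M.b M.b P) := by
    refine ⟨fun g q => ?_, linHat_map_pr hM hM degP⟩
    have h3 := linHat_comp (S := S) M.b M.b M.b (hgap g) gapP
    have h4 := linHat_comp (S := S) M.b M.b M.b gapP (suppIn_extend (S := S) (M.act g))
    rw [ρP g, h4, linHat_extend] at h3
    exact LinearMap.congr_fun h3 q
  exact ⟨M, hMb, hMd, hM, hpr, hmul, hone, linHat S M.b M.b P, A', cA, cA', LinearMap.congr_fun h1,
    LinearMap.congr_fun h2, gA, gA.inverse h1 h2, lA, lA'⟩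

end Transport

/-! ### Evaluation of paths -/

section Evaluation

variable {R : Type*} [Field R] {U V W : Type*} [AddCommGroup U] [Module R U]
  [AddCommGroup V] [Module R V] [AddCommGroup W] [Module R W] {N : ℕ}

theorem extend_extend (f : V →ₗ[R] W) (g : U →ₗ[R] V) (x : Completed R U) :
    extend f (extend g x) = extend (f ∘ₗ g) x := coeff_ext fun _ => rfl

theorem span_range_lsingle :
    Submodule.span R {p : PolynomialModule R V | ∃ n v, p = PolynomialModule.lsingle R n v} = ⊤ := by
  refine (Submodule.eq_top_iff').2 fun p => ?_
  induction p using PolynomialModule.induction_linear with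
  | zero => exact zero_mem _
  | add p q hp hq => exact add_mem hp hq
  | single n v => exact Submodule.subset_span ⟨n, v, rfl⟩

theorem polyExtend_lsingle {k : ℕ}
    (M : MultilinearMap (NovikovRing R) (fun _ : Fin k => Completed R V) (Completed R W))
    (n : Fin k → ℕ) (v : Fin k → V) :
    polyExtend M (fun j => const (PolynomialModule.lsingle R (n j) (v j))) =
      extend (PolynomialModule.lsingle R (∑ j, n j)) (M fun j => const (v j)) := by
  classical
  refine poly_ext fun i => ?_
  have h1 : extend (polyCoeff R W i) (polyExtend M fun j =>
      const (PolynomialModule.lsingle R (n j) (v j))) =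
      ∑ a ∈ Finset.Nat.antidiagonalTuple k i,
        M fun j => extend (polyCoeff R V (a j)) (const (PolynomialModule.lsingle R (n j) (v j))) := by
    rw [polyExtend, LinearMap.compMultilinearMap_apply, polyCoeff_assemble]
    change (MultilinearMap.pi _ _ : ℕ → Completed R W) i = _
    rw [MultilinearMap.pi_apply, _root_.sum_apply]
    rfl
  rw [h1, extend_extend]
  have h2 : ∀ a : Fin k → ℕ, a ≠ n → (M fun j => extend (polyCoeff R V (a j))
      (const (PolynomialModule.lsingle R (n j) (v j)))) = 0 := by
    intro a ha
    obtain ⟨j, hj⟩ := Function.ne_iff.1 ha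
    refine M.map_coord_zero j ?_
    rw [extend_const, polyCoeff_apply, PolynomialModule.lsingle_apply, if_neg (Ne.symm hj)]
    exact map_zero (constHom R V)
  rcases eq_or_ne (∑ j, n j) i with h | h
  · rw [Finset.sum_eq_single n (fun a _ ha => h2 a ha) (fun hn => absurd
      (Finset.Nat.mem_antidiagonalTuple.2 h) hn), h]
    have h3 : polyCoeff R W i ∘ₗ PolynomialModule.lsingle R i = LinearMap.id :=
      LinearMap.ext fun w => by
        rw [LinearMap.comp_apply, polyCoeff_apply, PolynomialModule.lsingle_apply, if_pos rfl]; rfl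
    rw [h3, extend_id, LinearMap.id_apply]
    congr 1
    funext j
    rw [extend_const, polyCoeff_apply, PolynomialModule.lsingle_apply, if_pos rfl]
  · rw [Finset.sum_eq_zero fun a ha => h2 a ?_]
    · refine coeff_ext fun l => ?_
      rw [coeff_zero, coeff_extend, LinearMap.comp_apply, polyCoeff_apply,
        PolynomialModule.lsingle_apply, if_neg h]
    · rintro rfl
      exact h (Finset.Nat.mem_antidiagonalTuple.1 ha)

/-- By multilinearity it is enough to consider constant monomials, where the claim is that a product
of powers of `r` is the power with the summed exponent. -/
theorem extend_eval_polyExtend {k : ℕ}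
    (M : MultilinearMap (NovikovRing R) (fun _ : Fin k => Completed R V) (Completed R W)) (r : R)
    (z : Fin k → Completed R (PolynomialModule R V)) :
    extend (PolynomialModule.eval r) (polyExtend M z) =
      M fun j => extend (PolynomialModule.eval r) (z j) := by
  refine coeff_ext fun l => ?_
  rw [← sub_eq_zero, ← coeff_sub, ← Submodule.mem_bot R]
  have := (((IsMultilinearOn.multilinearMap (polyExtend M)).map
    (extend (PolynomialModule.eval r))).sub (IsMultilinearOn.multilinearMap
      (M.compLinearMap fun _ => extend (PolynomialModule.eval r)))).coeff_mem
    isLowerSet_univ ⊥ (fun _ => {p | ∃ n v, p = PolynomialModule.lsingle R n v})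
    (fun x hx l _ => ?_) (fun j => if h : j < k then z ⟨j, h⟩ else 0)
    (fun s _ l => by rw [span_range_lsingle]; trivial) l trivial
  · simpa using this
  · have : ∀ j : Fin k, ∃ n v, x j = const (PolynomialModule.lsingle R n v) := by
      intro j
      obtain ⟨_, ⟨n, v, rfl⟩, h⟩ := hx j j.2
      exact ⟨n, v, h⟩
    choose n v hv using this
    rw [Submodule.mem_bot, coeff_sub, sub_eq_zero]
    congr 1
    simp only [hv, MultilinearMap.compLinearMap_apply]
    rw [polyExtend_lsingle, extend_extend]
    have h1 : ∀ j, extend (PolynomialModule.eval r)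
        (const (PolynomialModule.lsingle R (n j) (v j))) = scal R (r ^ n j) • const (v j) := by
      intro j
      rw [extend_const, PolynomialModule.eval_lsingle, ← smul_eq_scal]
      exact map_smul (constHom R V) _ _
    simp only [h1]
    rw [M.map_smul_univ, ← map_prod, Finset.prod_pow_eq_pow_sum, ← smul_eq_scal]
    refine coeff_ext fun l => ?_
    rw [coeff_extend, LinearMap.comp_apply, PolynomialModule.eval_lsingle, coeff_smul]

variable (V) in
/-- The value at `r` of the coefficient of `dt`. -/
def evalForm (r : R) : Completed R (PathSpace R V) →ₗ[NovikovRing R] Completed R V :=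
  extend (PolynomialModule.eval r ∘ₗ LinearMap.snd R _ _)

theorem evalAt_eq (r : R) (x : Completed R (PathSpace R V)) :
    evalAt V r x = extend (PolynomialModule.eval r) (functionPart R V x) := rfl

theorem evalForm_eq (r : R) (x : Completed R (PathSpace R V)) :
    evalForm V r x = extend (PolynomialModule.eval r) (formPart R V x) := rfl

theorem functionPart_ofFunction (x : Completed R (PolynomialModule R V)) :
    functionPart R V (ofFunction R V x) = x := coeff_ext fun _ => rfl

theorem functionPart_ofForm (x : Completed R (PolynomialModule R V)) :
    functionPart R V (ofForm R V x) = 0 := coeff_ext fun _ => rfl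

theorem formPart_ofFunction (x : Completed R (PolynomialModule R V)) :
    formPart R V (ofFunction R V x) = 0 := coeff_ext fun _ => rfl

theorem formPart_ofForm (x : Completed R (PolynomialModule R V)) :
    formPart R V (ofForm R V x) = x := coeff_ext fun _ => rfl

/-- Characteristic zero makes `R` infinite. Identities in `C ⊗ R[t, dt]` are checked below by
evaluating the function part and the form part at every `r`. -/
theorem coeff_path_eq_zero [CharZero R] {x : Completed R (PathSpace R V)} {l : ℝ≥0}
    (h₁ : ∀ r : R, coeff (evalAt V r x) l = 0) (h₂ : ∀ r : R, coeff (evalForm V r x) l = 0) :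
    coeff x l = 0 :=
  Prod.ext (eq_of_eval fun r => by rw [Prod.fst_zero, map_zero]; exact h₁ r)
    (eq_of_eval fun r => by rw [Prod.snd_zero, map_zero]; exact h₂ r)

theorem path_ext [CharZero R] {x y : Completed R (PathSpace R V)}
    (h₁ : ∀ r : R, evalAt V r x = evalAt V r y) (h₂ : ∀ r : R, evalForm V r x = evalForm V r y) :
    x = y := by
  refine coeff_ext fun l => sub_eq_zero.1 ?_
  rw [← coeff_sub]
  refine coeff_path_eq_zero (fun r => ?_) fun r => ?_
  · rw [map_sub, h₁, sub_self, coeff_zero]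
  · rw [map_sub, h₂, sub_self, coeff_zero]

variable {G : Type*} [Group G]

theorem evalAt_pathAction (ρ : Representation (NovikovRing R) G (Completed R V)) (g : G) (r : R)
    (x : Completed R (PathSpace R V)) : evalAt V r (pathAction ρ g x) = ρ g (evalAt V r x) := by
  rw [evalAt_eq, pathAction, map_add, functionPart_ofFunction, functionPart_ofForm, add_zero,
    extend_eval_polyExtend]
  rfl

theorem evalForm_pathAction (ρ : Representation (NovikovRing R) G (Completed R V)) (g : G) (r : R)
    (x : Completed R (PathSpace R V)) : evalForm V r (pathAction ρ g x) = ρ g (evalForm V r x) := by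
  rw [evalForm_eq, pathAction, map_add, formPart_ofFunction, formPart_ofForm, zero_add,
    extend_eval_polyExtend]
  rfl

variable (gr : ZMod (2 * N) → Submodule R V) [DirectSum.Decomposition gr] (m : Operations R V V)

theorem evalAt_formExtend (r : R) (k : ℕ) (z : Fin k → Completed R (PathSpace R V)) :
    evalAt V r (formExtend gr m k z) = m k fun j => evalAt V r (z j) := by
  rw [evalAt_eq, formExtend, _root_.add_apply, _root_.sum_apply, map_add, map_sum,
    LinearMap.compMultilinearMap_apply, functionPart_ofFunction, Finset.sum_eq_zero, add_zero,
    MultilinearMap.compLinearMap_apply, extend_eval_polyExtend]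
  · rfl
  · intro i _
    rw [LinearMap.compMultilinearMap_apply, functionPart_ofForm]

/-- For fixed `r` this is the pattern of `mixedArgs`: one form entry, functions on its left, and
functions changed by parity on its right. Form parts are therefore modelled by coderivations along
`Φ` and `Φ ∘ τ`. -/
theorem evalForm_formExtend (r : R) (k : ℕ) (z : Fin k → Completed R (PathSpace R V)) :
    evalForm V r (formExtend gr m k z) = ∑ i : Fin k, m k fun j =>
      if j < i then evalAt V r (z j) else if j = i then evalForm V r (z j)
      else extend (parity gr) (evalAt V r (z j)) := by
  rw [evalForm_eq, formExtend, _root_.add_apply, _root_.sum_apply, map_add, map_sum,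
    LinearMap.compMultilinearMap_apply, formPart_ofFunction, zero_add, map_sum]
  refine Finset.sum_congr rfl fun i _ => ?_
  rw [LinearMap.compMultilinearMap_apply, formPart_ofForm,
    MultilinearMap.compLinearMap_apply, extend_eval_polyExtend]
  congr 1
  funext j
  split_ifs
  · rfl
  · rfl
  · rw [LinearMap.comp_apply, evalAt_eq, extend_extend, extend_extend]
    congr 2
    refine LinearMap.ext fun p => ?_
    rw [LinearMap.comp_apply, LinearMap.comp_apply, PolynomialModule.eval_map']

theorem pathOperations_apply {k : ℕ} (hk : k ≠ 1) (z : Fin k → Completed R (PathSpace R V)) :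
    pathOperations gr m k z = formExtend gr m k z := by
  rcases k with _ | _ | k
  · rfl
  · exact absurd rfl hk
  · rfl

theorem pathOperations_one (z : Fin 1 → Completed R (PathSpace R V)) :
    pathOperations gr m 1 z = formExtend gr m 1 z + pathDifferential gr (z 0) := rfl

theorem evalAt_pathDifferential (r : R) (x : Completed R (PathSpace R V)) :
    evalAt V r (pathDifferential gr x) = 0 :=
  coeff_ext fun _ => map_zero (PolynomialModule.eval (M := V) r)

theorem coeff_evalForm_pathDifferential (r : R) (x : Completed R (PathSpace R V)) (l : ℝ≥0) :
    coeff (evalForm V r (pathDifferential gr x)) l =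
      parity gr (PolynomialModule.eval r (polyDerivative R V (coeff x l).1)) := by
  change PolynomialModule.eval r (polyDerivative R V (PolynomialModule.map R (parity gr)
    (coeff x l).1)) = _
  rw [← PolynomialModule.eval_map']
  congr 1
  have : polyDerivative R V ∘ₗ PolynomialModule.map R (parity gr) =
      PolynomialModule.map R (parity gr) ∘ₗ polyDerivative R V :=
    PolynomialModule.hom_ext fun n => LinearMap.ext fun v => by
      simp only [LinearMap.comp_apply, PolynomialModule.map_lsingle, polyDerivative_single, map_nsmul]
  exact LinearMap.congr_fun this _

theorem evalAt_pathOperations (r : R) (k : ℕ) (z : Fin k → Completed R (PathSpace R V)) :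
    evalAt V r (pathOperations gr m k z) = m k fun j => evalAt V r (z j) := by
  rcases eq_or_ne k 1 with rfl | hk
  · rw [pathOperations_one, map_add, evalAt_pathDifferential, add_zero, evalAt_formExtend]
  · rw [pathOperations_apply gr m hk, evalAt_formExtend]

end Evaluation

/-! ### Homotopies from families of morphisms of words -/

section Homotopy

variable {R : Type*} [Field R] {I J U V W G : Type*} [AddCommGroup U] [Module R U]
  [AddCommGroup V] [Module R V] [AddCommGroup W] [Module R W]
  {S : AddSubmonoid ℝ≥0} [hS : Discrete S] {N : ℕ}

theorem flat_postcomp_extend (b : Module.Basis I R U) (a : V →ₗ[R] W) (F : Operations R U V) :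
    flat S b (postcomp (extend a) F) = a ∘ₗ flat S b F :=
  bar_hom_ext fun ⟨u, l⟩ => by
    rw [LinearMap.comp_apply, flat_wd, flat_wd]
    rfl

theorem IsGapped.postcomp_extend {F : Operations R U V} (hF : IsGapped S F) (a : V →ₗ[R] W) :
    IsGapped S (AInf.postcomp (extend a) F) := hF.postcomp (suppIn_extend a)

theorem map_insertionSum (A : Completed R V →ₗ[NovikovRing R] Completed R W)
    (F : Operations R U V) (m : Operations R U U) (k : ℕ) (x : ℕ → Completed R U)
    (d : ℕ → ZMod (2 * N)) :
    A (insertionSum F m k x d) = insertionSum (postcomp A F) m k x d := by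
  simp only [insertionSum, map_sum, map_zsmul]
  rfl

section Path

variable (gr : ZMod (2 * N) → Submodule R V) [DirectSum.Decomposition gr] (m : Operations R V V)
  (H : Operations R U (PathSpace R V))

theorem evalAt_blockSum (r : R) (k : ℕ) (x : ℕ → Completed R U) (n : ℕ) :
    evalAt V r (blockSum (pathOperations gr m) H k x n) =
      blockSum m (postcomp (evalAt V r) H) k x n := by
  simp only [blockSum, map_sum, evalAt_pathOperations]
  rfl

/-- The differential of `R[t, dt]` belongs to `m₁`, so its extra term occurs for a single block
only. -/
theorem evalForm_blockSum (r : R) (k : ℕ) (x : ℕ → Completed R U) (n : ℕ) :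
    evalForm V r (blockSum (pathOperations gr m) H k x n) =
      ∑ c ∈ Finset.Nat.antidiagonalTuple n k, ∑ i, m n (mixedArgs (postcomp (evalAt V r) H)
        (postcomp (evalForm V r) H) (postcomp (extend (parity gr)) (postcomp (evalAt V r) H)) x c i) +
      if n = 1 then evalForm V r (pathDifferential gr (H k fun s => x s)) else 0 := by
  rw [blockSum, map_sum]
  by_cases hn : n = 1
  · subst hn
    rw [if_pos rfl, antidiagonalTuple_one, Finset.sum_singleton, Finset.sum_singleton,
      pathOperations_one, map_add, evalForm_formExtend]
    congr 2
    exact congrArg _ (blockArgs_one H x k 0)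
  · rw [if_neg hn, add_zero]
    refine Finset.sum_congr rfl fun c _ => ?_
    rw [pathOperations_apply gr m hn, evalForm_formExtend]
    rfl

end Path

theorem coeff_sum_mixedArgs {b : Module.Basis I R U} (b' : Module.Basis J R V)
    {F : Operations R V W} {f κ ψ : Operations R U V} (hF : IsGapped S F) (gf : IsGapped S f)
    (gκ : IsGapped S κ) (gψ : IsGapped S ψ) {Φ Ψ X : Bar R I S →ₗ[R] Bar R J S}
    (hX : IsCoder Φ Ψ X) (hΦ : IsComult Φ) (hΨ : IsComult Ψ) (hf : proj b' ∘ₗ Φ = flat S b f)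
    (hκ : proj b' ∘ₗ X = flat S b κ) (hψ : proj b' ∘ₗ Ψ = flat S b ψ)
    {x : ℕ → Completed R U} {u : List I} (hx : Spells b x u) {l : S} {E : ℝ≥0}
    (hl : (l : ℝ≥0) ≤ E) {n : ℕ} (hn : lengthBound S u.length E ≤ n) :
    coeff (∑ i ∈ Finset.range n, ∑ c ∈ Finset.Nat.antidiagonalTuple i u.length,
      ∑ j, F i (mixedArgs f κ ψ x c j)) l = flat S b' F (X (wd R ⟨u, l⟩)) := by
  have hlow : Lowers 0 X := hX.lowers hΦ hΨ b' fun m hm => by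
    rw [Word.eq_zero_of_weight (by omega : m.weight = 0), hX.one_eq, map_zero]
  rw [coeff_sum, ← sum_lenPart_of_lowers hlow hl hn, map_sum]
  refine Finset.sum_congr rfl fun i _ => ?_
  rw [← sum_cvec_mixedArgs b' hX hΨ hf hκ hψ i hx, map_sum, coeff_sum]
  refine Finset.sum_congr rfl fun c hc => ?_
  rw [map_sum, coeff_sum]
  refine Finset.sum_congr rfl fun j _ => hF.coeff_eq b' (fun j' => ?_) l
  rw [mixedArgs]
  split_ifs
  · exact blockArgs_suppIn gf hx hc j'
  · exact blockArgs_suppIn gκ hx hc j'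
  · exact blockArgs_suppIn gψ hx hc j'

theorem suppIn_sum_mixedArgs {b : Module.Basis I R U}
    {F : Operations R V W} {f κ ψ : Operations R U V} (hF : IsGapped S F) (gf : IsGapped S f)
    (gκ : IsGapped S κ) (gψ : IsGapped S ψ) {x : ℕ → Completed R U} {u : List I}
    (hx : Spells b x u) (n : ℕ) :
    SuppIn S (∑ i ∈ Finset.range n, ∑ c ∈ Finset.Nat.antidiagonalTuple i u.length,
      ∑ j, F i (mixedArgs f κ ψ x c j)) := by
  refine suppIn_sum fun i _ => suppIn_sum fun c hc => suppIn_sum fun j _ => hF.suppIn fun j' => ?_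
  rw [mixedArgs]
  split_ifs
  · exact blockArgs_suppIn gf hx hc j'
  · exact blockArgs_suppIn gκ hx hc j'
  · exact blockArgs_suppIn gψ hx hc j'

theorem Model.Adapted.parity_eq {M : Model R I V G N} {gr : ZMod (2 * N) → Submodule R V}
    [DirectSum.Decomposition gr] (hM : M.Adapted gr) : parity gr = M.sgn := by
  refine M.b.ext fun i => ?_
  have h := hM.basis_mem i
  rw [parity, LinearMap.comp_apply, LinearEquiv.coe_coe, DirectSum.decomposeLinearEquiv_apply,
    DirectSum.decompose_of_mem gr h]
  refine (DirectSum.toModule_lof R _ _).trans ?_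
  rw [LinearMap.smul_apply, add_sub_cancel_right, Model.sgn, Module.Basis.constr_basis]
  rfl

/-- The projection to the homogeneous part fixes all values of `p`, hence `p` itself, and it acts on
polynomials coefficientwise. -/
theorem Model.Adapted.coeff_mem_of_eval [CharZero R] {M : Model R I V G N}
    {gr : ZMod (2 * N) → Submodule R V} (hM : M.Adapted gr) {d : ZMod (2 * N)}
    {p : PolynomialModule R V} (h : ∀ r, PolynomialModule.eval r p ∈ gr (d + 1)) (n : ℕ) :
    p.coeff n ∈ gr (d + 1) := by
  have h1 : PolynomialModule.map R (M.vec.pr d) p = p := eq_of_eval fun r => by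
    rw [PolynomialModule.eval_map']
    exact hM.mem_iff.1 (h r)
  have h2 : polyCoeff R V n ∘ₗ PolynomialModule.map R (M.vec.pr d) =
      M.vec.pr d ∘ₗ polyCoeff R V n := PolynomialModule.hom_ext fun i => LinearMap.ext fun v => by
    simp only [LinearMap.comp_apply, PolynomialModule.map_lsingle, polyCoeff_apply,
      PolynomialModule.lsingle_apply]
    split_ifs
    · rfl
    · rw [map_zero]
  rw [hM.mem_iff]
  refine (LinearMap.congr_fun h2 p).symm.trans ?_
  rw [LinearMap.comp_apply, h1]
  rfl

theorem tau_comm_of_map_pr {M : Model R I U G N} {M' : Model R J V G N}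
    {X : Bar R I S →ₗ[R] Bar R J S}
    (h : ∀ d q, X ((M.bar S).pr d q) = (M'.bar S).pr (d + 0) (X q)) (q : Bar R I S) :
    X (M.tau S q) = M'.tau S (X q) := by
  have h1 : Good (M.forget.bar S) (M'.forget.bar S) 0 X := ⟨fun g => g.elim, h⟩
  have h2 := h1.sign_comm M.forget.isSign_bar M'.forget.isSign_bar q
  rw [sign_zero, one_smul] at h2
  exact h2

theorem IsAInfAction.suppIn [Group G] {gr : ZMod (2 * N) → Submodule R V} {m : Operations R V V}
    {ρ : Representation (NovikovRing R) G (Completed R V)} (hρ : IsAInfAction S gr m ρ) (g : G)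
    (v : V) : SuppIn S (ρ g (const v)) := hρ.gapped g v

/-- A homotopy from a polynomial family of morphisms of words. -/
theorem areGHomotopic_of_family [CharZero R] [Group G] {M : Model R I V G N}
    {gr : ZMod (2 * N) → Submodule R V} [DirectSum.Decomposition gr] (hM : M.Adapted gr)
    {m : Operations R V V} (hm : IsFilteredAInfAlgebra S gr m)
    {ρ : Representation (NovikovRing R) G (Completed R V)} (hρ : IsAInfAction S gr m ρ)
    {D : Bar R I S →ₗ[R] Bar R I S} (hD : IsCoder (M.tau S) LinearMap.id D)
    (hmD : proj M.b ∘ₗ D = flat S M.b m) {Φ X : R → Bar R I S →ₗ[R] Bar R I S}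
    (hΦ : ∀ r, IsComult (Φ r))
    (gΦ : ∀ r, Good (M.twisted (S := S) fun g => ρ g) (M.twisted fun g => ρ g) 0 (Φ r))
    (hΦD : ∀ r q, Φ r (D q) = D (Φ r q)) (hX : ∀ r, IsCoder (Φ r) (Φ r ∘ₗ M.tau S) (X r))
    (gX : ∀ r, Good (M.twisted (S := S) fun g => ρ g) (M.twisted fun g => ρ g) (-1) (X r))
    {P Q : Bar R I S →ₗ[R] PolynomialModule R V}
    (hP : ∀ r q, PolynomialModule.eval r (P q) = proj M.b (Φ r q))
    (hQ : ∀ r q, PolynomialModule.eval r (Q q) = proj M.b (X r q))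
    (hPQ : ∀ r q, PolynomialModule.eval r (polyDerivative R V (P q)) =
      M.sgn (proj M.b (X r (D q)) - proj M.b (D (X r q))))
    {φ φ' : Operations R V V} (gφ : IsGapped S φ) (gφ' : IsGapped S φ')
    (h0 : proj M.b ∘ₗ Φ 0 = flat S M.b φ) (h1 : proj M.b ∘ₗ Φ 1 = flat S M.b φ') :
    AreGHomotopic S gr m ρ gr m ρ φ φ' := by
  have hflat : flat S M.b (sharp M.b (P.prod Q)) = P.prod Q := flat_sharp _ _
  have gH : IsGapped S (sharp M.b (P.prod Q)) := isGapped_sharp _ _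
  -- `P` is the function part and `Q` the coefficient of `dt`. At a given `r` they are the
  -- components of `Φ r` and of `X r`.
  obtain ⟨H, hH⟩ : ∃ H, H = sharp M.b (P.prod Q) := ⟨_, rfl⟩
  rw [← hH] at hflat gH
  have gA : ∀ r : R, IsGapped S (postcomp (evalAt V r) H) := fun r => gH.postcomp_extend _
  have gF : ∀ r : R, IsGapped S (postcomp (evalForm V r) H) := fun r => gH.postcomp_extend _
  have fA : ∀ r : R, proj M.b ∘ₗ Φ r = flat S M.b (postcomp (evalAt V r) H) := fun r => by
    rw [evalAt, flat_postcomp_extend, hflat]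
    exact LinearMap.ext fun q => (hP r q).symm
  have fF : ∀ r : R, proj M.b ∘ₗ X r = flat S M.b (postcomp (evalForm V r) H) := fun r => by
    rw [evalForm, flat_postcomp_extend, hflat]
    exact LinearMap.ext fun q => (hQ r q).symm
  have hψ : ∀ r : R, IsComult (Φ r ∘ₗ M.tau S) := fun r => (hΦ r).comp M.isComult_tau
  have gψ : ∀ r : R, IsGapped S (postcomp (extend (parity gr)) (postcomp (evalAt V r) H)) :=
    fun r => (gA r).postcomp_extend _
  have fψ : ∀ r : R, proj M.b ∘ₗ Φ r ∘ₗ M.tau S =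
      flat S M.b (postcomp (extend (parity gr)) (postcomp (evalAt V r) H)) := fun r => by
    rw [flat_postcomp_extend, ← fA, hM.parity_eq]
    refine LinearMap.ext fun q => ?_
    rw [LinearMap.comp_apply, LinearMap.comp_apply, tau_comm_of_map_pr (gΦ r).map_pr]
    exact proj_strict _ _ _ _
  have hend : ∀ (r : R) (φ : Operations R V V), IsGapped S φ → proj M.b ∘ₗ Φ r = flat S M.b φ →
      ∀ k, (evalAt V r).compMultilinearMap (H k) = φ k := fun r φ gφ h k =>
    congrFun ((gA r).ext M.b gφ ((fA r).symm.trans h)) k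
  refine ⟨H, ⟨?_, gH, ?_, ?_⟩, ?_, hend 0 φ gφ h0, hend 1 φ' gφ' h1⟩
  · refine hM.degree_of_pr gH fun w => ?_
    rw [hflat, pathGrading, Submodule.mem_iInf]
    intro n
    refine ⟨hM.coeff_mem_of_eval (fun r => ?_) n, ?_⟩
    · change PolynomialModule.eval r (P (wd R w)) ∈ _
      rw [hP]
      exact flat_mem_of_good hM (gΦ r) w
    · have h := hM.coeff_mem_of_eval (p := Q (wd R w)) (d := wordDeg M.deg w + -1)
        (fun r => by
          rw [hQ]
          exact flat_mem_of_good hM (gX r) w) n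
      rw [neg_add_cancel_right] at h
      rw [SetLike.mem_coe, add_zero, add_sub_cancel_right]
      exact h
  · intro x
    have h : ∀ y : Fin 0 → Completed R V, coeff (H 0 y) 0 = flat S M.b H (wd R 0) := fun y => by
      rw [Subsingleton.elim y fun j => const (M.b (([] : List I).get j))]
      exact (flat_wd M.b H [] 0).symm
    rw [h, hflat]
    refine Prod.ext (eq_of_eval fun r => ?_) (eq_of_eval fun r => ?_)
    · refine (hP r _).trans ?_
      rw [(hΦ r).one_eq, proj_zero]
      exact (map_zero _).symm
    · refine (hQ r _).trans ?_
      rw [(hX r).one_eq, map_zero]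
      exact (map_zero _).symm
  · intro k x d hx
    refine hasAdicSum_of_words (S := S) M.b _ H (IsMultilinearOn.insertion H m k d)
      (fun s => {i | M.deg i = d s}) (fun x u hu hux hd E n hn => ?_) fun s hs l =>
        hM (d s) ▸ hx s hs l
    subst hu
    have hd' : ∀ (s : ℕ) (h : s < u.length), d s = M.deg u[s] := fun s hs => (hd s hs).symm
    intro l hl
    refine coeff_path_eq_zero (fun r => ?_) fun r => ?_
    · rw [map_sub, map_insertionSum, map_sum]
      simp only [evalAt_blockSum]
      refine sum_blockSum_mem M.b hm.gapped (gA r) (hΦ r) (fA r) hux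
        (suppIn_insertionSum (gA r) hm.gapped hux d) (fun l => ?_) hn l hl
      rw [coeff_insertionSum M (gA r) hm.gapped hD hmD hux hd', ← fA, ← hmD, LinearMap.comp_apply,
        LinearMap.comp_apply, hΦD]
    -- In the form part the differential of `R[t, dt]` contributes the parity of the derivative of
    -- `P`. By `hPQ` this is `sgn` applied twice to `X D - D X`, and `sgn` is an involution, so the
    -- relation balances.
    · rw [map_sub, map_insertionSum, map_sum]
      simp only [evalForm_blockSum]
      rw [Finset.sum_add_distrib, Finset.sum_ite_eq' (Finset.range n) 1, if_pos (by
        rw [Finset.mem_range]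
        simp only [lengthBound] at hn
        omega)]
      by_cases hlS : l ∈ S
      · rw [coeff_sub, coeff_add, coeff_evalForm_pathDifferential]
        rw [coeff_insertionSum M (gF r) hm.gapped hD hmD hux hd' ⟨l, hlS⟩,
          coeff_sum_mixedArgs M.b hm.gapped (gA r) (gF r) (gψ r) (hX r) (hΦ r) (hψ r) (fA r) (fF r)
            (fψ r) hux (l := ⟨l, hlS⟩) hl.le hn, flat_wd_seq M.b H rfl hux ⟨l, hlS⟩, hflat,
          hM.parity_eq, show ∀ q, ((P.prod Q) q).1 = P q from fun _ => rfl, hPQ, ← fF, ← hmD, LinearMap.comp_apply,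
          LinearMap.comp_apply]
        have h := LinearMap.congr_fun M.isSign_vec.comp_self
          (proj M.b (X r (D (wd R ⟨u, ⟨l, hlS⟩⟩))) - proj M.b (D (X r (wd R ⟨u, ⟨l, hlS⟩⟩))))
        rw [LinearMap.comp_apply, LinearMap.id_apply] at h
        rw [h]
        abel
      · by_contra h
        refine hlS ?_
        refine SuppIn.sub (suppIn_insertionSum (gF r) hm.gapped hux d) (fun l h => ?_) l h
        by_contra hl'
        refine h ?_
        have e1 := suppIn_sum_mixedArgs hm.gapped (gA r) (gF r) (gψ r) hux n l
        have e2 := gH.suppIn (y := fun j : Fin u.length => x j) (fun j => hux.suppIn j.2) l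
        rw [coeff_add, coeff_evalForm_pathDifferential, not_not.1 (fun h => hl' (e1 h)),
          not_not.1 (fun h => hl' (e2 h)), Prod.fst_zero, map_zero, map_zero, map_zero, add_zero]
  · intro g k x
    refine path_ext (fun r => ?_) fun r => ?_
    · rw [evalAt_pathAction]
      exact (flat_comp_linHat (hρ.suppIn g) (hρ.suppIn g) (gA r)
        ((hΦ r).lenPart_one M.b (fA r))).2 (fun q => by
          rw [← fA]
          exact congrArg (proj M.b) ((gΦ r).map_act g q)) k x
    · rw [evalForm_pathAction]
      exact (flat_comp_linHat (hρ.suppIn g) (hρ.suppIn g) (gF r)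
        ((hX r).lenPart_one M.b (hψ r) (fF r))).2 (fun q => by
          rw [← fF]
          exact congrArg (proj M.b) ((gX r).map_act g q)) k x

end Homotopy

/-! ### Presentations of algebras with actions -/

section Presentation

variable {R : Type*} [Field R] {I J V W G : Type*} [AddCommGroup V] [Module R V]
  [AddCommGroup W] [Module R W] {S : AddSubmonoid ℝ≥0} [hS : Discrete S] {N : ℕ} [Group G]

/-- The differential `D` on words presents the algebra `(C, m)`, and the mutually inverse
isomorphisms `A`, `A'` make the action on it strict. -/
structure IsPresentation (gr : ZMod (2 * N) → Submodule R V) (m : Operations R V V)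
    (ρ : Representation (NovikovRing R) G (Completed R V)) (M : Model R I V G N)
    (D A A' : Bar R I S →ₗ[R] Bar R I S) : Prop where
  adapted : M.Adapted gr
  actPr : M.ActPr
  act_mul : ∀ g h v, M.act (g * h) v = M.act g (M.act h v)
  act_one : ∀ v, M.act 1 v = v
  isCoder : IsCoder (M.tau S) LinearMap.id D
  proj_eq : proj M.b ∘ₗ D = flat S M.b m
  differential : ∀ q, D (D q) = 0
  good : Good (M.twisted (S := S) fun g => ρ g) (M.twisted fun g => ρ g) 1 D
  isComult : IsComult A
  isComult_symm : IsComult A'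
  apply_symm : ∀ q, A (A' q) = q
  symm_apply : ∀ q, A' (A q) = q
  good_iso : Good (M.bar S) (M.twisted fun g => ρ g) 0 A
  good_symm : Good (M.twisted fun g => ρ g) (M.bar S) 0 A'
  lead_iso : lead M.b M.b A = LinearMap.id
  lead_symm : lead M.b M.b A' = LinearMap.id

/-- As `D` anticommutes with the sign operator, `D D + D D` is a coderivation. Its component
vanishes by hypothesis, and two is invertible. -/
theorem comp_self_eq_zero [CharZero R] {M : Model R I V G N} {D : Bar R I S →ₗ[R] Bar R I S}
    (hD : IsCoder (M.tau S) LinearMap.id D)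
    (h : ∀ d q, D ((M.bar S).pr d q) = (M.bar S).pr (d + 1) (D q))
    (hpD : proj M.b ∘ₗ D ∘ₗ D = 0) (q : Bar R I S) : D (D q) = 0 := by
  have h1 : Good (M.forget.bar S) (M.forget.bar S) 1 D := ⟨fun g => g.elim, h⟩
  have h2 : D ∘ₗ M.tau S = -(M.tau S ∘ₗ D) := Model.tau_anticomm (M := M.forget) (M' := M.forget) h1 sign_one
  have h3 := hD.comp_add_comp hD hD hD rfl rfl h2 rfl h2 rfl
  have h4 := h3.eq_zero (M.isComult_tau.comp M.isComult_tau).one_eq M.b (by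
    rw [LinearMap.comp_add, hpD, add_zero])
  have h5 := LinearMap.congr_fun h4 q
  rw [LinearMap.add_apply, LinearMap.comp_apply, LinearMap.zero_apply, ← two_smul R] at h5
  exact (smul_eq_zero.1 h5).resolve_left two_ne_zero

universe v in
theorem exists_presentation [CharZero R] [Finite G] {V : Type v} [AddCommGroup V] [Module R V]
    {gr : ZMod (2 * N) → Submodule R V} [DirectSum.Decomposition gr] {m : Operations R V V}
    (hm : IsFilteredAInfAlgebra S gr m) {ρ : Representation (NovikovRing R) G (Completed R V)}
    (hρ : IsAInfAction S gr m ρ) :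
    ∃ (I : Type v) (M : Model R I V G N) (D A A' : Bar R I S →ₗ[R] Bar R I S),
      IsPresentation gr m ρ M D A A' := by
  obtain ⟨I, b, deg, hb⟩ := exists_adapted_basis gr
  obtain ⟨M, -, -, hM, hpr, hmul, hone, A, A', cA, cA', h1, h2, gA, gA', lA, lA'⟩ :=
    exists_straightening (S := S) b deg hb hρ.degree hρ.suppIn
  have h0 := flat_zero (S := S) M.b hm.curvature
  have cD := isCoder_coder M.b (M.isComult_tau (E := S)) IsComult.id h0
  have pD : proj M.b ∘ₗ coder M.b (M.tau S) LinearMap.id (flat S M.b m) = flat S M.b m :=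
    LinearMap.ext (proj_coder M.b M.isComult_tau IsComult.id h0)
  have gD := good_twisted_coder hM hm.degree hm.gapped hρ cD pD
  have DD := flat_comp_eq_zero hM hm.gapped cD pD hm.relation
  refine ⟨I, M, _, A, A', hM, hpr, hmul, hone, cD, pD,
    comp_self_eq_zero cD gD.map_pr ?_, gD, cA, cA', h1, h2, gA, gA', lA, lA'⟩
  rw [← LinearMap.comp_assoc, pD, DD]

theorem IsComult.lead_comp {K U : Type*} [AddCommGroup U] [Module R U] {Φ : Bar R I S →ₗ[R] Bar R J S}
    (hΦ : IsComult Φ) (c : Module.Basis I R V) (b : Module.Basis J R W) (b' : Module.Basis K R U)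
    (Y : Bar R J S →ₗ[R] Bar R K S) :
    lead c b' (Y ∘ₗ Φ) = lead b b' Y ∘ₗ lead c b Φ := AInf.lead_comp (hΦ.single c b)

namespace IsPresentation

variable {gr : ZMod (2 * N) → Submodule R V} {m : Operations R V V}
  {ρ : Representation (NovikovRing R) G (Completed R V)} {M : Model R I V G N}
  {D A A' : Bar R I S →ₗ[R] Bar R I S}

theorem isCoder_conj (h : IsPresentation gr m ρ M D A A') :
    IsCoder (M.tau S) LinearMap.id (A' ∘ₗ D ∘ₗ A) :=
  Model.isCoder_conj (M := M.forget) (M' := M.forget) h.isCoder h.isComult_symm h.isComult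
    ⟨fun g => g.elim, h.good_symm.map_pr⟩ (LinearMap.ext h.symm_apply)

theorem conj_conj (h : IsPresentation gr m ρ M D A A') (q : Bar R I S) :
    (A' ∘ₗ D ∘ₗ A) ((A' ∘ₗ D ∘ₗ A) q) = 0 := by
  simp only [LinearMap.comp_apply, h.apply_symm, h.differential, map_zero]

theorem good_conj (h : IsPresentation gr m ρ M D A A') :
    Good (M.bar S) (M.bar S) 1 (A' ∘ₗ D ∘ₗ A) :=
  h.good_symm.comp (h.good.comp h.good_iso (zero_add _)) (add_zero _)

/-- Straightening has identity linear part, so it does not change the reduced complex. -/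
theorem lead_conj (h : IsPresentation gr m ρ M D A A') (v : V) :
    lead M.b M.b (A' ∘ₗ D ∘ₗ A) v = linearPart m v := by
  rw [← LinearMap.comp_assoc, h.isComult.lead_comp M.b M.b, h.lead_iso, LinearMap.comp_id,
    lead_comp (h.isCoder.single M.isComult_tau IsComult.id M.b M.b), h.lead_symm,
    LinearMap.id_comp, lead_of_flat M.b M.b h.proj_eq]

/-- Morphisms of words that deform to the identity give homotopies. -/
theorem areGHomotopic_id [CharZero R] [DirectSum.Decomposition gr]
    (h : IsPresentation gr m ρ M D A A') (hm : IsFilteredAInfAlgebra S gr m)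
    (hρ : IsAInfAction S gr m ρ) {φ : Bar R I S →ₗ[R] Bar R I S} (hφ : IsComult φ)
    (gφ : Good (M.bar S) (M.bar S) 0 φ)
    (hφD : ∀ q, φ ((A' ∘ₗ D ∘ₗ A) q) = (A' ∘ₗ D ∘ₗ A) (φ q)) (hφφ : ∀ q, φ (φ q) = φ q)
    {k : V →ₗ[R] V} (gk : Good M.vec M.vec (-1) k)
    (c : Contraction (lead M.b M.b (A' ∘ₗ D ∘ₗ A)) k (lead M.b M.b φ)) {p : Operations R V V}
    (gp : IsGapped S p) (hp : proj M.b ∘ₗ A ∘ₗ φ ∘ₗ A' = flat S M.b p) :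
    AreGHomotopic S gr m ρ gr m ρ p (idHom R V) := by
  obtain ⟨Φ, X, Y, cΦ, gΦ, ΦD, cX, gX, Φ0, Φ1, pΦ, pX, hY, pY, hYX⟩ :=
    Model.exists_homotopy_family h.actPr h.isCoder_conj h.conj_conj h.good_conj hφ gφ hφD hφφ gk c
  have tA := tau_comm_of_map_pr h.good_iso.map_pr
  have tA' := tau_comm_of_map_pr h.good_symm.map_pr
  have eD : ∀ q, (A' ∘ₗ D ∘ₗ A) (A' q) = A' (D q) := fun q => by
    simp only [LinearMap.comp_apply, h.apply_symm]
  have eD' : ∀ q, A ((A' ∘ₗ D ∘ₗ A) q) = D (A q) := fun q => by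
    simp only [LinearMap.comp_apply, h.apply_symm]
  obtain ⟨P, Q, hP, hQ, hPQ⟩ := M.exists_polynomial_components (D := D)
    (Φ := fun r => A ∘ₗ Φ r ∘ₗ A') (X := fun r => A ∘ₗ X r ∘ₗ A')
    (Y := fun r' r => A ∘ₗ Y r' r ∘ₗ A') (fun q => (pΦ (A' q)).map A) (fun q => (pX (A' q)).map A)
    (fun r' r q => by
      simp only [LinearMap.comp_apply]
      rw [← map_sub, hY, map_smul])
    (fun r q => (pY r (A' q)).map A)
    (fun r q => by
      simp only [LinearMap.comp_apply]
      rw [hYX, tA, map_sub, eD, eD'])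
  refine areGHomotopic_of_family h.adapted hm hρ h.isCoder h.proj_eq
    (fun r => h.isComult.comp ((cΦ r).comp h.isComult_symm))
    (fun r => h.good_iso.comp ((gΦ r).comp h.good_symm (add_zero _)) (add_zero _))
    (fun r q => ?_) (fun r => ?_)
    (fun r => h.good_iso.comp ((gX r).comp h.good_symm (zero_add _)) (add_zero _)) hP hQ hPQ gp
    isGapped_idHom ?_ ?_
  · simp only [LinearMap.comp_apply]
    rw [← eD, ΦD, eD']
  · have h1 := h.isComult.comp_coder ((cX r).comp h.isComult_symm)
    have h2 : A ∘ₗ (Φ r ∘ₗ M.tau S) ∘ₗ A' = (A ∘ₗ Φ r ∘ₗ A') ∘ₗ M.tau S :=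
      LinearMap.ext fun q => by
        simp only [LinearMap.comp_apply]
        rw [tA']
    rwa [h2] at h1
  · rw [Φ0, hp]
  · rw [Φ1, flat_idHom]
    exact LinearMap.ext fun q => congrArg (proj M.b) (h.apply_symm q)

end IsPresentation

end Presentation

/-! ### The quasi-inverse of an equivariant weak homotopy equivalence -/

section QuasiInverse

variable {R : Type*} [Field R] {I J V W G : Type*} [AddCommGroup V] [Module R V]
  [AddCommGroup W] [Module R W] {S : AddSubmonoid ℝ≥0} [hS : Discrete S] {N : ℕ} [Group G]
  {gr₁ : ZMod (2 * N) → Submodule R V} {m₁ : Operations R V V}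
  {ρ₁ : Representation (NovikovRing R) G (Completed R V)} {M₁ : Model R I V G N}
  {D₁ A₁ A₁' : Bar R I S →ₗ[R] Bar R I S}
  {gr₂ : ZMod (2 * N) → Submodule R W} {m₂ : Operations R W W}
  {ρ₂ : Representation (NovikovRing R) G (Completed R W)} {M₂ : Model R J W G N}
  {D₂ A₂ A₂' : Bar R J S →ₗ[R] Bar R J S}

/-- Having degree zero, `Φ` commutes with the sign operators, so both composites are coderivations
along the same pair. Their components agree by the `A∞` relation for `f`. -/
theorem IsPresentation.comult_comm (h₁ : IsPresentation gr₁ m₁ ρ₁ M₁ D₁ A₁ A₁')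
    (h₂ : IsPresentation gr₂ m₂ ρ₂ M₂ D₂ A₂ A₂') (hm₁ : IsGapped S m₁) (hm₂ : IsGapped S m₂)
    {f : Operations R V W} (hf : IsFilteredAInfHom S gr₁ m₁ gr₂ m₂ f)
    {Φ : Bar R I S →ₗ[R] Bar R J S} (hΦ : IsComult Φ) (hfΦ : proj M₂.b ∘ₗ Φ = flat S M₁.b f)
    (gΦ : Good (M₁.twisted (S := S) fun g => ρ₁ g) (M₂.twisted fun g => ρ₂ g) 0 Φ)
    (q : Bar R I S) : Φ (D₁ q) = D₂ (Φ q) := by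
  have h := flat_comp_of_relation M₂.b h₁.adapted hm₁ hm₂ hf.gapped h₁.isCoder h₁.proj_eq hΦ hfΦ
    hf.relation
  have c₁ := hΦ.comp_coder h₁.isCoder
  have c₂ := h₂.isCoder.comp hΦ
  rw [LinearMap.comp_id, show Φ ∘ₗ M₁.tau S = M₂.tau S ∘ₗ Φ from
    LinearMap.ext (tau_comm_of_map_pr gΦ.map_pr)] at c₁
  refine LinearMap.congr_fun (c₁.ext c₂ (M₂.isComult_tau.comp hΦ).one_eq M₂.b ?_) q
  rw [← LinearMap.comp_assoc, ← LinearMap.comp_assoc, hfΦ, h₂.proj_eq, h]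

/-- The morphism of algebras given by a morphism of words. -/
theorem IsPresentation.exists_hom [CharZero R] (h₁ : IsPresentation gr₁ m₁ ρ₁ M₁ D₁ A₁ A₁')
    (h₂ : IsPresentation gr₂ m₂ ρ₂ M₂ D₂ A₂ A₂') (hm₁ : IsFilteredAInfAlgebra S gr₁ m₁)
    (hm₂ : IsFilteredAInfAlgebra S gr₂ m₂) (hρ₁ : IsAInfAction S gr₁ m₁ ρ₁)
    (hρ₂ : IsAInfAction S gr₂ m₂ ρ₂) {Φ : Bar R I S →ₗ[R] Bar R J S} (hΦ : IsComult Φ)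
    (gΦ : Good (M₁.twisted (S := S) fun g => ρ₁ g) (M₂.twisted fun g => ρ₂ g) 0 Φ)
    (hΦD : ∀ q, Φ (D₁ q) = D₂ (Φ q)) :
    IsFilteredAInfHom S gr₁ m₁ gr₂ m₂ (sharp M₁.b (proj M₂.b ∘ₗ Φ)) ∧
      IsEquivariant (fun g => ρ₁ g) (fun g => ρ₂ g) (sharp M₁.b (proj M₂.b ∘ₗ Φ)) := by
  have hflat := flat_sharp M₁.b (proj M₂.b ∘ₗ Φ)
  have gf := isGapped_sharp M₁.b (proj M₂.b ∘ₗ Φ)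
  refine ⟨⟨?_, gf, ?_, ?_⟩, fun g => ?_⟩
  · refine h₁.adapted.degree_of_pr gf fun w => ?_
    rw [hflat]
    exact flat_mem_of_good h₂.adapted gΦ w
  · intro x
    rw [Subsingleton.elim x fun j => const (M₁.b (([] : List I).get j))]
    refine (flat_wd M₁.b (sharp M₁.b (proj M₂.b ∘ₗ Φ)) [] (0 : S)).symm.trans ?_
    rw [hflat]
    exact (congrArg (proj M₂.b) hΦ.one_eq).trans (proj_zero _)
  · refine relation_of_flat_comp M₂.b h₁.adapted hm₁.gapped hm₂.gapped gf h₁.isCoder h₁.proj_eq hΦ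
      hflat.symm (LinearMap.ext fun q => ?_)
    rw [hflat, ← h₂.proj_eq]
    exact congrArg (proj M₂.b) (hΦD q).symm
  · refine (flat_comp_linHat (hρ₁.suppIn g) (hρ₂.suppIn g) gf
      (hΦ.lenPart_one M₂.b hflat.symm)).2 fun q => ?_
    rw [hflat]
    exact congrArg (proj M₂.b) (gΦ.map_act g q)

end QuasiInverse

end AInf

end

/-! ### The main theorem: passage to straightened words and back. -/

theorem mainTheorem9 {R : Type*} [Field R] [CharZero R] {G : Type*} [Group G] [Finite G]
    (N : ℕ) (S : AddSubmonoid ℝ≥0) (hS : ∀ E : ℝ≥0, ((S : Set ℝ≥0) ∩ Set.Iic E).Finite)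
    {V₁ : Type*} [AddCommGroup V₁] [Module R V₁]
    (gr₁ : ZMod (2 * N) → Submodule R V₁) [DirectSum.Decomposition gr₁]
    (m₁ : AInf.Operations R V₁ V₁) (hm₁ : AInf.IsFilteredAInfAlgebra S gr₁ m₁)
    (ρ₁ : Representation (AInf.NovikovRing R) G (AInf.Completed R V₁))
    (hρ₁ : AInf.IsAInfAction S gr₁ m₁ ρ₁)
    {V₂ : Type*} [AddCommGroup V₂] [Module R V₂]
    (gr₂ : ZMod (2 * N) → Submodule R V₂) [DirectSum.Decomposition gr₂]
    (m₂ : AInf.Operations R V₂ V₂) (hm₂ : AInf.IsFilteredAInfAlgebra S gr₂ m₂)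
    (ρ₂ : Representation (AInf.NovikovRing R) G (AInf.Completed R V₂))
    (hρ₂ : AInf.IsAInfAction S gr₂ m₂ ρ₂)
    (f : AInf.Operations R V₁ V₂) (hf : AInf.IsFilteredAInfHom S gr₁ m₁ gr₂ m₂ f)
    (hfG : AInf.IsEquivariant (fun g => ρ₁ g) (fun g => ρ₂ g) f)
    (hfw : AInf.IsWeakHomotopyEquiv m₁ m₂ f) :
    ∃ h : AInf.Operations R V₂ V₁,
      AInf.IsFilteredAInfHom S gr₂ m₂ gr₁ m₁ h ∧
      AInf.IsEquivariant (fun g => ρ₂ g) (fun g => ρ₁ g) h ∧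
      (∃ p : AInf.Operations R V₁ V₁, AInf.IsComposition h f p ∧
        AInf.AreGHomotopic S gr₁ m₁ ρ₁ gr₁ m₁ ρ₁ p (AInf.idHom R V₁)) ∧
      (∃ q : AInf.Operations R V₂ V₂, AInf.IsComposition f h q ∧
        AInf.AreGHomotopic S gr₂ m₂ ρ₂ gr₂ m₂ ρ₂ q (AInf.idHom R V₂)) := by
  have : AInf.Discrete S := ⟨hS⟩
  obtain ⟨I, M₁, D₁, A₁, A₁', h₁⟩ := AInf.exists_presentation hm₁ hρ₁
  obtain ⟨J, M₂, D₂, A₂, A₂', h₂⟩ := AInf.exists_presentation hm₂ hρ₂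
  obtain ⟨F, hF⟩ : ∃ F, F = AInf.hat M₂.b (AInf.flat S M₁.b f) := ⟨_, rfl⟩
  have f0 := AInf.flat_zero (S := S) M₁.b hf.curvature
  have cF : AInf.IsComult F := hF ▸ AInf.isComult_hat M₂.b f0
  have pF : AInf.proj M₂.b ∘ₗ F = AInf.flat S M₁.b f :=
    LinearMap.ext fun q => hF ▸ AInf.proj_hat M₂.b f0 q
  have gF := AInf.good_twisted_comult h₁.adapted h₂.adapted hf.degree hf.gapped hρ₁.suppIn
    hρ₂.suppIn hfG cF pF
  have FD := h₁.comult_comm h₂ hm₁.gapped hm₂.gapped hf cF pF gF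
  -- In straightened coordinates the actions are strict, so `F'` is equivariant in the sense
  -- required by the constructions on words.
  obtain ⟨F', hF'⟩ : ∃ F', F' = A₂' ∘ₗ F ∘ₗ A₁ := ⟨_, rfl⟩
  have F'_apply : ∀ q, F' q = A₂' (F (A₁ q)) := fun q => by rw [hF']; rfl
  have cF' : AInf.IsComult F' := hF' ▸ h₂.isComult_symm.comp (cF.comp h₁.isComult)
  have gF' : AInf.Good (M₁.bar S) (M₂.bar S) 0 F' :=
    hF' ▸ h₂.good_symm.comp (gF.comp h₁.good_iso (zero_add _)) (add_zero _)
  have lF' : ∀ v, AInf.lead M₁.b M₂.b F' v = AInf.linearPart f v := fun v => by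
    rw [hF', ← LinearMap.comp_assoc, h₁.isComult.lead_comp M₁.b M₁.b, h₁.lead_iso,
      LinearMap.comp_id, cF.lead_comp M₁.b M₂.b, h₂.lead_symm, LinearMap.id_comp,
      AInf.lead_of_flat M₁.b M₂.b pF]
  obtain ⟨E₁, hE₁⟩ : ∃ E₁, E₁ = A₁' ∘ₗ D₁ ∘ₗ A₁ := ⟨_, rfl⟩
  obtain ⟨E₂, hE₂⟩ : ∃ E₂, E₂ = A₂' ∘ₗ D₂ ∘ₗ A₂ := ⟨_, rfl⟩
  have E₁_apply : ∀ q, E₁ q = A₁' (D₁ (A₁ q)) := fun q => by rw [hE₁]; rfl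
  have E₂_apply : ∀ q, E₂ q = A₂' (D₂ (A₂ q)) := fun q => by rw [hE₂]; rfl
  have cE₁ := h₁.isCoder_conj
  have cE₂ := h₂.isCoder_conj
  have EE₁ := h₁.conj_conj
  have EE₂ := h₂.conj_conj
  have gE₁ := h₁.good_conj
  have gE₂ := h₂.good_conj
  have lE₁ := h₁.lead_conj
  have lE₂ := h₂.lead_conj
  rw [← hE₁] at cE₁ EE₁ gE₁ lE₁
  rw [← hE₂] at cE₂ EE₂ gE₂ lE₂
  have F'E : ∀ q, F' (E₁ q) = E₂ (F' q) := fun q => by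
    rw [F'_apply, F'_apply, E₁_apply, E₂_apply, h₁.apply_symm, h₂.apply_symm, FD]
  have sE₁ := cE₁.single M₁.isComult_tau AInf.IsComult.id M₁.b M₁.b
  have sE₂ := cE₂.single M₂.isComult_tau AInf.IsComult.id M₂.b M₂.b
  have dd₁ : ∀ v, AInf.lead M₁.b M₁.b E₁ (AInf.lead M₁.b M₁.b E₁ v) = 0 := fun v => by
    rw [AInf.lead_apply, ← sE₁, EE₁, map_zero]
  have dd₂ : ∀ v, AInf.lead M₂.b M₂.b E₂ (AInf.lead M₂.b M₂.b E₂ v) = 0 := fun v => by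
    rw [AInf.lead_apply, ← sE₂, EE₂, map_zero]
  have fd : ∀ v, AInf.lead M₁.b M₂.b F' (AInf.lead M₁.b M₁.b E₁ v) =
      AInf.lead M₂.b M₂.b E₂ (AInf.lead M₁.b M₂.b F' v) := fun v => by
    rw [AInf.lead_apply, ← sE₁, F'E, AInf.lead_apply _ _ E₂, ← cF'.single M₁.b M₂.b]
  obtain ⟨k₁, gk₁, c₁⟩ := AInf.Model.exists_contraction h₁.actPr h₁.act_mul h₁.act_one
    (AInf.Model.good_lead gE₁) dd₁
  obtain ⟨k₂, gk₂, c₂⟩ := AInf.Model.exists_contraction h₂.actPr h₂.act_mul h₂.act_one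
    (AInf.Model.good_lead gE₂) dd₂
  -- The linear parts of `E₁`, `E₂` and `F'` are the reductions of `m₁`, `m₂` and `f`, so the weak
  -- equivalence applies as it stands.
  obtain ⟨s, κ₁, κ₂, gs, gκ₁, gκ₂, hs, cκ₁, cκ₂⟩ := AInf.Model.exists_quasi_inverse c₁ c₂
    (AInf.Model.good_lead gE₁) gk₁ (AInf.Model.good_lead gE₂) gk₂ (AInf.Model.good_lead gF') fd
    (by simpa only [lF', lE₁, lE₂] using hfw.injective)
    (by simpa only [lF', lE₁, lE₂] using hfw.surjective)
  obtain ⟨H', cH', gH', H'E, H'F'H', lH'⟩ := AInf.Model.exists_homotopy_inverse h₂.actPr cE₁ EE₁ gE₁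
    cE₂ EE₂ gE₂ cF' gF' F'E gκ₁ gκ₂ gs cκ₁ cκ₂ hs
  -- The contractions now have the linear parts of `H' F'` and `F' H'` as their projections, as the
  -- deformation of these idempotents to the identity requires.
  rw [← lH', ← cF'.lead_comp M₁.b M₂.b] at cκ₁
  rw [← lH', ← cH'.lead_comp M₂.b M₁.b] at cκ₂
  obtain ⟨H, hH⟩ : ∃ H, H = A₁ ∘ₗ H' ∘ₗ A₂' := ⟨_, rfl⟩
  have H_apply : ∀ q, H q = A₁ (H' (A₂' q)) := fun q => by rw [hH]; rfl
  have cH : AInf.IsComult H := hH ▸ h₁.isComult.comp (cH'.comp h₂.isComult_symm)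
  have gH : AInf.Good (M₂.twisted (S := S) fun g => ρ₂ g) (M₁.twisted fun g => ρ₁ g) 0 H :=
    hH ▸ h₁.good_iso.comp (gH'.comp h₂.good_symm (zero_add _)) (add_zero _)
  have HD : ∀ q, H (D₂ q) = D₁ (H q) := fun q => by
    have h := H'E (A₂' q)
    rw [E₁_apply, E₂_apply, h₂.apply_symm] at h
    rw [H_apply, h, h₁.apply_symm, H_apply]
  obtain ⟨hh, hhG⟩ := h₂.exists_hom h₁ hm₂ hm₁ hρ₂ hρ₁ cH gH HD
  have fh := AInf.flat_sharp M₂.b (AInf.proj M₁.b ∘ₗ H)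
  refine ⟨_, hh, hhG, ⟨AInf.sharp M₁.b (AInf.proj M₁.b ∘ₗ H ∘ₗ F), ?_, ?_⟩,
    ⟨AInf.sharp M₂.b (AInf.proj M₂.b ∘ₗ F ∘ₗ H), ?_, ?_⟩⟩
  · refine AInf.isComposition_of_flat_comp M₁.b M₂.b hh.gapped hf.gapped (AInf.isGapped_sharp _ _)
      cF pF ?_
    rw [fh, AInf.flat_sharp]
    rfl
  · refine h₁.areGHomotopic_id hm₁ hρ₁ (cH'.comp cF') (gH'.comp gF' (zero_add _)) (fun q => ?_)
      (fun q => H'F'H' (F' q)) gκ₁ (hE₁ ▸ cκ₁) (AInf.isGapped_sharp _ _) ?_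
    · rw [← hE₁, LinearMap.comp_apply, LinearMap.comp_apply, F'E, H'E]
    · rw [AInf.flat_sharp]
      refine LinearMap.ext fun q => congrArg (AInf.proj M₁.b) ?_
      simp only [LinearMap.comp_apply, H_apply, F'_apply, h₁.apply_symm]
  · refine AInf.isComposition_of_flat_comp M₂.b M₁.b hf.gapped hh.gapped (AInf.isGapped_sharp _ _)
      cH fh.symm ?_
    rw [← pF, AInf.flat_sharp]
    rfl
  · refine h₂.areGHomotopic_id hm₂ hρ₂ (cF'.comp cH') (gF'.comp gH' (zero_add _)) (fun q => ?_)
      (fun q => congrArg F' (H'F'H' q)) gκ₂ (hE₂ ▸ cκ₂) (AInf.isGapped_sharp _ _) ?_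
    · rw [← hE₂, LinearMap.comp_apply, LinearMap.comp_apply, H'E, F'E]
    · rw [AInf.flat_sharp]
      refine LinearMap.ext fun q => congrArg (AInf.proj M₂.b) ?_
      simp only [LinearMap.comp_apply, H_apply, F'_apply, h₂.apply_symm]
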